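/- **Setting.** Let $A^{\top}(\phi)$ be the rotation of $\mathbb R^3$ by the angle $\phi$ about the $\boldsymbol e_3$-axis, $A(\phi)$ its transpose, and let $I=[a,b]$, $a<b$. A *surface of revolution* is a set $S=\{\boldsymbol\xi(\phi,t)=A^{\top}(\phi)\gamma(t):\phi\in\mathbb R,\ t\in I\}$, where $\gamma(t)=(x(t),0,z(t))$ is a $C^1$ curve on $I$ with $x\ge 0$ and $\dot\gamma\neq0$, without self-intersections except that possibly $\gamma(a)=\gamma(b)$; it may meet the axis only at its endpoints, at no more than two distinct points (a curve with $\gamma(a)=\gamma(b)$ does not meet the axis), and it meets the axis perpendicularly there. We write $\boldsymbol m(\phi,t)$ for $\boldsymbol m(\boldsymbol\xi(\phi,t))$. $H^1(S,T)$ is the set of the fields in $H^1(S,\mathbb R^3)$ with values in $T$ almost everywhere on $S$; fields are identified when they agree almost everywhere. A field $\boldsymbol u$ on $S$ is *axially symmetric* if $\boldsymbol u(A^{\top}(\phi)\xi)=A^{\top}(\phi)\boldsymbol u(\xi)$ for all $\phi\in\mathbb R$, $\xi\in S$; *axially antisymmetric* if $\boldsymbol u(A^{\top}(\phi)\xi)=A(\phi)\boldsymbol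 u(\xi)$ for all $\phi$, $\xi$; it has *line symmetry* if for every $\xi\in S$ one of these two identities holds for all $\phi$. A field $\boldsymbol m\in H^1(S,T)$ is *axially null-average* if $\int_0^{2\pi}\boldsymbol m_\perp(\theta,t)\,d\theta=0$ for (almost) every $t\in I$, where $\boldsymbol m_\perp$ is the horizontal part of $\boldsymbol m$. $T$ is *never flat* if the projection onto the horizontal plane of each horizontal section of $T$ is empty or a finite union of circles centred at the origin (a point counts as a circle of radius $0$). **Theorem.** Let $S,T\subseteq\mathbb R^3$ be surfaces of revolution, $g:\mathbb R\to[0,\infty)$ and $\boldsymbol a:S\to\mathbb R^3$ Lipschitz, and $$\mathcal E(\boldsymbol m)=\int_S|\nabla\boldsymbol m(\xi)|^2\,d\xi+\int_S g(\boldsymbol m(\xi)\cdot\boldsymbol a(\xi))\,d\xi,\qquad \boldsymbol m\in H^1(S,T).$$ A minimizer is a global minimizer of $\mathcal E$ in $H^1(S,T)$. 1. If $\boldsymbol a$ is axially symmetric or axially antisymmetric, then every axially null-average minimizer $\boldsymbol m$ has a $T$-valued representative of the form $$\boldsymbol m(\phi,t)=\boldsymbol\alpha_\perp(t)\cos\phi+\boldsymbol\beta_\perp(t)\sin\phi+\eta(t)\boldsymbol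 e_3\qquad(\phi\in\mathbb R,\ t\in I)$$ with (continuous) $\boldsymbol\alpha_\perp,\boldsymbol\beta_\perp\in H^1(I,\mathbb R^2)$ and $\eta\in H^1(I,\mathbb R)$. 2. Let $T$ be never flat. - If $\boldsymbol a$ is axially symmetric and there is an axially null-average minimizer, then every axially null-average minimizer is axially symmetric, or there also exist axially antisymmetric minimizers. - If $\boldsymbol a$ is axially antisymmetric and there is an axially null-average minimizer, then every axially null-average minimizer is axially antisymmetric, or there also exist axially symmetric minimizers. - If $\boldsymbol a$ is axially symmetric or antisymmetric, then every axially null-average minimizer has line symmetry and is of the form in 1, with $\boldsymbol\beta_\perp(t)\cdot\boldsymbol\alpha_\perp(t)=0$ and $|\boldsymbol\beta_\perp(t)|=|\boldsymbol\alpha_\perp(t)|$ for all $t\in I$. 3. If $\boldsymbol a$ is axially symmetric (respectively antisymmetric), then an axially symmetric (respectively antisymmetric) minimizer exists if and only if an axially null-average minimizer exists. (No never-flatness is assumed here.) -/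

import Mathlib

open MeasureTheory Set
open scoped ContDiff

/-- Euclidean three-space. -/
abbrev E3 : Type := EuclideanSpace ℝ (Fin 3)

/-- The Euclidean plane. -/
abbrev E2 : Type := EuclideanSpace ℝ (Fin 2)

namespace AxialSym

noncomputable section

/-- The rotation `Aᵀ(φ)` by the angle `φ` about the `e₃`-axis. Its transpose (and inverse) `A(φ)` is
`rot (-φ)`. -/
def rot (φ : ℝ) (v : E3) : E3 :=
  !₂[Real.cos φ * v 0 - Real.sin φ * v 1, Real.sin φ * v 0 + Real.cos φ * v 1, v 2]

/-- The third vector of the standard basis. -/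
def e3 : E3 := !₂[0, 0, 1]

/-- The projection of `ℝ³` onto the horizontal plane `ℝ² × {0}`. -/
def perp (v : E3) : E3 := !₂[v 0, v 1, 0]

/-- The inclusion of `ℝ²` as the horizontal plane `ℝ² × {0}`. -/
def planar (v : E2) : E3 := !₂[v 0, v 1, 0]

/-- `f ∈ H¹((a, b), F)`: `f` is in `L²` and has a weak derivative in `L²`. -/
def IntervalH1 {F : Type*} [NormedAddCommGroup F] [NormedSpace ℝ F] (a b : ℝ) (f : ℝ → F) : Prop :=
  MemLp f 2 (volume.restrict (Ioo a b)) ∧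
  ∃ f' : ℝ → F, MemLp f' 2 (volume.restrict (Ioo a b)) ∧
    ∀ ψ : ℝ → ℝ, ContDiff ℝ ∞ ψ → HasCompactSupport ψ → tsupport ψ ⊆ Ioo a b →
      ∫ t in Ioo a b, deriv ψ t • f t = - ∫ t in Ioo a b, ψ t • f' t

/-- A surface of revolution about the `e₃`-axis, given by its generating curve
`γ(t) = (x(t), 0, z(t))`, `t ∈ [a, b]`: a regular `C¹` curve, simple except that its two endpoints
may coincide (a loop), lying in `x ≥ 0`. It may meet the axis only at its endpoints, which are then
two different points or a single endpoint, and it meets the axis perpendicularly there. -/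
structure SurfaceOfRevolution where
  a : ℝ
  b : ℝ
  x : ℝ → ℝ
  z : ℝ → ℝ
  a_lt_b : a < b
  x_contDiffOn : ContDiffOn ℝ 1 x (Icc a b)
  z_contDiffOn : ContDiffOn ℝ 1 z (Icc a b)
  regular : ∀ t ∈ Icc a b, derivWithin x (Icc a b) t ≠ 0 ∨ derivWithin z (Icc a b) t ≠ 0
  simple : ∀ s ∈ Icc a b, ∀ t ∈ Icc a b, s < t → x s = x t → z s = z t → s = a ∧ t = b
  x_pos : ∀ t ∈ Ioo a b, 0 < x t
  x_left : 0 ≤ x a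
  x_right : 0 ≤ x b
  perp_left : x a = 0 → derivWithin z (Icc a b) a = 0
  perp_right : x b = 0 → derivWithin z (Icc a b) b = 0
  poles_ne : x a = 0 → x b = 0 → z a ≠ z b

namespace SurfaceOfRevolution

variable (S T : SurfaceOfRevolution)

/-- The parameterization `ξ(φ, t) = Aᵀ(φ) γ(t)`. -/
def param (φ t : ℝ) : E3 := rot φ !₂[S.x t, 0, S.z t]

/-- The surface as a subset of `ℝ³`. -/
def carrier : Set E3 := {p | ∃ φ : ℝ, ∃ t ∈ Icc S.a S.b, p = S.param φ t}

/-- The generating curve closes into a loop. -/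
def IsLoop : Prop := S.x S.a = S.x S.b ∧ S.z S.a = S.z S.b

/-- The metric coefficient `|∂_φ ξ| = x(t)`. -/
def h1 (t : ℝ) : ℝ := |S.x t|

/-- The metric coefficient `|∂_t ξ| = |γ'(t)|`. -/
def h2 (t : ℝ) : ℝ :=
  Real.sqrt (derivWithin S.x (Icc S.a S.b) t ^ 2 + derivWithin S.z (Icc S.a S.b) t ^ 2)

/-- The area element. -/
def areaElt (t : ℝ) : ℝ := S.h1 t * S.h2 t

/-- The coordinate domain `(0, 2π) × (a, b)`; its image is the surface up to a set of zero area. -/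
def cell : Set (ℝ × ℝ) := Ioo 0 (2 * Real.pi) ×ˢ Ioo S.a S.b

/-- The field `m` in the coordinates `(φ, t)`. -/
def pull (m : E3 → E3) (p : ℝ × ℝ) : E3 := m (S.param p.1 p.2)

/-- Equality almost everywhere on the surface. -/
def AEEq (m u : E3 → E3) : Prop := ∀ᵐ p ∂(volume.restrict S.cell), S.pull m p = S.pull u p

/-- Test functions on the surface without its poles and its boundary, in the coordinates `(φ, t)`:
smooth, `2π`-periodic in `φ`, and vanishing for `t` near `a` and `b`, or else, if the generating
curve is a loop, periodic in `t`. (In two dimensions the poles, being single points, are negligible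
for `H¹`.) -/
def IsTest (ψ : ℝ × ℝ → ℝ) : Prop :=
  ContDiff ℝ ∞ ψ ∧ (∀ φ t, ψ (φ + 2 * Real.pi, t) = ψ (φ, t)) ∧
  ((∃ c d, S.a < c ∧ d < S.b ∧ ∀ φ t, ψ (φ, t) ≠ 0 → t ∈ Icc c d) ∨
    (S.IsLoop ∧ ∀ φ t, ψ (φ, t + (S.b - S.a)) = ψ (φ, t)))

/-- The squared length of the tangential gradient with coordinate derivatives
`G = (∂_φ m, ∂_t m)`. -/
def gradSq (G : ℝ × ℝ → E3 × E3) (p : ℝ × ℝ) : ℝ :=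
  ‖(G p).1‖ ^ 2 / S.h1 p.2 ^ 2 + ‖(G p).2‖ ^ 2 / S.h2 p.2 ^ 2

/-- `G = (∂_φ m, ∂_t m)` in the weak sense, and the tangential gradient is square integrable on the
surface. Such a `G` is unique up to equality almost everywhere on `S.cell`. -/
structure IsWeakGradient (m : E3 → E3) (G : ℝ × ℝ → E3 × E3) : Prop where
  meas : AEStronglyMeasurable G (volume.restrict S.cell)
  sq_int : IntegrableOn (fun p => S.gradSq G p * S.areaElt p.2) S.cell
  parts_phi : ∀ ψ, S.IsTest ψ →
    ∫ p in S.cell, fderiv ℝ ψ p (1, 0) • S.pull m p = - ∫ p in S.cell, ψ p • (G p).1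
  parts_t : ∀ ψ, S.IsTest ψ →
    ∫ p in S.cell, fderiv ℝ ψ p (0, 1) • S.pull m p = - ∫ p in S.cell, ψ p • (G p).2

/-- `m ∈ H¹(S, ℝ³)`. -/
def MemH1 (m : E3 → E3) : Prop :=
  AEStronglyMeasurable (S.pull m) (volume.restrict S.cell) ∧
  IntegrableOn (fun p => ‖S.pull m p‖ ^ 2 * S.areaElt p.2) S.cell ∧
  ∃ G, S.IsWeakGradient m G

/-- `m ∈ H¹(S, T)`: an `H¹` field with values in `T` almost everywhere on `S`. -/
def MemH1Into (m : E3 → E3) : Prop :=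
  S.MemH1 m ∧ ∀ᵐ p ∂(volume.restrict S.cell), S.pull m p ∈ T.carrier

/-- The weak coordinate derivatives `(∂_φ m, ∂_t m)` of an `H¹` field. -/
def weakGrad (m : E3 → E3) : ℝ × ℝ → E3 × E3 := Classical.epsilon (S.IsWeakGradient m)

/-- The energy `∫_S |∇m|² dξ + ∫_S g(m · a) dξ`. -/
def energy (g : ℝ → ℝ) (a m : E3 → E3) : ℝ :=
  (∫ p in S.cell, S.gradSq (S.weakGrad m) p * S.areaElt p.2) +
  ∫ p in S.cell, g (inner ℝ (S.pull m p) (S.pull a p)) * S.areaElt p.2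

/-- `m` is a (global) minimizer of the energy in `H¹(S, T)`. -/
def IsMinimizer (g : ℝ → ℝ) (a m : E3 → E3) : Prop :=
  S.MemH1Into T m ∧ ∀ m', S.MemH1Into T m' → S.energy g a m ≤ S.energy g a m'

/-- Axially symmetric vector fields on `S`. -/
def AxiallySymmetric (u : E3 → E3) : Prop :=
  ∀ φ : ℝ, ∀ p ∈ S.carrier, u (rot φ p) = rot φ (u p)

/-- Axially antisymmetric vector fields on `S`. -/
def AxiallyAntisymmetric (u : E3 → E3) : Prop :=
  ∀ φ : ℝ, ∀ p ∈ S.carrier, u (rot φ p) = rot (-φ) (u p)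

/-- Vector fields on `S` with line symmetry. -/
def LineSymmetric (u : E3 → E3) : Prop :=
  ∀ p ∈ S.carrier, (∀ φ : ℝ, u (rot φ p) = rot φ (u p)) ∨ (∀ φ : ℝ, u (rot φ p) = rot (-φ) (u p))

/-- The average of `m` over the circle of latitude through `γ(t)`. -/
def latitudeAverage (m : E3 → E3) (t : ℝ) : E3 :=
  (2 * Real.pi)⁻¹ • ∫ φ in (0 : ℝ)..(2 * Real.pi), m (S.param φ t)

/-- `m` is axially null-average: on (almost) every circle of latitude the average of `m` is parallel
to `e₃`, i.e. its horizontal part vanishes. -/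
def NullAverage (m : E3 → E3) : Prop :=
  ∀ᵐ t ∂(volume.restrict (Ioo S.a S.b)), perp (S.latitudeAverage m t) = 0

/-- The circle of radius `r` about the origin in the horizontal plane `ℝ² × {0}`
(a point if `r = 0`). -/
def horizontalCircle (r : ℝ) : Set E3 := {p | p 2 = 0 ∧ ‖p‖ = r}

/-- The surface is never flat: the projection of each horizontal section is a finite (possibly
empty) union of circles. Finitely many distinct concentric circles are at positive distance. -/
def NeverFlat : Prop :=
  ∀ c : ℝ, ∃ R : Finset ℝ, (∀ r ∈ R, 0 ≤ r) ∧
    perp '' (T.carrier ∩ {p | p 2 = c}) = ⋃ r ∈ R, horizontalCircle r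

/-- `u` is a `T`-valued representative of `m` with
`u(φ, t) = α(t) cos φ + β(t) sin φ + η(t) e₃` for all `φ` and all `t ∈ I`, where `α`, `β`, `η` are
the continuous representatives of `H¹(I)` functions. -/
structure IsFirstHarmonicForm (m u : E3 → E3) (α β : ℝ → E2) (η : ℝ → ℝ) : Prop where
  mapsTo : MapsTo u S.carrier T.carrier
  aeEq : S.AEEq m u
  h1_α : IntervalH1 S.a S.b α
  h1_β : IntervalH1 S.a S.b β
  h1_η : IntervalH1 S.a S.b η
  cont_α : ContinuousOn α (Icc S.a S.b)
  cont_β : ContinuousOn β (Icc S.a S.b)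
  cont_η : ContinuousOn η (Icc S.a S.b)
  form : ∀ φ : ℝ, ∀ t ∈ Icc S.a S.b, u (S.param φ t) =
    Real.cos φ • planar (α t) + Real.sin φ • planar (β t) + η t • e3

end SurfaceOfRevolution

end

end AxialSym

open MeasureTheory Set
open scoped ContDiff

namespace AxialSym

noncomputable section

/-! Axial symmetry and antisymmetry of `a` are treated together: `a` turns by the angle `ε φ` when
the point turns by `φ`, with `ε = 1` or `ε = -1`. In the coordinates `(φ, t)` the energy is the
integral of `|∂_φ m|² h2 / x + |∂_t m|² x / h2` plus the potential.

Averaging. The meridian section of `m` at angle `φ`, turned back by `ε φ`, is a profile, and a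
profile generates an `ε`-equivariant field with values in `T`, since `T` is invariant under
rotations. That field has the `t`-derivative and the potential of the section, because `a` turns
along with it, and the length of its angular derivative is the length of the horizontal part of the
section. The average over `φ` of the energies of these competitors is therefore the energy of `m`
with `|∂_φ m|²` replaced by `|m_⊥|²`. If `m` is null-average, Wirtinger's inequality on the circles
of latitude shows that this average is at most the energy of `m`; if `m` is a minimizer, no
competitor lies below. So equality holds throughout: Wirtinger's inequality is an equality on almost
every circle, which leaves only first harmonics in the horizontal part and a constant vertical part,
and almost every section generates a minimizer (`IsMinimizer.null_average`). One such section gives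
the equivariant minimizer of the third claim. Conversely, equivariant fields are null-average.

Regularity at the poles. Finite energy controls `w'` only with the weight `x`, which vanishes at a
pole, whereas coefficients in `H¹(I)` need the unweighted bound. Near the axis `T` is almost a flat
disc orthogonal to the axis, so a minimal profile can be compared, in a collar of width `r`, with
the path that runs along a meridian of `T` from the pole of `T` to the boundary value. This bounds
the energy in the collar by `9/8 |w_⊥(r)|² + C r²`, while finite energy alone gives the lower bound
`|w_⊥(r)|²`. The two together force `w'` into `L²` (`integrableOn_deriv_sq_of_le`,
`MinProfile.integrable_deriv_sq_pole`). Two good sections at independent angles then recover both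
first-harmonic coefficients as `H¹` functions (`exists_harmonic`).

Never flat targets. On a fixed circle of latitude the first harmonic form has constant height, so
its distance from the axis takes finitely many values and is constant; the coefficients are then
orthogonal and of equal length, and the circle is traversed as `rot φ` or as `rot (-φ)`. To see that
the sense of rotation is that of `a`, the horizontal part is split into a co-rotating and a
counter-rotating part, and the latter is frozen in `φ`. The frozen field still has values in `T` and
the same potential energy, because doubling the angle preserves the mean over a period, and its
Dirichlet energy drops by the angular energy of the counter-rotating part. Minimality makes that
part vanish (`HarmonicField.equivariant`). Hence the first alternative of the never flat claims
always holds. -/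

/-! ### Rotations about the axis -/

theorem norm_sq_eq_coords (v : E3) : ‖v‖ ^ 2 = v 0 ^ 2 + v 1 ^ 2 + v 2 ^ 2 := by
  simp [EuclideanSpace.norm_sq_eq, Fin.sum_univ_three]

theorem inner_eq_coords (v w : E3) : inner ℝ v w = v 0 * w 0 + v 1 * w 1 + v 2 * w 2 := by
  simp [PiLp.inner_apply, Fin.sum_univ_three]; ring

theorem ext_coords {v w : E3} (h0 : v 0 = w 0) (h1 : v 1 = w 1) (h2 : v 2 = w 2) : v = w := by
  ext i; fin_cases i <;> assumption

@[simp] theorem rot_apply_zero (φ : ℝ) (v : E3) :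
    rot φ v 0 = Real.cos φ * v 0 - Real.sin φ * v 1 := by simp [rot]
@[simp] theorem rot_apply_one (φ : ℝ) (v : E3) :
    rot φ v 1 = Real.sin φ * v 0 + Real.cos φ * v 1 := by simp [rot]
@[simp] theorem rot_apply_two (φ : ℝ) (v : E3) : rot φ v 2 = v 2 := by simp [rot]
@[simp] theorem perp_apply_zero (v : E3) : perp v 0 = v 0 := by simp [perp]
@[simp] theorem perp_apply_one (v : E3) : perp v 1 = v 1 := by simp [perp]
@[simp] theorem perp_apply_two (v : E3) : perp v 2 = 0 := by simp [perp]
@[simp] theorem e3_apply_zero : e3 0 = 0 := by simp [e3]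
@[simp] theorem e3_apply_one : e3 1 = 0 := by simp [e3]
@[simp] theorem e3_apply_two : e3 2 = 1 := by simp [e3]
@[simp] theorem planar_apply_zero (v : E2) : planar v 0 = v 0 := by simp [planar]
@[simp] theorem planar_apply_one (v : E2) : planar v 1 = v 1 := by simp [planar]
@[simp] theorem planar_apply_two (v : E2) : planar v 2 = 0 := by simp [planar]

/-- The horizontal part, turned by a right angle. -/
def quarter (v : E3) : E3 := !₂[-v 1, v 0, 0]

@[simp] theorem quarter_apply_zero (v : E3) : quarter v 0 = -v 1 := by simp [quarter]
@[simp] theorem quarter_apply_one (v : E3) : quarter v 1 = v 0 := by simp [quarter]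
@[simp] theorem quarter_apply_two (v : E3) : quarter v 2 = 0 := by simp [quarter]

/-- The horizontal projection as a continuous linear map. -/
def perpL : E3 →L[ℝ] E3 := LinearMap.toContinuousLinearMap
  { toFun := perp
    map_add' := fun v w => by apply ext_coords <;> simp
    map_smul' := fun c v => by apply ext_coords <;> simp }

/-- The map `quarter` as a continuous linear map. -/
def quarterL : E3 →L[ℝ] E3 := LinearMap.toContinuousLinearMap
  { toFun := quarter
    map_add' := fun v w => by apply ext_coords <;> simp; ring
    map_smul' := fun c v => by apply ext_coords <;> simp }

/-- The vertical projection as a continuous linear map. -/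
def vertL : E3 →L[ℝ] E3 := LinearMap.toContinuousLinearMap
  { toFun := fun v => v 2 • e3
    map_add' := fun v w => by apply ext_coords <;> simp
    map_smul' := fun c v => by apply ext_coords <;> simp }

/-- The rotation `rot φ` as a continuous linear map. -/
def rotL (φ : ℝ) : E3 →L[ℝ] E3 := LinearMap.toContinuousLinearMap
  { toFun := rot φ
    map_add' := fun v w => by apply ext_coords <;> simp <;> ring
    map_smul' := fun c v => by apply ext_coords <;> simp <;> ring }

/-- The horizontal coordinates as a continuous linear map. -/
def toPlaneL : E3 →L[ℝ] E2 := LinearMap.toContinuousLinearMap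
  { toFun := fun v => !₂[v 0, v 1]
    map_add' := fun v w => by ext i; fin_cases i <;> simp
    map_smul' := fun c v => by ext i; fin_cases i <;> simp }

@[simp] theorem perpL_apply (v : E3) : perpL v = perp v := rfl
@[simp] theorem quarterL_apply (v : E3) : quarterL v = quarter v := rfl
@[simp] theorem vertL_apply (v : E3) : vertL v = v 2 • e3 := rfl
@[simp] theorem rotL_apply (φ : ℝ) (v : E3) : rotL φ v = rot φ v := rfl
theorem toPlaneL_apply (v : E3) : toPlaneL v = !₂[v 0, v 1] := rfl
@[simp] theorem toPlaneL_apply_zero (v : E3) : toPlaneL v 0 = v 0 := by simp [toPlaneL_apply]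
@[simp] theorem toPlaneL_apply_one (v : E3) : toPlaneL v 1 = v 1 := by simp [toPlaneL_apply]

@[simp] theorem planar_toPlaneL (v : E3) : planar (toPlaneL v) = perp v := by
  apply ext_coords <;> simp

/-- This is the bridge from equivariance to first harmonics: an orbit of the rotation group is a
trigonometric polynomial of degree one in the angle, with constant vertical part. -/
theorem rot_eq (φ : ℝ) (v : E3) :
    rot φ v = Real.cos φ • perp v + Real.sin φ • quarter v + v 2 • e3 := by
  apply ext_coords <;> simp <;> ring

theorem rot_rot (φ θ : ℝ) (v : E3) : rot φ (rot θ v) = rot (φ + θ) v := by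
  apply ext_coords <;> simp [Real.cos_add, Real.sin_add] <;> ring

@[simp] theorem rot_zero (v : E3) : rot 0 v = v := by
  apply ext_coords <;> simp

@[simp] theorem norm_rot (φ : ℝ) (v : E3) : ‖rot φ v‖ = ‖v‖ := by
  have h : ‖rot φ v‖ ^ 2 = ‖v‖ ^ 2 := by
    rw [norm_sq_eq_coords, norm_sq_eq_coords]; simp
    linear_combination (v 0 ^ 2 + v 1 ^ 2) * Real.sin_sq_add_cos_sq φ
  exact (sq_eq_sq₀ (norm_nonneg _) (norm_nonneg _)).1 h

theorem inner_rot_rot (φ : ℝ) (v w : E3) : inner ℝ (rot φ v) (rot φ w) = (inner ℝ v w : ℝ) := by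
  rw [inner_eq_coords, inner_eq_coords]; simp
  linear_combination (v 0 * w 0 + v 1 * w 1) * Real.sin_sq_add_cos_sq φ

theorem inner_rot_left (φ : ℝ) (v w : E3) :
    inner ℝ (rot φ v) w = (inner ℝ v (rot (-φ) w) : ℝ) := by
  rw [← inner_rot_rot φ v, rot_rot]; simp

theorem rot_add_two_pi (φ : ℝ) (v : E3) : rot (φ + 2 * Real.pi) v = rot φ v := by
  apply ext_coords <;> simp

theorem perp_rot (φ : ℝ) (v : E3) : perp (rot φ v) = rot φ (perp v) := by
  apply ext_coords <;> simp

theorem norm_quarter (v : E3) : ‖quarter v‖ = ‖perp v‖ := by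
  refine (sq_eq_sq₀ (norm_nonneg _) (norm_nonneg _)).1 ?_
  rw [norm_sq_eq_coords, norm_sq_eq_coords]; simp; ring

theorem norm_perp_sq (v : E3) : ‖perp v‖ ^ 2 = v 0 ^ 2 + v 1 ^ 2 := by
  rw [norm_sq_eq_coords]; simp

theorem norm_perp_le (v : E3) : ‖perp v‖ ≤ ‖v‖ := by
  refine (sq_le_sq₀ (norm_nonneg _) (norm_nonneg _)).1 ?_
  rw [norm_sq_eq_coords, norm_sq_eq_coords v]; simp; positivity

theorem norm_sq_eq_coords_two (v : E2) : ‖v‖ ^ 2 = v 0 ^ 2 + v 1 ^ 2 := by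
  simp [EuclideanSpace.norm_sq_eq, Fin.sum_univ_two]

theorem continuous_perp : Continuous perp := perpL.continuous

/-! ### Geometry of a surface of revolution -/

namespace SurfaceOfRevolution

variable (S T : SurfaceOfRevolution)

@[simp] theorem param_apply_zero (φ t : ℝ) : S.param φ t 0 = Real.cos φ * S.x t := by
  simp [param]
@[simp] theorem param_apply_one (φ t : ℝ) : S.param φ t 1 = Real.sin φ * S.x t := by
  simp [param]
@[simp] theorem param_apply_two (φ t : ℝ) : S.param φ t 2 = S.z t := by
  simp [param]

theorem rot_param (θ φ t : ℝ) : rot θ (S.param φ t) = S.param (θ + φ) t := by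
  simp [param, rot_rot]

theorem param_add_two_pi (φ t : ℝ) : S.param (φ + 2 * Real.pi) t = S.param φ t := by
  simp [param, rot_add_two_pi]

theorem param_mem (φ : ℝ) {t : ℝ} (ht : t ∈ Icc S.a S.b) : S.param φ t ∈ S.carrier :=
  ⟨φ, t, ht, rfl⟩

theorem rot_mem {p : E3} (φ : ℝ) (hp : p ∈ S.carrier) : rot φ p ∈ S.carrier := by
  obtain ⟨θ, t, ht, rfl⟩ := hp
  rw [rot_param]; exact S.param_mem _ ht

theorem x_nonneg {t : ℝ} (ht : t ∈ Icc S.a S.b) : 0 ≤ S.x t := by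
  rcases eq_or_lt_of_le ht.1 with h | h
  · exact h ▸ S.x_left
  rcases eq_or_lt_of_le ht.2 with h' | h'
  · exact h' ▸ S.x_right
  exact (S.x_pos t ⟨h, h'⟩).le

theorem continuousOn_x : ContinuousOn S.x (Icc S.a S.b) := S.x_contDiffOn.continuousOn
theorem continuousOn_z : ContinuousOn S.z (Icc S.a S.b) := S.z_contDiffOn.continuousOn

theorem continuousOn_derivWithin_x :
    ContinuousOn (derivWithin S.x (Icc S.a S.b)) (Icc S.a S.b) :=
  S.x_contDiffOn.continuousOn_derivWithin (uniqueDiffOn_Icc S.a_lt_b) le_rfl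

theorem continuousOn_derivWithin_z :
    ContinuousOn (derivWithin S.z (Icc S.a S.b)) (Icc S.a S.b) :=
  S.z_contDiffOn.continuousOn_derivWithin (uniqueDiffOn_Icc S.a_lt_b) le_rfl

theorem continuousOn_h2 : ContinuousOn S.h2 (Icc S.a S.b) :=
  ((S.continuousOn_derivWithin_x.pow 2).add (S.continuousOn_derivWithin_z.pow 2)).sqrt

theorem h2_pos {t : ℝ} (ht : t ∈ Icc S.a S.b) : 0 < S.h2 t := by
  apply Real.sqrt_pos.2
  rcases S.regular t ht with h | h
  · have := pow_pos (abs_pos.2 h) 2; rw [sq_abs] at this; positivity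
  · have := pow_pos (abs_pos.2 h) 2; rw [sq_abs] at this; positivity

theorem h1_eq {t : ℝ} (ht : t ∈ Icc S.a S.b) : S.h1 t = S.x t := abs_of_nonneg (S.x_nonneg ht)

theorem nonempty_Icc : (Icc S.a S.b).Nonempty := Set.nonempty_Icc.2 S.a_lt_b.le

/-- The speed of the generating curve is bounded above and below. -/
theorem exists_h2_bounds : ∃ k K : ℝ, 0 < k ∧ 0 < K ∧ ∀ t ∈ Icc S.a S.b,
    k ≤ S.h2 t ∧ S.h2 t ≤ K := by
  obtain ⟨t0, ht0, h0⟩ := isCompact_Icc.exists_isMinOn S.nonempty_Icc S.continuousOn_h2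
  obtain ⟨t1, ht1, h1⟩ := isCompact_Icc.exists_isMaxOn S.nonempty_Icc S.continuousOn_h2
  exact ⟨_, _, S.h2_pos ht0, S.h2_pos ht1, fun t ht => ⟨h0 ht, h1 ht⟩⟩

theorem exists_x_bound : ∃ K : ℝ, 0 < K ∧ ∀ t ∈ Icc S.a S.b, S.x t ≤ K := by
  obtain ⟨t1, ht1, h1⟩ := isCompact_Icc.exists_isMaxOn S.nonempty_Icc S.continuousOn_x
  exact ⟨S.x t1 + 1, by have := S.x_nonneg ht1; linarith, fun t ht => by
    have : S.x t ≤ S.x t1 := h1 ht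
    linarith⟩

/-- Away from its zeros, the distance to the axis is bounded below. -/
theorem exists_x_lower {K : Set ℝ} (hK : IsCompact K) (hKs : K ⊆ Icc S.a S.b)
    (hpos : ∀ t ∈ K, S.x t ≠ 0) : ∃ k : ℝ, 0 < k ∧ ∀ t ∈ K, k ≤ S.x t := by
  rcases K.eq_empty_or_nonempty with rfl | hne
  · exact ⟨1, one_pos, by simp⟩
  obtain ⟨t0, ht0, h0⟩ := hK.exists_isMinOn hne (S.continuousOn_x.mono hKs)
  exact ⟨_, lt_of_le_of_ne (S.x_nonneg (hKs ht0)) (hpos _ ht0).symm, fun t ht => h0 ht⟩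

/-- If an end of a loop were on the axis, so would be the other, and two ends on the axis are
distinct. On a loop the weight `x` is thus bounded below, which makes periodic test functions
harmless. -/
theorem IsLoop.x_ne_zero {S : SurfaceOfRevolution} (h : S.IsLoop) :
    ∀ t ∈ Icc S.a S.b, S.x t ≠ 0 := by
  intro t ht hx
  rcases eq_or_lt_of_le ht.1 with rfl | h1
  · exact S.poles_ne hx (h.1 ▸ hx) h.2
  rcases eq_or_lt_of_le ht.2 with rfl | h2
  · exact S.poles_ne (h.1.trans hx) hx h.2
  exact (S.x_pos t ⟨h1, h2⟩).ne' hx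

theorem continuousOn_param :
    ContinuousOn (fun p : ℝ × ℝ => S.param p.1 p.2) (univ ×ˢ Icc S.a S.b) := by
  have h1 : ContinuousOn (fun p : ℝ × ℝ => S.x p.2) (univ ×ˢ Icc S.a S.b) :=
    S.continuousOn_x.comp continuousOn_snd fun p hp => hp.2
  have h2 : ContinuousOn (fun p : ℝ × ℝ => S.z p.2) (univ ×ˢ Icc S.a S.b) :=
    S.continuousOn_z.comp continuousOn_snd fun p hp => hp.2
  have h3 : (fun p : ℝ × ℝ => S.param p.1 p.2) = fun p : ℝ × ℝ =>
      (Real.cos p.1 * S.x p.2) • (!₂[1, 0, 0] : E3) + (Real.sin p.1 * S.x p.2) • (!₂[0, 1, 0] : E3)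
        + S.z p.2 • e3 := by
    funext p; apply ext_coords <;> simp
  rw [h3]
  have hc : Continuous fun p : ℝ × ℝ => Real.cos p.1 := by fun_prop
  have hs : Continuous fun p : ℝ × ℝ => Real.sin p.1 := by fun_prop
  exact (((hc.continuousOn.mul h1).smul continuousOn_const).add
    ((hs.continuousOn.mul h1).smul continuousOn_const)).add (h2.smul continuousOn_const)

theorem carrier_eq_image :
    S.carrier = (fun p : ℝ × ℝ => S.param p.1 p.2) '' (Icc 0 (2 * Real.pi) ×ˢ Icc S.a S.b) := by
  ext p
  constructor
  · rintro ⟨φ, t, ht, rfl⟩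
    obtain ⟨θ, hθ, h⟩ := (show Function.Periodic (fun φ => S.param φ t) (2 * Real.pi) from
      fun φ => S.param_add_two_pi φ t).exists_mem_Ico₀ Real.two_pi_pos φ
    exact ⟨(θ, t), ⟨⟨hθ.1, hθ.2.le⟩, ht⟩, h.symm⟩
  · rintro ⟨q, hq, rfl⟩
    exact S.param_mem _ hq.2

theorem isCompact_carrier : IsCompact S.carrier := by
  rw [carrier_eq_image]
  exact (isCompact_Icc.prod isCompact_Icc).image_of_continuousOn
    (S.continuousOn_param.mono (prod_mono (subset_univ _) subset_rfl))

theorem exists_norm_bound : ∃ M : ℝ, 0 < M ∧ ∀ p ∈ S.carrier, ‖p‖ ≤ M := by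
  obtain ⟨M, hM⟩ := S.isCompact_carrier.isBounded.exists_norm_le
  exact ⟨max M 1, by positivity, fun p hp => (hM p hp).trans (le_max_left _ _)⟩

/-- The coordinates `(φ, t)` of a point of the surface are unique, up to the periodicity of the
angle, the indeterminacy of the angle at the poles, and the endpoints of a loop. -/
theorem param_eq_param {φ φ' t t' : ℝ} (ht : t ∈ Icc S.a S.b) (ht' : t' ∈ Icc S.a S.b)
    (h : S.param φ t = S.param φ' t') :
    (S.x t = S.x t' ∧ S.z t = S.z t') ∧
      (t = t' ∨ S.IsLoop ∧ (t = S.a ∧ t' = S.b ∨ t = S.b ∧ t' = S.a)) ∧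
      (S.x t = 0 ∨ Real.cos φ = Real.cos φ' ∧ Real.sin φ = Real.sin φ') := by
  have e0 : Real.cos φ * S.x t = Real.cos φ' * S.x t' := by
    simpa using congrArg (fun p : E3 => p 0) h
  have e1 : Real.sin φ * S.x t = Real.sin φ' * S.x t' := by
    simpa using congrArg (fun p : E3 => p 1) h
  have e2 : S.z t = S.z t' := by simpa using congrArg (fun p : E3 => p 2) h
  have hx : S.x t = S.x t' := by
    refine (sq_eq_sq₀ (S.x_nonneg ht) (S.x_nonneg ht')).1 ?_
    have h1 := Real.sin_sq_add_cos_sq φ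
    have h2 := Real.sin_sq_add_cos_sq φ'
    have : (Real.cos φ * S.x t) ^ 2 + (Real.sin φ * S.x t) ^ 2 =
      (Real.cos φ' * S.x t') ^ 2 + (Real.sin φ' * S.x t') ^ 2 := by rw [e0, e1]
    linear_combination this - (S.x t) ^ 2 * h1 + (S.x t') ^ 2 * h2
  refine ⟨⟨hx, e2⟩, ?_, ?_⟩
  · rcases lt_trichotomy t t' with hlt | heq | hlt
    · obtain ⟨rfl, rfl⟩ := S.simple t ht t' ht' hlt hx e2
      exact Or.inr ⟨⟨hx, e2⟩, Or.inl ⟨rfl, rfl⟩⟩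
    · exact Or.inl heq
    · obtain ⟨rfl, rfl⟩ := S.simple t' ht' t ht hlt hx.symm e2.symm
      exact Or.inr ⟨⟨hx.symm, e2.symm⟩, Or.inr ⟨rfl, rfl⟩⟩
  · rcases eq_or_ne (S.x t) 0 with h0 | h0
    · exact Or.inl h0
    · rw [← hx] at e0 e1
      exact Or.inr ⟨mul_right_cancel₀ h0 e0, mul_right_cancel₀ h0 e1⟩

/-- A field on the surface can be prescribed in the coordinates `(φ, t)`, if that is consistent. -/
theorem exists_field (F : ℝ → ℝ → E3)
    (hF : ∀ φ φ', ∀ t ∈ Icc S.a S.b, ∀ t' ∈ Icc S.a S.b, S.param φ t = S.param φ' t' →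
      F φ t = F φ' t') :
    ∃ m : E3 → E3, ∀ φ, ∀ t ∈ Icc S.a S.b, m (S.param φ t) = F φ t := by
  classical
  refine ⟨fun p => if h : p ∈ S.carrier then F h.choose h.choose_spec.choose else 0,
    fun φ t ht => ?_⟩
  have h : S.param φ t ∈ S.carrier := S.param_mem φ ht
  simp only [h, dif_pos]
  exact (hF _ _ _ ht _ h.choose_spec.choose_spec.1 h.choose_spec.choose_spec.2).symm

/-- A field that is a first-order trigonometric polynomial in the angle can be prescribed away from
the poles and the boundary of the surface. -/
theorem exists_field_Ioo (A B C : ℝ → E3) :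
    ∃ m : E3 → E3, ∀ φ, ∀ t ∈ Ioo S.a S.b, m (S.param φ t) =
      Real.cos φ • A t + Real.sin φ • B t + C t := by
  classical
  -- The value `0` on the end circles makes the prescription consistent at the poles and at the seam
  -- of a loop; the end circles lie outside the coordinate domain.
  obtain ⟨m, hm⟩ := S.exists_field (fun φ t => if t ∈ Ioo S.a S.b then
      Real.cos φ • A t + Real.sin φ • B t + C t else 0) (by
    intro φ φ' t ht t' ht' h
    obtain ⟨-, h2, h3⟩ := S.param_eq_param ht ht' h
    rcases h2 with rfl | ⟨-, ⟨rfl, rfl⟩ | ⟨rfl, rfl⟩⟩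
    · split_ifs with hi
      · rcases h3 with h3 | ⟨hc, hs⟩
        · exact absurd h3 (S.x_pos t hi).ne'
        · rw [hc, hs]
      · rfl
    · simp
    · simp)
  exact ⟨m, fun φ t ht => by rw [hm φ t (Ioo_subset_Icc_self ht), if_pos ht]⟩

theorem measurableSet_cell : MeasurableSet S.cell := measurableSet_Ioo.prod measurableSet_Ioo

theorem isOpen_cell : IsOpen S.cell := isOpen_Ioo.prod isOpen_Ioo

/-- The measure on the coordinate domain is a product. -/
theorem restrict_cell : (volume : Measure (ℝ × ℝ)).restrict S.cell =
    (volume.restrict (Ioo 0 (2 * Real.pi))).prod (volume.restrict (Ioo S.a S.b)) := by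
  rw [Measure.prod_restrict]; rfl

instance : IsFiniteMeasure ((volume : Measure (ℝ × ℝ)).restrict S.cell) := by
  rw [restrict_cell]; infer_instance

end SurfaceOfRevolution

/-! ### Absolutely continuous functions as indefinite integrals -/

section AbsolutelyContinuous

variable {F F' : Type*} [NormedAddCommGroup F] [NormedSpace ℝ F] [NormedAddCommGroup F']
  [NormedSpace ℝ F']

/-- `v` is locally absolutely continuous on `J` with derivative `v'`: it is an indefinite integral
of the locally integrable function `v'`. -/
def IsAC (v v' : ℝ → F) (J : Set ℝ) : Prop :=
  ∀ ⦃s⦄, s ∈ J → ∀ ⦃t⦄, t ∈ J → IntervalIntegrable v' volume s t ∧ v t - v s = ∫ r in s..t, v' r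

namespace IsAC

variable {v v' w w' : ℝ → F} {J : Set ℝ}

theorem mono {K : Set ℝ} (h : IsAC v v' J) (hK : K ⊆ J) : IsAC v v' K :=
  fun _ hs _ ht => h (hK hs) (hK ht)

theorem add (hv : IsAC v v' J) (hw : IsAC w w' J) :
    IsAC (fun t => v t + w t) (fun t => v' t + w' t) J := by
  intro s hs t ht
  obtain ⟨h1, h2⟩ := hv hs ht
  obtain ⟨h3, h4⟩ := hw hs ht
  refine ⟨h1.add h3, ?_⟩
  rw [intervalIntegral.integral_add h1 h3, ← h2, ← h4, add_sub_add_comm]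

theorem const (c : F) (J : Set ℝ) : IsAC (fun _ => c) (fun _ => 0) J := by
  intro s _ t _; simp

theorem clm [CompleteSpace F] [CompleteSpace F'] (L : F →L[ℝ] F') (hv : IsAC v v' J) :
    IsAC (fun t => L (v t)) (fun t => L (v' t)) J := by
  intro s hs t ht
  obtain ⟨h1, h2⟩ := hv hs ht
  exact ⟨⟨L.integrable_comp h1.1, L.integrable_comp h1.2⟩, by
    rw [L.intervalIntegral_comp_comm h1, ← h2, map_sub]⟩

theorem const_smul (c : ℝ) (hv : IsAC v v' J) :
    IsAC (fun t => c • v t) (fun t => c • v' t) J := by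
  intro s hs t ht
  obtain ⟨h1, h2⟩ := hv hs ht
  exact ⟨h1.smul c, by rw [intervalIntegral.integral_smul, ← h2, smul_sub]⟩

theorem of_base {t0 : ℝ} (h : ∀ t ∈ J, IntervalIntegrable v' volume t0 t ∧
    v t - v t0 = ∫ r in t0..t, v' r) : IsAC v v' J := by
  intro s hs t ht
  obtain ⟨h1, h2⟩ := h s hs
  obtain ⟨h3, h4⟩ := h t ht
  refine ⟨h1.symm.trans h3, ?_⟩
  rw [← intervalIntegral.integral_interval_sub_left h3 h1, ← h4, ← h2]; abel

theorem congr_on (hv : IsAC v v' J) (hw : ∀ t ∈ J, w t = v t) : IsAC w v' J := by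
  intro s hs t ht
  rw [hw s hs, hw t ht]; exact hv hs ht

theorem eq_add (hv : IsAC v v' J) {s t : ℝ} (hs : s ∈ J) (ht : t ∈ J) :
    v t = v s + ∫ r in s..t, v' r := by
  rw [← (hv hs ht).2]; abel

theorem continuousOn_Icc {s t : ℝ} (hst : s ≤ t) (hv : IsAC v v' (Icc s t)) :
    ContinuousOn v (Icc s t) := by
  have hi := (hv (left_mem_Icc.2 hst) (right_mem_Icc.2 hst)).1
  have h : ContinuousOn (fun r => v s + ∫ x in s..r, v' x) (Icc s t) := by
    have := intervalIntegral.continuousOn_primitive_interval' hi left_mem_uIcc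
    rw [uIcc_of_le hst] at this
    exact continuousOn_const.add this
  exact h.congr fun r hr => hv.eq_add (left_mem_Icc.2 hst) hr

theorem continuousOn_Ioo {a b : ℝ} (hv : IsAC v v' (Ioo a b)) : ContinuousOn v (Ioo a b) := by
  intro t ht
  obtain ⟨c, hc1, hc2⟩ := exists_between ht.1
  obtain ⟨d, hd1, hd2⟩ := exists_between ht.2
  have hcd : c ≤ d := (hc2.trans hd1).le
  have := continuousOn_Icc hcd (hv.mono fun r hr => ⟨hc1.trans_le hr.1, hr.2.trans_lt hd2⟩)
  exact (this.continuousAt (Icc_mem_nhds hc2 hd1)).continuousWithinAt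

end IsAC

/-- After subtraction of the values at `s`, both factors are primitives vanishing at `s`, to which
integration by parts for absolutely continuous functions applies; what remains is linear in `u'` and
`v'`. -/
theorem IsAC.mul {u u' v v' : ℝ → ℝ} {J : Set ℝ} (hJ : J.OrdConnected) (hu : IsAC u u' J)
    (hv : IsAC v v' J) : IsAC (fun t => u t * v t) (fun t => u' t * v t + u t * v' t) J := by
  intro s hs t ht
  have hsub : uIcc s t ⊆ J := hJ.uIcc_subset hs ht
  obtain ⟨hu1, hu2⟩ := hu hs ht
  obtain ⟨hv1, hv2⟩ := hv hs ht
  set U := fun r => ∫ x in s..r, u' x with hU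
  set V := fun r => ∫ x in s..r, v' x with hV
  have aU : AbsolutelyContinuousOnInterval U s t :=
    hu1.absolutelyContinuousOnInterval_intervalIntegral left_mem_uIcc
  have aV : AbsolutelyContinuousOnInterval V s t :=
    hv1.absolutelyContinuousOnInterval_intervalIntegral left_mem_uIcc
  have key := aU.integral_deriv_mul_eq_sub aV
  have eU : ∀ r ∈ uIcc s t, u r = u s + U r := fun r hr => hu.eq_add hs (hsub hr)
  have eV : ∀ r ∈ uIcc s t, v r = v s + V r := fun r hr => hv.eq_add hs (hsub hr)
  have cU : ContinuousOn U (uIcc s t) := aU.continuousOn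
  have cV : ContinuousOn V (uIcc s t) := aV.continuousOn
  have i1 : IntervalIntegrable (fun r => u' r * V r) volume s t := hu1.mul_continuousOn cV
  have i2 : IntervalIntegrable (fun r => U r * v' r) volume s t := hv1.continuousOn_mul cU
  have key2 : ∫ r in s..t, (u' r * V r + U r * v' r) = U t * V t := by
    have : ∫ r in s..t, (u' r * V r + U r * v' r)
        = ∫ r in s..t, (deriv U r * V r + U r * deriv V r) := by
      apply intervalIntegral.integral_congr_ae
      filter_upwards [hu1.ae_hasDerivAt_integral, hv1.ae_hasDerivAt_integral] with r h1 h2 hr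
      rw [(h1 (uIoc_subset_uIcc hr) s left_mem_uIcc).deriv,
        (h2 (uIoc_subset_uIcc hr) s left_mem_uIcc).deriv]
    rw [this, key]; simp [hU, hV]
  have e : ∀ r ∈ uIcc s t, u' r * v r + u r * v' r =
      (v s * u' r + u s * v' r) + (u' r * V r + U r * v' r) := by
    intro r hr; rw [eU r hr, eV r hr]; ring
  have i3 : IntervalIntegrable (fun r => v s * u' r + u s * v' r) volume s t :=
    (hu1.const_mul _).add (hv1.const_mul _)
  constructor
  · refine (i3.add (i1.add i2)).congr fun r hr => ?_
    exact (e r (uIoc_subset_uIcc hr)).symm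
  · rw [intervalIntegral.integral_congr e, intervalIntegral.integral_add i3 (i1.add i2), key2,
      intervalIntegral.integral_add (hu1.const_mul _) (hv1.const_mul _),
      intervalIntegral.integral_const_mul, intervalIntegral.integral_const_mul, ← hu2, ← hv2,
      show U t = u t - u s from hu2.symm, show V t = v t - v s from hv2.symm]
    ring

theorem isAC_iff_coords {v v' : ℝ → E3} {J : Set ℝ} :
    IsAC v v' J ↔ ∀ i, IsAC (fun t => v t i) (fun t => v' t i) J := by
  constructor
  · intro h i
    exact h.clm (EuclideanSpace.proj i : E3 →L[ℝ] ℝ)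
  · intro h s hs t ht
    have hi : IntervalIntegrable v' volume s t := by
      have : v' = fun r => v' r 0 • (!₂[1, 0, 0] : E3) + v' r 1 • (!₂[0, 1, 0] : E3)
          + v' r 2 • (!₂[0, 0, 1] : E3) := by
        funext r; apply ext_coords <;> simp
      rw [this]
      exact (((h 0 hs ht).1.smul_continuousOn continuousOn_const).add
        ((h 1 hs ht).1.smul_continuousOn continuousOn_const)).add
        ((h 2 hs ht).1.smul_continuousOn continuousOn_const)
    refine ⟨hi, ?_⟩
    ext i
    have := (EuclideanSpace.proj i : E3 →L[ℝ] ℝ).intervalIntegral_comp_comm hi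
    simp only [PiLp.proj_apply] at this
    rw [← this]
    exact (h i hs ht).2

theorem IsAC.smul_E3 {u u' : ℝ → ℝ} {v v' : ℝ → E3} {J : Set ℝ} (hJ : J.OrdConnected)
    (hu : IsAC u u' J) (hv : IsAC v v' J) :
    IsAC (fun t => u t • v t) (fun t => u' t • v t + u t • v' t) J := by
  rw [isAC_iff_coords] at hv ⊢
  intro i
  simpa using hu.mul hJ (hv i)

theorem IsAC.norm_sq {v v' : ℝ → E3} {J : Set ℝ} (hJ : J.OrdConnected) (hv : IsAC v v' J) :
    IsAC (fun t => ‖v t‖ ^ 2) (fun t => 2 * inner ℝ (v t) (v' t)) J := by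
  rw [isAC_iff_coords] at hv
  have := (((hv 0).mul hJ (hv 0)).add ((hv 1).mul hJ (hv 1))).add ((hv 2).mul hJ (hv 2))
  convert this using 2
  · rw [norm_sq_eq_coords]; ring
  · rw [inner_eq_coords]; ring

theorem isAC_of_hasDerivAt [CompleteSpace F] {f f' : ℝ → F} {J : Set ℝ} (hJ : J.OrdConnected)
    (hf : ∀ t ∈ J, HasDerivAt f (f' t) t) (hc : ContinuousOn f' J) : IsAC f f' J := by
  intro s hs t ht
  have hsub := hJ.uIcc_subset hs ht
  have hi : IntervalIntegrable f' volume s t := (hc.mono hsub).intervalIntegrable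
  exact ⟨hi, (intervalIntegral.integral_eq_sub_of_hasDerivAt (fun r hr => hf r (hsub hr)) hi).symm⟩

theorem isAC_of_contDiff [CompleteSpace F] {f : ℝ → F} (hf : ContDiff ℝ ∞ f) (J : Set ℝ) :
    IsAC f (deriv f) J := by
  refine IsAC.mono (J := univ) (isAC_of_hasDerivAt ordConnected_univ (fun t _ => ?_) ?_)
    (subset_univ _)
  · exact (hf.differentiable (by simp)).differentiableAt.hasDerivAt
  · exact (hf.continuous_deriv (by simp)).continuousOn

end AbsolutelyContinuous

/-! ### Weighted integrability and weak derivatives along the generating curve -/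

/-- A field that is square integrable with a weight is integrable against functions controlled by
the weight. -/
theorem integrable_smul_of_weight {X : Type*} [MeasurableSpace X] {μ : Measure X}
    {w ψ : X → ℝ} {f : X → E3} {C : ℝ} (hw : Integrable w μ) (hw0 : ∀ᵐ p ∂μ, 0 ≤ w p)
    (hf : AEStronglyMeasurable f μ) (hfw : Integrable (fun p => ‖f p‖ ^ 2 * w p) μ)
    (hψ : AEStronglyMeasurable ψ μ) (hψw : ∀ᵐ p ∂μ, |ψ p| ≤ C * w p) :
    Integrable (fun p => ψ p • f p) μ := by
  refine Integrable.mono' ((hw.add hfw).const_mul |C|) (hψ.smul hf) ?_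
  filter_upwards [hw0, hψw] with p h0 h1
  rw [norm_smul, Real.norm_eq_abs]
  have h2 : |ψ p| ≤ |C| * w p := h1.trans (mul_le_mul_of_nonneg_right (le_abs_self C) h0)
  -- From `y ≤ 1 + y²`: a finite total weight and a finite weighted square suffice.
  have h3 : w p * ‖f p‖ ≤ w p + ‖f p‖ ^ 2 * w p := by
    nlinarith [mul_nonneg h0 (sq_nonneg (‖f p‖ - 1)), mul_nonneg h0 (sq_nonneg ‖f p‖)]
  calc |ψ p| * ‖f p‖ ≤ |C| * w p * ‖f p‖ := mul_le_mul_of_nonneg_right h2 (norm_nonneg _)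
    _ = |C| * (w p * ‖f p‖) := by ring
    _ ≤ |C| * (w p + ‖f p‖ ^ 2 * w p) := mul_le_mul_of_nonneg_left h3 (abs_nonneg C)

namespace SurfaceOfRevolution

variable (S : SurfaceOfRevolution)

/-- Test functions on the generating curve: smooth, vanishing near the endpoints or else, if the
curve is a loop, periodic. -/
def Test1 (χ : ℝ → ℝ) : Prop :=
  ContDiff ℝ ∞ χ ∧ ((∃ c d, S.a < c ∧ d < S.b ∧ ∀ t, χ t ≠ 0 → t ∈ Icc c d) ∨
    (S.IsLoop ∧ ∀ t, χ (t + (S.b - S.a)) = χ t))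

/-- `v'` is the weak derivative of the bounded function `v` along the generating curve, and is
square integrable with weight `x`. -/
structure WeakD1 (v v' : ℝ → E3) : Prop where
  meas : AEStronglyMeasurable v (volume.restrict (Ioo S.a S.b))
  bdd : ∃ C, ∀ t ∈ Ioo S.a S.b, ‖v t‖ ≤ C
  meas' : AEStronglyMeasurable v' (volume.restrict (Ioo S.a S.b))
  sq_int : IntegrableOn (fun t => ‖v' t‖ ^ 2 * S.x t) (Ioo S.a S.b)
  parts : ∀ χ, S.Test1 χ → ∫ t in Ioo S.a S.b, deriv χ t • v t = - ∫ t in Ioo S.a S.b, χ t • v' t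

theorem aestronglyMeasurable_of_continuousOn {F : Type*} [NormedAddCommGroup F]
    {f : ℝ → F} (hf : ContinuousOn f (Icc S.a S.b)) :
    AEStronglyMeasurable f (volume.restrict (Ioo S.a S.b)) :=
  (hf.mono Ioo_subset_Icc_self).aestronglyMeasurable measurableSet_Ioo

theorem integrableOn_of_continuousOn {F : Type*} [NormedAddCommGroup F]
    {f : ℝ → F} (hf : ContinuousOn f (Icc S.a S.b)) : IntegrableOn f (Ioo S.a S.b) :=
  (hf.integrableOn_Icc).mono_set Ioo_subset_Icc_self

/-- Functions of `t` alone on the coordinate domain. -/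
theorem aestronglyMeasurable_cell_snd {F : Type*} [NormedAddCommGroup F] {f : ℝ → F}
    (hf : AEStronglyMeasurable f (volume.restrict (Ioo S.a S.b))) :
    AEStronglyMeasurable (fun p : ℝ × ℝ => f p.2) (volume.restrict S.cell) := by
  rw [restrict_cell]; exact hf.comp_snd

theorem integrableOn_cell_snd {F : Type*} [NormedAddCommGroup F] {f : ℝ → F}
    (hf : IntegrableOn f (Ioo S.a S.b)) : IntegrableOn (fun p : ℝ × ℝ => f p.2) S.cell := by
  rw [IntegrableOn, restrict_cell]
  exact Integrable.comp_snd hf _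

theorem ae_cell_of_forall {P : ℝ × ℝ → Prop} (h : ∀ φ, ∀ t ∈ Ioo S.a S.b, P (φ, t)) :
    ∀ᵐ p ∂(volume.restrict S.cell), P p := by
  filter_upwards [ae_restrict_mem S.measurableSet_cell] with p hp
  exact h p.1 p.2 hp.2

theorem x_lower_of_support {c d : ℝ} (hc : S.a < c) (hd : d < S.b) :
    ∃ k : ℝ, 0 < k ∧ ∀ t ∈ Icc c d, k ≤ S.x t := by
  have hsub : Icc c d ⊆ Ioo S.a S.b := fun t ht => ⟨hc.trans_le ht.1, ht.2.trans_lt hd⟩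
  exact S.exists_x_lower isCompact_Icc (hsub.trans Ioo_subset_Icc_self)
    fun t ht => (S.x_pos t (hsub ht)).ne'

theorem exists_bound_Icc {f : ℝ → ℝ} (hf : Continuous f) (c d : ℝ) :
    ∃ K : ℝ, 0 ≤ K ∧ ∀ t ∈ Icc c d, |f t| ≤ K := by
  obtain ⟨K, hK⟩ := isCompact_Icc.exists_bound_of_continuousOn (hf.continuousOn (s := Icc c d))
  exact ⟨max K 0, le_max_right _ _, fun t ht => (hK t ht).trans (le_max_left _ _)⟩

variable {S}

/-- A weight-type bound from the support condition on a test function. -/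
theorem exists_weight_bound {ψ : ℝ × ℝ → ℝ} (hψ : Continuous ψ)
    (h : (∃ c d, S.a < c ∧ d < S.b ∧ ∀ φ t, ψ (φ, t) ≠ 0 → t ∈ Icc c d) ∨ S.IsLoop) :
    ∃ C, ∀ φ ∈ Icc 0 (2 * Real.pi), ∀ t ∈ Icc S.a S.b, |ψ (φ, t)| ≤ C * S.x t := by
  obtain ⟨K, hK⟩ := (isCompact_Icc.prod isCompact_Icc).exists_bound_of_continuousOn
    (hψ.continuousOn (s := Icc 0 (2 * Real.pi) ×ˢ Icc S.a S.b))
  have hK0 : 0 ≤ max K 0 := le_max_right _ _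
  -- Where a test function lives, `x` is bounded below: either the support keeps away from the ends,
  -- or the curve is a loop and never meets the axis.
  obtain ⟨k, hk, H⟩ : ∃ k : ℝ, 0 < k ∧ ∀ φ, ∀ t ∈ Icc S.a S.b, ψ (φ, t) ≠ 0 → k ≤ S.x t := by
    rcases h with ⟨c, d, hc, hd, h⟩ | h
    · obtain ⟨k, hk, H⟩ := S.x_lower_of_support hc hd
      exact ⟨k, hk, fun φ t _ h0 => H t (h φ t h0)⟩
    · obtain ⟨k, hk, H⟩ := S.exists_x_lower isCompact_Icc subset_rfl h.x_ne_zero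
      exact ⟨k, hk, fun φ t ht _ => H t ht⟩
  refine ⟨max K 0 / k, fun φ hφ t ht => ?_⟩
  rcases eq_or_ne (ψ (φ, t)) 0 with h0 | h0
  · rw [h0, abs_zero]; exact mul_nonneg (by positivity) (S.x_nonneg ht)
  · calc |ψ (φ, t)| ≤ max K 0 := (hK (φ, t) ⟨hφ, ht⟩).trans (le_max_left _ _)
      _ = max K 0 / k * k := by field_simp
      _ ≤ max K 0 / k * S.x t := mul_le_mul_of_nonneg_left (H φ t ht h0) (by positivity)

theorem Test1.exists_bound {χ : ℝ → ℝ} (hχ : S.Test1 χ) :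
    ∃ C, ∀ t ∈ Icc S.a S.b, |χ t| ≤ C * S.x t := by
  obtain ⟨C, hC⟩ := exists_weight_bound (S := S) (ψ := fun p => χ p.2)
    (hχ.1.continuous.comp continuous_snd) (by
      rcases hχ.2 with ⟨c, d, hc, hd, h⟩ | h
      · exact Or.inl ⟨c, d, hc, hd, fun _ t => h t⟩
      · exact Or.inr h.1)
  exact ⟨C, fun t ht => hC 0 ⟨le_rfl, Real.two_pi_pos.le⟩ t ht⟩

theorem IsTest.exists_bound {ψ : ℝ × ℝ → ℝ} (hψ : S.IsTest ψ) :
    ∃ C, ∀ φ ∈ Icc 0 (2 * Real.pi), ∀ t ∈ Icc S.a S.b, |ψ (φ, t)| ≤ C * S.x t :=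
  exists_weight_bound hψ.1.continuous (by
      rcases hψ.2.2 with h | h
      · exact Or.inl h
      · exact Or.inr h.1)

theorem Test1.integrable_smul {χ : ℝ → ℝ} (hχ : S.Test1 χ) {f : ℝ → E3}
    (hf : AEStronglyMeasurable f (volume.restrict (Ioo S.a S.b)))
    (hfw : IntegrableOn (fun t => ‖f t‖ ^ 2 * S.x t) (Ioo S.a S.b)) :
    IntegrableOn (fun t => χ t • f t) (Ioo S.a S.b) := by
  obtain ⟨C, hC⟩ := hχ.exists_bound
  refine integrable_smul_of_weight (w := S.x) (C := C)
    (S.integrableOn_of_continuousOn S.continuousOn_x) ?_ hf hfw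
    hχ.1.continuous.aestronglyMeasurable ?_
  · filter_upwards [ae_restrict_mem measurableSet_Ioo] with t ht
    exact (S.x_pos t ht).le
  · filter_upwards [ae_restrict_mem measurableSet_Ioo] with t ht
    exact hC t (Ioo_subset_Icc_self ht)

theorem IsTest.integrable_smul {ψ : ℝ × ℝ → ℝ} (hψ : S.IsTest ψ) {f : ℝ × ℝ → E3}
    (hf : AEStronglyMeasurable f (volume.restrict S.cell))
    (hfw : IntegrableOn (fun p => ‖f p‖ ^ 2 * S.x p.2) S.cell) :
    IntegrableOn (fun p => ψ p • f p) S.cell := by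
  obtain ⟨C, hC⟩ := hψ.exists_bound
  refine integrable_smul_of_weight (w := fun p : ℝ × ℝ => S.x p.2) (C := C)
    (S.integrableOn_cell_snd (S.integrableOn_of_continuousOn S.continuousOn_x)) ?_ hf hfw
    hψ.1.continuous.aestronglyMeasurable ?_
  · filter_upwards [ae_restrict_mem S.measurableSet_cell] with t ht
    exact (S.x_pos _ ht.2).le
  · filter_upwards [ae_restrict_mem S.measurableSet_cell] with t ht
    exact hC t.1 (Ioo_subset_Icc_self ht.1) t.2 (Ioo_subset_Icc_self ht.2)

theorem integrableOn_smul_of_bdd {f : ℝ → E3} {χ : ℝ → ℝ} (hχ : Continuous χ)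
    (hf : AEStronglyMeasurable f (volume.restrict (Ioo S.a S.b)))
    (hb : ∃ C, ∀ t ∈ Ioo S.a S.b, ‖f t‖ ≤ C) :
    IntegrableOn (fun t => χ t • f t) (Ioo S.a S.b) := by
  obtain ⟨C, hC⟩ := hb
  obtain ⟨K, hK0, hK⟩ := exists_bound_Icc hχ S.a S.b
  refine Integrable.mono' (integrable_const (K * C)) (hχ.aestronglyMeasurable.smul hf) ?_
  filter_upwards [ae_restrict_mem measurableSet_Ioo] with t ht
  rw [norm_smul]
  exact mul_le_mul (hK t (Ioo_subset_Icc_self ht)) (hC t ht) (norm_nonneg _) hK0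

theorem integrableOn_cell_of_bdd {f : ℝ × ℝ → E3} {ψ : ℝ × ℝ → ℝ} (hψ : Continuous ψ)
    (hf : AEStronglyMeasurable f (volume.restrict S.cell))
    (hb : ∃ C, ∀ᵐ p ∂(volume.restrict S.cell), ‖f p‖ ≤ C) :
    IntegrableOn (fun p => ψ p • f p) S.cell := by
  obtain ⟨C, hC⟩ := hb
  obtain ⟨K, hK⟩ := (isCompact_Icc.prod isCompact_Icc).exists_bound_of_continuousOn
    (hψ.continuousOn (s := Icc 0 (2 * Real.pi) ×ˢ Icc S.a S.b))
  refine Integrable.mono' (integrable_const (max K 0 * C)) (hψ.aestronglyMeasurable.smul hf) ?_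
  filter_upwards [ae_restrict_mem S.measurableSet_cell, hC] with p hp hCp
  rw [norm_smul]
  exact mul_le_mul ((hK p ⟨Ioo_subset_Icc_self hp.1, Ioo_subset_Icc_self hp.2⟩).trans
    (le_max_left _ _)) hCp (norm_nonneg _) (le_max_right _ _)

namespace WeakD1

variable {v v' w w' : ℝ → E3}

theorem integrable_parts (hv : S.WeakD1 v v') {χ : ℝ → ℝ} (hχ : S.Test1 χ) :
    IntegrableOn (fun t => deriv χ t • v t) (Ioo S.a S.b) ∧
      IntegrableOn (fun t => χ t • v' t) (Ioo S.a S.b) :=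
  ⟨integrableOn_smul_of_bdd (hχ.1.continuous_deriv (by simp)) hv.meas hv.bdd,
    hχ.integrable_smul hv.meas' hv.sq_int⟩

theorem add (hv : S.WeakD1 v v') (hw : S.WeakD1 w w') :
    S.WeakD1 (fun t => v t + w t) (fun t => v' t + w' t) where
  meas := hv.meas.add hw.meas
  bdd := by
    obtain ⟨C, hC⟩ := hv.bdd
    obtain ⟨D, hD⟩ := hw.bdd
    exact ⟨C + D, fun t ht => (norm_add_le _ _).trans (add_le_add (hC t ht) (hD t ht))⟩
  meas' := hv.meas'.add hw.meas'
  sq_int := by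
    refine Integrable.mono' ((hv.sq_int.add hw.sq_int).const_mul 2)
      (((hv.meas'.add hw.meas').norm.pow 2).mul
        (S.aestronglyMeasurable_of_continuousOn S.continuousOn_x)) ?_
    filter_upwards [ae_restrict_mem measurableSet_Ioo] with t ht
    have hx := (S.x_pos t ht).le
    rw [Real.norm_of_nonneg (by positivity)]
    have h1 : ‖v' t + w' t‖ ^ 2 ≤ 2 * (‖v' t‖ ^ 2 + ‖w' t‖ ^ 2) := by
      have := pow_le_pow_left₀ (norm_nonneg _) (norm_add_le (v' t) (w' t)) 2
      nlinarith [sq_nonneg (‖v' t‖ - ‖w' t‖)]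
    calc ‖v' t + w' t‖ ^ 2 * S.x t ≤ 2 * (‖v' t‖ ^ 2 + ‖w' t‖ ^ 2) * S.x t :=
          mul_le_mul_of_nonneg_right h1 hx
      _ = 2 * (‖v' t‖ ^ 2 * S.x t + ‖w' t‖ ^ 2 * S.x t) := by ring
  parts := by
    intro χ hχ
    have h1 := hv.integrable_parts hχ
    have h2 := hw.integrable_parts hχ
    simp only [smul_add]
    rw [integral_add h1.1 h2.1, integral_add h1.2 h2.2, hv.parts χ hχ, hw.parts χ hχ, neg_add]

theorem clm (L : E3 →L[ℝ] E3) (hv : S.WeakD1 v v') :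
    S.WeakD1 (fun t => L (v t)) (fun t => L (v' t)) where
  meas := L.continuous.comp_aestronglyMeasurable hv.meas
  bdd := by
    obtain ⟨C, hC⟩ := hv.bdd
    exact ⟨‖L‖ * C, fun t ht => (L.le_opNorm _).trans
      (mul_le_mul_of_nonneg_left (hC t ht) (norm_nonneg _))⟩
  meas' := L.continuous.comp_aestronglyMeasurable hv.meas'
  sq_int := by
    refine Integrable.mono' (hv.sq_int.const_mul (‖L‖ ^ 2))
      (((L.continuous.comp_aestronglyMeasurable hv.meas').norm.pow 2).mul
        (S.aestronglyMeasurable_of_continuousOn S.continuousOn_x)) ?_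
    filter_upwards [ae_restrict_mem measurableSet_Ioo] with t ht
    have hx := (S.x_pos t ht).le
    rw [Real.norm_of_nonneg (by positivity), ← mul_assoc, ← mul_pow]
    exact mul_le_mul_of_nonneg_right
      (pow_le_pow_left₀ (norm_nonneg _) (L.le_opNorm _) 2) hx
  parts := by
    intro χ hχ
    have h1 := hv.integrable_parts hχ
    simp only [← map_smul]
    rw [L.integral_comp_comm h1.1, L.integral_comp_comm h1.2, hv.parts χ hχ, map_neg]

theorem const_smul (c : ℝ) (hv : S.WeakD1 v v') :
    S.WeakD1 (fun t => c • v t) (fun t => c • v' t) :=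
  hv.clm (c • ContinuousLinearMap.id ℝ E3)

end WeakD1

/-- The derivative of a test function vanishes where the function does, off its support. -/
theorem deriv_eq_zero_of_notMem {χ : ℝ → ℝ} {c d : ℝ} (h : ∀ t, χ t ≠ 0 → t ∈ Icc c d) {t : ℝ}
    (ht : t ∉ Icc c d) : deriv χ t = 0 := by
  have : χ =ᶠ[nhds t] fun _ => (0 : ℝ) := by
    filter_upwards [isClosed_Icc.isOpen_compl.mem_nhds ht] with s hs
    by_contra h0
    exact hs (h s h0)
  rw [this.deriv_eq]; simp

/-- The integrand is the derivative of `χ u`, which vanishes at both ends of an interval slightly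
larger than the support of `χ`. -/
theorem integral_test_of_support {a b : ℝ} (hab : a < b) {u u' : ℝ → E3}
    (hu : IsAC u u' (Ioo a b)) {χ : ℝ → ℝ}
    (hχ : ContDiff ℝ ∞ χ) {c d : ℝ} (hc : a < c) (hd : d < b)
    (h : ∀ t, χ t ≠ 0 → t ∈ Icc c d) :
    ∫ t in Ioo a b, (deriv χ t • u t + χ t • u' t) = 0 := by
  -- `Icc c d` may be empty, so the midpoint of `a` and `b` is also kept between `c'` and `d'` to
  -- ensure `c' < d'`.
  obtain ⟨c', hc1, hc2⟩ := exists_between (lt_min hc (left_lt_add_div_two.2 hab))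
  obtain ⟨d', hd1, hd2⟩ := exists_between (max_lt hd (add_div_two_lt_right.2 hab))
  obtain ⟨hc2, hc3⟩ := lt_min_iff.1 hc2
  obtain ⟨hd1, hd3⟩ := max_lt_iff.1 hd1
  have hcd : c' ≤ d' := (hc3.trans hd3).le
  have hsub : Icc c' d' ⊆ Ioo a b := fun t ht => ⟨hc1.trans_le ht.1, ht.2.trans_lt hd2⟩
  have hz : ∀ t, t ∉ Ioo c' d' → t ∉ Icc c d := fun t ht h' =>
    ht ⟨hc2.trans_le h'.1, h'.2.trans_lt hd1⟩
  have hz0 : ∀ t, t ∉ Ioo c' d' → χ t = 0 := fun t ht => by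
    by_contra h0
    exact hz t ht (h t h0)
  have hac := (isAC_of_contDiff hχ (Ioo a b)).smul_E3 ordConnected_Ioo hu
  have h1 := (hac (hsub (left_mem_Icc.2 hcd)) (hsub (right_mem_Icc.2 hcd))).2
  beta_reduce at h1
  rw [hz0 c' (by simp), hz0 d' (by simp)] at h1
  rw [setIntegral_eq_of_subset_of_forall_sdiff_eq_zero measurableSet_Ioo
    (Ioc_subset_Icc_self.trans hsub), ← intervalIntegral.integral_of_le hcd, ← h1]
  · simp
  · intro t ht
    have : t ∉ Ioo c' d' := fun h' => ht.2 (Ioo_subset_Ioc_self h')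
    rw [hz0 t this, deriv_eq_zero_of_notMem h (hz t this)]; simp

/-- A locally absolutely continuous function with integrable derivative extends to the closed
interval. -/
theorem IsAC.exists_extension {F : Type*} [NormedAddCommGroup F] [NormedSpace ℝ F]
    {a b : ℝ} (hab : a < b) {u u' : ℝ → F} (hu : IsAC u u' (Ioo a b))
    (hi : IntegrableOn u' (Ioo a b)) :
    ∃ w, IsAC w u' (Icc a b) ∧ ∀ t ∈ Ioo a b, w t = u t := by
  obtain ⟨t0, ht0⟩ := exists_between hab
  have hi' : IntervalIntegrable u' volume a b := by
    rwa [intervalIntegrable_iff_integrableOn_Ioo_of_le hab.le]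
  refine ⟨fun t => u t0 + ∫ r in t0..t, u' r, IsAC.of_base (t0 := t0) fun t ht => ⟨?_, ?_⟩,
    fun t ht => (hu.eq_add ht0 ht).symm⟩
  · refine hi'.mono_set ?_
    rw [uIcc_of_le hab.le]
    exact uIcc_subset_Icc (Ioo_subset_Icc_self ht0) ht
  · simp

/-- On a loop the constant `1` is itself a test function, so the weighted bound gives plain
integrability. -/
theorem IsLoop.integrableOn_of_sq (h : S.IsLoop) {f : ℝ → E3}
    (hf : AEStronglyMeasurable f (volume.restrict (Ioo S.a S.b)))
    (hfw : IntegrableOn (fun t => ‖f t‖ ^ 2 * S.x t) (Ioo S.a S.b)) :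
    IntegrableOn f (Ioo S.a S.b) := by
  have : S.Test1 fun _ => 1 := ⟨contDiff_const, Or.inr ⟨h, fun _ => rfl⟩⟩
  simpa using this.integrable_smul hf hfw

/-- Compactly supported test functions produce no boundary terms. On a loop the test functions are
periodic, and the boundary terms cancel exactly when `u` closes up; this is the hypothesis that `u'`
has integral zero. -/
theorem weakD1_of_isAC {u u' : ℝ → E3} (hu : IsAC u u' (Ioo S.a S.b))
    (hb : ∃ C, ∀ t ∈ Ioo S.a S.b, ‖u t‖ ≤ C)
    (hm : AEStronglyMeasurable u' (volume.restrict (Ioo S.a S.b)))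
    (hsq : IntegrableOn (fun t => ‖u' t‖ ^ 2 * S.x t) (Ioo S.a S.b))
    (hloop : S.IsLoop → ∫ t in Ioo S.a S.b, u' t = 0) : S.WeakD1 u u' where
  meas := hu.continuousOn_Ioo.aestronglyMeasurable measurableSet_Ioo
  bdd := hb
  meas' := hm
  sq_int := hsq
  parts := by
    intro χ hχ
    have hmu := hu.continuousOn_Ioo.aestronglyMeasurable (μ := volume) measurableSet_Ioo
    have i1 : IntegrableOn (fun t => deriv χ t • u t) (Ioo S.a S.b) :=
      integrableOn_smul_of_bdd (hχ.1.continuous_deriv (by simp)) hmu hb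
    have i2 := hχ.integrable_smul hm hsq
    rw [eq_neg_iff_add_eq_zero, ← integral_add i1 i2]
    rcases hχ.2 with ⟨c, d, hc, hd, h⟩ | ⟨hl, hper⟩
    · exact integral_test_of_support S.a_lt_b hu hχ.1 hc hd h
    · have hint := hl.integrableOn_of_sq hm hsq
      obtain ⟨w, hw, hwu⟩ := IsAC.exists_extension S.a_lt_b hu hint
      have hac := (isAC_of_contDiff hχ.1 (Icc S.a S.b)).smul_E3 ordConnected_Icc hw
      have ha : S.a ∈ Icc S.a S.b := left_mem_Icc.2 S.a_lt_b.le
      have hb : S.b ∈ Icc S.a S.b := right_mem_Icc.2 S.a_lt_b.le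
      have h1 := (hac ha hb).2
      have h2 := (hw ha hb).2
      rw [intervalIntegral.integral_of_le S.a_lt_b.le, integral_Ioc_eq_integral_Ioo] at h1 h2
      rw [hloop hl, sub_eq_zero] at h2
      have h3 : χ S.b = χ S.a := by simpa using hper S.a
      beta_reduce at h1
      rw [h2, h3, sub_self] at h1
      rw [h1]
      refine setIntegral_congr_fun measurableSet_Ioo fun t ht => ?_
      simp only [hwu t ht]

end SurfaceOfRevolution

/-! ### Trigonometric integrals -/

theorem integral_Ioo_two_pi {F : Type*} [NormedAddCommGroup F] [NormedSpace ℝ F] (f : ℝ → F) :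
    ∫ φ in Ioo 0 (2 * Real.pi), f φ = ∫ φ in (0 : ℝ)..(2 * Real.pi), f φ := by
  rw [intervalIntegral.integral_of_le Real.two_pi_pos.le, integral_Ioc_eq_integral_Ioo]

theorem integral_trig_quadratic (c0 c1 c2 c3 c4 c5 : ℝ) :
    ∫ φ in Ioo 0 (2 * Real.pi), (c0 + c1 * Real.cos φ + c2 * Real.sin φ + c3 * Real.cos φ ^ 2
      + c4 * Real.sin φ ^ 2 + c5 * (Real.sin φ * Real.cos φ)) =
      2 * Real.pi * c0 + Real.pi * (c3 + c4) := by
  rw [integral_Ioo_two_pi]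
  have hi : ∀ f : ℝ → ℝ, Continuous f → IntervalIntegrable f volume 0 (2 * Real.pi) :=
    fun f hf => hf.intervalIntegrable _ _
  rw [intervalIntegral.integral_add (hi _ (by fun_prop)) (hi _ (by fun_prop)),
    intervalIntegral.integral_add (hi _ (by fun_prop)) (hi _ (by fun_prop)),
    intervalIntegral.integral_add (hi _ (by fun_prop)) (hi _ (by fun_prop)),
    intervalIntegral.integral_add (hi _ (by fun_prop)) (hi _ (by fun_prop)),
    intervalIntegral.integral_add (hi _ (by fun_prop)) (hi _ (by fun_prop))]
  simp only [intervalIntegral.integral_const_mul, intervalIntegral.integral_const, integral_cos,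
    integral_sin, integral_cos_sq, integral_sin_sq, integral_sin_mul_cos₁]
  simp
  ring

theorem integral_norm_sq_trig (A B C : E3) :
    ∫ φ in Ioo 0 (2 * Real.pi), ‖Real.cos φ • A + Real.sin φ • B + C‖ ^ 2 =
      Real.pi * (‖A‖ ^ 2 + ‖B‖ ^ 2) + 2 * Real.pi * ‖C‖ ^ 2 := by
  have := integral_trig_quadratic (‖C‖ ^ 2) (2 * inner ℝ A C) (2 * inner ℝ B C) (‖A‖ ^ 2)
    (‖B‖ ^ 2) (2 * inner ℝ A B)
  rw [show Real.pi * (‖A‖ ^ 2 + ‖B‖ ^ 2) + 2 * Real.pi * ‖C‖ ^ 2 =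
    2 * Real.pi * ‖C‖ ^ 2 + Real.pi * (‖A‖ ^ 2 + ‖B‖ ^ 2) by ring, ← this]
  congr 1
  funext φ
  simp only [norm_sq_eq_coords, inner_eq_coords]
  simp; ring

theorem integral_norm_sq_trig' (A B : E3) :
    ∫ φ in Ioo 0 (2 * Real.pi), ‖-Real.sin φ • A + Real.cos φ • B‖ ^ 2 =
      Real.pi * (‖A‖ ^ 2 + ‖B‖ ^ 2) := by
  have := integral_trig_quadratic 0 0 0 (‖B‖ ^ 2) (‖A‖ ^ 2) (- 2 * inner ℝ A B)
  rw [show Real.pi * (‖A‖ ^ 2 + ‖B‖ ^ 2) =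
    2 * Real.pi * 0 + Real.pi * (‖B‖ ^ 2 + ‖A‖ ^ 2) by ring, ← this]
  congr 1
  funext φ
  simp only [norm_sq_eq_coords, inner_eq_coords]
  simp; ring

/-! ### Fields that are first-order trigonometric polynomials in the angle -/

namespace SurfaceOfRevolution

variable {S : SurfaceOfRevolution}

/-- The area element `x h2` cancels one factor of each squared metric coefficient. Only the angular
derivative keeps a weight that is singular at the poles. -/
theorem gradSq_mul_areaElt (G : ℝ × ℝ → E3 × E3) {p : ℝ × ℝ} (hp : p.2 ∈ Ioo S.a S.b) :
    S.gradSq G p * S.areaElt p.2 =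
      ‖(G p).1‖ ^ 2 * (S.h2 p.2 / S.x p.2) + ‖(G p).2‖ ^ 2 * (S.x p.2 / S.h2 p.2) := by
  have hx := S.x_pos _ hp
  have hh := S.h2_pos (Ioo_subset_Icc_self hp)
  rw [gradSq, areaElt, S.h1_eq (Ioo_subset_Icc_self hp)]
  field_simp

theorem aestronglyMeasurable_x : AEStronglyMeasurable S.x (volume.restrict (Ioo S.a S.b)) :=
  S.aestronglyMeasurable_of_continuousOn S.continuousOn_x

/-- Nonnegative weights that are comparable give the same integrable functions. -/
theorem integrableOn_mul_weight {X : Type*} [MeasurableSpace X] {μ : Measure X} {f w w' : X → ℝ}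
    {C : ℝ} (hf : Integrable (fun p => f p * w p) μ) (hm : AEStronglyMeasurable f μ)
    (hw' : AEStronglyMeasurable w' μ) (hf0 : ∀ p, 0 ≤ f p)
    (h : ∀ᵐ p ∂μ, 0 ≤ w' p ∧ w' p ≤ C * w p) :
    Integrable (fun p => f p * w' p) μ := by
  refine Integrable.mono' (hf.const_mul C) (hm.mul hw') ?_
  filter_upwards [h] with p hp
  rw [Real.norm_of_nonneg (mul_nonneg (hf0 p) hp.1)]
  calc f p * w' p ≤ f p * (C * w p) := mul_le_mul_of_nonneg_left hp.2 (hf0 p)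
    _ = C * (f p * w p) := by ring

theorem aesm_h2_div_x : AEStronglyMeasurable (fun t => S.h2 t / S.x t)
    (volume.restrict (Ioo S.a S.b)) := by
  refine ContinuousOn.aestronglyMeasurable ?_ measurableSet_Ioo
  exact (S.continuousOn_h2.mono Ioo_subset_Icc_self).div
    (S.continuousOn_x.mono Ioo_subset_Icc_self) fun t ht => (S.x_pos t ht).ne'

theorem aesm_x_div_h2 : AEStronglyMeasurable (fun t => S.x t / S.h2 t)
    (volume.restrict (Ioo S.a S.b)) := by
  refine ContinuousOn.aestronglyMeasurable ?_ measurableSet_Ioo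
  exact (S.continuousOn_x.mono Ioo_subset_Icc_self).div
    (S.continuousOn_h2.mono Ioo_subset_Icc_self) fun t ht =>
      (S.h2_pos (Ioo_subset_Icc_self ht)).ne'

theorem aesm_inv_x : AEStronglyMeasurable (fun t => (S.x t)⁻¹)
    (volume.restrict (Ioo S.a S.b)) := by
  refine ContinuousOn.aestronglyMeasurable ?_ measurableSet_Ioo
  exact (S.continuousOn_x.mono Ioo_subset_Icc_self).inv₀ fun t ht => (S.x_pos t ht).ne'

/-- The weights of the Dirichlet energy may be replaced by powers of `x`. -/
theorem exists_weight_comparison (S : SurfaceOfRevolution) : ∃ C : ℝ, 0 < C ∧ ∀ t ∈ Ioo S.a S.b,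
    (0 ≤ S.h2 t / S.x t ∧ S.h2 t / S.x t ≤ C * (S.x t)⁻¹) ∧
    (0 ≤ (S.x t)⁻¹ ∧ (S.x t)⁻¹ ≤ C * (S.h2 t / S.x t)) ∧
    (0 ≤ S.x t / S.h2 t ∧ S.x t / S.h2 t ≤ C * S.x t) ∧
    (0 ≤ S.x t ∧ S.x t ≤ C * (S.x t / S.h2 t)) ∧ (0 ≤ S.x t ∧ S.x t ≤ C * (S.x t)⁻¹) := by
  obtain ⟨k, K, hk, hK, h⟩ := S.exists_h2_bounds
  obtain ⟨X, hX, hx⟩ := S.exists_x_bound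
  refine ⟨K + k⁻¹ + X ^ 2, by positivity, fun t ht => ?_⟩
  have h0 := S.x_pos t ht
  have h1 := S.h2_pos (Ioo_subset_Icc_self ht)
  obtain ⟨h2, h3⟩ := h t (Ioo_subset_Icc_self ht)
  have h4 := hx t (Ioo_subset_Icc_self ht)
  have hkk : 1 ≤ k⁻¹ * S.h2 t := by rw [inv_mul_eq_div, one_le_div hk]; exact h2
  have hkK : 0 < k⁻¹ := by positivity
  have hX2 : 0 < X ^ 2 := by positivity
  refine ⟨⟨by positivity, ?_⟩, ⟨by positivity, ?_⟩, ⟨by positivity, ?_⟩, ⟨h0.le, ?_⟩, h0.le, ?_⟩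
  · rw [div_eq_mul_inv]
    exact mul_le_mul_of_nonneg_right (by linarith) (by positivity)
  · rw [div_eq_mul_inv, ← mul_assoc]
    refine le_mul_of_one_le_left (by positivity) ?_
    nlinarith
  · rw [div_eq_mul_inv, mul_comm]
    refine mul_le_mul_of_nonneg_right ?_ h0.le
    have : (S.h2 t)⁻¹ ≤ k⁻¹ := inv_anti₀ hk h2
    linarith
  · rw [mul_div_assoc', le_div_iff₀ h1, mul_comm]
    exact mul_le_mul_of_nonneg_right (by linarith) h0.le
  · rw [← div_eq_mul_inv, le_div_iff₀ h0]
    nlinarith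

/-- Both terms of the density are nonnegative, so they are integrable separately, and `h2` lies
between positive constants, so it can be dropped from the weights. -/
theorem sq_int_iff {G : ℝ × ℝ → E3 × E3} (hG : AEStronglyMeasurable G (volume.restrict S.cell)) :
    IntegrableOn (fun p => S.gradSq G p * S.areaElt p.2) S.cell ↔
      IntegrableOn (fun p => ‖(G p).1‖ ^ 2 * (S.x p.2)⁻¹) S.cell ∧
      IntegrableOn (fun p => ‖(G p).2‖ ^ 2 * S.x p.2) S.cell := by
  obtain ⟨C, hC, hw⟩ := S.exists_weight_comparison
  have hm1 : AEStronglyMeasurable (fun p => ‖(G p).1‖ ^ 2) (volume.restrict S.cell) :=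
    (continuous_fst.comp_aestronglyMeasurable hG).norm.pow 2
  have hm2 : AEStronglyMeasurable (fun p => ‖(G p).2‖ ^ 2) (volume.restrict S.cell) :=
    (continuous_snd.comp_aestronglyMeasurable hG).norm.pow 2
  have w1 := S.aestronglyMeasurable_cell_snd S.aesm_h2_div_x
  have w2 := S.aestronglyMeasurable_cell_snd S.aesm_x_div_h2
  have w3 := S.aestronglyMeasurable_cell_snd S.aesm_inv_x
  have w4 := S.aestronglyMeasurable_cell_snd S.aestronglyMeasurable_x
  have e : IntegrableOn (fun p => S.gradSq G p * S.areaElt p.2) S.cell ↔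
      IntegrableOn (fun p => ‖(G p).1‖ ^ 2 * (S.h2 p.2 / S.x p.2) +
        ‖(G p).2‖ ^ 2 * (S.x p.2 / S.h2 p.2)) S.cell :=
    integrableOn_congr_fun (fun p hp => gradSq_mul_areaElt G hp.2) S.measurableSet_cell
  rw [e]
  constructor
  · intro h
    have h1 : IntegrableOn (fun p => ‖(G p).1‖ ^ 2 * (S.h2 p.2 / S.x p.2)) S.cell := by
      refine Integrable.mono' h (hm1.mul w1) (S.ae_cell_of_forall fun φ t ht => ?_)
      obtain ⟨⟨a1, -⟩, -, ⟨a3, -⟩, -⟩ := hw t ht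
      rw [Real.norm_of_nonneg (mul_nonneg (sq_nonneg _) a1)]
      exact le_add_of_nonneg_right (mul_nonneg (sq_nonneg _) a3)
    have h2 : IntegrableOn (fun p => ‖(G p).2‖ ^ 2 * (S.x p.2 / S.h2 p.2)) S.cell := by
      refine Integrable.mono' h (hm2.mul w2) (S.ae_cell_of_forall fun φ t ht => ?_)
      obtain ⟨⟨a1, -⟩, -, ⟨a3, -⟩, -⟩ := hw t ht
      rw [Real.norm_of_nonneg (mul_nonneg (sq_nonneg _) a3)]
      exact le_add_of_nonneg_left (mul_nonneg (sq_nonneg _) a1)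
    exact ⟨integrableOn_mul_weight h1 hm1 w3 (fun p => sq_nonneg _)
        (S.ae_cell_of_forall fun φ t ht => (hw t ht).2.1),
      integrableOn_mul_weight h2 hm2 w4 (fun p => sq_nonneg _)
        (S.ae_cell_of_forall fun φ t ht => (hw t ht).2.2.2.1)⟩
  · rintro ⟨h1, h2⟩
    exact (integrableOn_mul_weight h1 hm1 w1 (fun p => sq_nonneg _)
        (S.ae_cell_of_forall fun φ t ht => (hw t ht).1)).add
      (integrableOn_mul_weight h2 hm2 w2 (fun p => sq_nonneg _)
        (S.ae_cell_of_forall fun φ t ht => (hw t ht).2.2.1))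

/-- The derivatives of a test function along the coordinate lines. -/
theorem IsTest.hasDerivAt_snd {ψ : ℝ × ℝ → ℝ} (hψ : S.IsTest ψ) (φ t : ℝ) :
    HasDerivAt (fun s => ψ (φ, s)) (fderiv ℝ ψ (φ, t) (0, 1)) t :=
  ((hψ.1.differentiable (by simp)).differentiableAt.hasFDerivAt (x := (φ, t))).comp_hasDerivAt t
    ((hasDerivAt_const t φ).prodMk (hasDerivAt_id t))

theorem IsTest.hasDerivAt_fst {ψ : ℝ × ℝ → ℝ} (hψ : S.IsTest ψ) (φ t : ℝ) :
    HasDerivAt (fun s => ψ (s, t)) (fderiv ℝ ψ (φ, t) (1, 0)) φ :=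
  ((hψ.1.differentiable (by simp)).differentiableAt.hasFDerivAt (x := (φ, t))).comp_hasDerivAt φ
    ((hasDerivAt_id φ).prodMk (hasDerivAt_const φ t))

theorem IsTest.test1 {ψ : ℝ × ℝ → ℝ} (hψ : S.IsTest ψ) (φ : ℝ) : S.Test1 fun t => ψ (φ, t) := by
  refine ⟨hψ.1.comp (contDiff_const.prodMk contDiff_id), ?_⟩
  rcases hψ.2.2 with ⟨c, d, hc, hd, h⟩ | ⟨hl, h⟩
  · exact Or.inl ⟨c, d, hc, hd, fun t => h φ t⟩
  · exact Or.inr ⟨hl, fun t => h φ t⟩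

theorem IsTest.continuous_fderiv_apply {ψ : ℝ × ℝ → ℝ} (hψ : S.IsTest ψ) (e : ℝ × ℝ) :
    Continuous fun p => fderiv ℝ ψ p e :=
  (hψ.1.continuous_fderiv (by simp)).clm_apply continuous_const

/-- Products of functions of one coordinate are test functions. -/
theorem isTest_mul {ρ χ : ℝ → ℝ} (hρ : ContDiff ℝ ∞ ρ)
    (hper : ∀ φ, ρ (φ + 2 * Real.pi) = ρ φ) (hχ : S.Test1 χ) :
    S.IsTest fun p => ρ p.1 * χ p.2 := by
  refine ⟨(hρ.comp contDiff_fst).mul (hχ.1.comp contDiff_snd), fun φ t => by simp [hper], ?_⟩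
  rcases hχ.2 with ⟨c, d, hc, hd, h⟩ | ⟨hl, h⟩
  · exact Or.inl ⟨c, d, hc, hd, fun φ t h0 => h t (right_ne_zero_of_mul h0)⟩
  · exact Or.inr ⟨hl, fun φ t => by simp [h]⟩

theorem fderiv_mul_apply {ρ χ : ℝ → ℝ} (hρ : ContDiff ℝ ∞ ρ) (hχ : ContDiff ℝ ∞ χ) (p : ℝ × ℝ) :
    fderiv ℝ (fun p : ℝ × ℝ => ρ p.1 * χ p.2) p (1, 0) = deriv ρ p.1 * χ p.2 ∧
    fderiv ℝ (fun p : ℝ × ℝ => ρ p.1 * χ p.2) p (0, 1) = ρ p.1 * deriv χ p.2 := by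
  have h1 : HasFDerivAt (fun p : ℝ × ℝ => ρ p.1) (deriv ρ p.1 • ContinuousLinearMap.fst ℝ ℝ ℝ) p :=
    ((hρ.differentiable (by simp)).differentiableAt.hasDerivAt).comp_hasFDerivAt p hasFDerivAt_fst
  have h2 : HasFDerivAt (fun p : ℝ × ℝ => χ p.2) (deriv χ p.2 • ContinuousLinearMap.snd ℝ ℝ ℝ) p :=
    ((hχ.differentiable (by simp)).differentiableAt.hasDerivAt).comp_hasFDerivAt p hasFDerivAt_snd
  rw [show (fun p : ℝ × ℝ => ρ p.1 * χ p.2) = (fun p => ρ p.1) * fun p => χ p.2 from rfl,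
    (h1.mul h2).fderiv]
  simp; ring

theorem integral_cell {F : Type*} [NormedAddCommGroup F] [NormedSpace ℝ F] {f : ℝ × ℝ → F}
    (hf : IntegrableOn f S.cell) :
    ∫ p in S.cell, f p = ∫ φ in Ioo 0 (2 * Real.pi), ∫ t in Ioo S.a S.b, f (φ, t) := by
  rw [IntegrableOn, restrict_cell] at hf
  rw [restrict_cell, integral_prod _ hf]

theorem integral_cell_symm {F : Type*} [NormedAddCommGroup F] [NormedSpace ℝ F] {f : ℝ × ℝ → F}
    (hf : IntegrableOn f S.cell) :
    ∫ p in S.cell, f p = ∫ t in Ioo S.a S.b, ∫ φ in Ioo 0 (2 * Real.pi), f (φ, t) := by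
  rw [IntegrableOn, restrict_cell] at hf
  rw [restrict_cell, integral_prod_symm _ hf]

/-- The coordinate derivatives of the field `cos φ • A + sin φ • B + C`. -/
def trigGrad (A A' B B' C' : ℝ → E3) (p : ℝ × ℝ) : E3 × E3 :=
  (-Real.sin p.1 • A p.2 + Real.cos p.1 • B p.2,
    Real.cos p.1 • A' p.2 + Real.sin p.1 • B' p.2 + C' p.2)

section Trig

variable {A A' B B' C C' : ℝ → E3}

theorem aesm_cos_smul {f : ℝ → E3} {ρ : ℝ → ℝ} (hρ : Continuous ρ)
    (hf : AEStronglyMeasurable f (volume.restrict (Ioo S.a S.b))) :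
    AEStronglyMeasurable (fun p : ℝ × ℝ => ρ p.1 • f p.2) (volume.restrict S.cell) :=
  (hρ.comp continuous_fst).aestronglyMeasurable.smul (S.aestronglyMeasurable_cell_snd hf)

theorem aesm_trigGrad (hA : S.WeakD1 A A') (hB : S.WeakD1 B B') (hC : S.WeakD1 C C') :
    AEStronglyMeasurable (trigGrad A A' B B' C') (volume.restrict S.cell) :=
  ((aesm_cos_smul Real.continuous_sin.neg hA.meas).add
    (aesm_cos_smul Real.continuous_cos hB.meas)).prodMk
  (((aesm_cos_smul Real.continuous_cos hA.meas').add
    (aesm_cos_smul Real.continuous_sin hB.meas')).add (S.aestronglyMeasurable_cell_snd hC.meas'))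

theorem norm_sq_add_le {F : Type*} [SeminormedAddCommGroup F] (u v : F) :
    ‖u + v‖ ^ 2 ≤ 2 * (‖u‖ ^ 2 + ‖v‖ ^ 2) := by
  have := pow_le_pow_left₀ (norm_nonneg _) (norm_add_le u v) 2
  nlinarith [sq_nonneg (‖u‖ - ‖v‖)]

theorem norm_smul_sq_le {c : ℝ} (hc : |c| ≤ 1) (v : E3) : ‖c • v‖ ^ 2 ≤ ‖v‖ ^ 2 := by
  rw [norm_smul, Real.norm_eq_abs]
  exact pow_le_pow_left₀ (by positivity) (mul_le_of_le_one_left (norm_nonneg _) hc) 2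

theorem trigGrad_sq_int (hA : S.WeakD1 A A') (hB : S.WeakD1 B B') (hC : S.WeakD1 C C')
    (hAB : IntegrableOn (fun t => (‖A t‖ ^ 2 + ‖B t‖ ^ 2) * (S.x t)⁻¹) (Ioo S.a S.b)) :
    IntegrableOn (fun p => ‖(trigGrad A A' B B' C' p).1‖ ^ 2 * (S.x p.2)⁻¹) S.cell ∧
      IntegrableOn (fun p => ‖(trigGrad A A' B B' C' p).2‖ ^ 2 * S.x p.2) S.cell := by
  have hG := aesm_trigGrad hA hB hC
  have hm1 : AEStronglyMeasurable (fun p => ‖(trigGrad A A' B B' C' p).1‖ ^ 2)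
      (volume.restrict S.cell) := (continuous_fst.comp_aestronglyMeasurable hG).norm.pow 2
  have hm2 : AEStronglyMeasurable (fun p => ‖(trigGrad A A' B B' C' p).2‖ ^ 2)
      (volume.restrict S.cell) := (continuous_snd.comp_aestronglyMeasurable hG).norm.pow 2
  constructor
  · refine Integrable.mono' ((S.integrableOn_cell_snd hAB).const_mul 2)
      (hm1.mul (S.aestronglyMeasurable_cell_snd S.aesm_inv_x))
      (S.ae_cell_of_forall fun φ t ht => ?_)
    have hx := inv_nonneg.2 (S.x_pos t ht).le
    rw [Real.norm_of_nonneg (mul_nonneg (sq_nonneg _) hx), ← mul_assoc]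
    refine mul_le_mul_of_nonneg_right ((norm_sq_add_le _ _).trans ?_) hx
    have h1 := norm_smul_sq_le (c := -Real.sin φ) (by rw [abs_neg]; exact Real.abs_sin_le_one φ)
      (A t)
    have h2 := norm_smul_sq_le (Real.abs_cos_le_one φ) (B t)
    dsimp only
    linarith
  · refine Integrable.mono' (((S.integrableOn_cell_snd hA.sq_int).add
      ((S.integrableOn_cell_snd hB.sq_int).add (S.integrableOn_cell_snd hC.sq_int))).const_mul 4)
      (hm2.mul (S.aestronglyMeasurable_cell_snd S.aestronglyMeasurable_x))
      (S.ae_cell_of_forall fun φ t ht => ?_)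
    have hx := (S.x_pos t ht).le
    rw [Real.norm_of_nonneg (mul_nonneg (sq_nonneg _) hx)]
    have h1 := norm_smul_sq_le (Real.abs_cos_le_one φ) (A' t)
    have h2 := norm_smul_sq_le (Real.abs_sin_le_one φ) (B' t)
    have h3 := norm_sq_add_le (Real.cos φ • A' t + Real.sin φ • B' t) (C' t)
    have h4 := norm_sq_add_le (Real.cos φ • A' t) (Real.sin φ • B' t)
    have h5 := sq_nonneg ‖C' t‖
    calc ‖(trigGrad A A' B B' C' (φ, t)).2‖ ^ 2 * S.x t
        ≤ (4 * (‖A' t‖ ^ 2 + (‖B' t‖ ^ 2 + ‖C' t‖ ^ 2))) * S.x t :=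
          mul_le_mul_of_nonneg_right (by simp only [trigGrad]; linarith) hx
      _ = 4 * (‖A' t‖ ^ 2 * S.x t + (‖B' t‖ ^ 2 * S.x t + ‖C' t‖ ^ 2 * S.x t)) := by ring

theorem integral_periodic_parts {ρ ρ' : ℝ → ℝ} (hρ : ∀ φ, HasDerivAt ρ (ρ' φ) φ)
    (hc : Continuous ρ') (hper : ρ (2 * Real.pi) = ρ 0) (A B C : E3) :
    ∫ φ in Ioo 0 (2 * Real.pi), ρ' φ • (Real.cos φ • A + Real.sin φ • B + C) =
      - ∫ φ in Ioo 0 (2 * Real.pi), ρ φ • (-Real.sin φ • A + Real.cos φ • B) := by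
  have hcρ : Continuous ρ := continuous_iff_continuousAt.2 fun φ => (hρ φ).continuousAt
  have hd : ∀ φ, HasDerivAt (fun φ => ρ φ • (Real.cos φ • A + Real.sin φ • B + C))
      (ρ' φ • (Real.cos φ • A + Real.sin φ • B + C) +
        ρ φ • (-Real.sin φ • A + Real.cos φ • B)) φ := by
    intro φ
    have h1 : HasDerivAt (fun φ => Real.cos φ • A + Real.sin φ • B + C)
        (-Real.sin φ • A + Real.cos φ • B) φ :=
      (((Real.hasDerivAt_cos φ).smul_const A).add
        ((Real.hasDerivAt_sin φ).smul_const B)).add_const C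
    have := (hρ φ).smul h1
    rwa [add_comm] at this
  have i1 : Continuous fun φ => ρ' φ • (Real.cos φ • A + Real.sin φ • B + C) := by fun_prop
  have i2 : Continuous fun φ => ρ φ • (-Real.sin φ • A + Real.cos φ • B) := by fun_prop
  have key := intervalIntegral.integral_eq_sub_of_hasDerivAt (a := 0) (b := 2 * Real.pi)
    (fun φ _ => hd φ) ((i1.add i2).intervalIntegrable _ _)
  rw [intervalIntegral.integral_add (i1.intervalIntegrable _ _) (i2.intervalIntegrable _ _)] at key
  rw [integral_Ioo_two_pi, integral_Ioo_two_pi, eq_neg_iff_add_eq_zero, key]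
  simp [hper]

variable {m : E3 → E3}

theorem pull_trig_bdd (hA : S.WeakD1 A A') (hB : S.WeakD1 B B') (hC : S.WeakD1 C C')
    (hm : ∀ φ, ∀ t ∈ Ioo S.a S.b, m (S.param φ t) =
      Real.cos φ • A t + Real.sin φ • B t + C t) :
    AEStronglyMeasurable (S.pull m) (volume.restrict S.cell) ∧
      ∃ K, ∀ᵐ p ∂(volume.restrict S.cell), ‖S.pull m p‖ ≤ K := by
  constructor
  · have : AEStronglyMeasurable
      (fun p : ℝ × ℝ => Real.cos p.1 • A p.2 + Real.sin p.1 • B p.2 + C p.2)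
        (volume.restrict S.cell) :=
      ((aesm_cos_smul Real.continuous_cos hA.meas).add
        (aesm_cos_smul Real.continuous_sin hB.meas)).add (S.aestronglyMeasurable_cell_snd hC.meas)
    exact this.congr (S.ae_cell_of_forall fun φ t ht => (hm φ t ht).symm)
  · obtain ⟨K1, h1⟩ := hA.bdd
    obtain ⟨K2, h2⟩ := hB.bdd
    obtain ⟨K3, h3⟩ := hC.bdd
    refine ⟨K1 + K2 + K3, S.ae_cell_of_forall fun φ t ht => ?_⟩
    rw [pull, hm φ t ht]
    refine (norm_add_le _ _).trans (add_le_add ((norm_add_le _ _).trans (add_le_add ?_ ?_))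
      (h3 t ht))
    · rw [norm_smul]
      exact (mul_le_of_le_one_left (norm_nonneg _) (Real.abs_cos_le_one φ)).trans (h1 t ht)
    · rw [norm_smul]
      exact (mul_le_of_le_one_left (norm_nonneg _) (Real.abs_sin_le_one φ)).trans (h2 t ht)

/-- By Fubini the identity for `∂_φ` is classical integration by parts on each circle of latitude,
with periodic boundary values. The identity for `∂_t` is checked on each meridian, where the field
is a linear combination of `A`, `B`, `C` and the test function restricts to a test function of one
variable. The hypothesis `hAB` keeps the angular energy finite at the poles. -/
theorem isWeakGradient_trig (hA : S.WeakD1 A A') (hB : S.WeakD1 B B') (hC : S.WeakD1 C C')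
    (hAB : IntegrableOn (fun t => (‖A t‖ ^ 2 + ‖B t‖ ^ 2) * (S.x t)⁻¹) (Ioo S.a S.b))
    (hm : ∀ φ, ∀ t ∈ Ioo S.a S.b, m (S.param φ t) =
      Real.cos φ • A t + Real.sin φ • B t + C t) :
    S.IsWeakGradient m (trigGrad A A' B B' C') := by
  have hG := aesm_trigGrad hA hB hC
  obtain ⟨hs1, hs2⟩ := trigGrad_sq_int hA hB hC hAB
  obtain ⟨hpm, hpb⟩ := pull_trig_bdd hA hB hC hm
  have hs1' : IntegrableOn (fun p => ‖(trigGrad A A' B B' C' p).1‖ ^ 2 * S.x p.2) S.cell := by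
    obtain ⟨K, hK, hw⟩ := S.exists_weight_comparison
    exact integrableOn_mul_weight hs1 ((continuous_fst.comp_aestronglyMeasurable hG).norm.pow 2)
      (S.aestronglyMeasurable_cell_snd S.aestronglyMeasurable_x) (fun p => sq_nonneg _)
      (S.ae_cell_of_forall fun φ t ht => (hw t ht).2.2.2.2)
  refine ⟨hG, (sq_int_iff hG).2 ⟨hs1, hs2⟩, fun ψ hψ => ?_, fun ψ hψ => ?_⟩
  · have i1 := integrableOn_cell_of_bdd (S := S) (hψ.continuous_fderiv_apply (1, 0)) hpm hpb
    have i2 := hψ.integrable_smul (continuous_fst.comp_aestronglyMeasurable hG) hs1'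
    rw [integral_cell_symm i1, integral_cell_symm i2, ← integral_neg]
    refine setIntegral_congr_fun measurableSet_Ioo fun t ht => ?_
    have := integral_periodic_parts (ρ := fun φ => ψ (φ, t)) (fun φ => hψ.hasDerivAt_fst φ t)
      ((hψ.continuous_fderiv_apply (1, 0)).comp (continuous_id.prodMk continuous_const))
      (by simpa using hψ.2.1 0 t) (A t) (B t) (C t)
    simp only [pull, hm _ t ht, trigGrad]
    exact this
  · have i1 := integrableOn_cell_of_bdd (S := S) (hψ.continuous_fderiv_apply (0, 1)) hpm hpb
    have i2 := hψ.integrable_smul (continuous_snd.comp_aestronglyMeasurable hG) hs2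
    rw [integral_cell i1, integral_cell i2, ← integral_neg]
    congr 1
    funext φ
    have h := (((hA.const_smul (Real.cos φ)).add (hB.const_smul (Real.sin φ))).add hC).parts _
      (hψ.test1 φ)
    rw [← integral_neg] at h
    rw [← integral_neg]
    refine Eq.trans ?_ h
    refine setIntegral_congr_fun measurableSet_Ioo fun t ht => ?_
    simp only [pull, hm _ t ht, (hψ.hasDerivAt_snd φ t).deriv]

theorem memH1_trig (hA : S.WeakD1 A A') (hB : S.WeakD1 B B') (hC : S.WeakD1 C C')
    (hAB : IntegrableOn (fun t => (‖A t‖ ^ 2 + ‖B t‖ ^ 2) * (S.x t)⁻¹) (Ioo S.a S.b))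
    (hm : ∀ φ, ∀ t ∈ Ioo S.a S.b, m (S.param φ t) =
      Real.cos φ • A t + Real.sin φ • B t + C t) : S.MemH1 m := by
  obtain ⟨hpm, K, hpb⟩ := pull_trig_bdd hA hB hC hm
  refine ⟨hpm, ?_, _, isWeakGradient_trig hA hB hC hAB hm⟩
  have ha : ContinuousOn S.areaElt (Icc S.a S.b) := S.continuousOn_x.abs.mul S.continuousOn_h2
  have hi := S.integrableOn_cell_snd (S.integrableOn_of_continuousOn ha)
  refine Integrable.mono' (hi.const_mul (K ^ 2)) ((hpm.norm.pow 2).mul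
    (S.aestronglyMeasurable_cell_snd (S.aestronglyMeasurable_of_continuousOn ha))) ?_
  filter_upwards [hpb] with p hp
  have h0 : 0 ≤ S.areaElt p.2 := mul_nonneg (abs_nonneg _) (Real.sqrt_nonneg _)
  rw [Real.norm_of_nonneg (mul_nonneg (sq_nonneg _) h0)]
  exact mul_le_mul_of_nonneg_right (pow_le_pow_left₀ (norm_nonneg _) hp 2) h0

/-- The functions `1`, `cos`, `sin` are orthogonal on the circle, so no mixed terms survive; a
constant counts twice as much as a harmonic. -/
theorem integral_gradSq_trig (hA : S.WeakD1 A A') (hB : S.WeakD1 B B') (hC : S.WeakD1 C C')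
    (hAB : IntegrableOn (fun t => (‖A t‖ ^ 2 + ‖B t‖ ^ 2) * (S.x t)⁻¹) (Ioo S.a S.b)) :
    ∫ p in S.cell, S.gradSq (trigGrad A A' B B' C') p * S.areaElt p.2 =
      ∫ t in Ioo S.a S.b, (Real.pi * (‖A t‖ ^ 2 + ‖B t‖ ^ 2) * (S.h2 t / S.x t) +
        (Real.pi * (‖A' t‖ ^ 2 + ‖B' t‖ ^ 2) + 2 * Real.pi * ‖C' t‖ ^ 2) * (S.x t / S.h2 t)) := by
  have hG := aesm_trigGrad hA hB hC
  rw [integral_cell_symm ((sq_int_iff hG).2 (trigGrad_sq_int hA hB hC hAB))]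
  refine setIntegral_congr_fun measurableSet_Ioo fun t ht => ?_
  have : ∀ φ, S.gradSq (trigGrad A A' B B' C') (φ, t) * S.areaElt (φ, t).2 =
      ‖-Real.sin φ • A t + Real.cos φ • B t‖ ^ 2 * (S.h2 t / S.x t) +
      ‖Real.cos φ • A' t + Real.sin φ • B' t + C' t‖ ^ 2 * (S.x t / S.h2 t) := fun φ =>
    gradSq_mul_areaElt _ ht
  simp only [this]
  have hci : ∀ f : ℝ → ℝ, Continuous f → IntegrableOn f (Ioo 0 (2 * Real.pi)) := fun f hf =>
    (hf.integrableOn_Icc).mono_set Ioo_subset_Icc_self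
  rw [integral_add (hci _ (by fun_prop)) (hci _ (by fun_prop)), integral_mul_const,
    integral_mul_const, integral_norm_sq_trig, integral_norm_sq_trig']

end Trig

end SurfaceOfRevolution

/-! ### Functions with vanishing Fourier coefficients -/

instance : Fact (0 < 2 * Real.pi) := ⟨Real.two_pi_pos⟩

/-- The functional on continuous functions on the circle given by integration against an
integrable function. -/
def circleFunctional (f : ℝ → ℝ) (hf : IntegrableOn f (Ioo 0 (2 * Real.pi))) :
    C(AddCircle (2 * Real.pi), ℂ) →L[ℂ] ℂ :=
  have hi : ∀ h : C(AddCircle (2 * Real.pi), ℂ),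
      IntegrableOn (fun φ : ℝ => h (φ : AddCircle (2 * Real.pi)) * (f φ : ℂ))
        (Ioo 0 (2 * Real.pi)) := fun h => by
    refine Integrable.mono' (hf.norm.const_mul ‖h‖)
      ((h.continuous.comp (AddCircle.continuous_mk' _)).aestronglyMeasurable.mul
        (Complex.continuous_ofReal.comp_aestronglyMeasurable hf.aestronglyMeasurable)) ?_
    filter_upwards with φ
    rw [norm_mul, Complex.norm_real]
    exact mul_le_mul_of_nonneg_right (h.norm_coe_le_norm _) (norm_nonneg _)
  LinearMap.mkContinuous
    { toFun := fun h => ∫ φ in Ioo 0 (2 * Real.pi), h (φ : AddCircle (2 * Real.pi)) * (f φ : ℂ)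
      map_add' := fun h k => by
        rw [← integral_add (hi h) (hi k)]; simp [add_mul]
      map_smul' := fun c h => by
        rw [RingHom.id_apply, smul_eq_mul, ← integral_const_mul]
        simp only [ContinuousMap.smul_apply, smul_eq_mul, mul_assoc] }
    (∫ φ in Ioo 0 (2 * Real.pi), ‖f φ‖) (fun h => by
      refine (norm_integral_le_integral_norm _).trans ?_
      rw [← integral_mul_const]
      refine integral_mono (hi h).norm (hf.norm.mul_const _) fun φ => ?_
      dsimp only
      rw [norm_mul, Complex.norm_real, mul_comm ‖f φ‖]
      exact mul_le_mul_of_nonneg_right (h.norm_coe_le_norm _) (norm_nonneg _))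

theorem circleFunctional_apply (f : ℝ → ℝ) (hf : IntegrableOn f (Ioo 0 (2 * Real.pi)))
    (h : C(AddCircle (2 * Real.pi), ℂ)) :
    circleFunctional f hf h =
      ∫ φ in Ioo 0 (2 * Real.pi), h (φ : AddCircle (2 * Real.pi)) * (f φ : ℂ) := rfl

theorem fourier_two_pi (n : ℤ) (φ : ℝ) : fourier n (φ : AddCircle (2 * Real.pi)) =
    (Real.cos (n * φ) : ℂ) + (Real.sin (n * φ) : ℂ) * Complex.I := by
  rw [fourier_coe_apply, Complex.ofReal_cos, Complex.ofReal_sin, ← Complex.exp_mul_I]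
  congr 1
  push_cast
  have : (Real.pi : ℂ) ≠ 0 := by exact_mod_cast Real.pi_ne_zero
  field_simp

/-- An integrable function on the circle whose Fourier coefficients vanish is zero. -/
theorem ae_eq_zero_of_fourier {f : ℝ → ℝ} (hf : IntegrableOn f (Ioo 0 (2 * Real.pi)))
    (hc : ∀ n : ℤ, ∫ φ in Ioo 0 (2 * Real.pi), Real.cos (n * φ) * f φ = 0)
    (hs : ∀ n : ℤ, ∫ φ in Ioo 0 (2 * Real.pi), Real.sin (n * φ) * f φ = 0) :
    ∀ᵐ φ ∂(volume.restrict (Ioo 0 (2 * Real.pi))), f φ = 0 := by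
  -- The kernel of this continuous functional is closed and contains all characters, whose span is
  -- dense in the continuous functions on the circle.
  have hz : ∀ h, circleFunctional f hf h = 0 := by
    have h1 : (Submodule.span ℂ (range (@fourier (2 * Real.pi)))).topologicalClosure ≤
        (circleFunctional f hf).ker := by
      refine Submodule.topologicalClosure_minimal _ ?_ (circleFunctional f hf).isClosed_ker
      rw [Submodule.span_le]
      rintro _ ⟨n, rfl⟩
      rw [SetLike.mem_coe, LinearMap.mem_ker]
      have hi : ∀ u : ℝ → ℝ, Continuous u → (∀ φ, |u φ| ≤ 1) →
          IntegrableOn (fun φ => u φ * f φ) (Ioo 0 (2 * Real.pi)) := by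
        intro u hu hu1
        refine Integrable.mono' hf.norm (hu.aestronglyMeasurable.mul hf.aestronglyMeasurable) ?_
        filter_upwards with φ
        rw [norm_mul]
        exact mul_le_of_le_one_left (norm_nonneg _) (hu1 φ)
      have e : ∀ φ : ℝ, fourier n (φ : AddCircle (2 * Real.pi)) * (f φ : ℂ) =
          ((Real.cos (n * φ) * f φ : ℝ) : ℂ) + ((Real.sin (n * φ) * f φ : ℝ) : ℂ) * Complex.I := by
        intro φ; rw [fourier_two_pi]; push_cast; ring
      have i1 := hi (fun φ => Real.cos (n * φ)) (by fun_prop) fun φ => Real.abs_cos_le_one _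
      have i2 := hi (fun φ => Real.sin (n * φ)) (by fun_prop) fun φ => Real.abs_sin_le_one _
      change circleFunctional f hf (fourier n) = 0
      rw [circleFunctional_apply]
      simp only [e]
      rw [integral_add i1.ofReal (i2.ofReal.mul_const _), integral_mul_const,
        integral_complex_ofReal,
        integral_complex_ofReal, hc n, hs n]
      simp
    rw [span_fourier_closure_eq_top] at h1
    exact fun h => h1 trivial
  rw [ae_restrict_iff' measurableSet_Ioo]
  refine isOpen_Ioo.ae_eq_zero_of_integral_contDiff_smul_eq_zero hf.locallyIntegrableOn
    fun g hg _ hgs => ?_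
  have h0 : g 0 = 0 := by
    by_contra h
    exact absurd (hgs (subset_tsupport g h)).1 (lt_irrefl _)
  have h2 : g (2 * Real.pi) = 0 := by
    by_contra h
    exact absurd (hgs (subset_tsupport g h)).2 (lt_irrefl _)
  -- A test function supported in the open interval vanishes at `0` and `2π`, so it descends to a
  -- continuous function on the circle and `hz` applies to it.
  have hcont : Continuous (AddCircle.liftIco (2 * Real.pi) 0 fun φ => (g φ : ℂ)) :=
    AddCircle.liftIco_zero_continuous (by simp [h0, h2])
      (Complex.continuous_ofReal.comp hg.continuous).continuousOn
  have := hz ⟨_, hcont⟩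
  rw [circleFunctional_apply] at this
  have e : ∫ φ in Ioo 0 (2 * Real.pi), ((g φ * f φ : ℝ) : ℂ) = 0 := by
    rw [← this]
    refine setIntegral_congr_fun measurableSet_Ioo fun φ hφ => ?_
    simp only [ContinuousMap.coe_mk]
    rw [AddCircle.liftIco_zero_coe_apply (Ioo_subset_Ico_self hφ)]
    push_cast; ring
  rw [integral_complex_ofReal, Complex.ofReal_eq_zero] at e
  rw [← setIntegral_eq_integral_of_forall_compl_eq_zero (s := Ioo 0 (2 * Real.pi))]
  · exact e
  · intro φ hφ
    have : g φ = 0 := by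
      by_contra h
      exact hφ (hgs (subset_tsupport g h))
    rw [this, zero_smul]

/-- An integrable function on a box that is orthogonal to the products of periodic functions of
the angle and test functions is zero. -/
theorem ae_eq_zero_of_products {c d : ℝ} {f : ℝ × ℝ → ℝ}
    (hf : IntegrableOn f (Ioo 0 (2 * Real.pi) ×ˢ Ioo c d))
    (h : ∀ ρ χ : ℝ → ℝ, ContDiff ℝ ∞ ρ → (∀ φ, ρ (φ + 2 * Real.pi) = ρ φ) → ContDiff ℝ ∞ χ →
      HasCompactSupport χ → tsupport χ ⊆ Ioo c d →
      ∫ p in Ioo 0 (2 * Real.pi) ×ˢ Ioo c d, (ρ p.1 * χ p.2) * f p = 0) :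
    ∀ᵐ p ∂(volume.restrict (Ioo 0 (2 * Real.pi) ×ˢ Ioo c d)), f p = 0 := by
  have hm : (volume : Measure (ℝ × ℝ)).restrict (Ioo 0 (2 * Real.pi) ×ˢ Ioo c d) =
      (volume.restrict (Ioo 0 (2 * Real.pi))).prod (volume.restrict (Ioo c d)) := by
    rw [Measure.prod_restrict]; rfl
  -- The variables are separated: for a fixed `ρ` the angular integral is a function of `t`
  -- orthogonal to all test functions. It is then enough to take the countably many `ρ = cos (n ·)`
  -- and `ρ = sin (n ·)`, which leaves one common null set of `t`.
  have key : ∀ ρ : ℝ → ℝ, ContDiff ℝ ∞ ρ → (∀ φ, ρ (φ + 2 * Real.pi) = ρ φ) →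
      (∀ φ, |ρ φ| ≤ 1) → ∀ᵐ t ∂(volume.restrict (Ioo c d)),
        ∫ φ in Ioo 0 (2 * Real.pi), ρ φ * f (φ, t) = 0 := by
    intro ρ hρ hper hb
    have hint : Integrable (fun p : ℝ × ℝ => ρ p.1 * f p)
        ((volume.restrict (Ioo 0 (2 * Real.pi))).prod (volume.restrict (Ioo c d))) := by
      rw [← hm]
      refine Integrable.mono' hf.norm
        ((hρ.continuous.comp continuous_fst).aestronglyMeasurable.mul hf.aestronglyMeasurable) ?_
      filter_upwards with p
      rw [norm_mul]
      exact mul_le_of_le_one_left (norm_nonneg _) (hb p.1)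
    have hF := hint.integral_prod_right
    rw [ae_restrict_iff' measurableSet_Ioo]
    refine isOpen_Ioo.ae_eq_zero_of_integral_contDiff_smul_eq_zero
      (IntegrableOn.locallyIntegrableOn hF) fun χ hχ hχc hχs => ?_
    obtain ⟨K, hK⟩ := hχc.exists_bound_of_continuous hχ.continuous
    have hint2 : Integrable (fun p : ℝ × ℝ => (ρ p.1 * χ p.2) * f p)
        ((volume.restrict (Ioo 0 (2 * Real.pi))).prod (volume.restrict (Ioo c d))) := by
      refine Integrable.mono' (hint.norm.const_mul K) ?_ ?_
      · have : (fun p : ℝ × ℝ => (ρ p.1 * χ p.2) * f p) = fun p => χ p.2 * (ρ p.1 * f p) := by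
          funext p; ring
        rw [this]
        exact (hχ.continuous.comp continuous_snd).aestronglyMeasurable.mul hint.aestronglyMeasurable
      · filter_upwards with p
        rw [show ρ p.1 * χ p.2 * f p = χ p.2 * (ρ p.1 * f p) by ring, norm_mul]
        exact mul_le_mul_of_nonneg_right (hK _) (norm_nonneg _)
    have h1 := h ρ χ hρ hper hχ hχc hχs
    rw [hm, integral_prod_symm _ hint2] at h1
    rw [← setIntegral_eq_integral_of_forall_compl_eq_zero (s := Ioo c d)]
    · refine Eq.trans ?_ h1
      congr 1
      funext t
      rw [smul_eq_mul, ← integral_const_mul]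
      congr 1; funext φ; ring
    · intro t ht
      have : χ t = 0 := by
        by_contra h
        exact ht (hχs (subset_tsupport χ h))
      rw [this, zero_smul]
  have hcos : ∀ n : ℤ, ∀ᵐ t ∂(volume.restrict (Ioo c d)),
      ∫ φ in Ioo 0 (2 * Real.pi), Real.cos (n * φ) * f (φ, t) = 0 := fun n =>
    key _ (Real.contDiff_cos.comp (contDiff_const.mul contDiff_id))
      (fun φ => by rw [mul_add, Real.cos_add_int_mul_two_pi]) fun φ => Real.abs_cos_le_one _
  have hsin : ∀ n : ℤ, ∀ᵐ t ∂(volume.restrict (Ioo c d)),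
      ∫ φ in Ioo 0 (2 * Real.pi), Real.sin (n * φ) * f (φ, t) = 0 := fun n =>
    key _ (Real.contDiff_sin.comp (contDiff_const.mul contDiff_id))
      (fun φ => by rw [mul_add, Real.sin_add_int_mul_two_pi]) fun φ => Real.abs_sin_le_one _
  rw [IntegrableOn, hm] at hf
  rw [hm]
  have hfin : ∀ᵐ t ∂(volume.restrict (Ioo c d)), ∫⁻ φ in Ioo 0 (2 * Real.pi), ‖f (φ, t)‖ₑ = 0 := by
    filter_upwards [ae_all_iff.2 hcos, ae_all_iff.2 hsin, hf.prod_left_ae] with t h1 h2 h3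
    rw [lintegral_eq_zero_iff' h3.aestronglyMeasurable.enorm]
    filter_upwards [ae_eq_zero_of_fourier h3 h1 h2] with φ h
    simp [h]
  have h0 : ∫⁻ p, ‖f p‖ₑ ∂((volume.restrict (Ioo 0 (2 * Real.pi))).prod
      (volume.restrict (Ioo c d))) = 0 := by
    rw [lintegral_prod_symm _ hf.aestronglyMeasurable.enorm, lintegral_congr_ae hfin]
    simp
  rw [lintegral_eq_zero_iff' hf.aestronglyMeasurable.enorm] at h0
  filter_upwards [h0] with p hp
  simpa using hp

theorem ae_eq_zero_of_products_E3 {c d : ℝ} {f : ℝ × ℝ → E3}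
    (hf : IntegrableOn f (Ioo 0 (2 * Real.pi) ×ˢ Ioo c d))
    (h : ∀ ρ χ : ℝ → ℝ, ContDiff ℝ ∞ ρ → (∀ φ, ρ (φ + 2 * Real.pi) = ρ φ) → ContDiff ℝ ∞ χ →
      HasCompactSupport χ → tsupport χ ⊆ Ioo c d →
      IntegrableOn (fun p => (ρ p.1 * χ p.2) • f p) (Ioo 0 (2 * Real.pi) ×ˢ Ioo c d) →
      ∫ p in Ioo 0 (2 * Real.pi) ×ˢ Ioo c d, (ρ p.1 * χ p.2) • f p = 0) :
    ∀ᵐ p ∂(volume.restrict (Ioo 0 (2 * Real.pi) ×ˢ Ioo c d)), f p = 0 := by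
  have hi : ∀ i : Fin 3, ∀ᵐ p ∂(volume.restrict (Ioo 0 (2 * Real.pi) ×ˢ Ioo c d)), f p i = 0 := by
    intro i
    refine ae_eq_zero_of_products ((EuclideanSpace.proj i : E3 →L[ℝ] ℝ).integrable_comp hf)
      fun ρ χ hρ hper hχ hχc hχs => ?_
    obtain ⟨K, hK⟩ := hχc.exists_bound_of_continuous hχ.continuous
    obtain ⟨R, hR⟩ := isCompact_Icc.exists_bound_of_continuousOn
      (hρ.continuous.continuousOn (s := Icc 0 (2 * Real.pi)))
    have hint : IntegrableOn (fun p => (ρ p.1 * χ p.2) • f p)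
        (Ioo 0 (2 * Real.pi) ×ˢ Ioo c d) := by
      refine Integrable.mono' (hf.norm.const_mul (R * K))
        (((hρ.continuous.comp continuous_fst).mul
          (hχ.continuous.comp continuous_snd)).aestronglyMeasurable.smul hf.aestronglyMeasurable) ?_
      filter_upwards [ae_restrict_mem (measurableSet_Ioo.prod measurableSet_Ioo)] with p hp
      have h1 := hR p.1 (Ioo_subset_Icc_self hp.1)
      rw [norm_smul, norm_mul]
      exact mul_le_mul_of_nonneg_right (mul_le_mul h1 (hK _) (norm_nonneg _)
        ((norm_nonneg _).trans h1)) (norm_nonneg _)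
    have h1 := h ρ χ hρ hper hχ hχc hχs hint
    have h2 := (EuclideanSpace.proj i : E3 →L[ℝ] ℝ).integral_comp_comm hint
    rw [h1, map_zero] at h2
    simpa using h2
  filter_upwards [hi 0, hi 1, hi 2] with p h0 h1 h2
  exact ext_coords h0 h1 h2

/-! ### Uniqueness of weak gradients -/

namespace SurfaceOfRevolution

variable {S : SurfaceOfRevolution}

/-- The coordinate domain is exhausted by smaller boxes. -/
theorem ae_cell_of_boxes {P : ℝ × ℝ → Prop} (h : ∀ c d, S.a < c → c < d → d < S.b →
    ∀ᵐ p ∂(volume.restrict (Ioo 0 (2 * Real.pi) ×ˢ Ioo c d)), P p) :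
    ∀ᵐ p ∂(volume.restrict S.cell), P p := by
  have hab := S.a_lt_b
  set δ := S.b - S.a with hδ
  have hδ0 : 0 < δ := sub_pos.2 hab
  -- With `n + 3` each side is cut by at most a third of the length, so every box is nonempty.
  have hn : ∀ n : ℕ, 0 < δ / (n + 3) ∧ δ / (n + 3) ≤ δ / 3 := fun n =>
    ⟨by positivity, div_le_div_of_nonneg_left hδ0.le (by norm_num)
      (by linarith [n.cast_nonneg (α := ℝ)])⟩
  have hcell : S.cell ⊆
      ⋃ n : ℕ, Ioo 0 (2 * Real.pi) ×ˢ Ioo (S.a + δ / (n + 3)) (S.b - δ / (n + 3)) := by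
    rintro p ⟨hp1, hp2⟩
    obtain ⟨n, hn⟩ := exists_nat_gt (δ / min (p.2 - S.a) (S.b - p.2))
    have hm : 0 < min (p.2 - S.a) (S.b - p.2) := lt_min (sub_pos.2 hp2.1) (sub_pos.2 hp2.2)
    have h3 : δ / (n + 3) < min (p.2 - S.a) (S.b - p.2) := by
      rw [div_lt_iff₀ hm] at hn
      rw [div_lt_iff₀ (by positivity)]
      nlinarith
    obtain ⟨h4, h5⟩ := lt_min_iff.1 h3
    exact mem_iUnion.2 ⟨n, hp1, by linarith, by linarith⟩
  refine ae_restrict_of_ae_restrict_of_subset hcell ?_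
  rw [ae_restrict_iUnion_iff]
  intro n
  obtain ⟨h1, h2⟩ := hn n
  exact h _ _ (by linarith) (by linarith) (by linarith)

theorem test1_of_tsupport {c d : ℝ} (hc : S.a < c) (hd : d < S.b) {χ : ℝ → ℝ}
    (hχ : ContDiff ℝ ∞ χ) (hs : tsupport χ ⊆ Ioo c d) : S.Test1 χ :=
  ⟨hχ, Or.inl ⟨c, d, hc, hd, fun _ ht => Ioo_subset_Icc_self (hs (subset_tsupport χ ht))⟩⟩

theorem box_subset_cell {c d : ℝ} (hc : S.a < c) (hd : d < S.b) :
    Ioo 0 (2 * Real.pi) ×ˢ Ioo c d ⊆ S.cell :=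
  prod_mono subset_rfl (Ioo_subset_Ioo hc.le hd.le)

/-- Square integrability with the weight gives integrability on boxes. -/
theorem integrableOn_box_of_sq {f : ℝ × ℝ → E3}
    (hf : AEStronglyMeasurable f (volume.restrict S.cell))
    (hfw : IntegrableOn (fun p => ‖f p‖ ^ 2 * S.x p.2) S.cell) {c d : ℝ} (hc : S.a < c)
    (hd : d < S.b) : IntegrableOn f (Ioo 0 (2 * Real.pi) ×ˢ Ioo c d) := by
  have hsub := S.box_subset_cell hc hd
  obtain ⟨k, hk, hx⟩ := S.x_lower_of_support hc hd
  have hX := (S.integrableOn_cell_snd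
    (S.integrableOn_of_continuousOn S.continuousOn_x)).mono_set hsub
  have := integrable_smul_of_weight (ψ := fun _ => (1 : ℝ)) (w := fun p : ℝ × ℝ => S.x p.2)
    (C := k⁻¹) hX ?_ (hf.mono_measure (Measure.restrict_mono hsub le_rfl)) (hfw.mono_set hsub)
    aestronglyMeasurable_const ?_
  · simp only [one_smul] at this
    exact this
  · filter_upwards [ae_restrict_mem (measurableSet_Ioo.prod measurableSet_Ioo)] with p hp
    exact hk.le.trans (hx _ (Ioo_subset_Icc_self hp.2))
  · filter_upwards [ae_restrict_mem (measurableSet_Ioo.prod measurableSet_Ioo)] with p hp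
    rw [abs_one, inv_mul_eq_div, one_le_div hk]
    exact hx _ (Ioo_subset_Icc_self hp.2)

theorem IsWeakGradient.sq_int_fst {m : E3 → E3} {G : ℝ × ℝ → E3 × E3} (h : S.IsWeakGradient m G) :
    IntegrableOn (fun p => ‖(G p).1‖ ^ 2 * S.x p.2) S.cell := by
  obtain ⟨K, hK, hw⟩ := S.exists_weight_comparison
  exact integrableOn_mul_weight ((sq_int_iff h.meas).1 h.sq_int).1
    ((continuous_fst.comp_aestronglyMeasurable h.meas).norm.pow 2)
    (S.aestronglyMeasurable_cell_snd S.aestronglyMeasurable_x) (fun p => sq_nonneg _)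
    (S.ae_cell_of_forall fun φ t ht => (hw t ht).2.2.2.2)

theorem IsWeakGradient.sq_int_snd {m : E3 → E3} {G : ℝ × ℝ → E3 × E3} (h : S.IsWeakGradient m G) :
    IntegrableOn (fun p => ‖(G p).2‖ ^ 2 * S.x p.2) S.cell :=
  ((sq_int_iff h.meas).1 h.sq_int).2

theorem setIntegral_box {c d : ℝ} (hc : S.a < c) (hd : d < S.b) {χ : ℝ → ℝ}
    (hs : tsupport χ ⊆ Ioo c d) (ρ : ℝ → ℝ) (f : ℝ × ℝ → E3) :
    ∫ p in Ioo 0 (2 * Real.pi) ×ˢ Ioo c d, (ρ p.1 * χ p.2) • f p =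
      ∫ p in S.cell, (ρ p.1 * χ p.2) • f p := by
  refine (setIntegral_eq_of_subset_of_forall_sdiff_eq_zero S.measurableSet_cell
    (S.box_subset_cell hc hd) fun p hp => ?_).symm
  have : χ p.2 = 0 := by
    by_contra h
    exact hp.2 ⟨hp.1.1, hs (subset_tsupport χ h)⟩
  rw [this, mul_zero, zero_smul]

theorem ae_eq_of_test {f f' : ℝ × ℝ → E3} (hf : AEStronglyMeasurable f (volume.restrict S.cell))
    (hf' : AEStronglyMeasurable f' (volume.restrict S.cell))
    (hfw : IntegrableOn (fun p => ‖f p‖ ^ 2 * S.x p.2) S.cell)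
    (hfw' : IntegrableOn (fun p => ‖f' p‖ ^ 2 * S.x p.2) S.cell)
    (h : ∀ ψ, S.IsTest ψ → ∫ p in S.cell, ψ p • f p = ∫ p in S.cell, ψ p • f' p) :
    ∀ᵐ p ∂(volume.restrict S.cell), f p = f' p := by
  refine ae_cell_of_boxes fun c d hc _ hd => ?_
  have h1 := ae_eq_zero_of_products_E3 (f := fun p => f p - f' p)
    ((integrableOn_box_of_sq hf hfw hc hd).sub (integrableOn_box_of_sq hf' hfw' hc hd))
    fun ρ χ hρ hper hχ hχc hχs _ => by
      have ht := isTest_mul hρ hper (test1_of_tsupport hc hd hχ hχs)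
      rw [setIntegral_box hc hd hχs]
      simp only [smul_sub]
      rw [integral_sub (ht.integrable_smul hf hfw) (ht.integrable_smul hf' hfw'), h _ ht, sub_self]
  filter_upwards [h1] with p hp
  exact sub_eq_zero.1 hp

/-- Weak gradients are unique. -/
theorem IsWeakGradient.unique {m : E3 → E3} {G G' : ℝ × ℝ → E3 × E3} (h : S.IsWeakGradient m G)
    (h' : S.IsWeakGradient m G') : ∀ᵐ p ∂(volume.restrict S.cell), G p = G' p := by
  have h1 := ae_eq_of_test (S := S) (continuous_fst.comp_aestronglyMeasurable h.meas)
    (continuous_fst.comp_aestronglyMeasurable h'.meas) h.sq_int_fst h'.sq_int_fst fun ψ hψ => by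
      have := (h.parts_phi ψ hψ).symm.trans (h'.parts_phi ψ hψ)
      exact neg_injective this
  have h2 := ae_eq_of_test (S := S) (continuous_snd.comp_aestronglyMeasurable h.meas)
    (continuous_snd.comp_aestronglyMeasurable h'.meas) h.sq_int_snd h'.sq_int_snd fun ψ hψ => by
      have := (h.parts_t ψ hψ).symm.trans (h'.parts_t ψ hψ)
      exact neg_injective this
  filter_upwards [h1, h2] with p e1 e2
  exact Prod.ext e1 e2

/-- The energy is defined through an arbitrary choice of weak gradient; by uniqueness any explicit
weak gradient may be used instead. -/
theorem energy_eq {m : E3 → E3} {G : ℝ × ℝ → E3 × E3} (h : S.IsWeakGradient m G) (g : ℝ → ℝ)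
    (a : E3 → E3) : S.energy g a m = (∫ p in S.cell, S.gradSq G p * S.areaElt p.2) +
      ∫ p in S.cell, g (inner ℝ (S.pull m p) (S.pull a p)) * S.areaElt p.2 := by
  have h1 : S.IsWeakGradient m (S.weakGrad m) := Classical.epsilon_spec ⟨G, h⟩
  rw [energy]
  congr 1
  refine integral_congr_ae ?_
  filter_upwards [h1.unique h] with p hp
  simp only [gradSq, hp]

theorem isWeakGradient_congr {m u : E3 → E3} (h : S.AEEq m u) (G : ℝ × ℝ → E3 × E3) :
    S.IsWeakGradient m G → S.IsWeakGradient u G := by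
  intro hm
  refine ⟨hm.meas, hm.sq_int, fun ψ hψ => ?_, fun ψ hψ => ?_⟩
  · rw [← hm.parts_phi ψ hψ]
    refine integral_congr_ae ?_
    filter_upwards [h] with p hp
    rw [hp]
  · rw [← hm.parts_t ψ hψ]
    refine integral_congr_ae ?_
    filter_upwards [h] with p hp
    rw [hp]

/-- Fields that agree almost everywhere are minimizers together. -/
theorem IsMinimizer.congr {T : SurfaceOfRevolution} {g : ℝ → ℝ} {a m u : E3 → E3}
    (hm : S.IsMinimizer T g a m) (h : S.AEEq m u) : S.IsMinimizer T g a u := by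
  obtain ⟨⟨⟨h1, h2, G, hG⟩, h3⟩, h4⟩ := hm
  have hG' := isWeakGradient_congr h G hG
  have he : S.energy g a u = S.energy g a m := by
    rw [energy_eq hG, energy_eq hG']
    congr 1
    refine integral_congr_ae ?_
    filter_upwards [h] with p hp
    rw [hp]
  refine ⟨⟨⟨h1.congr h, h2.congr ?_, G, hG'⟩, ?_⟩, fun m' hm' => he ▸ h4 m' hm'⟩
  · filter_upwards [h] with p hp
    rw [hp]
  · filter_upwards [h, h3] with p hp hT
    rwa [← hp]

end SurfaceOfRevolution

/-! ### Absolute continuity of meridian sections -/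

theorem IsAC.congr_deriv {F : Type*} [NormedAddCommGroup F] [NormedSpace ℝ F] {v v' w' : ℝ → F}
    {a b : ℝ} (hv : IsAC v v' (Ioo a b)) (h : ∀ᵐ t ∂(volume.restrict (Ioo a b)), v' t = w' t) :
    IsAC v w' (Ioo a b) := by
  intro s hs t ht
  obtain ⟨h1, h2⟩ := hv hs ht
  have hsub : uIoc s t ⊆ Ioo a b :=
    uIoc_subset_uIcc.trans (ordConnected_Ioo.uIcc_subset hs ht)
  have h3 := ae_restrict_of_ae_restrict_of_subset hsub h
  exact ⟨h1.congr_ae h3, h2.trans (intervalIntegral.integral_congr_ae_restrict h3)⟩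

/-- A smooth function with integral zero supported in an interval has a primitive supported in the
interval. -/
theorem exists_primitive_support {c d : ℝ} {η : ℝ → ℝ} (hη : ContDiff ℝ ∞ η)
    (hc : HasCompactSupport η) (hs : tsupport η ⊆ Ioo c d) (h0 : ∫ t in Ioo c d, η t = 0) :
    ∃ χ : ℝ → ℝ, ContDiff ℝ ∞ χ ∧ (∃ c' d', c < c' ∧ d' < d ∧ ∀ t, χ t ≠ 0 → t ∈ Icc c' d') ∧
      deriv χ = η := by
  rcases lt_or_ge c d with hcd | hcd
  swap
  · have : η = 0 := by
      rw [← tsupport_eq_empty_iff, ← subset_empty_iff, ← Ioo_eq_empty (not_lt.2 hcd)]; exact hs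
    exact ⟨0, contDiff_const, ⟨c + 1, d - 1, by simp, by simp, by simp⟩, by rw [this]; simp⟩
  obtain ⟨c', d', hc', hd', hsub⟩ : ∃ c' d', c < c' ∧ d' < d ∧ tsupport η ⊆ Icc c' d' := by
    rcases (tsupport η).eq_empty_or_nonempty with he | hne
    · exact ⟨c + 1, d - 1, by simp, by simp, by simp [he]⟩
    · exact ⟨sInf (tsupport η), sSup (tsupport η), (hs (hc.isCompact.sInf_mem hne)).1,
        (hs (hc.isCompact.sSup_mem hne)).2, fun t ht =>
        ⟨csInf_le hc.isCompact.bddBelow ht, le_csSup hc.isCompact.bddAbove ht⟩⟩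
  have hz : ∀ t, t ∉ Icc c' d' → η t = 0 := fun t ht => by
    by_contra h
    exact ht (hsub (subset_tsupport η h))
  have hderiv : ∀ t, HasDerivAt (fun t => ∫ s in c..t, η s) (η t) t := fun t =>
    intervalIntegral.integral_hasDerivAt_right (hη.continuous.intervalIntegrable _ _)
      (hη.continuous.stronglyMeasurableAtFilter _ _) hη.continuous.continuousAt
  have hd : deriv (fun t => ∫ s in c..t, η s) = η := funext fun t => (hderiv t).deriv
  have h0' : ∫ s in c..d, η s = 0 := by
    rw [intervalIntegral.integral_of_le hcd.le, integral_Ioc_eq_integral_Ioo, h0]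
  refine ⟨fun t => ∫ s in c..t, η s, ?_, ⟨c', d', hc', hd', fun t ht => ?_⟩, hd⟩
  · rw [contDiff_infty_iff_deriv, hd]
    exact ⟨fun t => (hderiv t).differentiableAt, hη⟩
  · by_contra h
    apply ht
    rw [mem_Icc, not_and_or, not_le, not_le] at h
    rcases h with h | h
    · refine (intervalIntegral.integral_congr
        (g := fun _ => (0 : ℝ)) fun s hs => hz s fun h' => ?_).trans
        (by simp)
      exact absurd (h'.1.trans hs.2) (not_le.2 (max_lt hc' h))
    · have h1 : ∫ s in t..d, η s = 0 := by
        refine (intervalIntegral.integral_congr (g := fun _ =>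
          (0 : ℝ)) fun s hs => hz s fun h' => ?_).trans
          (by simp)
        exact absurd (hs.1.trans h'.2) (not_le.2 (lt_min h hd'))
      have h2 := intervalIntegral.integral_add_adjacent_intervals
        (hη.continuous.intervalIntegrable (μ := volume) c t) (hη.continuous.intervalIntegrable t d)
      rw [h1, h0', add_zero] at h2
      exact h2

/-- The primitive of a jointly measurable function in one of its variables is jointly measurable. -/
theorem stronglyMeasurable_primitive {g : ℝ × ℝ → E3} (hg : StronglyMeasurable g) (t0 : ℝ) :
    StronglyMeasurable fun p : ℝ × ℝ => ∫ s in t0..p.2, g (p.1, s) := by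
  have hg' : StronglyMeasurable fun q : (ℝ × ℝ) × ℝ => g (q.1.1, q.2) :=
    hg.comp_measurable (by fun_prop)
  have hA : MeasurableSet {q : (ℝ × ℝ) × ℝ | q.2 ∈ Ioc t0 q.1.2} :=
    (measurableSet_lt measurable_const measurable_snd).inter
      (measurableSet_le measurable_snd (by fun_prop))
  have hB : MeasurableSet {q : (ℝ × ℝ) × ℝ | q.2 ∈ Ioc q.1.2 t0} :=
    (measurableSet_lt (by fun_prop) measurable_snd).inter
      (measurableSet_le measurable_snd measurable_const)
  have h1 := (hg'.indicator hA).integral_prod_right' (ν := volume)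
  have h2 := (hg'.indicator hB).integral_prod_right' (ν := volume)
  -- The moving endpoint is absorbed into indicator functions of two jointly measurable sets, one
  -- for each orientation of the interval.
  have e : (fun p : ℝ × ℝ => ∫ s in t0..p.2, g (p.1, s)) = fun p : ℝ × ℝ =>
      (∫ s, ({q : (ℝ × ℝ) × ℝ | q.2 ∈ Ioc t0 q.1.2}.indicator fun q => g (q.1.1, q.2)) (p, s)) -
      ∫ s, ({q : (ℝ × ℝ) × ℝ | q.2 ∈ Ioc q.1.2 t0}.indicator fun q => g (q.1.1, q.2)) (p, s) := by
    funext p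
    rw [intervalIntegral, ← integral_indicator measurableSet_Ioc,
      ← integral_indicator measurableSet_Ioc]
    rfl
  rw [e]
  exact h1.sub h2

theorem box_restrict (c d : ℝ) : (volume : Measure (ℝ × ℝ)).restrict
    (Ioo 0 (2 * Real.pi) ×ˢ Ioo c d) =
      (volume.restrict (Ioo 0 (2 * Real.pi))).prod (volume.restrict (Ioo c d)) := by
  rw [Measure.prod_restrict]; rfl

/-- Products with bounded smooth functions stay integrable on boxes. -/
theorem integrableOn_box_smul {c d : ℝ} {f : ℝ × ℝ → E3} {ρ χ : ℝ → ℝ}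
    (hf : IntegrableOn f (Ioo 0 (2 * Real.pi) ×ˢ Ioo c d)) (hρ : Continuous ρ)
    (hχ : Continuous χ) :
    IntegrableOn (fun p => (ρ p.1 * χ p.2) • f p) (Ioo 0 (2 * Real.pi) ×ˢ Ioo c d) := by
  obtain ⟨K, hK⟩ := isCompact_Icc.exists_bound_of_continuousOn (hχ.continuousOn (s := Icc c d))
  obtain ⟨R, hR⟩ := isCompact_Icc.exists_bound_of_continuousOn
    (hρ.continuousOn (s := Icc 0 (2 * Real.pi)))
  refine Integrable.mono' (hf.norm.const_mul (R * K))
    (((hρ.comp continuous_fst).mul (hχ.comp continuous_snd)).aestronglyMeasurable.smul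
      hf.aestronglyMeasurable) ?_
  filter_upwards [ae_restrict_mem (measurableSet_Ioo.prod measurableSet_Ioo)] with p hp
  have h1 := hR p.1 (Ioo_subset_Icc_self hp.1)
  have h2 := hK p.2 (Ioo_subset_Icc_self hp.2)
  rw [norm_smul, norm_mul]
  exact mul_le_mul_of_nonneg_right (mul_le_mul h1 h2 (norm_nonneg _)
    ((norm_nonneg _).trans h1)) (norm_nonneg _)

namespace SurfaceOfRevolution

variable {S : SurfaceOfRevolution}

theorem integrableOn_sub_of_sq {f : ℝ → E3}
    (hf : AEStronglyMeasurable f (volume.restrict (Ioo S.a S.b)))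
    (hfw : IntegrableOn (fun t => ‖f t‖ ^ 2 * S.x t) (Ioo S.a S.b)) {c d : ℝ} (hc : S.a < c)
    (hd : d < S.b) : IntegrableOn f (Icc c d) := by
  have hsub : Icc c d ⊆ Ioo S.a S.b := fun t ht => ⟨hc.trans_le ht.1, ht.2.trans_lt hd⟩
  obtain ⟨k, hk, hx⟩ := S.x_lower_of_support hc hd
  have hX := (S.integrableOn_of_continuousOn S.continuousOn_x).mono_set hsub
  have := integrable_smul_of_weight (ψ := fun _ => (1 : ℝ)) (w := S.x)
    (C := k⁻¹) hX ?_ (hf.mono_measure (Measure.restrict_mono hsub le_rfl)) (hfw.mono_set hsub)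
    aestronglyMeasurable_const ?_
  · simp only [one_smul] at this
    exact this
  · filter_upwards [ae_restrict_mem measurableSet_Icc] with p hp
    exact hk.le.trans (hx _ hp)
  · filter_upwards [ae_restrict_mem measurableSet_Icc] with p hp
    rw [abs_one, inv_mul_eq_div, one_le_div hk]
    exact hx _ hp

theorem intervalIntegrable_of_sq {f : ℝ → E3}
    (hf : AEStronglyMeasurable f (volume.restrict (Ioo S.a S.b)))
    (hfw : IntegrableOn (fun t => ‖f t‖ ^ 2 * S.x t) (Ioo S.a S.b)) {s t : ℝ}
    (hs : s ∈ Ioo S.a S.b) (ht : t ∈ Ioo S.a S.b) : IntervalIntegrable f volume s t := by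
  rw [intervalIntegrable_iff]
  exact (integrableOn_sub_of_sq hf hfw (lt_min hs.1 ht.1) (max_lt hs.2 ht.2)).mono_set
    Ioc_subset_Icc_self

/-- Sections of a function that is square integrable with the weight. -/
theorem ae_section_sq {f : ℝ × ℝ → E3} (hf : AEStronglyMeasurable f (volume.restrict S.cell))
    (hfw : IntegrableOn (fun p => ‖f p‖ ^ 2 * S.x p.2) S.cell) :
    ∀ᵐ φ ∂(volume.restrict (Ioo 0 (2 * Real.pi))),
      AEStronglyMeasurable (fun t => f (φ, t)) (volume.restrict (Ioo S.a S.b)) ∧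
      IntegrableOn (fun t => ‖f (φ, t)‖ ^ 2 * S.x t) (Ioo S.a S.b) := by
  rw [restrict_cell] at hf
  rw [IntegrableOn, restrict_cell] at hfw
  filter_upwards [hf.prodMk_left, hfw.prod_right_ae] with φ h1 h2
  exact ⟨h1, h2⟩

theorem ae_ae_cell {P : ℝ × ℝ → Prop} (h : ∀ᵐ p ∂(volume.restrict S.cell), P p) :
    ∀ᵐ φ ∂(volume.restrict (Ioo 0 (2 * Real.pi))), ∀ᵐ t ∂(volume.restrict (Ioo S.a S.b)),
      P (φ, t) := by
  rw [restrict_cell] at h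
  exact Measure.ae_ae_of_ae_prod h

/-- A weak derivative in `t` is realized by absolutely continuous sections: for jointly measurable
representatives. -/
theorem ae_eq_primitive {M g : ℝ × ℝ → E3} (hM : StronglyMeasurable M) (hg : StronglyMeasurable g)
    (hMb : ∃ K, ∀ᵐ p ∂(volume.restrict S.cell), ‖M p‖ ≤ K)
    (hgw : IntegrableOn (fun p => ‖g p‖ ^ 2 * S.x p.2) S.cell)
    (hparts : ∀ ψ, S.IsTest ψ →
      ∫ p in S.cell, fderiv ℝ ψ p (0, 1) • M p = - ∫ p in S.cell, ψ p • g p)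
    {t0 : ℝ} (ht0 : t0 ∈ Ioo S.a S.b) :
    ∃ k : ℝ → E3, ∀ᵐ p ∂(volume.restrict S.cell),
      M p = k p.1 + ∫ s in t0..p.2, g (p.1, s) := by
  set F : ℝ × ℝ → E3 := fun p => ∫ s in t0..p.2, g (p.1, s) with hF
  have hFm : StronglyMeasurable F := stronglyMeasurable_primitive hg t0
  have hgm := hg.aestronglyMeasurable (μ := volume.restrict S.cell)
  have hsec := ae_section_sq hgm hgw
  have hFac : ∀ᵐ φ ∂(volume.restrict (Ioo 0 (2 * Real.pi))),
      IsAC (fun t => F (φ, t)) (fun t => g (φ, t)) (Ioo S.a S.b) := by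
    filter_upwards [hsec] with φ h
    refine IsAC.of_base (t0 := t0) fun t ht => ⟨intervalIntegrable_of_sq h.1 h.2 ht0 ht, ?_⟩
    simp [hF]
  have hFint : ∀ c d, S.a < c → d < S.b → t0 ∈ Ioo c d →
      IntegrableOn F (Ioo 0 (2 * Real.pi) ×ˢ Ioo c d) := by
    intro c d hc hd h0
    have hgi := integrableOn_box_of_sq hgm hgw hc hd
    rw [IntegrableOn, box_restrict] at hgi ⊢
    have hN := hgi.norm.integral_prod_left
    refine Integrable.mono' (Integrable.comp_fst hN (volume.restrict
      (Ioo c d))) hFm.aestronglyMeasurable ?_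
    have h1 := Measure.quasiMeasurePreserving_fst (ν := volume.restrict (Ioo c d)) |>.ae
      hgi.prod_right_ae
    have h2 : ∀ᵐ p : ℝ × ℝ ∂((volume.restrict (Ioo 0 (2 * Real.pi))).prod
        (volume.restrict (Ioo c d))), p.2 ∈ Ioo c d :=
      Measure.quasiMeasurePreserving_snd.ae (ae_restrict_mem measurableSet_Ioo)
    filter_upwards [h1, h2] with p hp hp2
    refine intervalIntegral.norm_integral_le_integral_norm_uIoc.trans ?_
    refine setIntegral_mono_set hp.norm (by filter_upwards with s using norm_nonneg _) ?_
    exact (uIoc_subset_uIcc.trans (ordConnected_Ioo.uIcc_subset h0 hp2)).eventuallyLE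
  have hMint : ∀ c d, S.a < c → d < S.b → IntegrableOn M (Ioo 0 (2 * Real.pi) ×ˢ Ioo c d) := by
    intro c d hc hd
    obtain ⟨K, hK⟩ := hMb
    have : IntegrableOn M S.cell :=
      Integrable.mono' (integrable_const K) hM.aestronglyMeasurable hK
    exact this.mono_set (S.box_subset_cell hc hd)
  obtain ⟨r, hr, hball⟩ := Metric.isOpen_iff.1 isOpen_Ioo t0 ht0
  -- The closed support has radius `r / 2`, so it lies in the open interval of radius `3 r / 4`
  -- about `t0`, whose ends are still interior points.
  let b : ContDiffBump t0 := ⟨r / 4, r / 2, by positivity, by linarith⟩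
  set χ0 : ℝ → ℝ := b.normed volume with hχ0
  have hχ0s : tsupport χ0 ⊆ Ioo (t0 - 3 * r / 4) (t0 + 3 * r / 4) := by
    rw [hχ0, b.tsupport_normed_eq]
    intro t ht
    have : |t - t0| ≤ r / 2 := by simpa [b, Real.dist_eq] using ht
    rw [abs_le] at this
    constructor <;> linarith
  have hχ0c : HasCompactSupport χ0 := b.hasCompactSupport_normed
  have hχ0d : ContDiff ℝ ∞ χ0 := b.contDiff_normed
  have hr1 : S.a < t0 - 3 * r / 4 := by
    have : t0 - 3 * r / 4 ∈ Ioo S.a S.b := hball (by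
      rw [Metric.mem_ball, Real.dist_eq, abs_lt]; constructor <;> linarith)
    exact this.1
  have hr2 : t0 + 3 * r / 4 < S.b := by
    have : t0 + 3 * r / 4 ∈ Ioo S.a S.b := hball (by
      rw [Metric.mem_ball, Real.dist_eq, abs_lt]; constructor <;> linarith)
    exact this.2
  set t1 := t0 - 3 * r / 4 with ht1
  set t2 := t0 + 3 * r / 4 with ht2
  have h01 : t1 < t0 := by rw [ht1]; linarith
  have h02 : t0 < t2 := by rw [ht2]; linarith
  -- Argument of du Bois-Reymond, uniformly in `φ`: the difference `M - F` has weak `t`-derivative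
  -- zero, so for almost every `φ` it should equal its mean against the normalized bump `χ0`.
  set k : ℝ → E3 := fun φ => ∫ t in Ioo t1 t2, χ0 t • (M (φ, t) - F (φ, t)) with hk
  refine ⟨k, ae_cell_of_boxes fun c' d' hc' _ hd' => ?_⟩
  obtain ⟨c, hc, hcc, hc1⟩ : ∃ c, S.a < c ∧ c ≤ c' ∧ c ≤ t1 :=
    ⟨min c' t1, lt_min hc' hr1, min_le_left _ _, min_le_right _ _⟩
  obtain ⟨d, hd, hdd, hd1⟩ : ∃ d, d < S.b ∧ d' ≤ d ∧ t2 ≤ d :=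
    ⟨max d' t2, max_lt hd' hr2, le_max_left _ _, le_max_right _ _⟩
  have h0cd : t0 ∈ Ioo c d := ⟨hc1.trans_lt h01, h02.trans_le hd1⟩
  have hcd : c < d := h0cd.1.trans h0cd.2
  refine ae_restrict_of_ae_restrict_of_subset (prod_mono subset_rfl (Ioo_subset_Ioo hcc hdd)) ?_
  have hχ0s' : tsupport χ0 ⊆ Ioo c d := hχ0s.trans (Ioo_subset_Ioo hc1 hd1)
  have hD : IntegrableOn (fun p => M p - F p) (Ioo 0 (2 * Real.pi) ×ˢ Ioo c d) :=
    (hMint c d hc hd).sub (hFint c d hc hd h0cd)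
  have hD1 : IntegrableOn (fun p => M p - F p) (Ioo 0 (2 * Real.pi) ×ˢ Ioo t1 t2) :=
    hD.mono_set (prod_mono subset_rfl (Ioo_subset_Ioo hc1 hd1))
  have hkint : IntegrableOn k (Ioo 0 (2 * Real.pi)) := by
    have := integrableOn_box_smul (ρ := fun _ => 1) hD1 continuous_const hχ0d.continuous
    rw [IntegrableOn, box_restrict] at this
    have h := this.integral_prod_left
    simp only [one_mul] at h
    exact h
  have hk2 : IntegrableOn (fun p : ℝ × ℝ => k p.1) (Ioo 0 (2 * Real.pi) ×ˢ Ioo c d) := by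
    rw [IntegrableOn, box_restrict]
    exact Integrable.comp_fst hkint _
  have key := ae_eq_zero_of_products_E3 (f := fun p => (M p - F p) - k p.1) (hD.sub hk2)
    fun ρ θ hρ hper hθ hθc hθs _ => by
      have hDsec : ∀ᵐ φ ∂(volume.restrict (Ioo 0 (2 * Real.pi))),
          IntegrableOn (fun t => M (φ, t) - F (φ, t)) (Ioo c d) := by
        rw [IntegrableOn, box_restrict] at hD
        exact hD.prod_right_ae
      have hbs : ∀ {f : ℝ → E3} {u : ℝ → ℝ}, IntegrableOn f (Ioo c d) → Continuous u →
          IntegrableOn (fun t => u t • f t) (Ioo c d) := by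
        intro f u hf hu
        obtain ⟨K, hK⟩ := isCompact_Icc.exists_bound_of_continuousOn
          (hu.continuousOn (s := Icc c d))
        refine Integrable.mono' (hf.norm.const_mul K)
          (hu.aestronglyMeasurable.smul hf.aestronglyMeasurable) ?_
        filter_upwards [ae_restrict_mem measurableSet_Ioo] with t ht
        rw [norm_smul]
        exact mul_le_mul_of_nonneg_right (hK t (Ioo_subset_Icc_self ht)) (norm_nonneg _)
      set κ := ∫ t in Ioo c d, θ t with hκ
      have hχ01 : ∫ t in Ioo c d, χ0 t = 1 := by
        rw [setIntegral_eq_integral_of_forall_compl_eq_zero, hχ0, b.integral_normed]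
        intro t ht
        by_contra h
        exact ht (hχ0s' (subset_tsupport χ0 h))
      have hci : ∀ u : ℝ → ℝ, Continuous u → IntegrableOn u (Ioo c d) := fun u hu =>
        (hu.integrableOn_Icc).mono_set Ioo_subset_Icc_self
      have hηs : tsupport (fun t => θ t - κ * χ0 t) ⊆ Ioo c d := by
        refine (tsupport_sub θ fun t => κ * χ0 t).trans (union_subset hθs ?_)
        exact (closure_mono (Function.support_mul_subset_right (fun _ => κ) χ0)).trans hχ0s'
      have hηc : HasCompactSupport (fun t => θ t - κ * χ0 t) :=
        hθc.sub (hχ0c.mul_left (f := fun _ => κ))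
      have hηd : ContDiff ℝ ∞ (fun t => θ t - κ * χ0 t) := hθ.sub (contDiff_const.mul hχ0d)
      -- An arbitrary test function `θ` becomes a derivative of a test function once a multiple of
      -- `χ0` with the same integral is subtracted. The subtracted multiple is what produces `k`.
      obtain ⟨χ, hχ, ⟨c2, d2, hc2, hd2, hχs⟩, hχd⟩ := exists_primitive_support hηd hηc hηs (by
        rw [integral_sub (hci _ hθ.continuous) (hci (fun t => κ * χ0 t)
            (continuous_const.mul hχ0d.continuous)),
          integral_const_mul, hχ01, ← hκ]; ring)
      have hχ1 : S.Test1 χ := ⟨hχ, Or.inl ⟨c2, d2, hc.trans hc2, hd2.trans hd, hχs⟩⟩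
      have hψ := isTest_mul hρ hper hχ1
      have hdc : Continuous (deriv χ) := hχ.continuous_deriv (by simp)
      have hχts : tsupport χ ⊆ Ioo c d := by
        refine (closure_minimal (fun t ht => hχs t ht) isClosed_Icc).trans fun t ht => ?_
        exact ⟨hc2.trans_le ht.1, ht.2.trans_lt hd2⟩
      have hdts : tsupport (deriv χ) ⊆ Ioo c d := by rw [hχd]; exact hηs
      have e1 : ∫ p in Ioo 0 (2 * Real.pi) ×ˢ Ioo c d, (ρ p.1 * deriv χ p.2) • M p =
          - ∫ p in Ioo 0 (2 * Real.pi) ×ˢ Ioo c d, (ρ p.1 * χ p.2) • g p := by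
        rw [setIntegral_box hc hd hdts, setIntegral_box hc hd hχts, ← hparts _ hψ]
        refine setIntegral_congr_fun S.measurableSet_cell fun p _ => ?_
        simp only [(fderiv_mul_apply hρ hχ p).2]
      have iF := integrableOn_box_smul (hFint c d hc hd h0cd) hρ.continuous hdc
      have iM := integrableOn_box_smul (hMint c d hc hd) hρ.continuous hdc
      have ig := integrableOn_box_smul (integrableOn_box_of_sq hgm hgw hc hd) hρ.continuous
        hχ.continuous
      have e2 : ∫ p in Ioo 0 (2 * Real.pi) ×ˢ Ioo c d, (ρ p.1 * deriv χ p.2) • F p =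
          - ∫ p in Ioo 0 (2 * Real.pi) ×ˢ Ioo c d, (ρ p.1 * χ p.2) • g p := by
        rw [IntegrableOn, box_restrict] at iF ig
        rw [box_restrict, integral_prod _ iF, integral_prod _ ig, ← integral_neg]
        refine integral_congr_ae ?_
        filter_upwards [hFac, hsec] with φ h1 h2
        have hsub : Ioo c d ⊆ Ioo S.a S.b := Ioo_subset_Ioo hc.le hd.le
        have h3 := integral_test_of_support hcd (h1.mono hsub) hχ hc2 hd2 hχs
        have h4 : IntegrableOn (fun t => F (φ, t)) (Ioo c d) :=
          (((h1.mono (K := Icc c d) fun t ht => ⟨hc.trans_le ht.1,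
            ht.2.trans_lt hd⟩).continuousOn_Icc
            hcd.le).integrableOn_Icc).mono_set Ioo_subset_Icc_self
        have h5 : IntegrableOn (fun t => g (φ, t)) (Ioo c d) :=
          (integrableOn_sub_of_sq h2.1 h2.2 hc hd).mono_set Ioo_subset_Icc_self
        rw [integral_add (hbs h4 hdc) (hbs h5 hχ.continuous), ← eq_neg_iff_add_eq_zero] at h3
        simp only [mul_smul]
        rw [integral_smul, h3, integral_smul, smul_neg]
      have e3 : ∫ p in Ioo 0 (2 * Real.pi) ×ˢ Ioo c d, (ρ p.1 * deriv χ p.2) • (M p - F p) = 0 := by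
        simp only [smul_sub]
        rw [integral_sub iM iF, e1, e2, sub_self]
      have iD := integrableOn_box_smul hD hρ.continuous hdc
      have iDk := integrableOn_box_smul (hD.sub hk2) hρ.continuous hθ.continuous
      rw [← e3]
      rw [IntegrableOn, box_restrict] at iD iDk
      rw [box_restrict, integral_prod _ iD]
      refine (integral_prod _ iDk).trans ?_
      refine integral_congr_ae ?_
      filter_upwards [hDsec] with φ h1
      simp only [mul_smul, Pi.sub_apply]
      rw [integral_smul, integral_smul]
      congr 1
      have hkφ : k φ = ∫ t in Ioo c d, χ0 t • (M (φ, t) - F (φ, t)) := by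
        refine (setIntegral_eq_of_subset_of_forall_sdiff_eq_zero measurableSet_Ioo
          (Ioo_subset_Ioo hc1 hd1) fun t ht => ?_).symm
        have : χ0 t = 0 := by
          by_contra h
          exact ht.2 (hχ0s (subset_tsupport χ0 h))
        rw [this, zero_smul]
      simp only [smul_sub (θ _) (_ - _) (k φ)]
      rw [integral_sub (hbs h1 hθ.continuous) ((hci _ hθ.continuous).smul_const _),
        integral_smul_const, ← hκ, hkφ, ← integral_smul,
        ← integral_sub (hbs h1 hθ.continuous)
          (show Integrable (fun t => κ • χ0 t • (M (φ, t) - F (φ, t))) _ from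
            (hbs h1 hχ0d.continuous).smul κ), hχd]
      refine integral_congr_ae ?_
      filter_upwards with t
      simp only [sub_smul, mul_smul]
  filter_upwards [key] with p hp
  rw [sub_sub, sub_eq_zero] at hp
  rw [hp, add_comm]

/-- Almost every section of an `H¹` field along the generating curve is absolutely continuous, and
closes up if the curve is a loop. -/
theorem IsWeakGradient.ae_section_isAC {m : E3 → E3} {G : ℝ × ℝ → E3 × E3}
    (h : S.IsWeakGradient m G) (hm : AEStronglyMeasurable (S.pull m) (volume.restrict S.cell))
    (hb : ∃ K, ∀ᵐ p ∂(volume.restrict S.cell), ‖S.pull m p‖ ≤ K) :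
    ∀ᵐ φ ∂(volume.restrict (Ioo 0 (2 * Real.pi))), ∃ v : ℝ → E3,
      IsAC v (fun t => (G (φ, t)).2) (Ioo S.a S.b) ∧
      (∀ᵐ t ∂(volume.restrict (Ioo S.a S.b)), S.pull m (φ, t) = v t) ∧
      (S.IsLoop → ∫ t in Ioo S.a S.b, (G (φ, t)).2 = 0) := by
  have hGm := continuous_snd.comp_aestronglyMeasurable h.meas
  have hg := hGm.stronglyMeasurable_mk
  have hM := hm.stronglyMeasurable_mk
  have heg := hGm.ae_eq_mk
  have heM := hm.ae_eq_mk
  set g := hGm.mk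
  set M := hm.mk
  obtain ⟨t0, ht0⟩ := exists_between S.a_lt_b
  have hgw : IntegrableOn (fun p => ‖g p‖ ^ 2 * S.x p.2) S.cell := by
    refine h.sq_int_snd.congr ?_
    filter_upwards [heg] with p hp
    rw [← hp]
  obtain ⟨K, hK⟩ := hb
  obtain ⟨k, hk⟩ := ae_eq_primitive hM hg ⟨K, by
      filter_upwards [heM, hK] with p h1 h2
      rwa [← h1]⟩ hgw (fun ψ hψ => by
      have := h.parts_t ψ hψ
      rw [integral_congr_ae (g := fun p => fderiv ℝ ψ p (0, 1) • M p) (by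
          filter_upwards [heM] with p hp
          rw [hp]),
        integral_congr_ae (μ := volume.restrict S.cell) (f := fun p => ψ p • (G p).2)
          (g := fun p => ψ p • g p) (by
          filter_upwards [heg] with p hp
          rw [← hp])] at this
      exact this) ht0
  -- On a loop `ρ(φ) · 1` is an admissible test function. Its `t`-derivative is zero, so the
  -- integral of `∂_t m` over a meridian is orthogonal to every smooth periodic `ρ` and vanishes for
  -- almost every `φ`.
  have hloop : ∀ᵐ φ ∂(volume.restrict (Ioo 0 (2 * Real.pi))),
      S.IsLoop → ∫ t in Ioo S.a S.b, (G (φ, t)).2 = 0 := by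
    by_cases hl : S.IsLoop
    swap
    · exact Filter.Eventually.of_forall fun φ h => absurd h hl
    have h1 : S.Test1 fun _ => 1 := ⟨contDiff_const, Or.inr ⟨hl, fun _ => rfl⟩⟩
    have hint : IntegrableOn (fun p => (G p).2) S.cell := by
      have := (isTest_mul (S := S) (ρ := fun _ => 1) contDiff_const
        (fun _ => rfl) h1).integrable_smul
        hGm h.sq_int_snd
      simpa using this
    have hker : ∀ ρ : ℝ → ℝ, ContDiff ℝ ∞ ρ → (∀ φ, ρ (φ + 2 * Real.pi) = ρ φ) →
        ∀ i : Fin 3,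
          ∫ φ in Ioo 0 (2 * Real.pi), ρ φ * (∫ t in Ioo S.a S.b, (G (φ, t)).2) i = 0 := by
      intro ρ hρ hper i
      have ht := isTest_mul hρ hper h1
      have e := h.parts_t _ ht
      have hi := ht.integrable_smul hGm h.sq_int_snd
      simp only [(fderiv_mul_apply hρ h1.1 _).2] at e
      simp only [deriv_const, mul_zero, zero_smul, integral_zero, mul_one] at e
      simp only [mul_one] at hi
      have e' := neg_eq_zero.1 e.symm
      change ∫ p in S.cell, ρ p.1 • (G p).2 = 0 at e'
      rw [integral_cell (f := fun p => ρ p.1 • (G p).2) hi] at e'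
      simp only [integral_smul] at e'
      rw [IntegrableOn, restrict_cell] at hi
      have hi2 := hi.integral_prod_left
      simp only [integral_smul] at hi2
      have := (EuclideanSpace.proj i : E3 →L[ℝ] ℝ).integral_comp_comm hi2
      rw [e', map_zero] at this
      simpa using this
    rw [IntegrableOn, restrict_cell] at hint
    have hH := hint.integral_prod_left
    have hz : ∀ i : Fin 3, ∀ᵐ φ ∂(volume.restrict (Ioo 0 (2 * Real.pi))),
        (∫ t in Ioo S.a S.b, (G (φ, t)).2) i = 0 := fun i =>
      ae_eq_zero_of_fourier ((EuclideanSpace.proj i : E3 →L[ℝ] ℝ).integrable_comp hH)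
        (fun n => hker _ (Real.contDiff_cos.comp (contDiff_const.mul contDiff_id))
          (fun φ => by
            change Real.cos (n * (φ + 2 * Real.pi)) = Real.cos (n * φ)
            rw [mul_add, Real.cos_add_int_mul_two_pi]) i)
        (fun n => hker _ (Real.contDiff_sin.comp (contDiff_const.mul contDiff_id))
          (fun φ => by
            change Real.sin (n * (φ + 2 * Real.pi)) = Real.sin (n * φ)
            rw [mul_add, Real.sin_add_int_mul_two_pi]) i)
    filter_upwards [hz 0, hz 1, hz 2] with φ a0 a1 a2 _
    exact ext_coords a0 a1 a2
  filter_upwards [ae_ae_cell hk, ae_ae_cell heg, ae_ae_cell heM, hloop,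
    ae_section_sq hg.aestronglyMeasurable hgw] with φ h1 h2 h3 h4 h5
  refine ⟨fun t => k φ + ∫ s in t0..t, g (φ, s), ?_, ?_, h4⟩
  · refine IsAC.congr_deriv (v' := fun t => g (φ, t)) (IsAC.of_base (t0 := t0) fun t ht =>
      ⟨intervalIntegrable_of_sq h5.1 h5.2 ht0 ht, by simp⟩) ?_
    filter_upwards [h2] with t ht
    rw [← ht]
  · filter_upwards [h1, h3] with t e1 e3
    rw [e3, e1]

end SurfaceOfRevolution

/-! ### Parseval's identity and Wirtinger's inequality on the circle -/

theorem sq_norm_fourierCoeffOn {f : ℝ → ℝ} (hf : IntegrableOn f (Ioo 0 (2 * Real.pi))) (n : ℤ) :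
    ‖fourierCoeffOn Real.two_pi_pos (fun φ => (f φ : ℂ)) n‖ ^ 2 = (2 * Real.pi)⁻¹ ^ 2 *
      ((∫ φ in Ioo 0 (2 * Real.pi), Real.cos (n * φ) * f φ) ^ 2 +
        (∫ φ in Ioo 0 (2 * Real.pi), Real.sin (n * φ) * f φ) ^ 2) := by
  have hi : ∀ u : ℝ → ℝ, Continuous u → (∀ φ, |u φ| ≤ 1) →
      IntegrableOn (fun φ => u φ * f φ) (Ioo 0 (2 * Real.pi)) := by
    intro u hu hu1
    refine Integrable.mono' hf.norm (hu.aestronglyMeasurable.mul hf.aestronglyMeasurable) ?_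
    filter_upwards with φ
    rw [norm_mul]
    exact mul_le_of_le_one_left (norm_nonneg _) (hu1 φ)
  have i1 := hi (fun φ => Real.cos (n * φ)) (by fun_prop) fun φ => Real.abs_cos_le_one _
  have i2 := hi (fun φ => Real.sin (n * φ)) (by fun_prop) fun φ => Real.abs_sin_le_one _
  have hpi : (Real.pi : ℂ) ≠ 0 := by exact_mod_cast Real.pi_ne_zero
  have e : ∀ φ : ℝ, fourier (-n) (φ : AddCircle (2 * Real.pi - 0)) • (f φ : ℂ) =
      ((Real.cos (n * φ) * f φ : ℝ) : ℂ) - ((Real.sin (n * φ) * f φ : ℝ) : ℂ) * Complex.I := by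
    intro φ
    rw [fourier_coe_apply]
    have : (2 * Real.pi * Complex.I * ((-n : ℤ) : ℂ) * φ / ((2 * Real.pi - 0 : ℝ) : ℂ)) =
        ((-(n * φ) : ℝ) : ℂ) * Complex.I := by
      push_cast; rw [sub_zero]; field_simp
    rw [this, Complex.exp_mul_I, ← Complex.ofReal_cos, ← Complex.ofReal_sin, Real.cos_neg,
      Real.sin_neg]
    push_cast; rw [smul_eq_mul]; ring
  rw [fourierCoeffOn_eq_integral, ← integral_Ioo_two_pi]
  simp only [e]
  rw [integral_sub i1.ofReal (i2.ofReal.mul_const _), integral_mul_const, integral_complex_ofReal,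
    integral_complex_ofReal, norm_smul, mul_pow, sub_zero, one_div, Real.norm_of_nonneg
      (by positivity)]
  congr 1
  rw [← Complex.normSq_eq_norm_sq, Complex.normSq_apply]
  simp; ring

theorem hasSum_of_eq {f g : ℤ → ℝ} {a b : ℝ} (h : HasSum f a) (hfg : ∀ n, g n = f n) (hab : b = a) :
    HasSum g b := by
  rw [funext hfg, hab]; exact h

/-- **Parseval's identity** for real functions on the circle. -/
theorem hasSum_parseval {f : ℝ → ℝ} (hf : MemLp f 2 (volume.restrict (Ioo 0 (2 * Real.pi)))) :
    HasSum (fun n : ℤ => (∫ φ in Ioo 0 (2 * Real.pi), Real.cos (n * φ) * f φ) ^ 2 +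
        (∫ φ in Ioo 0 (2 * Real.pi), Real.sin (n * φ) * f φ) ^ 2)
      (2 * Real.pi * ∫ φ in Ioo 0 (2 * Real.pi), f φ ^ 2) := by
  have h1 : MemLp (fun φ => (f φ : ℂ)) 2 (volume.restrict (Ioc 0 (2 * Real.pi))) := by
    rw [← restrict_Ioo_eq_restrict_Ioc]; exact hf.ofReal
  have h2 := hasSum_sq_fourierCoeffOn Real.two_pi_pos h1
  have hfi : IntegrableOn f (Ioo 0 (2 * Real.pi)) := hf.integrable (by norm_num)
  simp only [sq_norm_fourierCoeffOn hfi] at h2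
  have h3 := h2.mul_left ((2 * Real.pi) ^ 2)
  have hpi := Real.pi_pos
  refine hasSum_of_eq h3 (fun n => ?_) ?_
  · field_simp
  · rw [← integral_Ioo_two_pi]
    simp only [Complex.norm_real, Real.norm_eq_abs, sq_abs, sub_zero, smul_eq_mul]
    field_simp

/-- Weak derivatives on the circle. -/
def CircleWeakDeriv (f g : ℝ → ℝ) : Prop :=
  MemLp f 2 (volume.restrict (Ioo 0 (2 * Real.pi))) ∧
  MemLp g 2 (volume.restrict (Ioo 0 (2 * Real.pi))) ∧
  ∀ n : ℤ, (∫ φ in Ioo 0 (2 * Real.pi), Real.cos (n * φ) * g φ =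
      n * ∫ φ in Ioo 0 (2 * Real.pi), Real.sin (n * φ) * f φ) ∧
    (∫ φ in Ioo 0 (2 * Real.pi), Real.sin (n * φ) * g φ =
      - n * ∫ φ in Ioo 0 (2 * Real.pi), Real.cos (n * φ) * f φ)

theorem CircleWeakDeriv.hasSum {f g : ℝ → ℝ} (h : CircleWeakDeriv f g) :
    HasSum (fun n : ℤ => (n : ℝ) ^ 2 *
        ((∫ φ in Ioo 0 (2 * Real.pi), Real.cos (n * φ) * f φ) ^ 2 +
        (∫ φ in Ioo 0 (2 * Real.pi), Real.sin (n * φ) * f φ) ^ 2))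
      (2 * Real.pi * ∫ φ in Ioo 0 (2 * Real.pi), g φ ^ 2) := by
  refine hasSum_of_eq (hasSum_parseval h.2.1) (fun n => ?_) rfl
  rw [(h.2.2 n).1, (h.2.2 n).2]; ring

theorem one_le_cast_sq {n : ℤ} (hn : n ≠ 0) : (1 : ℝ) ≤ (n : ℝ) ^ 2 := by
  have : (1 : ℤ) ≤ n ^ 2 := by
    have := pow_pos (abs_pos.2 hn) 2
    rw [sq_abs] at this; omega
  exact_mod_cast this

/-- The factor `n² - 1` is negative only for `n = 0`, and vanishing average removes that frequency.
-/
theorem CircleWeakDeriv.term_nonneg {f g : ℝ → ℝ} (_ : CircleWeakDeriv f g)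
    (h0 : ∫ φ in Ioo 0 (2 * Real.pi), f φ = 0) (n : ℤ) :
    0 ≤ ((n : ℝ) ^ 2 - 1) * ((∫ φ in Ioo 0 (2 * Real.pi), Real.cos (n * φ) * f φ) ^ 2 +
        (∫ φ in Ioo 0 (2 * Real.pi), Real.sin (n * φ) * f φ) ^ 2) := by
  rcases eq_or_ne n 0 with rfl | hn
  · simp [h0]
  · exact mul_nonneg (sub_nonneg.2 (one_le_cast_sq hn)) (by positivity)

/-- Parseval's identity applied to `g` and to `f`: the Wirtinger deficit is a series weighted by `n²
- 1`, from which both the inequality and its equality case are read off. -/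
theorem CircleWeakDeriv.hasSum_sub {f g : ℝ → ℝ} (h : CircleWeakDeriv f g) :
    HasSum (fun n : ℤ => ((n : ℝ) ^ 2 - 1) *
        ((∫ φ in Ioo 0 (2 * Real.pi), Real.cos (n * φ) * f φ) ^ 2 +
        (∫ φ in Ioo 0 (2 * Real.pi), Real.sin (n * φ) * f φ) ^ 2))
      (2 * Real.pi * ((∫ φ in Ioo 0 (2 * Real.pi), g φ ^ 2) -
        ∫ φ in Ioo 0 (2 * Real.pi), f φ ^ 2)) := by
  exact hasSum_of_eq (h.hasSum.sub (hasSum_parseval h.1)) (fun n => by ring) (by ring)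

/-- **Wirtinger's inequality.** -/
theorem CircleWeakDeriv.wirtinger {f g : ℝ → ℝ} (h : CircleWeakDeriv f g)
    (h0 : ∫ φ in Ioo 0 (2 * Real.pi), f φ = 0) :
    ∫ φ in Ioo 0 (2 * Real.pi), f φ ^ 2 ≤ ∫ φ in Ioo 0 (2 * Real.pi), g φ ^ 2 := by
  have h1 := h.hasSum_sub.nonneg (h.term_nonneg h0)
  exact sub_nonneg.1 (nonneg_of_mul_nonneg_right h1 Real.two_pi_pos)

theorem ae_eq_zero_of_integral_sq {f : ℝ → ℝ}
    (hf : IntegrableOn (fun φ => f φ ^ 2) (Ioo 0 (2 * Real.pi)))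
    (h : ∫ φ in Ioo 0 (2 * Real.pi), f φ ^ 2 = 0) :
    ∀ᵐ φ ∂(volume.restrict (Ioo 0 (2 * Real.pi))), f φ = 0 := by
  rw [integral_eq_zero_iff_of_nonneg (fun φ => sq_nonneg _) hf] at h
  filter_upwards [h] with φ hφ
  exact pow_eq_zero_iff two_ne_zero |>.1 hφ

theorem integral_sub_trig_sq {f : ℝ → ℝ} (hf : MemLp f 2 (volume.restrict (Ioo 0 (2 * Real.pi))))
    (k c s : ℝ) :
    IntegrableOn (fun φ => (f φ - (k + c * Real.cos φ + s * Real.sin φ)) ^ 2)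
      (Ioo 0 (2 * Real.pi)) ∧
    ∫ φ in Ioo 0 (2 * Real.pi), (f φ - (k + c * Real.cos φ + s * Real.sin φ)) ^ 2 =
      (∫ φ in Ioo 0 (2 * Real.pi), f φ ^ 2) -
      2 * (k * (∫ φ in Ioo 0 (2 * Real.pi), f φ) +
        c * (∫ φ in Ioo 0 (2 * Real.pi), Real.cos φ * f φ) +
        s * ∫ φ in Ioo 0 (2 * Real.pi), Real.sin φ * f φ) +
      (2 * Real.pi * k ^ 2 + Real.pi * (c ^ 2 + s ^ 2)) := by
  have hfi : IntegrableOn f (Ioo 0 (2 * Real.pi)) := hf.integrable (by norm_num)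
  have hi : ∀ u : ℝ → ℝ, Continuous u → (∀ φ, |u φ| ≤ 1) →
      IntegrableOn (fun φ => u φ * f φ) (Ioo 0 (2 * Real.pi)) := by
    intro u hu hu1
    refine Integrable.mono' hfi.norm (hu.aestronglyMeasurable.mul hfi.aestronglyMeasurable) ?_
    filter_upwards with φ
    rw [norm_mul]
    exact mul_le_of_le_one_left (norm_nonneg _) (hu1 φ)
  have i0 : IntegrableOn (fun φ => f φ ^ 2) (Ioo 0 (2 * Real.pi)) := hf.integrable_sq
  have i1 := hi (fun φ => Real.cos φ) (by fun_prop) fun φ => Real.abs_cos_le_one _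
  have i2 := hi (fun φ => Real.sin φ) (by fun_prop) fun φ => Real.abs_sin_le_one _
  have i3 : IntegrableOn (fun φ => k ^ 2 + (2 * k * c) * Real.cos φ + (2 * k * s) * Real.sin φ +
      c ^ 2 * Real.cos φ ^ 2 + s ^ 2 * Real.sin φ ^ 2 + (2 * c * s) * (Real.sin φ * Real.cos φ))
      (Ioo 0 (2 * Real.pi)) :=
    (Continuous.integrableOn_Icc (by fun_prop)).mono_set Ioo_subset_Icc_self
  have i4 := ((hfi.const_mul k).add (i1.const_mul c)).add (i2.const_mul s)
  have e : ∀ φ, (f φ - (k + c * Real.cos φ + s * Real.sin φ)) ^ 2 =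
      (f φ ^ 2 - 2 * (k * f φ + c * (Real.cos φ * f φ) + s * (Real.sin φ * f φ))) +
      (k ^ 2 + (2 * k * c) * Real.cos φ + (2 * k * s) * Real.sin φ +
      c ^ 2 * Real.cos φ ^ 2 + s ^ 2 * Real.sin φ ^ 2 + (2 * c * s) *
        (Real.sin φ * Real.cos φ)) := by
    intro φ; ring
  simp only [e]
  have i5 := i0.sub (i4.const_mul 2)
  refine ⟨i5.add i3, ?_⟩
  refine (integral_add i5 i3).trans ?_
  rw [integral_trig_quadratic]
  have e1 := integral_sub i0 (i4.const_mul 2)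
  simp only [Pi.sub_apply]
  refine congrArg₂ (· + ·) (e1.trans ?_) rfl
  rw [integral_const_mul]
  congr 2
  refine (integral_add ((hfi.const_mul k).add (i1.const_mul c)) (i2.const_mul s)).trans ?_
  rw [integral_const_mul]
  congr 1
  refine (integral_add (hfi.const_mul k) (i1.const_mul c)).trans ?_
  rw [integral_const_mul, integral_const_mul]

/-- In the case of equality in Wirtinger's inequality, only the first harmonics are present. -/
theorem CircleWeakDeriv.eq_first_harmonic {f g : ℝ → ℝ} (h : CircleWeakDeriv f g)
    (h0 : ∫ φ in Ioo 0 (2 * Real.pi), f φ = 0)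
    (hle : ∫ φ in Ioo 0 (2 * Real.pi), g φ ^ 2 ≤ ∫ φ in Ioo 0 (2 * Real.pi), f φ ^ 2) :
    ∀ᵐ φ ∂(volume.restrict (Ioo 0 (2 * Real.pi))), f φ =
      (Real.pi⁻¹ * ∫ θ in Ioo 0 (2 * Real.pi), Real.cos θ * f θ) * Real.cos φ +
      (Real.pi⁻¹ * ∫ θ in Ioo 0 (2 * Real.pi), Real.sin θ * f θ) * Real.sin φ := by
  set c := ∫ θ in Ioo 0 (2 * Real.pi), Real.cos θ * f θ with hc
  set s := ∫ θ in Ioo 0 (2 * Real.pi), Real.sin θ * f θ with hs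
  have hsum := h.hasSum_sub
  rw [le_antisymm hle (h.wirtinger h0), sub_self, mul_zero,
    hasSum_zero_iff_of_nonneg (h.term_nonneg h0)] at hsum
  -- A vanishing series of nonnegative terms has only zero terms, and `n² - 1` is nonzero except at
  -- `n = ±1`.
  have hz : ∀ n : ℤ, n ∉ ({1, -1} : Finset ℤ) →
      (∫ φ in Ioo 0 (2 * Real.pi), Real.cos (n * φ) * f φ) ^ 2 +
        (∫ φ in Ioo 0 (2 * Real.pi), Real.sin (n * φ) * f φ) ^ 2 = 0 := by
    intro n hn
    rcases eq_or_ne n 0 with rfl | hn0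
    · simp [h0]
    · have h1 := congrFun hsum n
      rcases mul_eq_zero.1 h1 with h2 | h2
      · exfalso
        have h3 : (n : ℝ) ^ 2 = 1 := sub_eq_zero.1 h2
        have h4 : n ^ 2 = 1 := by exact_mod_cast h3
        rcases sq_eq_one_iff.1 h4 with h5 | h5 <;> simp [h5] at hn
      · exact h2
  -- The terms at `1` and `-1` coincide, so Parseval gives the `L²` norm of `f` in terms of `c` and
  -- `s`; this is exactly the norm of the proposed harmonic, and the distance between the two is
  -- zero.
  have hP := (hasSum_parseval h.1).unique (hasSum_sum_of_ne_finset_zero hz)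
  rw [Finset.sum_pair (by norm_num)] at hP
  simp only [Int.cast_one, one_mul, Int.cast_neg, neg_mul, Real.cos_neg, Real.sin_neg,
    integral_neg, neg_sq] at hP
  rw [← hc, ← hs] at hP
  obtain ⟨h1, h2⟩ := integral_sub_trig_sq h.1 0 (Real.pi⁻¹ * c) (Real.pi⁻¹ * s)
  rw [← hc, ← hs] at h2
  have hpi := Real.pi_pos
  have h3 : ∫ φ in Ioo 0 (2 * Real.pi), f φ ^ 2 = Real.pi⁻¹ * (c ^ 2 + s ^ 2) := by
    field_simp; linarith
  have h4 := ae_eq_zero_of_integral_sq h1 (by rw [h2, h3]; field_simp; ring)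
  filter_upwards [h4] with φ hφ
  linarith

/-- A zero derivative kills every frequency `n ≠ 0`, and by Parseval the distance of `f` to its mean
is zero. -/
theorem CircleWeakDeriv.eq_const {f g : ℝ → ℝ} (h : CircleWeakDeriv f g)
    (hg : ∫ φ in Ioo 0 (2 * Real.pi), g φ ^ 2 = 0) :
    ∀ᵐ φ ∂(volume.restrict (Ioo 0 (2 * Real.pi))), f φ =
      (2 * Real.pi)⁻¹ * ∫ θ in Ioo 0 (2 * Real.pi), f θ := by
  set k := ∫ θ in Ioo 0 (2 * Real.pi), f θ with hk
  have hsum := h.hasSum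
  rw [hg, mul_zero, hasSum_zero_iff_of_nonneg (fun n => by positivity)] at hsum
  have hz : ∀ n : ℤ, n ∉ ({0} : Finset ℤ) →
      (∫ φ in Ioo 0 (2 * Real.pi), Real.cos (n * φ) * f φ) ^ 2 +
        (∫ φ in Ioo 0 (2 * Real.pi), Real.sin (n * φ) * f φ) ^ 2 = 0 := by
    intro n hn
    rw [Finset.mem_singleton] at hn
    rcases mul_eq_zero.1 (congrFun hsum n) with h2 | h2
    · have := one_le_cast_sq hn
      linarith
    · exact h2
  have hP := (hasSum_parseval h.1).unique (hasSum_sum_of_ne_finset_zero hz)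
  rw [Finset.sum_singleton] at hP
  simp only [Int.cast_zero, zero_mul, Real.cos_zero, Real.sin_zero, one_mul, integral_zero] at hP
  rw [← hk] at hP
  obtain ⟨h1, h2⟩ := integral_sub_trig_sq h.1 ((2 * Real.pi)⁻¹ * k) 0 0
  rw [← hk] at h2
  have hpi := Real.pi_pos
  have h3 : ∫ φ in Ioo 0 (2 * Real.pi), f φ ^ 2 = (2 * Real.pi)⁻¹ * k ^ 2 := by
    field_simp; linarith
  have h4 := ae_eq_zero_of_integral_sq h1 (by rw [h2, h3]; field_simp; ring)
  filter_upwards [h4] with φ hφ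
  linarith

/-! ### Profiles and the equivariant fields they generate -/

namespace SurfaceOfRevolution

variable {S T : SurfaceOfRevolution} {g : ℝ → ℝ} {a : E3 → E3} {ε : ℝ}

theorem continuousOn_areaElt : ContinuousOn S.areaElt (Icc S.a S.b) :=
  S.continuousOn_x.abs.mul S.continuousOn_h2

theorem areaElt_nonneg (t : ℝ) : 0 ≤ S.areaElt t := mul_nonneg (abs_nonneg _) (Real.sqrt_nonneg _)

theorem continuousOn_pull {u : E3 → E3} (hu : ContinuousOn u S.carrier) :
    ContinuousOn (S.pull u) (univ ×ˢ Icc S.a S.b) :=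
  hu.comp S.continuousOn_param fun p hp => S.param_mem p.1 hp.2

theorem continuousOn_section {u : E3 → E3} (hu : ContinuousOn u S.carrier) (φ : ℝ) :
    ContinuousOn (fun t => u (S.param φ t)) (Icc S.a S.b) := by
  have h : ContinuousOn (fun t : ℝ => (φ, t)) (Icc S.a S.b) := by fun_prop
  exact ContinuousOn.comp (g := S.pull u) (f := fun t : ℝ => (φ, t))
    (continuousOn_pull hu) h fun t ht => ⟨mem_univ _, ht⟩

theorem aesm_pull {u : E3 → E3} (hu : ContinuousOn u S.carrier) :
    AEStronglyMeasurable (S.pull u) (volume.restrict S.cell) :=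
  ((continuousOn_pull hu).mono (prod_mono (subset_univ _) Ioo_subset_Icc_self)).aestronglyMeasurable
    S.measurableSet_cell

theorem exists_pull_bound {u : E3 → E3} (hu : ContinuousOn u S.carrier) :
    ∃ K, 0 ≤ K ∧ ∀ φ, ∀ t ∈ Icc S.a S.b, ‖u (S.param φ t)‖ ≤ K := by
  obtain ⟨K, hK⟩ := S.isCompact_carrier.exists_bound_of_continuousOn hu
  exact ⟨max K 0, le_max_right _ _, fun φ t ht =>
    (hK _ (S.param_mem φ ht)).trans (le_max_left _ _)⟩

/-- The potential is bounded. -/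
theorem exists_potential_bound (hg : Continuous g) (ha : ContinuousOn a S.carrier)
    (T : SurfaceOfRevolution) : ∃ K, 0 ≤ K ∧ ∀ q ∈ T.carrier, ∀ φ, ∀ t ∈ Icc S.a S.b,
      |g (inner ℝ q (a (S.param φ t)))| ≤ K := by
  obtain ⟨A, hA0, hA⟩ := exists_pull_bound ha
  obtain ⟨M, hM0, hM⟩ := T.exists_norm_bound
  obtain ⟨K, hK0, hK⟩ := exists_bound_Icc hg (-(M * A)) (M * A)
  refine ⟨K, hK0, fun q hq φ t ht => hK _ (abs_le.1 ?_)⟩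
  exact (abs_real_inner_le_norm _ _).trans
    (mul_le_mul (hM q hq) (hA φ t ht) (norm_nonneg _) hM0.le)

theorem integrableOn_potential (hg : Continuous g) (ha : ContinuousOn a S.carrier) {m : E3 → E3}
    (hm : AEStronglyMeasurable (S.pull m) (volume.restrict S.cell))
    (hT : ∀ᵐ p ∂(volume.restrict S.cell), S.pull m p ∈ T.carrier) :
    IntegrableOn (fun p => g (inner ℝ (S.pull m p) (S.pull a p)) * S.areaElt p.2) S.cell := by
  obtain ⟨K, hK0, hK⟩ := exists_potential_bound hg ha T
  refine Integrable.mono' ((S.integrableOn_cell_snd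
    (S.integrableOn_of_continuousOn S.continuousOn_areaElt)).const_mul K)
    ((hg.comp_aestronglyMeasurable (hm.inner (aesm_pull ha))).mul
      (S.aestronglyMeasurable_cell_snd (S.aestronglyMeasurable_of_continuousOn
        S.continuousOn_areaElt))) ?_
  filter_upwards [hT, ae_restrict_mem S.measurableSet_cell] with p hp hc
  rw [norm_mul, Real.norm_of_nonneg (S.areaElt_nonneg p.2)]
  exact mul_le_mul_of_nonneg_right (hK _ hp p.1 p.2 (Ioo_subset_Icc_self hc.2))
    (S.areaElt_nonneg _)

/-- Profiles of equivariant fields: functions with values in the target and finite energy. -/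
structure Profile (S T : SurfaceOfRevolution) (w w' : ℝ → E3) : Prop where
  weak : S.WeakD1 w w'
  mem : ∀ t ∈ Ioo S.a S.b, w t ∈ T.carrier
  perp_int : IntegrableOn (fun t => ‖perp (w t)‖ ^ 2 * (S.x t)⁻¹) (Ioo S.a S.b)

/-- The energy density of a profile. -/
def density (S : SurfaceOfRevolution) (g : ℝ → ℝ) (a : E3 → E3) (w w' : ℝ → E3) (t : ℝ) : ℝ :=
  ‖perp (w t)‖ ^ 2 * (S.h2 t / S.x t) + ‖w' t‖ ^ 2 * (S.x t / S.h2 t) +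
    g (inner ℝ (w t) (a (S.param 0 t))) * S.areaElt t

/-- Equivariance of the field `a` under rotations, with `ε = 1` for axial symmetry and `ε = -1` for
axial antisymmetry. -/
def Equivariant (S : SurfaceOfRevolution) (ε : ℝ) (u : E3 → E3) : Prop :=
  ∀ φ : ℝ, ∀ p ∈ S.carrier, u (rot φ p) = rot (ε * φ) (u p)

theorem Equivariant.apply_param {u : E3 → E3} (hu : S.Equivariant ε u) (φ : ℝ) {t : ℝ}
    (ht : t ∈ Icc S.a S.b) : u (S.param φ t) = rot (ε * φ) (u (S.param 0 t)) := by
  rw [← hu φ _ (S.param_mem 0 ht), rot_param, add_zero]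

theorem cos_sign_mul (hε : ε = 1 ∨ ε = -1) (φ : ℝ) :
    Real.cos (ε * φ) = Real.cos φ ∧ Real.sin (ε * φ) = ε * Real.sin φ := by
  rcases hε with rfl | rfl <;> simp

/-- The sign enters only through the sine coefficient, which lets symmetric and antisymmetric fields
share all computations. -/
theorem rot_sign_eq (hε : ε = 1 ∨ ε = -1) (φ : ℝ) (v : E3) : rot (ε * φ) v =
    Real.cos φ • perp v + Real.sin φ • (ε • quarter v) + v 2 • e3 := by
  rw [rot_eq, (cos_sign_mul hε φ).1, (cos_sign_mul hε φ).2, smul_smul, mul_comm (Real.sin φ)]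

theorem sign_sq (hε : ε = 1 ∨ ε = -1) : ε ^ 2 = 1 := by rcases hε with rfl | rfl <;> norm_num

theorem norm_sq_decomp (v : E3) : ‖perp v‖ ^ 2 + ‖v 2 • e3‖ ^ 2 = ‖v‖ ^ 2 := by
  simp only [norm_sq_eq_coords]; simp

theorem norm_sign_quarter (hε : ε = 1 ∨ ε = -1) (v : E3) : ‖ε • quarter v‖ ^ 2 = ‖perp v‖ ^ 2 := by
  rw [norm_smul, mul_pow, norm_quarter, Real.norm_eq_abs, sq_abs, sign_sq hε, one_mul]

namespace Profile

variable {w w' : ℝ → E3}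

theorem integrable_perp (hw : Profile S T w w') :
    IntegrableOn (fun t => ‖perp (w t)‖ ^ 2 * (S.h2 t / S.x t)) (Ioo S.a S.b) := by
  obtain ⟨C, hC, hcmp⟩ := S.exists_weight_comparison
  refine integrableOn_mul_weight (C := C) hw.perp_int
    ((continuous_perp.comp_aestronglyMeasurable hw.weak.meas).norm.pow 2) S.aesm_h2_div_x
    (fun _ => sq_nonneg _) ?_
  filter_upwards [ae_restrict_mem measurableSet_Ioo] with t ht using (hcmp t ht).1

theorem integrable_deriv (hw : Profile S T w w') :
    IntegrableOn (fun t => ‖w' t‖ ^ 2 * (S.x t / S.h2 t)) (Ioo S.a S.b) := by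
  obtain ⟨C, hC, hcmp⟩ := S.exists_weight_comparison
  refine integrableOn_mul_weight (C := C) hw.weak.sq_int (hw.weak.meas'.norm.pow 2) S.aesm_x_div_h2
    (fun _ => sq_nonneg _) ?_
  filter_upwards [ae_restrict_mem measurableSet_Ioo] with t ht using (hcmp t ht).2.2.1

theorem integrable_potential (hw : Profile S T w w') (hg : Continuous g)
    (ha : ContinuousOn a S.carrier) :
    IntegrableOn (fun t => g (inner ℝ (w t) (a (S.param 0 t))) * S.areaElt t) (Ioo S.a S.b) := by
  obtain ⟨K, hK0, hK⟩ := exists_potential_bound hg ha T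
  have hac : ContinuousOn (fun t => a (S.param 0 t)) (Icc S.a S.b) :=
    continuousOn_section ha 0
  have hm1 : AEStronglyMeasurable (fun t => (inner ℝ (w t) (a (S.param 0 t)) : ℝ))
      (volume.restrict (Ioo S.a S.b)) :=
    hw.weak.meas.inner (S.aestronglyMeasurable_of_continuousOn hac)
  refine Integrable.mono' ((S.integrableOn_of_continuousOn S.continuousOn_areaElt).const_mul K)
    ((hg.comp_aestronglyMeasurable hm1).mul
      (S.aestronglyMeasurable_of_continuousOn S.continuousOn_areaElt)) ?_
  filter_upwards [ae_restrict_mem measurableSet_Ioo] with t ht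
  rw [norm_mul, Real.norm_of_nonneg (S.areaElt_nonneg t)]
  exact mul_le_mul_of_nonneg_right (hK _ (hw.mem t ht) 0 t (Ioo_subset_Icc_self ht))
    (S.areaElt_nonneg _)

theorem integrable_density (hw : Profile S T w w') (hg : Continuous g)
    (ha : ContinuousOn a S.carrier) : IntegrableOn (S.density g a w w') (Ioo S.a S.b) :=
  (hw.integrable_perp.add hw.integrable_deriv).add (hw.integrable_potential hg ha)

/-- The energy of the equivariant field generated by a profile is given by the density. -/
theorem memH1Into_energy (hw : Profile S T w w') (hε : ε = 1 ∨ ε = -1) (hg : Continuous g)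
    (ha : ContinuousOn a S.carrier) (hae : S.Equivariant ε a) {m : E3 → E3}
    (hmT : ∀ φ, ∀ t ∈ Ioo S.a S.b, m (S.param φ t) = rot (ε * φ) (w t)) :
    S.MemH1Into T m ∧
      S.energy g a m = 2 * Real.pi * ∫ t in Ioo S.a S.b, S.density g a w w' t := by
  have hm : ∀ φ, ∀ t ∈ Ioo S.a S.b, m (S.param φ t) =
      Real.cos φ • perp (w t) + Real.sin φ • (ε • quarter (w t)) + w t 2 • e3 := fun φ t ht => by
    rw [hmT φ t ht, rot_sign_eq hε]
  have hA := hw.weak.clm perpL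
  -- The sine coefficient is a fixed linear image of the profile, so it inherits its weak
  -- derivative.
  have hB := hw.weak.clm (ε • quarterL)
  have hC := hw.weak.clm vertL
  have hN : ∀ t, ‖perp (w t)‖ ^ 2 + ‖ε • quarter (w t)‖ ^ 2 = 2 * ‖perp (w t)‖ ^ 2 := fun t => by
    rw [norm_sign_quarter hε]; ring
  have hAB : IntegrableOn (fun t => (‖perpL (w t)‖ ^ 2 + ‖(ε • quarterL) (w t)‖ ^ 2) * (S.x t)⁻¹)
      (Ioo S.a S.b) := by
    refine (hw.perp_int.const_mul 2).congr ?_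
    filter_upwards with t
    rw [← mul_assoc, ← hN]; rfl
  have hmem : ∀ᵐ p ∂(volume.restrict S.cell), S.pull m p ∈ T.carrier :=
    S.ae_cell_of_forall fun φ t ht => by
      rw [pull, hmT φ t ht]; exact T.rot_mem _ (hw.mem t ht)
  have hH1 := memH1_trig hA hB hC hAB hm
  refine ⟨⟨hH1, hmem⟩, ?_⟩
  rw [energy_eq (isWeakGradient_trig hA hB hC hAB hm), integral_gradSq_trig hA hB hC hAB,
    integral_cell_symm (integrableOn_potential hg ha hH1.1 hmem)]
  have e1 : ∫ t in Ioo S.a S.b, (Real.pi * (‖perpL (w t)‖ ^ 2 + ‖(ε • quarterL) (w t)‖ ^ 2) *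
      (S.h2 t / S.x t) + (Real.pi * (‖perpL (w' t)‖ ^ 2 + ‖(ε • quarterL) (w' t)‖ ^ 2) +
        2 * Real.pi * ‖vertL (w' t)‖ ^ 2) * (S.x t / S.h2 t)) =
      ∫ t in Ioo S.a S.b, 2 * Real.pi * (‖perp (w t)‖ ^ 2 * (S.h2 t / S.x t) +
        ‖w' t‖ ^ 2 * (S.x t / S.h2 t)) := by
    congr 1
    funext t
    have h1 := norm_sq_decomp (w' t)
    have h2 := norm_sign_quarter hε (w t)
    have h3 := norm_sign_quarter hε (w' t)
    simp only [perpL_apply, smul_apply, quarterL_apply, vertL_apply]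
    rw [h2, h3, ← h1]; ring
  have e2 : ∫ t in Ioo S.a S.b, ∫ φ in Ioo 0 (2 * Real.pi),
      g (inner ℝ (S.pull m (φ, t)) (S.pull a (φ, t))) * S.areaElt t =
      ∫ t in Ioo S.a S.b, 2 * Real.pi * (g (inner ℝ (w t) (a (S.param 0 t))) * S.areaElt t) := by
    refine setIntegral_congr_fun measurableSet_Ioo fun t ht => ?_
    -- The field and `a` turn by the same angle, so their inner product is constant along the circle
    -- of latitude.
    have e : ∀ φ, g (inner ℝ (S.pull m (φ, t)) (S.pull a (φ, t))) * S.areaElt t =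
        g (inner ℝ (w t) (a (S.param 0 t))) * S.areaElt t := fun φ => by
      rw [pull, pull, hmT _ t ht, hae.apply_param φ (Ioo_subset_Icc_self ht), inner_rot_rot]
    simp only [e]
    rw [setIntegral_const, Real.volume_real_Ioo_of_le Real.two_pi_pos.le, sub_zero, smul_eq_mul]
  have hi : IntegrableOn (fun t => ‖perp (w t)‖ ^ 2 * (S.h2 t / S.x t) +
      ‖w' t‖ ^ 2 * (S.x t / S.h2 t)) (Ioo S.a S.b) := hw.integrable_perp.add hw.integrable_deriv
  rw [e1, e2, integral_const_mul, integral_const_mul, ← mul_add,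
    ← integral_add hi (hw.integrable_potential hg ha)]
  rfl

/-- A profile generates an equivariant field, whose energy is given by the density. -/
theorem exists_field (hw : Profile S T w w') (hε : ε = 1 ∨ ε = -1) (hg : Continuous g)
    (ha : ContinuousOn a S.carrier) (hae : S.Equivariant ε a) :
    ∃ m, S.MemH1Into T m ∧
      S.energy g a m = 2 * Real.pi * ∫ t in Ioo S.a S.b, S.density g a w w' t := by
  obtain ⟨m, hm⟩ := S.exists_field_Ioo (fun t => perp (w t)) (fun t => ε • quarter (w t))
    fun t => w t 2 • e3
  exact ⟨m, hw.memH1Into_energy hε hg ha hae fun φ t ht => by rw [hm φ t ht, rot_sign_eq hε]⟩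

end Profile

/-! ### Restriction to the circles of latitude -/

/-- Functions that vanish on almost every horizontal section vanish almost everywhere. -/
theorem ae_cell_of_ae_ae {F : Type*} [NormedAddCommGroup F] {f : ℝ × ℝ → F}
    (hf : AEStronglyMeasurable f (volume.restrict S.cell))
    (h : ∀ᵐ t ∂(volume.restrict (Ioo S.a S.b)), ∀ᵐ φ ∂(volume.restrict (Ioo 0 (2 * Real.pi))),
      f (φ, t) = 0) : ∀ᵐ p ∂(volume.restrict S.cell), f p = 0 := by
  rw [restrict_cell] at hf ⊢
  have h0 : ∫⁻ p, ‖f p‖ₑ ∂((volume.restrict (Ioo 0 (2 * Real.pi))).prod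
      (volume.restrict (Ioo S.a S.b))) = 0 := by
    rw [lintegral_prod_symm _ hf.enorm]
    refine (lintegral_congr_ae (g := fun _ => 0) ?_).trans (by simp)
    filter_upwards [h] with t ht
    refine (lintegral_congr_ae (g := fun _ => 0) ?_).trans (by simp)
    filter_upwards [ht] with φ hφ
    simp [hφ]
  rw [lintegral_eq_zero_iff' hf.enorm] at h0
  filter_upwards [h0] with p hp
  simpa using hp

/-- Continuous functions with values almost everywhere in a closed set have all values there. -/
theorem mem_of_ae_mem {X : Type*} [TopologicalSpace X] [MeasurableSpace X] [BorelSpace X]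
    {μ : Measure X} [μ.IsOpenPosMeasure] {v : X → E3} {U : Set X} (hU : IsOpen U)
    (hv : ContinuousOn v U) {C : Set E3} (hC : IsClosed C) (h : ∀ᵐ t ∂(μ.restrict U), v t ∈ C) :
    ∀ t ∈ U, v t ∈ C := by
  have ho : IsOpen (U ∩ v ⁻¹' Cᶜ) := hv.isOpen_inter_preimage hU hC.isOpen_compl
  rw [ae_restrict_iff' hU.measurableSet] at h
  have hz : μ (U ∩ v ⁻¹' Cᶜ) = 0 := by
    refine measure_mono_null (fun t ht => ?_) h
    exact fun h' => ht.2 (h' ht.1)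
  rw [ho.measure_eq_zero_iff (μ := μ)] at hz
  intro t ht
  by_contra hn
  exact (hz ▸ (⟨ht, hn⟩ : t ∈ U ∩ v ⁻¹' Cᶜ) : t ∈ (∅ : Set X))

/-- The weak identity is tested with products `ρ(φ) χ(t)`; as `χ` is arbitrary, it localizes to
almost every `t`. The exceptional null set depends on `ρ`. -/
theorem IsWeakGradient.ae_circle_parts {m : E3 → E3} {G : ℝ × ℝ → E3 × E3}
    (h : S.IsWeakGradient m G) (hm : AEStronglyMeasurable (S.pull m) (volume.restrict S.cell))
    (hb : ∃ K, ∀ᵐ p ∂(volume.restrict S.cell), ‖S.pull m p‖ ≤ K) {ρ : ℝ → ℝ}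
    (hρ : ContDiff ℝ ∞ ρ) (hper : ∀ φ, ρ (φ + 2 * Real.pi) = ρ φ) :
    ∀ᵐ t ∂(volume.restrict (Ioo S.a S.b)),
      ∫ φ in Ioo 0 (2 * Real.pi), deriv ρ φ • S.pull m (φ, t) =
        - ∫ φ in Ioo 0 (2 * Real.pi), ρ φ • (G (φ, t)).1 := by
  have hd : Continuous (deriv ρ) := hρ.continuous_deriv (by simp)
  have hGm := continuous_fst.comp_aestronglyMeasurable h.meas
  obtain ⟨K, hK⟩ := hb
  have hmi : IntegrableOn (S.pull m) S.cell := Integrable.mono' (integrable_const K) hm hK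
  have i1 : ∀ c d, S.a < c → d < S.b → ∀ χ : ℝ → ℝ, Continuous χ → Integrable
      (fun p : ℝ × ℝ => (deriv ρ p.1 * χ p.2) • S.pull m p + (ρ p.1 * χ p.2) • (G p).1)
      ((volume.restrict (Ioo 0 (2 * Real.pi))).prod (volume.restrict (Ioo c d))) := by
    intro c d hc hd' χ hχ
    rw [← box_restrict]
    exact (integrableOn_box_smul (hmi.mono_set (S.box_subset_cell hc hd')) hd hχ).add
      (integrableOn_box_smul (integrableOn_box_of_sq hGm h.sq_int_fst hc hd') hρ.continuous hχ)
  set H : ℝ → E3 := fun t => ∫ φ in Ioo 0 (2 * Real.pi),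
    (deriv ρ φ • S.pull m (φ, t) + ρ φ • (G (φ, t)).1) with hH
  have hHint : ∀ c d, S.a < c → d < S.b → IntegrableOn H (Ioo c d) := by
    intro c d hc hd'
    have h := (i1 c d hc hd' (fun _ => 1) continuous_const).integral_prod_right
    simp only [mul_one] at h
    exact h
  have hHz : ∀ᵐ t ∂(volume.restrict (Ioo S.a S.b)), H t = 0 := by
    rw [ae_restrict_iff' measurableSet_Ioo]
    refine isOpen_Ioo.ae_eq_zero_of_integral_contDiff_smul_eq_zero ?_ fun χ hχ hχc hχs => ?_
    · intro t ht
      obtain ⟨c, hc1, hc2⟩ := exists_between ht.1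
      obtain ⟨d, hd1, hd2⟩ := exists_between ht.2
      exact ⟨Ioo c d, mem_nhdsWithin_of_mem_nhds (Ioo_mem_nhds hc2 hd1), hHint c d hc1 hd2⟩
    · obtain ⟨c, d, hc, hd', hcd⟩ : ∃ c d, S.a < c ∧ d < S.b ∧ tsupport χ ⊆ Ioo c d := by
        rcases (tsupport χ).eq_empty_or_nonempty with he | hne
        · exact ⟨S.a + 1, S.b - 1, by simp, by simp, by simp [he]⟩
        · obtain ⟨c, h1, h2⟩ := exists_between (hχs (hχc.isCompact.sInf_mem hne)).1
          obtain ⟨d, h3, h4⟩ := exists_between (hχs (hχc.isCompact.sSup_mem hne)).2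
          exact ⟨c, d, h1, h4, fun t ht => ⟨h2.trans_le (csInf_le hχc.isCompact.bddBelow ht),
            (le_csSup hχc.isCompact.bddAbove ht).trans_lt h3⟩⟩
      have hψ := isTest_mul hρ hper (test1_of_tsupport hc hd' hχ hcd)
      have e := h.parts_phi _ hψ
      simp only [(fderiv_mul_apply hρ hχ _).1] at e
      rw [← setIntegral_box hc hd' hcd, ← setIntegral_box hc hd' hcd, eq_neg_iff_add_eq_zero,
        ← integral_add (integrableOn_box_smul (hmi.mono_set (S.box_subset_cell hc hd')) hd
          hχ.continuous) (integrableOn_box_smul (integrableOn_box_of_sq hGm h.sq_int_fst hc hd')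
          hρ.continuous hχ.continuous), box_restrict,
        integral_prod_symm _ (i1 c d hc hd' χ hχ.continuous)] at e
      rw [← setIntegral_eq_integral_of_forall_compl_eq_zero (s := Ioo c d)]
      · refine Eq.trans ?_ e
        congr 1
        funext t
        rw [hH, ← integral_smul]
        congr 1
        funext φ
        rw [smul_add, smul_smul, smul_smul, mul_comm (χ t), mul_comm (χ t)]
      · intro t ht
        have : χ t = 0 := by
          by_contra h
          exact ht (hcd (subset_tsupport χ h))
        rw [this, zero_smul]
  have hsec : ∀ᵐ t ∂(volume.restrict (Ioo S.a S.b)),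
      IntegrableOn (fun φ => S.pull m (φ, t)) (Ioo 0 (2 * Real.pi)) := by
    rw [IntegrableOn, restrict_cell] at hmi
    exact hmi.prod_left_ae
  have hsecG : ∀ᵐ t ∂(volume.restrict (Ioo S.a S.b)),
      IntegrableOn (fun φ => (G (φ, t)).1) (Ioo 0 (2 * Real.pi)) := by
    have h1 := h.sq_int_fst
    rw [restrict_cell] at hGm
    rw [IntegrableOn, restrict_cell] at h1
    filter_upwards [h1.prod_left_ae, hGm.prodMk_right, ae_restrict_mem measurableSet_Ioo]
      with t h2 h3 ht
    have hx := S.x_pos t ht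
    have h4 : IntegrableOn (fun φ => ‖(G (φ, t)).1‖ ^ 2) (Ioo 0 (2 * Real.pi)) := by
      refine (h2.mul_const (S.x t)⁻¹).congr ?_
      filter_upwards with φ
      field_simp
    exact ((memLp_two_iff_integrable_sq_norm h3).2 h4).integrable (by norm_num)
  have hbs : ∀ {f : ℝ → E3} {u : ℝ → ℝ}, IntegrableOn f (Ioo 0 (2 * Real.pi)) → Continuous u →
      IntegrableOn (fun t => u t • f t) (Ioo 0 (2 * Real.pi)) := by
    intro f u hf hu
    obtain ⟨K, hK⟩ := isCompact_Icc.exists_bound_of_continuousOn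
      (hu.continuousOn (s := Icc 0 (2 * Real.pi)))
    refine Integrable.mono' (hf.norm.const_mul K)
      (hu.aestronglyMeasurable.smul hf.aestronglyMeasurable) ?_
    filter_upwards [ae_restrict_mem measurableSet_Ioo] with t ht
    rw [norm_smul]
    exact mul_le_mul_of_nonneg_right (hK t (Ioo_subset_Icc_self ht)) (norm_nonneg _)
  filter_upwards [hHz, hsec, hsecG] with t h1 h2 h3
  rw [eq_neg_iff_add_eq_zero, ← integral_add (hbs h2 hd) (hbs h3 hρ.continuous)]
  exact h1

end SurfaceOfRevolution

/-! ### Wirtinger's inequality for vector fields on the circle -/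

theorem integral_coord {X : Type*} [MeasurableSpace X] {μ : Measure X} {f : X → E3}
    (hf : Integrable f μ) (i : Fin 3) : (∫ x, f x ∂μ) i = ∫ x, f x i ∂μ :=
  ((EuclideanSpace.proj i : E3 →L[ℝ] ℝ).integral_comp_comm hf).symm

/-- The first order Fourier coefficients of a vector field on the circle. -/
def cosCoeff (f : ℝ → E3) : E3 := Real.pi⁻¹ • perp (∫ θ in Ioo 0 (2 * Real.pi), Real.cos θ • f θ)

def sinCoeff (f : ℝ → E3) : E3 := Real.pi⁻¹ • perp (∫ θ in Ioo 0 (2 * Real.pi), Real.sin θ • f θ)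

def vertCoeff (f : ℝ → E3) : E3 := vertL ((2 * Real.pi)⁻¹ • ∫ θ in Ioo 0 (2 * Real.pi), f θ)

theorem integrable_trig_smul {f : ℝ → E3} (hf : IntegrableOn f (Ioo 0 (2 * Real.pi))) {u : ℝ → ℝ}
    (hu : Continuous u) : IntegrableOn (fun t => u t • f t) (Ioo 0 (2 * Real.pi)) := by
  obtain ⟨K, hK⟩ := isCompact_Icc.exists_bound_of_continuousOn
    (hu.continuousOn (s := Icc 0 (2 * Real.pi)))
  refine Integrable.mono' (hf.norm.const_mul K)
    (hu.aestronglyMeasurable.smul hf.aestronglyMeasurable) ?_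
  filter_upwards [ae_restrict_mem measurableSet_Ioo] with t ht
  rw [norm_smul]
  exact mul_le_mul_of_nonneg_right (hK t (Ioo_subset_Icc_self ht)) (norm_nonneg _)

theorem integral_norm_sq_coords {f : ℝ → E3}
    (hf : ∀ i, MemLp (fun φ => f φ i) 2 (volume.restrict (Ioo 0 (2 * Real.pi)))) :
    (∫ φ in Ioo 0 (2 * Real.pi), ‖f φ‖ ^ 2 = (∫ φ in Ioo 0 (2 * Real.pi), f φ 0 ^ 2) +
      (∫ φ in Ioo 0 (2 * Real.pi), f φ 1 ^ 2) + ∫ φ in Ioo 0 (2 * Real.pi), f φ 2 ^ 2) ∧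
    (∫ φ in Ioo 0 (2 * Real.pi), ‖perp (f φ)‖ ^ 2 = (∫ φ in Ioo 0 (2 * Real.pi), f φ 0 ^ 2) +
      (∫ φ in Ioo 0 (2 * Real.pi), f φ 1 ^ 2)) := by
  have i0 : IntegrableOn (fun φ => f φ 0 ^ 2) (Ioo 0 (2 * Real.pi)) := (hf 0).integrable_sq
  have i1 : IntegrableOn (fun φ => f φ 1 ^ 2) (Ioo 0 (2 * Real.pi)) := (hf 1).integrable_sq
  have i2 : IntegrableOn (fun φ => f φ 2 ^ 2) (Ioo 0 (2 * Real.pi)) := (hf 2).integrable_sq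
  have i01 : IntegrableOn (fun φ => f φ 0 ^ 2 + f φ 1 ^ 2) (Ioo 0 (2 * Real.pi)) := i0.add i1
  simp only [norm_sq_eq_coords (f _), norm_perp_sq]
  exact ⟨by rw [integral_add i01 i2, integral_add i0 i1], integral_add i0 i1⟩

/-- Wirtinger's inequality for the horizontal part of a vector field on the circle, with the case
of equality. -/
theorem wirtinger_perp {f g : ℝ → E3}
    (h : ∀ i, CircleWeakDeriv (fun φ => f φ i) (fun φ => g φ i))
    (hfi : IntegrableOn f (Ioo 0 (2 * Real.pi)))
    (h0 : ∫ φ in Ioo 0 (2 * Real.pi), f φ 0 = 0) (h1 : ∫ φ in Ioo 0 (2 * Real.pi), f φ 1 = 0) :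
    (∫ φ in Ioo 0 (2 * Real.pi), ‖perp (f φ)‖ ^ 2 ≤ ∫ φ in Ioo 0 (2 * Real.pi), ‖g φ‖ ^ 2) ∧
    (∫ φ in Ioo 0 (2 * Real.pi), ‖g φ‖ ^ 2 ≤ ∫ φ in Ioo 0 (2 * Real.pi), ‖perp (f φ)‖ ^ 2 →
      ∀ᵐ φ ∂(volume.restrict (Ioo 0 (2 * Real.pi))), f φ =
        Real.cos φ • cosCoeff f + Real.sin φ • sinCoeff f + vertCoeff f) := by
  obtain ⟨e1, -⟩ := integral_norm_sq_coords fun i => (h i).2.1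
  obtain ⟨-, e2⟩ := integral_norm_sq_coords fun i => (h i).1
  have w0 := (h 0).wirtinger h0
  have w1 := (h 1).wirtinger h1
  have p2 : 0 ≤ ∫ φ in Ioo 0 (2 * Real.pi), g φ 2 ^ 2 := integral_nonneg fun _ => sq_nonneg _
  refine ⟨by rw [e1, e2]; linarith, fun hle => ?_⟩
  rw [e1, e2] at hle
  -- The total deficit is the sum of two Wirtinger deficits and of the squared norm of the vertical
  -- derivative. All three are nonnegative, so each of them vanishes.
  filter_upwards [(h 0).eq_first_harmonic h0 (by linarith), (h 1).eq_first_harmonic h1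
    (by linarith),
    (h 2).eq_const (by linarith)] with φ k0 k1 k2
  have c (i : Fin 3) : (∫ θ in Ioo 0 (2 * Real.pi), Real.cos θ • f θ) i =
      ∫ θ in Ioo 0 (2 * Real.pi), Real.cos θ * f θ i :=
    integral_coord (integrable_trig_smul hfi Real.continuous_cos) i
  have s (i : Fin 3) : (∫ θ in Ioo 0 (2 * Real.pi), Real.sin θ • f θ) i =
      ∫ θ in Ioo 0 (2 * Real.pi), Real.sin θ * f θ i :=
    integral_coord (integrable_trig_smul hfi Real.continuous_sin) i
  have v := integral_coord hfi 2
  apply ext_coords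
  · simp [cosCoeff, sinCoeff, vertCoeff, c, s]; rw [k0]; ring
  · simp [cosCoeff, sinCoeff, vertCoeff, c, s]; rw [k1]; ring
  · simp [cosCoeff, sinCoeff, vertCoeff, v]; rw [k2]; ring

namespace SurfaceOfRevolution

variable {S T : SurfaceOfRevolution} {g : ℝ → ℝ} {a : E3 → E3} {ε : ℝ} {m : E3 → E3}
  {G : ℝ × ℝ → E3 × E3}

theorem ae_section_bdd {f : ℝ × ℝ → E3} (hm : AEStronglyMeasurable f (volume.restrict S.cell))
    (hb : ∃ K, ∀ᵐ p ∂(volume.restrict S.cell), ‖f p‖ ≤ K) :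
    ∀ᵐ t ∂(volume.restrict (Ioo S.a S.b)),
      MemLp (fun φ => f (φ, t)) 2 (volume.restrict (Ioo 0 (2 * Real.pi))) := by
  obtain ⟨K, hK⟩ := hb
  rw [restrict_cell] at hm hK
  have hK' := (Measure.measurePreserving_swap (μ := volume.restrict (Ioo S.a S.b))
    (ν := volume.restrict (Ioo 0 (2 * Real.pi)))).quasiMeasurePreserving.ae hK
  filter_upwards [hm.prodMk_right, Measure.ae_ae_of_ae_prod hK'] with t h1 h2
  exact MemLp.of_bound h1 K h2

theorem IsWeakGradient.ae_section_fst (h : S.IsWeakGradient m G) :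
    ∀ᵐ t ∂(volume.restrict (Ioo S.a S.b)),
      MemLp (fun φ => (G (φ, t)).1) 2 (volume.restrict (Ioo 0 (2 * Real.pi))) := by
  have hGm := continuous_fst.comp_aestronglyMeasurable h.meas
  have h1 := h.sq_int_fst
  rw [restrict_cell] at hGm
  rw [IntegrableOn, restrict_cell] at h1
  filter_upwards [h1.prod_left_ae, hGm.prodMk_right, ae_restrict_mem measurableSet_Ioo]
    with t h2 h3 ht
  have hx := S.x_pos t ht
  have h4 : IntegrableOn (fun φ => ‖(G (φ, t)).1‖ ^ 2) (Ioo 0 (2 * Real.pi)) := by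
    refine (h2.mul_const (S.x t)⁻¹).congr ?_
    filter_upwards with φ
    field_simp
  exact (memLp_two_iff_integrable_sq_norm h3).2 h4

theorem memLp_coord {X : Type*} [MeasurableSpace X] {μ : Measure X} {f : X → E3}
    (hf : MemLp f 2 μ) (i : Fin 3) : MemLp (fun φ => f φ i) 2 μ :=
  (EuclideanSpace.proj i : E3 →L[ℝ] ℝ).comp_memLp' hf

/-- The weak derivative on a circle is tested only with the countably many functions `cos (n ·)` and
`sin (n ·)`, so the exceptional null sets can be united. -/
theorem IsWeakGradient.ae_circleWeakDeriv (h : S.IsWeakGradient m G)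
    (hm : AEStronglyMeasurable (S.pull m) (volume.restrict S.cell))
    (hb : ∃ K, ∀ᵐ p ∂(volume.restrict S.cell), ‖S.pull m p‖ ≤ K) :
    ∀ᵐ t ∂(volume.restrict (Ioo S.a S.b)), ∀ i : Fin 3,
      CircleWeakDeriv (fun φ => S.pull m (φ, t) i) (fun φ => (G (φ, t)).1 i) := by
  have hper : ∀ (n : ℤ) (φ : ℝ), Real.cos (n * (φ + 2 * Real.pi)) = Real.cos (n * φ) ∧
      Real.sin (n * (φ + 2 * Real.pi)) = Real.sin (n * φ) := fun n φ => by
    rw [mul_add]; exact ⟨Real.cos_add_int_mul_two_pi _ n, Real.sin_add_int_mul_two_pi _ n⟩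
  have hc : ∀ᵐ t ∂(volume.restrict (Ioo S.a S.b)), ∀ n : ℤ,
      ∫ φ in Ioo 0 (2 * Real.pi), (-(n * Real.sin (n * φ))) • S.pull m (φ, t) =
        - ∫ φ in Ioo 0 (2 * Real.pi), Real.cos (n * φ) • (G (φ, t)).1 := by
    refine ae_all_iff.2 fun n => ?_
    have hd : deriv (fun φ : ℝ => Real.cos (n * φ)) = fun φ => -(n * Real.sin (n * φ)) := by
      funext φ
      have := (((hasDerivAt_id φ).const_mul (n : ℝ)).cos).deriv
      simp only [id, mul_one] at this
      rw [this]; ring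
    have := h.ae_circle_parts hm hb (ρ := fun φ : ℝ => Real.cos (n * φ)) (by fun_prop)
      fun φ => (hper n φ).1
    rw [hd] at this
    exact this
  have hs : ∀ᵐ t ∂(volume.restrict (Ioo S.a S.b)), ∀ n : ℤ,
      ∫ φ in Ioo 0 (2 * Real.pi), (n * Real.cos (n * φ)) • S.pull m (φ, t) =
        - ∫ φ in Ioo 0 (2 * Real.pi), Real.sin (n * φ) • (G (φ, t)).1 := by
    refine ae_all_iff.2 fun n => ?_
    have hd : deriv (fun φ : ℝ => Real.sin (n * φ)) = fun φ => n * Real.cos (n * φ) := by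
      funext φ
      have := (((hasDerivAt_id φ).const_mul (n : ℝ)).sin).deriv
      simp only [id, mul_one] at this
      rw [this]; ring
    have := h.ae_circle_parts hm hb (ρ := fun φ : ℝ => Real.sin (n * φ)) (by fun_prop)
      fun φ => (hper n φ).2
    rw [hd] at this
    exact this
  filter_upwards [hc, hs, ae_section_bdd hm hb, h.ae_section_fst] with t h1 h2 h3 h4 i
  have h3i : IntegrableOn (fun φ => S.pull m (φ, t)) (Ioo 0 (2 * Real.pi)) :=
    h3.integrable (by norm_num)
  have h4i : IntegrableOn (fun φ => (G (φ, t)).1) (Ioo 0 (2 * Real.pi)) :=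
    h4.integrable (by norm_num)
  refine ⟨memLp_coord h3 i, memLp_coord h4 i, fun n => ⟨?_, ?_⟩⟩
  · have e := congrArg (fun v : E3 => v i) (h1 n)
    simp only [PiLp.neg_apply] at e
    rw [integral_coord (integrable_trig_smul h3i (by fun_prop)),
      integral_coord (integrable_trig_smul h4i (by fun_prop))] at e
    simp only [PiLp.smul_apply, smul_eq_mul, neg_mul, integral_neg, neg_inj, mul_assoc,
      integral_const_mul] at e
    exact e.symm
  · have e := congrArg (fun v : E3 => v i) (h2 n)
    simp only [PiLp.neg_apply] at e
    rw [integral_coord (integrable_trig_smul h3i (by fun_prop)),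
      integral_coord (integrable_trig_smul h4i (by fun_prop))] at e
    simp only [PiLp.smul_apply, smul_eq_mul, mul_assoc, integral_const_mul] at e
    rw [neg_mul, e, neg_neg]

theorem NullAverage.integral_coord_eq_zero (h : S.NullAverage m)
    (hm : AEStronglyMeasurable (S.pull m) (volume.restrict S.cell))
    (hb : ∃ K, ∀ᵐ p ∂(volume.restrict S.cell), ‖S.pull m p‖ ≤ K) :
    ∀ᵐ t ∂(volume.restrict (Ioo S.a S.b)), ∫ φ in Ioo 0 (2 * Real.pi), S.pull m (φ, t) 0 = 0 ∧
      ∫ φ in Ioo 0 (2 * Real.pi), S.pull m (φ, t) 1 = 0 := by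
  filter_upwards [h, ae_section_bdd hm hb] with t h1 h3
  have h3i : IntegrableOn (fun φ => S.pull m (φ, t)) (Ioo 0 (2 * Real.pi)) :=
    h3.integrable (by norm_num)
  rw [← integral_coord h3i, ← integral_coord h3i, integral_Ioo_two_pi]
  rw [latitudeAverage] at h1
  have e0 := congrArg (fun v : E3 => v 0) h1
  have e1 := congrArg (fun v : E3 => v 1) h1
  simp only [perp_apply_zero, perp_apply_one, PiLp.smul_apply, smul_eq_mul, PiLp.zero_apply,
    mul_eq_zero, inv_eq_zero, Real.two_pi_pos.ne', false_or] at e0 e1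
  exact ⟨e0, e1⟩

end SurfaceOfRevolution

/-! ### The averaging argument for null-average minimizers -/

namespace SurfaceOfRevolution

variable {S T : SurfaceOfRevolution} {g : ℝ → ℝ} {a : E3 → E3} {ε : ℝ} {m : E3 → E3}
  {G : ℝ × ℝ → E3 × E3}

theorem exists_bound_of_mem (hT : ∀ᵐ p ∂(volume.restrict S.cell), S.pull m p ∈ T.carrier) :
    ∃ K, ∀ᵐ p ∂(volume.restrict S.cell), ‖S.pull m p‖ ≤ K := by
  obtain ⟨M, -, hM⟩ := T.exists_norm_bound
  exact ⟨M, hT.mono fun p hp => hM _ hp⟩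

theorem aesm_norm_perp_sq (hm : AEStronglyMeasurable (S.pull m) (volume.restrict S.cell)) :
    AEStronglyMeasurable (fun p => ‖perp (S.pull m p)‖ ^ 2) (volume.restrict S.cell) :=
  (continuous_perp.comp_aestronglyMeasurable hm).norm.pow 2

/-- Wirtinger's inequality on almost every circle of latitude. -/
theorem IsWeakGradient.ae_wirtinger (h : S.IsWeakGradient m G)
    (hm : AEStronglyMeasurable (S.pull m) (volume.restrict S.cell))
    (hb : ∃ K, ∀ᵐ p ∂(volume.restrict S.cell), ‖S.pull m p‖ ≤ K) (h0 : S.NullAverage m) :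
    ∀ᵐ t ∂(volume.restrict (Ioo S.a S.b)),
      (∫ φ in Ioo 0 (2 * Real.pi), ‖perp (S.pull m (φ, t))‖ ^ 2 ≤
        ∫ φ in Ioo 0 (2 * Real.pi), ‖(G (φ, t)).1‖ ^ 2) ∧
      (∫ φ in Ioo 0 (2 * Real.pi), ‖(G (φ, t)).1‖ ^ 2 ≤
        ∫ φ in Ioo 0 (2 * Real.pi), ‖perp (S.pull m (φ, t))‖ ^ 2 →
        ∀ᵐ φ ∂(volume.restrict (Ioo 0 (2 * Real.pi))), S.pull m (φ, t) =
          Real.cos φ • cosCoeff (fun φ => S.pull m (φ, t)) +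
          Real.sin φ • sinCoeff (fun φ => S.pull m (φ, t)) +
          vertCoeff (fun φ => S.pull m (φ, t))) := by
  filter_upwards [h.ae_circleWeakDeriv hm hb, h0.integral_coord_eq_zero hm hb, ae_section_bdd hm hb]
    with t h1 h2 h3
  exact wirtinger_perp h1 (h3.integrable (by norm_num)) h2.1 h2.2

/-- Here null average controls the horizontal part at the poles: Wirtinger's inequality bounds
`|m_⊥|² / x` by the angular Dirichlet density, although `1 / x` itself need not be integrable.
Without this bound the sections would not generate fields of finite energy. -/
theorem IsWeakGradient.integrable_perp (h : S.IsWeakGradient m G)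
    (hm : AEStronglyMeasurable (S.pull m) (volume.restrict S.cell))
    (hb : ∃ K, ∀ᵐ p ∂(volume.restrict S.cell), ‖S.pull m p‖ ≤ K) (h0 : S.NullAverage m) :
    IntegrableOn (fun p => ‖perp (S.pull m p)‖ ^ 2 * (S.x p.2)⁻¹) S.cell := by
  have hme : AEStronglyMeasurable (fun p => ‖perp (S.pull m p)‖ ^ 2 * (S.x p.2)⁻¹)
      (volume.restrict S.cell) := (aesm_norm_perp_sq hm).mul
        (S.aestronglyMeasurable_cell_snd aesm_inv_x)
  have hG := ((sq_int_iff h.meas).1 h.sq_int).1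
  rw [IntegrableOn, restrict_cell] at hG ⊢
  rw [restrict_cell] at hme
  rw [integrable_prod_iff' hme]
  constructor
  · filter_upwards [ae_section_bdd hm hb] with t ht
    have h1 : MemLp (fun φ => perp (S.pull m (φ, t))) 2 (volume.restrict (Ioo 0 (2 * Real.pi))) :=
      perpL.comp_memLp' ht
    exact ((memLp_two_iff_integrable_sq_norm h1.1).1 h1).mul_const _
  · refine Integrable.mono' hG.integral_prod_right hme.norm.prod_swap.integral_prod_right' ?_
    filter_upwards [h.ae_wirtinger hm hb h0, ae_restrict_mem measurableSet_Ioo] with t h1 ht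
    have hx : 0 ≤ (S.x t)⁻¹ := inv_nonneg.2 (S.x_pos t ht).le
    have e : ∀ φ, ‖‖perp (S.pull m (φ, t))‖ ^ 2 * (S.x t)⁻¹‖ =
        ‖perp (S.pull m (φ, t))‖ ^ 2 * (S.x t)⁻¹ := fun φ =>
      Real.norm_of_nonneg (by positivity)
    simp only [e, integral_mul_const]
    rw [Real.norm_of_nonneg (mul_nonneg (integral_nonneg fun _ => sq_nonneg _) hx)]
    exact mul_le_mul_of_nonneg_right h1.1 hx

/-- The energy density of the equivariant field generated by a meridian section of `m`. -/
def fiberDensity (S : SurfaceOfRevolution) (g : ℝ → ℝ) (a m : E3 → E3) (G : ℝ × ℝ → E3 × E3)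
    (p : ℝ × ℝ) : ℝ :=
  ‖perp (S.pull m p)‖ ^ 2 * (S.h2 p.2 / S.x p.2) + ‖(G p).2‖ ^ 2 * (S.x p.2 / S.h2 p.2) +
    g (inner ℝ (S.pull m p) (S.pull a p)) * S.areaElt p.2

theorem ae_comparison_cell {P : ℝ → Prop} (h : ∀ t ∈ Ioo S.a S.b, P t) :
    ∀ᵐ p ∂(volume.restrict S.cell), P p.2 := S.ae_cell_of_forall fun _ t ht => h t ht

theorem IsWeakGradient.integrable_parts (h : S.IsWeakGradient m G)
    (hm : AEStronglyMeasurable (S.pull m) (volume.restrict S.cell))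
    (hb : ∃ K, ∀ᵐ p ∂(volume.restrict S.cell), ‖S.pull m p‖ ≤ K) (h0 : S.NullAverage m) :
    IntegrableOn (fun p => ‖perp (S.pull m p)‖ ^ 2 * (S.h2 p.2 / S.x p.2)) S.cell ∧
    IntegrableOn (fun p => ‖(G p).1‖ ^ 2 * (S.h2 p.2 / S.x p.2)) S.cell ∧
    IntegrableOn (fun p => ‖(G p).2‖ ^ 2 * (S.x p.2 / S.h2 p.2)) S.cell := by
  obtain ⟨C, hC, hcmp⟩ := S.exists_weight_comparison
  obtain ⟨h1, h2⟩ := (sq_int_iff h.meas).1 h.sq_int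
  have k1 := S.aestronglyMeasurable_cell_snd aesm_h2_div_x
  have k2 := S.aestronglyMeasurable_cell_snd aesm_x_div_h2
  exact ⟨integrableOn_mul_weight (C := C) (h.integrable_perp hm hb h0) (aesm_norm_perp_sq hm) k1
      (fun _ => sq_nonneg _) (ae_comparison_cell fun t ht => (hcmp t ht).1),
    integrableOn_mul_weight (C := C) h1
      ((continuous_fst.comp_aestronglyMeasurable h.meas).norm.pow 2) k1
      (fun _ => sq_nonneg _) (ae_comparison_cell fun t ht => (hcmp t ht).1),
    integrableOn_mul_weight (C := C) h2
      ((continuous_snd.comp_aestronglyMeasurable h.meas).norm.pow 2) k2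
      (fun _ => sq_nonneg _) (ae_comparison_cell fun t ht => (hcmp t ht).2.2.1)⟩

/-- Almost every meridian section of a field is, after a rotation, a profile. -/
theorem IsWeakGradient.ae_profile (h : S.IsWeakGradient m G)
    (hm : AEStronglyMeasurable (S.pull m) (volume.restrict S.cell))
    (hT : ∀ᵐ p ∂(volume.restrict S.cell), S.pull m p ∈ T.carrier) (h0 : S.NullAverage m)
    (hae : S.Equivariant ε a) (g : ℝ → ℝ) :
    ∀ᵐ φ ∂(volume.restrict (Ioo 0 (2 * Real.pi))), ∃ w w' : ℝ → E3, Profile S T w w' ∧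
      IsAC w w' (Ioo S.a S.b) ∧ (S.IsLoop → ∫ t in Ioo S.a S.b, w' t = 0) ∧
      (∀ᵐ t ∂(volume.restrict (Ioo S.a S.b)), S.pull m (φ, t) = rot (ε * φ) (w t)) ∧
      ∫ t in Ioo S.a S.b, S.density g a w w' t =
        ∫ t in Ioo S.a S.b, S.fiberDensity g a m G (φ, t) := by
  have hb := exists_bound_of_mem hT
  have hp := h.integrable_perp hm hb h0
  rw [IntegrableOn, restrict_cell] at hp
  filter_upwards [h.ae_section_isAC hm hb, ae_section_sq
    (continuous_snd.comp_aestronglyMeasurable h.meas) h.sq_int_snd, ae_ae_cell hT, hp.prod_right_ae]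
    with φ ⟨v, hv, hmv, hl⟩ hG hTφ hpφ
  -- The continuous section takes values almost everywhere, hence everywhere, in the closed set `T`.
  have hvT : ∀ t ∈ Ioo S.a S.b, v t ∈ T.carrier := by
    refine mem_of_ae_mem
      (μ := volume) isOpen_Ioo hv.continuousOn_Ioo T.isCompact_carrier.isClosed ?_
    filter_upwards [hmv, hTφ] with t h1 h2
    exact h1 ▸ h2
  obtain ⟨M, -, hM⟩ := T.exists_norm_bound
  have hvW : S.WeakD1 v fun t => (G (φ, t)).2 :=
    weakD1_of_isAC hv ⟨M, fun t ht => hM _ (hvT t ht)⟩ hG.1 hG.2 hl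
  have e : ∀ t, rot (ε * φ) (rotL (-(ε * φ)) (v t)) = v t := fun t => by
    rw [rotL_apply, rot_rot, add_neg_cancel, rot_zero]
  have ew : ∀ u : E3, ‖perp (rotL (-(ε * φ)) u)‖ = ‖perp u‖ := fun u => by
    rw [rotL_apply, perp_rot, norm_rot]
  refine ⟨fun t => rotL (-(ε * φ)) (v t), fun t => rotL (-(ε * φ)) (G (φ, t)).2,
    ⟨hvW.clm _, fun t ht => T.rot_mem _ (hvT t ht), ?_⟩, hv.clm _, fun hL => ?_, ?_, ?_⟩
  · refine hpφ.congr ?_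
    filter_upwards [hmv] with t ht
    rw [ew, ht]
  · rw [ContinuousLinearMap.integral_comp_comm _ (hL.integrableOn_of_sq hG.1 hG.2), hl hL, map_zero]
  · filter_upwards [hmv] with t ht
    rw [e, ht]
  · refine integral_congr_ae ?_
    filter_upwards [hmv, ae_restrict_mem measurableSet_Ioo] with t ht hI
    -- Turning the section back by `ε φ` while moving the point back to angle `0` leaves the
    -- potential unchanged, by equivariance of `a`.
    have h3 : (inner ℝ (rotL (-(ε * φ)) (v t)) (a (S.param 0 t)) : ℝ) =
        inner ℝ (S.pull m (φ, t)) (S.pull a (φ, t)) := by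
      rw [ht, pull, hae.apply_param φ (Ioo_subset_Icc_self hI), rotL_apply, inner_rot_left, neg_neg]
    simp only [density, fiberDensity]
    rw [ew, h3, ht, rotL_apply, norm_rot]

/-- Profiles of least energy. -/
structure MinProfile (S T : SurfaceOfRevolution) (g : ℝ → ℝ) (a : E3 → E3) (w w' : ℝ → E3) : Prop
    extends Profile S T w w' where
  ac : IsAC w w' (Ioo S.a S.b)
  loop : S.IsLoop → ∫ t in Ioo S.a S.b, w' t = 0
  le : ∀ u u', Profile S T u u' →
    ∫ t in Ioo S.a S.b, S.density g a w w' t ≤ ∫ t in Ioo S.a S.b, S.density g a u u' t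

/-- Null-average minimizers contain only first harmonics, and almost all of their meridian sections
generate equivariant minimizers. -/
theorem IsMinimizer.null_average (hmin : S.IsMinimizer T g a m) (h0 : S.NullAverage m)
    (hε : ε = 1 ∨ ε = -1) (hg : Continuous g) (ha : ContinuousOn a S.carrier)
    (hae : S.Equivariant ε a) :
    (∃ A B C : ℝ → E3, ∀ᵐ p ∂(volume.restrict S.cell), S.pull m p =
      Real.cos p.1 • perp (A p.2) + Real.sin p.1 • perp (B p.2) + C p.2 2 • e3) ∧
    ∀ᵐ φ ∂(volume.restrict (Ioo 0 (2 * Real.pi))), ∃ w w' : ℝ → E3, MinProfile S T g a w w' ∧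
      (∀ᵐ t ∂(volume.restrict (Ioo S.a S.b)), S.pull m (φ, t) = rot (ε * φ) (w t)) ∧
      S.energy g a m = 2 * Real.pi * ∫ t in Ioo S.a S.b, S.density g a w w' t := by
  obtain ⟨⟨⟨hm, -, G, h⟩, hT⟩, hle⟩ := hmin
  have hb := exists_bound_of_mem hT
  obtain ⟨i1, i2, i3⟩ := h.integrable_parts hm hb h0
  have i4 := integrableOn_potential hg ha hm hT
  have hpi := Real.two_pi_pos
  have i13 : IntegrableOn (fun p => ‖perp (S.pull m p)‖ ^ 2 * (S.h2 p.2 / S.x p.2) +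
      ‖(G p).2‖ ^ 2 * (S.x p.2 / S.h2 p.2)) S.cell := i1.add i3
  have iD : IntegrableOn (S.fiberDensity g a m G) S.cell := i13.add i4
  have eD : ∫ p in S.cell, S.fiberDensity g a m G p =
      (∫ p in S.cell, ‖perp (S.pull m p)‖ ^ 2 * (S.h2 p.2 / S.x p.2)) +
      (∫ p in S.cell, ‖(G p).2‖ ^ 2 * (S.x p.2 / S.h2 p.2)) +
      ∫ p in S.cell, g (inner ℝ (S.pull m p) (S.pull a p)) * S.areaElt p.2 := by
    rw [← integral_add i1 i3, ← integral_add i13 i4]; rfl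
  have eE : S.energy g a m =
      (∫ p in S.cell, ‖(G p).1‖ ^ 2 * (S.h2 p.2 / S.x p.2)) +
      (∫ p in S.cell, ‖(G p).2‖ ^ 2 * (S.x p.2 / S.h2 p.2)) +
      ∫ p in S.cell, g (inner ℝ (S.pull m p) (S.pull a p)) * S.areaElt p.2 := by
    rw [energy_eq h, ← integral_add i2 i3]
    congr 1
    refine setIntegral_congr_fun S.measurableSet_cell fun p hp => ?_
    exact gradSq_mul_areaElt G hp.2
  have hprof := h.ae_profile hm hT h0 hae g
  -- the energy of the fields generated by the sections
  have hsec : ∀ᵐ φ ∂(volume.restrict (Ioo 0 (2 * Real.pi))),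
      S.energy g a m ≤ 2 * Real.pi * ∫ t in Ioo S.a S.b, S.fiberDensity g a m G (φ, t) := by
    filter_upwards [hprof] with φ ⟨w, w', hw, _, _, _, he⟩
    obtain ⟨m', hm', he'⟩ := hw.exists_field hε hg ha hae
    rw [← he, ← he']
    exact hle m' hm'
  have iDφ : Integrable (fun φ => ∫ t in Ioo S.a S.b, S.fiberDensity g a m G (φ, t))
      (volume.restrict (Ioo 0 (2 * Real.pi))) := by
    have := iD
    rw [IntegrableOn, restrict_cell] at this
    exact this.integral_prod_left
  have eDφ : ∫ φ in Ioo 0 (2 * Real.pi), ∫ t in Ioo S.a S.b, S.fiberDensity g a m G (φ, t) =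
      ∫ p in S.cell, S.fiberDensity g a m G p := (integral_cell iD).symm
  have hconst : ∫ _ in Ioo 0 (2 * Real.pi), S.energy g a m = 2 * Real.pi * S.energy g a m := by
    rw [setIntegral_const, Real.volume_real_Ioo_of_le hpi.le, sub_zero, smul_eq_mul]
  -- Every competitor has at least the energy of `m`, hence so has their average over the angle.
  have hED : S.energy g a m ≤ ∫ p in S.cell, S.fiberDensity g a m G p := by
    have := integral_mono_ae (integrable_const _) (iDφ.const_mul (2 * Real.pi)) hsec
    rw [integral_const_mul, eDφ, hconst] at this
    exact le_of_mul_le_mul_left this hpi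
  -- Wirtinger's inequality
  have iWt : ∀ f : ℝ × ℝ → ℝ, IntegrableOn (fun p => f p * (S.h2 p.2 / S.x p.2)) S.cell →
      Integrable (fun t => (∫ φ in Ioo 0 (2 * Real.pi), f (φ, t)) * (S.h2 t / S.x t))
        (volume.restrict (Ioo S.a S.b)) ∧
      ∫ p in S.cell, f p * (S.h2 p.2 / S.x p.2) =
        ∫ t in Ioo S.a S.b, (∫ φ in Ioo 0 (2 * Real.pi), f (φ, t)) * (S.h2 t / S.x t) := by
    intro f hf
    have e := integral_cell_symm hf
    rw [IntegrableOn, restrict_cell] at hf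
    have := hf.integral_prod_right
    simp only [integral_mul_const] at this e
    exact ⟨this, e⟩
  obtain ⟨j1, f1⟩ := iWt (fun p => ‖perp (S.pull m p)‖ ^ 2) i1
  obtain ⟨j2, f2⟩ := iWt (fun p => ‖(G p).1‖ ^ 2) i2
  have hW := h.ae_wirtinger hm hb h0
  have hnn : 0 ≤ᵐ[volume.restrict (Ioo S.a S.b)] fun t =>
      (∫ φ in Ioo 0 (2 * Real.pi), ‖(G (φ, t)).1‖ ^ 2) * (S.h2 t / S.x t) -
      (∫ φ in Ioo 0 (2 * Real.pi), ‖perp (S.pull m (φ, t))‖ ^ 2) * (S.h2 t / S.x t) := by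
    filter_upwards [hW, ae_restrict_mem measurableSet_Ioo] with t h1 ht
    have : 0 ≤ S.h2 t / S.x t :=
      div_nonneg (S.h2_pos (Ioo_subset_Icc_self ht)).le (S.x_pos t ht).le
    exact sub_nonneg.2 (mul_le_mul_of_nonneg_right h1.1 this)
  have hge := integral_nonneg_of_ae hnn
  have hsub := integral_sub j2 j1
  rw [hsub, ← f1, ← f2] at hge
  -- The energy and the fiber density differ only in the angular term. Wirtinger's inequality orders
  -- them one way and `hED` the other way, so the deficit integrates to zero.
  have heq0 : ∫ t in Ioo S.a S.b,
      ((∫ φ in Ioo 0 (2 * Real.pi), ‖(G (φ, t)).1‖ ^ 2) * (S.h2 t / S.x t) -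
      (∫ φ in Ioo 0 (2 * Real.pi), ‖perp (S.pull m (φ, t))‖ ^ 2) * (S.h2 t / S.x t)) = 0 := by
    rw [hsub, ← f1, ← f2]; linarith
  have hEeq : S.energy g a m = ∫ p in S.cell, S.fiberDensity g a m G p := by linarith
  rw [integral_eq_zero_iff_of_nonneg_ae hnn (j2.sub j1)] at heq0
  constructor
  · refine ⟨fun t => Real.pi⁻¹ • ∫ θ in Ioo 0 (2 * Real.pi), Real.cos θ • S.pull m (θ, t),
      fun t => Real.pi⁻¹ • ∫ θ in Ioo 0 (2 * Real.pi), Real.sin θ • S.pull m (θ, t),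
      fun t => (2 * Real.pi)⁻¹ • ∫ θ in Ioo 0 (2 * Real.pi), S.pull m (θ, t), ?_⟩
    have hm' := hm
    rw [restrict_cell] at hm'
    -- Measurability of the coefficients is needed to pass from almost every circle of latitude to
    -- almost every point of the surface.
    have mc : ∀ u : ℝ → ℝ, Continuous u → AEStronglyMeasurable
        (fun t => ∫ θ in Ioo 0 (2 * Real.pi), u θ • S.pull m (θ, t))
        (volume.restrict (Ioo S.a S.b)) := fun u hu =>
      ((hu.comp continuous_fst).aestronglyMeasurable.smul hm').prod_swap.integral_prod_right'
    have m3 : AEStronglyMeasurable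
        (fun t => ∫ θ in Ioo 0 (2 * Real.pi), S.pull m (θ, t))
        (volume.restrict (Ioo S.a S.b)) := hm'.prod_swap.integral_prod_right'
    have mA := aesm_cos_smul (S := S) Real.continuous_cos (continuous_perp.comp_aestronglyMeasurable
      ((mc Real.cos Real.continuous_cos).const_smul Real.pi⁻¹))
    have mB := aesm_cos_smul (S := S) Real.continuous_sin (continuous_perp.comp_aestronglyMeasurable
      ((mc Real.sin Real.continuous_sin).const_smul Real.pi⁻¹))
    have mC := S.aestronglyMeasurable_cell_snd (vertL.continuous.comp_aestronglyMeasurable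
      (m3.const_smul (2 * Real.pi)⁻¹))
    have key := ae_cell_of_ae_ae (hm.sub ((mA.add mB).add mC)) (by
      filter_upwards [heq0, hW, ae_restrict_mem measurableSet_Ioo] with t h1 h2 ht
      have hpos : 0 < S.h2 t / S.x t :=
        div_pos (S.h2_pos (Ioo_subset_Icc_self ht)) (S.x_pos t ht)
      have h3 := mul_right_cancel₀ hpos.ne' (sub_eq_zero.1 h1)
      filter_upwards [h2.2 h3.le] with φ hφ
      simp only [cosCoeff, sinCoeff, vertCoeff] at hφ
      refine sub_eq_zero.2 (hφ.trans ?_)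
      simp only [← perpL_apply, map_smul, Pi.add_apply, Pi.smul_apply])
    filter_upwards [key] with p hp
    exact sub_eq_zero.1 hp
  -- None of the competitors lies below the minimum and their average equals it, so almost all of
  -- them attain it.
  · have hzero : ∀ᵐ φ ∂(volume.restrict (Ioo 0 (2 * Real.pi))),
        2 * Real.pi * (∫ t in Ioo S.a S.b, S.fiberDensity g a m G (φ, t)) - S.energy g a m = 0 := by
      have hn : 0 ≤ᵐ[volume.restrict (Ioo 0 (2 * Real.pi))] fun φ =>
          2 * Real.pi * (∫ t in Ioo S.a S.b, S.fiberDensity g a m G (φ, t)) - S.energy g a m := by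
        filter_upwards [hsec] with φ hφ using sub_nonneg.2 hφ
      refine (integral_eq_zero_iff_of_nonneg_ae hn
        ((iDφ.const_mul (2 * Real.pi)).sub (integrable_const _))).1 ?_
      rw [integral_sub (iDφ.const_mul (2 * Real.pi)) (integrable_const _), integral_const_mul, eDφ,
        hconst, hEeq, sub_self]
    filter_upwards [hprof, hzero] with φ ⟨w, w', hw, hac, hl, hmw, he⟩ hz
    have hen : S.energy g a m = 2 * Real.pi * ∫ t in Ioo S.a S.b, S.density g a w w' t := by
      rw [he]; linarith
    refine ⟨w, w', ⟨hw, hac, hl, fun u u' hu => ?_⟩, hmw, hen⟩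
    obtain ⟨m', hm', he'⟩ := hu.exists_field hε hg ha hae
    have := hle m' hm'
    rw [hen, he'] at this
    exact le_of_mul_le_mul_left this hpi

end SurfaceOfRevolution

/-! ### Rescaling and joining absolutely continuous functions -/

section AbsolutelyContinuous

variable {F : Type*} [NormedAddCommGroup F] [NormedSpace ℝ F] {v v' w' : ℝ → F} {J K : Set ℝ}

theorem IsAC.comp_affine (hv : IsAC v v' J) (d c : ℝ) (hK : ∀ r ∈ K, d + c * r ∈ J) :
    IsAC (fun r => v (d + c * r)) (fun r => c • v' (d + c * r)) K := by
  rcases eq_or_ne c 0 with rfl | hc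
  · intro s _ t _; simp
  intro s hs t ht
  obtain ⟨h1, h2⟩ := hv (hK s hs) (hK t ht)
  have h3 := (h1.comp_add_left d).comp_mul_left (c := c)
  rw [add_sub_cancel_left, add_sub_cancel_left, mul_div_cancel_left₀ _ hc,
    mul_div_cancel_left₀ _ hc] at h3
  exact ⟨h3.smul c, by
    rw [intervalIntegral.integral_smul, intervalIntegral.smul_integral_comp_add_mul, h2]⟩

theorem IsAC.union (h1 : IsAC v v' J) (h2 : IsAC v v' K) {t0 : ℝ} (hJ : t0 ∈ J) (hK : t0 ∈ K) :
    IsAC v v' (J ∪ K) :=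
  IsAC.of_base (t0 := t0) fun _ ht => ht.elim (fun h => h1 hJ h) fun h => h2 hK h

theorem IsAC.congr_deriv_of_ne (hv : IsAC v v' J) (hJ : J.OrdConnected) {t0 : ℝ}
    (h : ∀ t ∈ J, t ≠ t0 → w' t = v' t) : IsAC v w' J := by
  intro s hs t ht
  obtain ⟨h1, h2⟩ := hv hs ht
  have hsub : uIoc s t ⊆ J := uIoc_subset_uIcc.trans (hJ.uIcc_subset hs ht)
  have hae : ∀ᵐ r : ℝ, r ≠ t0 := by simp [ae_iff, measure_singleton]
  have hae2 : ∀ᵐ r : ℝ, r ∈ uIoc s t → v' r = w' r := by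
    filter_upwards [hae] with r hr hm using (h r (hsub hm) hr).symm
  refine ⟨h1.congr_ae ?_, ?_⟩
  · exact (ae_restrict_iff' measurableSet_uIoc).2 hae2
  · rw [h2]; exact intervalIntegral.integral_congr_ae hae2

theorem isAC_of_contDiffOn [CompleteSpace F] {f : ℝ → F} {a b : ℝ} (hab : a < b)
    (hf : ContDiffOn ℝ 1 f (Icc a b)) : IsAC f (derivWithin f (Icc a b)) (Icc a b) := by
  have hd := hf.continuousOn_derivWithin (uniqueDiffOn_Icc hab) le_rfl
  refine IsAC.of_base (t0 := a) fun t ht => ?_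
  have hi : IntervalIntegrable (derivWithin f (Icc a b)) volume a t :=
    (hd.mono (Icc_subset_Icc_right ht.2)).intervalIntegrable_of_Icc ht.1
  refine ⟨hi, (intervalIntegral.integral_eq_sub_of_hasDerivAt_of_le ht.1
    (hf.continuousOn.mono (Icc_subset_Icc_right ht.2)) (fun s hs => ?_) hi).symm⟩
  have hs' : s ∈ Ioo a b := ⟨hs.1, hs.2.trans_le ht.2⟩
  exact ((hf.differentiableOn one_ne_zero s (Ioo_subset_Icc_self hs')).hasDerivWithinAt).hasDerivAt
    (Icc_mem_nhds hs'.1 hs'.2)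

end AbsolutelyContinuous

/-! ### Geometry near the poles and radial paths in the target -/

namespace SurfaceOfRevolution

variable {S T : SurfaceOfRevolution} {e σ : ℝ}

/-- The derivative of the generating curve. -/
def velocity (S : SurfaceOfRevolution) (t : ℝ) : E3 :=
  !₂[derivWithin S.x (Icc S.a S.b) t, 0, derivWithin S.z (Icc S.a S.b) t]

theorem norm_velocity (t : ℝ) : ‖S.velocity t‖ = S.h2 t := by
  rw [h2, ← Real.sqrt_sq (norm_nonneg (S.velocity t)), norm_sq_eq_coords]
  simp [velocity]

theorem isAC_param_zero : IsAC (S.param 0) S.velocity (Icc S.a S.b) := by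
  rw [isAC_iff_coords]
  intro i
  fin_cases i
  · simpa [velocity] using isAC_of_contDiffOn S.a_lt_b S.x_contDiffOn
  · simpa [velocity] using IsAC.const (0 : ℝ) (Icc S.a S.b)
  · simpa [velocity] using isAC_of_contDiffOn S.a_lt_b S.z_contDiffOn

/-- `e` is the parameter of a pole, and `σ` is the direction from `e` into the interval. -/
def IsPole (S : SurfaceOfRevolution) (e σ : ℝ) : Prop :=
  S.x e = 0 ∧ (e = S.a ∧ σ = 1 ∨ e = S.b ∧ σ = -1)

theorem IsPole.mem (h : S.IsPole e σ) : e ∈ Icc S.a S.b := by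
  have := S.a_lt_b
  rcases h.2 with ⟨rfl, -⟩ | ⟨rfl, -⟩
  · exact left_mem_Icc.2 this.le
  · exact right_mem_Icc.2 this.le

theorem IsPole.abs_eq (h : S.IsPole e σ) {t : ℝ} (ht : t ∈ Icc S.a S.b) :
    |t - e| = σ * (t - e) := by
  rcases h.2 with ⟨rfl, rfl⟩ | ⟨rfl, rfl⟩
  · rw [abs_of_nonneg (sub_nonneg.2 ht.1), one_mul]
  · rw [abs_of_nonpos (sub_nonpos.2 ht.2), neg_one_mul]

theorem IsPole.sign (h : S.IsPole e σ) : σ = 1 ∨ σ = -1 := h.2.imp And.right And.right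

theorem IsPole.not_isLoop (h : S.IsPole e σ) : ¬ S.IsLoop := fun hL => hL.x_ne_zero e h.mem h.1

/-- Asymptotics of the metric coefficients at a pole. -/
theorem IsPole.asymptotics (h : S.IsPole e σ) {θ : ℝ} (hθ : 1 < θ) :
    ∃ k R : ℝ, 0 < k ∧ 0 < R ∧ ∀ t ∈ Icc S.a S.b, |t - e| < R →
      (k * |t - e| ≤ S.x t ∧ S.x t ≤ θ * k * |t - e|) ∧ (k ≤ S.h2 t ∧ S.h2 t ≤ θ * k) := by
  set κ := S.h2 e with hκ
  have hκ0 : 0 < κ := S.h2_pos h.mem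
  -- The curve meets the axis perpendicularly, so at the pole its speed is all in `x`, and `x` grows
  -- like the speed times the distance to `e`.
  have hz : derivWithin S.z (Icc S.a S.b) e = 0 := by
    obtain ⟨hx, ⟨rfl, -⟩ | ⟨rfl, -⟩⟩ := h
    · exact S.perp_left hx
    · exact S.perp_right hx
  have hx' : |derivWithin S.x (Icc S.a S.b) e| = κ := by
    rw [hκ, h2, hz]; simp [Real.sqrt_sq_eq_abs]
  -- Chosen so that `(1 + δ) / (1 - δ) = θ`: a relative error `δ` on either side of the limit
  -- becomes a total ratio `θ`, with lower constant `k = (1 - δ) κ`.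
  set δ := (θ - 1) / (θ + 1) with hδ
  have hδ0 : 0 < δ := div_pos (by linarith) (by linarith)
  have e1 : (1 + δ) * κ = θ * ((1 - δ) * κ) := by rw [hδ]; field_simp; ring
  have hδ1 : 0 < 1 - δ := by
    have : 1 - δ = 2 / (θ + 1) := by rw [hδ]; field_simp; ring
    rw [this]; positivity
  have hd : HasDerivWithinAt S.x (derivWithin S.x (Icc S.a S.b) e) (Icc S.a S.b) e :=
    (S.x_contDiffOn.differentiableOn one_ne_zero e h.mem).hasDerivWithinAt
  have ho := hd.isLittleO.bound (mul_pos hδ0 hκ0)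
  have hc := (S.continuousOn_h2 e h.mem)
  obtain ⟨R1, hR1, hb1⟩ := Metric.mem_nhdsWithin_iff.1 ho
  obtain ⟨R2, hR2, hb2⟩ := Metric.continuousWithinAt_iff.1 hc (δ * κ) (mul_pos hδ0 hκ0)
  refine ⟨(1 - δ) * κ, min R1 R2, mul_pos hδ1 hκ0, lt_min hR1 hR2, fun t ht hr => ?_⟩
  have k1 := hb1 ⟨show t ∈ Metric.ball e R1 by
    rw [Metric.mem_ball, Real.dist_eq]; exact hr.trans_le (min_le_left _ _), ht⟩
  have k2 := hb2 ht (show dist t e < R2 by rw [Real.dist_eq]; exact hr.trans_le (min_le_right _ _))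
  simp only [mem_ofPred_eq, h.1, sub_zero, smul_eq_mul, Real.norm_eq_abs] at k1
  rw [Real.dist_eq, ← hκ, abs_lt] at k2
  have k3 : |(t - e) * derivWithin S.x (Icc S.a S.b) e| = κ * |t - e| := by
    rw [abs_mul, hx', mul_comm]
  have k4 := (abs_abs_sub_abs_le (S.x t) ((t - e) * derivWithin S.x (Icc S.a S.b) e)).trans k1
  rw [k3, abs_of_nonneg (S.x_nonneg ht), abs_le] at k4
  refine ⟨⟨by nlinarith [k4.1], ?_⟩, by nlinarith [k2.1], ?_⟩
  · rw [← e1]; nlinarith [k4.2]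
  · rw [← e1]; nlinarith [k2.2]

theorem perp_param_norm (φ : ℝ) {t : ℝ} (ht : t ∈ Icc S.a S.b) : ‖perp (S.param φ t)‖ = S.x t := by
  rw [← Real.sqrt_sq (norm_nonneg _), norm_perp_sq, param_apply_zero, param_apply_one]
  rw [show (Real.cos φ * S.x t) ^ 2 + (Real.sin φ * S.x t) ^ 2 = S.x t ^ 2 by
    linear_combination (S.x t ^ 2) * Real.cos_sq_add_sin_sq φ]
  exact Real.sqrt_sq (S.x_nonneg ht)

/-- The radial paths in `T` that end near the axis. -/
structure IsRadialPath (T : SurfaceOfRevolution) (θ : ℝ) (q : E3) (c c' : ℝ → E3) : Prop where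
  end_eq : c 1 = q
  mem : ∀ l ∈ Icc (0 : ℝ) 1, c l ∈ T.carrier
  ac : IsAC c c' (Icc 0 1)
  speed : ∀ l ∈ Icc (0 : ℝ) 1, ‖c' l‖ ≤ θ * ‖perp q‖
  perp_le : ∀ l ∈ Icc (0 : ℝ) 1, ‖perp (c l)‖ ≤ θ * l * ‖perp q‖

/-- The path follows the meridian of `T` from the pole to the given point, linearly in the
parameter. Near the pole the surface is almost a flat disc orthogonal to the axis, so speed and
distance from the axis exceed those of a straight radius by at most the factor `θ`. -/
theorem exists_radial_path_of_pole (h : T.IsPole e σ) {θ : ℝ} (hθ : 1 < θ) :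
    ∃ R, 0 < R ∧ ∀ φ, ∀ t ∈ Icc T.a T.b, |t - e| < R →
      ∃ c c', T.IsRadialPath θ (T.param φ t) c c' := by
  obtain ⟨k, R, hk, hR, has⟩ := h.asymptotics hθ
  refine ⟨R, hR, fun φ t ht hr => ?_⟩
  have hmem : ∀ l ∈ Icc (0 : ℝ) 1, e + (t - e) * l ∈ Icc T.a T.b := fun l hl => by
    have := (convex_Icc T.a T.b) h.mem ht (sub_nonneg.2 hl.2) hl.1 (by ring)
    simp only [smul_eq_mul] at this
    convert this using 1; ring
  have habs : ∀ l ∈ Icc (0 : ℝ) 1, |e + (t - e) * l - e| = l * |t - e| := fun l hl => by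
    rw [add_sub_cancel_left, abs_mul, abs_of_nonneg hl.1, mul_comm]
  have hlt : ∀ l ∈ Icc (0 : ℝ) 1, |e + (t - e) * l - e| < R := fun l hl => by
    rw [habs l hl]
    exact (mul_le_of_le_one_left (abs_nonneg _) hl.2).trans_lt hr
  have hk1 := (has t ht hr).1.1
  refine ⟨fun l => rotL φ (T.param 0 (e + (t - e) * l)),
    fun l => rotL φ ((t - e) • T.velocity (e + (t - e) * l)), ?_, fun l hl => ?_, ?_,
    fun l hl => ?_, fun l hl => ?_⟩
  · rw [mul_one, add_sub_cancel, rotL_apply, rot_param, add_zero]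
  · rw [rotL_apply]; exact T.rot_mem φ (T.param_mem 0 (hmem l hl))
  · exact (T.isAC_param_zero.comp_affine e (t - e) hmem).clm (rotL φ)
  · rw [rotL_apply, norm_rot, norm_smul, norm_velocity, perp_param_norm φ ht, Real.norm_eq_abs]
    have := (has _ (hmem l hl) (hlt l hl)).2.2
    nlinarith [mul_le_mul_of_nonneg_left this (abs_nonneg (t - e)),
      mul_le_mul_of_nonneg_left hk1 (zero_le_one.trans hθ.le)]
  · rw [rotL_apply, rot_param, perp_param_norm _ (hmem l hl), perp_param_norm φ ht]
    have := (has _ (hmem l hl) (hlt l hl)).1.2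
    rw [habs l hl] at this
    nlinarith [mul_le_mul_of_nonneg_left hk1 (mul_nonneg (zero_le_one.trans hθ.le) hl.1)]

/-- Away from the poles, the distance from the axis is bounded below. -/
theorem exists_x_lower_away (S : SurfaceOfRevolution) {R1 R2 : ℝ} (hR1 : 0 < R1) (hR2 : 0 < R2) :
    ∃ k, 0 < k ∧ ∀ t ∈ Icc S.a S.b, k ≤ S.x t ∨ S.IsPole S.a 1 ∧ |t - S.a| < R1 ∨
      S.IsPole S.b (-1) ∧ |t - S.b| < R2 := by
  -- A neighbourhood of an endpoint is removed only if that endpoint is on the axis; what remains is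
  -- compact and contains no zero of `x`.
  set K : Set ℝ := Icc S.a S.b ∩
    ({t | S.x S.a = 0 → R1 ≤ |t - S.a|} ∩ {t | S.x S.b = 0 → R2 ≤ |t - S.b|}) with hK
  have hcl : ∀ (P : Prop) (e R : ℝ), IsClosed {t : ℝ | P → R ≤ |t - e|} := fun P e R => by
    by_cases h : P
    · simp only [h, true_imp_iff]
      exact isClosed_le continuous_const (by fun_prop)
    · have : {t : ℝ | P → R ≤ |t - e|} = univ := by ext; simp [h]
      rw [this]; exact isClosed_univ
  have hKc : IsCompact K := isCompact_Icc.inter_right ((hcl _ _ _).inter (hcl _ _ _))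
  have hne : ∀ t ∈ K, S.x t ≠ 0 := by
    intro t ht h0
    rcases eq_or_lt_of_le ht.1.1 with h | h
    · subst h
      have := ht.2.1 h0
      rw [sub_self, abs_zero] at this; linarith
    rcases eq_or_lt_of_le ht.1.2 with h' | h'
    · rw [h'] at h0
      have := ht.2.2 h0
      rw [h', sub_self, abs_zero] at this; linarith
    · exact (S.x_pos t ⟨h, h'⟩).ne' h0
  obtain ⟨k, hk, hkx⟩ := S.exists_x_lower hKc inter_subset_left hne
  refine ⟨k, hk, fun t ht => ?_⟩
  by_contra! hcon
  refine (hkx t ⟨ht, fun h => hcon.2.1 ⟨h, Or.inl ⟨rfl, rfl⟩⟩,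
    fun h => hcon.2.2 ⟨h, Or.inr ⟨rfl, rfl⟩⟩⟩).not_gt hcon.1

/-- Points of `T` close enough to the axis are close to a pole. If `T` has no poles, the claim is
vacuous for small `ρ`. -/
theorem exists_radial_path (T : SurfaceOfRevolution) {θ : ℝ} (hθ : 1 < θ) :
    ∃ ρ, 0 < ρ ∧ ∀ q ∈ T.carrier, ‖perp q‖ < ρ → ∃ c c', T.IsRadialPath θ q c c' := by
  have hex : ∀ e σ : ℝ, ∃ R, 0 < R ∧ (T.IsPole e σ → ∀ φ, ∀ t ∈ Icc T.a T.b, |t - e| < R →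
      ∃ c c', T.IsRadialPath θ (T.param φ t) c c') := fun e σ => by
    by_cases h : T.IsPole e σ
    · obtain ⟨R, hR, hp⟩ := exists_radial_path_of_pole h hθ
      exact ⟨R, hR, fun _ => hp⟩
    · exact ⟨1, one_pos, fun h' => (h h').elim⟩
  obtain ⟨R1, hR1, hp1⟩ := hex T.a 1
  obtain ⟨R2, hR2, hp2⟩ := hex T.b (-1)
  obtain ⟨k, hk, hkx⟩ := T.exists_x_lower_away hR1 hR2
  refine ⟨k, hk, ?_⟩
  rintro q ⟨φ, t, ht, rfl⟩ hq
  rw [perp_param_norm φ ht] at hq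
  rcases hkx t ht with h | ⟨h, hr⟩ | ⟨h, hr⟩
  · exact (h.not_gt hq).elim
  · exact hp1 h φ t ht hr
  · exact hp2 h φ t ht hr

end SurfaceOfRevolution

/-! ### Energy estimates at a pole -/

theorem isAC_inv (R : ℝ) : IsAC (fun r : ℝ => r⁻¹) (fun r => -(r ^ 2)⁻¹) (Ioo 0 R) :=
  isAC_of_hasDerivAt ordConnected_Ioo (fun _ hr => hasDerivAt_inv hr.1.ne')
    ((continuousOn_id.pow 2).inv₀ fun _ hr => (pow_pos hr.1 2).ne').neg

theorem isAC_primitive {k : ℝ → ℝ} {R : ℝ} (hk : IntegrableOn k (Ioo 0 R)) :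
    IsAC (fun r => ∫ s in (0 : ℝ)..r, k s) k (Ioo 0 R) := by
  have hi : ∀ r ∈ Ioo 0 R, IntervalIntegrable k volume 0 r := fun r hr => by
    rw [intervalIntegrable_iff_integrableOn_Ioo_of_le hr.1.le]
    exact hk.mono_set (Ioo_subset_Ioo_right hr.2.le)
  intro s hs t ht
  exact ⟨(hi s hs).symm.trans (hi t ht),
    intervalIntegral.integral_interval_sub_left (hi t ht) (hi s hs)⟩

theorem not_integrableOn_inv {r : ℝ} (hr : 0 < r) :
    ¬ IntegrableOn (fun s : ℝ => s⁻¹) (Ioo 0 r) := by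
  rw [← intervalIntegrable_iff_integrableOn_Ioo_of_le hr.le, intervalIntegrable_inv_iff]
  simp [hr.le, hr.ne]

/-- The density of the Dirichlet energy at a pole. -/
def poleDensity (f f' : ℝ → E3) (s : ℝ) : ℝ := ‖perp (f s)‖ ^ 2 * s⁻¹ + ‖f' s‖ ^ 2 * s

section PoleEstimates

variable {f f' : ℝ → E3} {R : ℝ}

theorem poleDensity_nonneg {s : ℝ} (hs : 0 ≤ s) : 0 ≤ poleDensity f f' s := by
  unfold poleDensity; positivity

theorem two_inner_perp_le (u v : E3) {c : ℝ} (hc : 0 < c) :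
    2 * inner ℝ (perp u) (perp v) ≤ c * ‖perp u‖ ^ 2 + c⁻¹ * ‖v‖ ^ 2 := by
  have h1 := real_inner_le_norm (perp u) (perp v)
  have h2 := norm_perp_le v
  have h3 : inner ℝ (perp u) (perp v) ≤ ‖perp u‖ * ‖v‖ :=
    h1.trans (mul_le_mul_of_nonneg_left h2 (norm_nonneg _))
  have h4 : 0 ≤ c⁻¹ * (c * ‖perp u‖ - ‖v‖) ^ 2 := by positivity
  have h5 : c⁻¹ * (c * ‖perp u‖ - ‖v‖) ^ 2 =
      c * ‖perp u‖ ^ 2 + c⁻¹ * ‖v‖ ^ 2 - 2 * (‖perp u‖ * ‖v‖) := by field_simp; ring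
  linarith

theorem isAC_norm_sq_perp (hf : IsAC f f' (Ioo 0 R)) :
    IsAC (fun r => ‖perp (f r)‖ ^ 2) (fun r => 2 * inner ℝ (perp (f r)) (perp (f' r))) (Ioo 0 R) :=
  (hf.clm perpL).norm_sq ordConnected_Ioo

/-- A field of finite Dirichlet energy is vertical at a pole. -/
theorem norm_sq_perp_le_integral (hf : IsAC f f' (Ioo 0 R))
    (hk : IntegrableOn (poleDensity f f') (Ioo 0 R)) {r : ℝ} (hr : r ∈ Ioo 0 R) :
    ‖perp (f r)‖ ^ 2 ≤ ∫ s in Ioo 0 r, poleDensity f f' s := by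
  have hkr : IntegrableOn (poleDensity f f') (Ioo 0 r) :=
    hk.mono_set (Ioo_subset_Ioo_right hr.2.le)
  -- By Young's inequality with constant `1 / t`, the derivative of the squared horizontal length at
  -- `t` is at most the pole density.
  have hle : ∀ s ∈ Ioo 0 r, ‖perp (f r)‖ ^ 2 ≤ ‖perp (f s)‖ ^ 2 +
      ∫ s in Ioo 0 r, poleDensity f f' s := by
    intro s hs
    obtain ⟨h1, h2⟩ := isAC_norm_sq_perp hf (show s ∈ Ioo 0 R from ⟨hs.1, hs.2.trans hr.2⟩) hr
    have hki : IntervalIntegrable (poleDensity f f') volume s r := by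
      rw [intervalIntegrable_iff_integrableOn_Ioo_of_le hs.2.le]
      exact hkr.mono_set (Ioo_subset_Ioo_left hs.1.le)
    have h3 := intervalIntegral.integral_mono_on hs.2.le h1 hki fun t ht => by
      have ht0 : 0 < t := hs.1.trans_le ht.1
      have := two_inner_perp_le (f t) (f' t) (inv_pos.2 ht0)
      rw [inv_inv] at this
      rw [poleDensity]; linarith
    have h4 : ∫ t in s..r, poleDensity f f' t ≤ ∫ s in Ioo 0 r, poleDensity f f' s := by
      rw [intervalIntegral.integral_of_le hs.2.le, integral_Ioc_eq_integral_Ioo]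
      refine setIntegral_mono_set hkr ?_ (Ioo_subset_Ioo_left hs.1.le).eventuallyLE
      filter_upwards [ae_restrict_mem measurableSet_Ioo] with t ht using poleDensity_nonneg ht.1.le
    linarith
  by_contra hlt
  push Not at hlt
  -- If the claim failed, the squared horizontal length would be at least `η > 0` all the way to the
  -- pole, and `η / s` would be integrable.
  set η := ‖perp (f r)‖ ^ 2 - ∫ s in Ioo 0 r, poleDensity f f' s with hη
  have hη0 : 0 < η := sub_pos.2 hlt
  refine not_integrableOn_inv hr.1 (Integrable.mono' (hkr.const_mul η⁻¹)
    (measurable_inv.aestronglyMeasurable) ?_)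
  filter_upwards [ae_restrict_mem measurableSet_Ioo] with s hs
  have h5 := hle s hs
  have hs0 : 0 < s⁻¹ := inv_pos.2 hs.1
  rw [Real.norm_of_nonneg hs0.le]
  have h6 : η * s⁻¹ ≤ poleDensity f f' s := by
    have h7 : 0 ≤ ‖f' s‖ ^ 2 * s := mul_nonneg (sq_nonneg _) hs.1.le
    have h8 : η * s⁻¹ ≤ ‖perp (f s)‖ ^ 2 * s⁻¹ :=
      mul_le_mul_of_nonneg_right (by linarith) hs0.le
    rw [poleDensity]; linarith
  calc s⁻¹ = η⁻¹ * (η * s⁻¹) := by field_simp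
    _ ≤ η⁻¹ * poleDensity f f' s := mul_le_mul_of_nonneg_left h6 (inv_nonneg.2 hη0.le)

/-- If the energy near a pole is almost controlled by the boundary values, then the derivative is
square integrable up to the pole. -/
theorem integrableOn_deriv_sq_of_le (hf : IsAC f f' (Ioo 0 R))
    (hk : IntegrableOn (poleDensity f f') (Ioo 0 R)) {C : ℝ} (hC : 0 ≤ C)
    (hle : ∀ r ∈ Ioo 0 R, ∫ s in Ioo 0 r, poleDensity f f' s ≤
      9 / 8 * ‖perp (f r)‖ ^ 2 + C * r ^ 2) {R' : ℝ} (hR' : R' ∈ Ioo 0 R) :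
    IntegrableOn (fun r => ‖f' r‖ ^ 2) (Ioc 0 R') := by
  have hF := isAC_primitive hk
  have hFI : ∀ r ∈ Ioo 0 R, ∫ s in (0 : ℝ)..r, poleDensity f f' s =
      ∫ s in Ioo 0 r, poleDensity f f' s := fun r hr => by
    rw [intervalIntegral.integral_of_le hr.1.le, integral_Ioc_eq_integral_Ioo]
  have hWle : ∀ r ∈ Ioo 0 R, ‖perp (f r)‖ ^ 2 ≤ ∫ s in (0 : ℝ)..r, poleDensity f f' s :=
    fun r hr => by rw [hFI r hr]; exact norm_sq_perp_le_integral hf hk hr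
  have hFle : ∀ r ∈ Ioo 0 R, ∫ s in (0 : ℝ)..r, poleDensity f f' s ≤
      9 / 8 * ‖perp (f r)‖ ^ 2 + C * r ^ 2 := fun r hr => by rw [hFI r hr]; exact hle r hr
  have hW := isAC_norm_sq_perp hf
  have hd1 := hF.mul ordConnected_Ioo (isAC_inv R)
  have hd2 := hW.mul ordConnected_Ioo (isAC_inv R)
  set F : ℝ → ℝ := fun r => ∫ s in (0 : ℝ)..r, poleDensity f f' s with hFdef
  have hint : ∀ ρ ∈ Ioo 0 R', IntervalIntegrable (fun r => ‖f' r‖ ^ 2) volume ρ R' ∧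
      IntervalIntegrable (fun r => ‖perp (f r)‖ ^ 2 * (r ^ 2)⁻¹) volume ρ R' := by
    intro ρ hρ
    have hsub : uIcc ρ R' ⊆ Ioo 0 R := by
      rw [uIcc_of_le hρ.2.le]
      exact fun s hs => ⟨hρ.1.trans_le hs.1, hs.2.trans_lt hR'.2⟩
    have i1 : IntervalIntegrable (fun r => ‖perp (f r)‖ ^ 2 * (r ^ 2)⁻¹) volume ρ R' := by
      refine ContinuousOn.intervalIntegrable ?_
      refine (hW.continuousOn_Ioo.mono hsub).mul
        ((continuousOn_id.pow 2).inv₀ fun r hr => (pow_pos (hsub hr).1 2).ne')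
    have i2 : IntervalIntegrable (fun r => poleDensity f f' r * r⁻¹) volume ρ R' :=
      (hF ⟨hρ.1, hρ.2.trans hR'.2⟩ hR').1.mul_continuousOn
        (continuousOn_id.inv₀ fun r hr => (hsub hr).1.ne')
    refine ⟨(i2.sub i1).congr fun r hr => ?_, i1⟩
    have hr0 : 0 < r := (hsub (uIoc_subset_uIcc hr)).1
    simp only [poleDensity]
    field_simp; ring
  set C' := F R' * R'⁻¹ + C * R' with hC'
  -- Let `W = ‖perp f‖²`, and let `U` and `V` be the integrals of `‖f'‖²` and `W / r²` over `(ρ,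
  -- R')`. As `F ≤ 9/8 W + C r²`, the derivative of `F / r` is at least `‖f'‖² - W / (8 r²) - C`. By
  -- Young's inequality the derivative of `W / r` is at most `2 ‖f'‖² - W / (2 r²)`, so `V / 8 ≤ U /
  -- 2 + W(ρ) / (4 ρ)`. The last term is absorbed by `F(ρ) / ρ` because `W ≤ F`, and there remains
  -- `U ≤ U / 2 + C'`. The absorption works since the excess `1/8` is below `1/4`.
  have hbound : ∀ ρ ∈ Ioo 0 R', ∫ r in ρ..R', ‖f' r‖ ^ 2 ≤ 2 * C' := by
    intro ρ hρ
    have hρR : ρ ∈ Ioo 0 R := ⟨hρ.1, hρ.2.trans hR'.2⟩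
    obtain ⟨iU, iX⟩ := hint ρ hρ
    obtain ⟨j1, e1⟩ := hd1 hρR hR'
    obtain ⟨j2, e2⟩ := hd2 hρR hR'
    have m1 : ∫ r in ρ..R', (‖f' r‖ ^ 2 - 1 / 8 * (‖perp (f r)‖ ^ 2 * (r ^ 2)⁻¹) - C) ≤
        F R' * R'⁻¹ - F ρ * ρ⁻¹ := by
      rw [e1]
      refine intervalIntegral.integral_mono_on hρ.2.le
        ((iU.sub (iX.const_mul _)).sub intervalIntegrable_const) j1 fun r hr => ?_
      have hrR : r ∈ Ioo 0 R := ⟨hρ.1.trans_le hr.1, hr.2.trans_lt hR'.2⟩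
      have hr0 := hrR.1
      have h1 : F r * (r ^ 2)⁻¹ ≤ (9 / 8 * ‖perp (f r)‖ ^ 2 + C * r ^ 2) * (r ^ 2)⁻¹ :=
        mul_le_mul_of_nonneg_right (hFle r hrR) (by positivity)
      have h2 : (9 / 8 * ‖perp (f r)‖ ^ 2 + C * r ^ 2) * (r ^ 2)⁻¹ =
          9 / 8 * (‖perp (f r)‖ ^ 2 * (r ^ 2)⁻¹) + C := by field_simp
      have h3 : poleDensity f f' r * r⁻¹ = ‖perp (f r)‖ ^ 2 * (r ^ 2)⁻¹ + ‖f' r‖ ^ 2 := by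
        rw [poleDensity]; field_simp
      rw [h3, mul_neg]; linarith
    have m2 : ‖perp (f R')‖ ^ 2 * R'⁻¹ - ‖perp (f ρ)‖ ^ 2 * ρ⁻¹ ≤
        ∫ r in ρ..R', (2 * ‖f' r‖ ^ 2 - 1 / 2 * (‖perp (f r)‖ ^ 2 * (r ^ 2)⁻¹)) := by
      rw [e2]
      refine intervalIntegral.integral_mono_on hρ.2.le j2
        ((iU.const_mul _).sub (iX.const_mul _)) fun r hr => ?_
      have hr0 : 0 < r := hρ.1.trans_le hr.1
      have h1 := mul_le_mul_of_nonneg_right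
        (two_inner_perp_le (f r) (f' r) (c := 1 / 2 * r⁻¹) (by positivity)) (inv_pos.2 hr0).le
      have h2 : (1 / 2 * r⁻¹ * ‖perp (f r)‖ ^ 2 + (1 / 2 * r⁻¹)⁻¹ * ‖f' r‖ ^ 2) * r⁻¹ =
          1 / 2 * (‖perp (f r)‖ ^ 2 * (r ^ 2)⁻¹) + 2 * ‖f' r‖ ^ 2 := by field_simp
      linarith
    rw [intervalIntegral.integral_sub (iU.sub (iX.const_mul _)) intervalIntegrable_const,
      intervalIntegral.integral_sub iU (iX.const_mul _), intervalIntegral.integral_const_mul,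
      intervalIntegral.integral_const, smul_eq_mul] at m1
    rw [intervalIntegral.integral_sub (iU.const_mul _) (iX.const_mul _),
      intervalIntegral.integral_const_mul, intervalIntegral.integral_const_mul] at m2
    have p1 : 0 ≤ ‖perp (f R')‖ ^ 2 * R'⁻¹ := mul_nonneg (sq_nonneg _) (inv_nonneg.2 hR'.1.le)
    have p2 : ‖perp (f ρ)‖ ^ 2 * ρ⁻¹ ≤ F ρ * ρ⁻¹ :=
      mul_le_mul_of_nonneg_right (hWle ρ hρR) (inv_nonneg.2 hρ.1.le)
    have p3 : 0 ≤ ‖perp (f ρ)‖ ^ 2 * ρ⁻¹ := mul_nonneg (sq_nonneg _) (inv_nonneg.2 hρ.1.le)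
    have p4 : (R' - ρ) * C ≤ C * R' := by nlinarith [hρ.1]
    linarith
  -- With `n + 2` all cut-off points lie strictly between `0` and `R'`.
  have hseq : Filter.Tendsto (fun n : ℕ => R' / (n + 2)) Filter.atTop (nhds 0) :=
    (Filter.tendsto_atTop_add_const_right _ 2 tendsto_natCast_atTop_atTop).const_div_atTop R'
  have hmem : ∀ n : ℕ, R' / ((n : ℝ) + 2) ∈ Ioo 0 R' := fun n => by
    have hn : (0 : ℝ) ≤ n := n.cast_nonneg
    refine ⟨div_pos hR'.1 (by linarith), ?_⟩
    rw [div_lt_iff₀ (by linarith)]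
    nlinarith [hR'.1]
  refine integrableOn_Ioc_of_intervalIntegral_norm_bounded_left (I := 2 * C') (fun n => ?_) hseq
    (Filter.Eventually.of_forall fun n => ?_)
  · exact (intervalIntegrable_iff_integrableOn_Ioc_of_le (hmem n).2.le).1 (hint _ (hmem n)).1
  · have := hbound _ (hmem n)
    rw [intervalIntegral.integral_of_le (hmem n).2.le] at this
    simpa using this

end PoleEstimates

theorem IsAC.aestronglyMeasurable_deriv {F : Type*} [NormedAddCommGroup F] [NormedSpace ℝ F]
    {v v' : ℝ → F} {a b : ℝ} (hv : IsAC v v' (Ioo a b)) :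
    AEStronglyMeasurable v' (volume.restrict (Ioo a b)) := by
  refine LocallyIntegrableOn.aestronglyMeasurable fun t ht => ?_
  obtain ⟨c, hc1, hc2⟩ := exists_between ht.1
  obtain ⟨d, hd1, hd2⟩ := exists_between ht.2
  refine ⟨Ioc c d, mem_nhdsWithin_of_mem_nhds (Ioc_mem_nhds hc2 hd1), ?_⟩
  exact (hv ⟨hc1, (hc2.trans hd1).trans hd2⟩ ⟨hc1.trans (hc2.trans hd1), hd2⟩).1.1

/-! ### Comparison in collars of a pole -/

section Collar

variable {e σ : ℝ}

/-- The points at distance at most `r` from `e` on the side given by the sign `σ`. -/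
def collar (e σ r : ℝ) : Set ℝ := {t | σ * (t - e) ∈ Ioc 0 r}

theorem sign_mul_sign (hσ : σ = 1 ∨ σ = -1) (s : ℝ) : σ * (e + σ * s - e) = s := by
  rcases hσ with rfl | rfl <;> ring

theorem collar_preimage (hσ : σ = 1 ∨ σ = -1) (r : ℝ) :
    (fun s => e + σ * s) ⁻¹' collar e σ r = Ioc 0 r := by
  ext s
  simp only [collar, mem_preimage, mem_ofPred_eq, sign_mul_sign hσ]

theorem measurableSet_collar (r : ℝ) : MeasurableSet (collar e σ r) :=
  measurableSet_Ioc.preimage (by fun_prop : Measurable fun t => σ * (t - e))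

theorem measurePreserving_sign (hσ : σ = 1 ∨ σ = -1) :
    MeasurePreserving (fun s : ℝ => e + σ * s) volume volume := by
  rcases hσ with rfl | rfl
  · simpa using measurePreserving_add_left volume e
  · simpa [Function.comp_def] using (measurePreserving_add_left volume e).comp
      (Measure.measurePreserving_neg volume)

theorem measurableEmbedding_sign (hσ : σ = 1 ∨ σ = -1) :
    MeasurableEmbedding (fun s : ℝ => e + σ * s) := by
  have h0 : σ ≠ 0 := by rcases hσ with rfl | rfl <;> norm_num
  exact ((Homeomorph.mulLeft₀ σ h0).trans (Homeomorph.addLeft e)).measurableEmbedding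

theorem setIntegral_collar (hσ : σ = 1 ∨ σ = -1) (r : ℝ) (h : ℝ → ℝ) :
    ∫ t in collar e σ r, h t = ∫ s in Ioc 0 r, h (e + σ * s) := by
  rw [← collar_preimage hσ r]
  exact ((measurePreserving_sign hσ).setIntegral_preimage_emb
    (measurableEmbedding_sign hσ) h _).symm

theorem integrableOn_collar (hσ : σ = 1 ∨ σ = -1) (r : ℝ) (h : ℝ → ℝ) :
    IntegrableOn h (collar e σ r) ↔ IntegrableOn (fun s => h (e + σ * s)) (Ioc 0 r) := by
  rw [← collar_preimage hσ r]
  exact ((measurePreserving_sign hσ).integrableOn_comp_preimage (measurableEmbedding_sign hσ)).symm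

end Collar

namespace SurfaceOfRevolution

variable {S T : SurfaceOfRevolution} {e σ : ℝ} {g : ℝ → ℝ} {a : E3 → E3} {w w' : ℝ → E3}

theorem IsPole.collar_subset (h : S.IsPole e σ) {r : ℝ} (hr : r < S.b - S.a) :
    collar e σ r ⊆ Ioo S.a S.b := by
  rintro t ⟨h1, h2⟩
  rcases h.2 with ⟨rfl, rfl⟩ | ⟨rfl, rfl⟩ <;> constructor <;> linarith

/-- Comparison of the weights with their limits at a pole. -/
theorem IsPole.weights (h : S.IsPole e σ) {θ : ℝ} (hθ : 1 < θ) :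
    ∃ k R : ℝ, 0 < k ∧ 0 < R ∧ R ≤ S.b - S.a ∧ ∀ t, ∀ r < R, t ∈ collar e σ r →
      k * (σ * (t - e)) ≤ S.x t ∧
      (S.h2 t / S.x t ≤ θ * (σ * (t - e))⁻¹ ∧ (σ * (t - e))⁻¹ ≤ θ * (S.h2 t / S.x t)) ∧
      (S.x t / S.h2 t ≤ θ * (σ * (t - e)) ∧ σ * (t - e) ≤ θ * (S.x t / S.h2 t)) ∧
      S.areaElt t ≤ (θ * k) ^ 2 * (σ * (t - e)) := by
  obtain ⟨k, R, hk, hR, has⟩ := h.asymptotics hθ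
  refine ⟨k, min R (S.b - S.a), hk, lt_min hR (sub_pos.2 S.a_lt_b), min_le_right _ _,
    fun t r hr ht => ?_⟩
  have htI := h.collar_subset (hr.trans_le (min_le_right _ _)) ht
  have htc := Ioo_subset_Icc_self htI
  obtain ⟨⟨h1, h2⟩, h3, h4⟩ := has t htc (by
    rw [h.abs_eq htc]; exact ht.2.trans_lt (hr.trans_le (min_le_left _ _)))
  rw [h.abs_eq htc] at h1 h2
  have hs : 0 < σ * (t - e) := ht.1
  set s := σ * (t - e)
  have hx := S.x_pos t htI
  have hh := S.h2_pos htc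
  have hθ0 : 0 < θ := zero_lt_one.trans hθ
  refine ⟨h1, ⟨?_, ?_⟩, ⟨?_, ?_⟩, ?_⟩
  · rw [← div_eq_mul_inv, div_le_div_iff₀ hx hs]
    nlinarith [mul_le_mul_of_nonneg_left h1 hθ0.le, mul_le_mul_of_nonneg_right h4 hs.le]
  · rw [← mul_div_assoc, inv_eq_one_div, div_le_div_iff₀ hs hx]
    nlinarith [mul_le_mul_of_nonneg_left h3 (mul_nonneg hθ0.le hs.le)]
  · rw [div_le_iff₀ hh]
    nlinarith [mul_le_mul_of_nonneg_left h3 (mul_nonneg hθ0.le hs.le)]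
  · rw [← mul_div_assoc, le_div_iff₀ hh]
    nlinarith [mul_le_mul_of_nonneg_left h1 hθ0.le, mul_le_mul_of_nonneg_right h4 hs.le]
  · rw [areaElt, h1_eq S htc]
    calc S.x t * S.h2 t ≤ (θ * k * s) * (θ * k) := by gcongr
      _ = (θ * k) ^ 2 * s := by ring

/-- The nonnegativity of `g` enters here: the Dirichlet energy in a collar is bounded by the full
energy there. -/
theorem density_ge (hg0 : ∀ s, 0 ≤ g s) (t : ℝ) :
    ‖perp (w t)‖ ^ 2 * (S.h2 t / S.x t) + ‖w' t‖ ^ 2 * (S.x t / S.h2 t) ≤ S.density g a w w' t :=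
  le_add_of_nonneg_right (mul_nonneg (hg0 _) (S.areaElt_nonneg t))

section Competitor

variable {c c' : ℝ → E3} {r θ : ℝ} {q : E3}

/-- The affine rescaling of the collar. -/
def rescale (e σ r t : ℝ) : ℝ := -(σ * e / r) + σ / r * t

theorem rescale_eq (e σ r t : ℝ) : rescale e σ r t = σ * (t - e) / r := by rw [rescale]; ring

open Classical in
/-- A profile modified in a collar of a pole. -/
def glue (e σ r : ℝ) (c w : ℝ → E3) (t : ℝ) : E3 :=
  if σ * (t - e) ≤ r then c (rescale e σ r t) else w t

open Classical in
def glueDeriv (e σ r : ℝ) (c' w' : ℝ → E3) (t : ℝ) : E3 :=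
  if σ * (t - e) ≤ r then (σ / r) • c' (rescale e σ r t) else w' t

theorem IsPole.pos (h : S.IsPole e σ) {t : ℝ} (ht : t ∈ Ioo S.a S.b) : 0 < σ * (t - e) := by
  rcases h.2 with ⟨rfl, rfl⟩ | ⟨rfl, rfl⟩
  · linarith [ht.1]
  · linarith [ht.2]

/-- The rescaled path ends at the value of `w` at the edge of the collar, so the two pieces join
continuously. -/
theorem isAC_glue (h : S.IsPole e σ) (hr : 0 < r) (hrb : r < S.b - S.a)
    (hw : IsAC w w' (Ioo S.a S.b)) (hc : T.IsRadialPath θ (w (e + σ * r)) c c') :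
    IsAC (glue e σ r c w) (glueDeriv e σ r c' w') (Ioo S.a S.b) := by
  have hσ := h.sign
  have ht0 : e + σ * r ∈ Ioo S.a S.b := h.collar_subset hrb (by
    simp only [collar, mem_ofPred_eq, sign_mul_sign hσ]; exact ⟨hr, le_rfl⟩)
  have hl0 : σ * (e + σ * r - e) = r := sign_mul_sign hσ r
  set J1 := {t | t ∈ Ioo S.a S.b ∧ σ * (t - e) ≤ r}
  set J2 := {t | t ∈ Ioo S.a S.b ∧ r ≤ σ * (t - e)}
  have hU : Ioo S.a S.b = J1 ∪ J2 := by
    ext t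
    constructor
    · intro ht
      rcases le_total (σ * (t - e)) r with h' | h'
      exacts [Or.inl ⟨ht, h'⟩, Or.inr ⟨ht, h'⟩]
    · rintro (ht | ht) <;> exact ht.1
  have hO1 : J1.OrdConnected := ⟨fun x hx y hy z hz =>
    ⟨⟨hx.1.1.trans_le hz.1, hz.2.trans_lt hy.1.2⟩, by
      have := hx.2; have := hy.2; rcases hσ with rfl | rfl <;> linarith [hz.1, hz.2]⟩⟩
  have hO2 : J2.OrdConnected := ⟨fun x hx y hy z hz =>
    ⟨⟨hx.1.1.trans_le hz.1, hz.2.trans_lt hy.1.2⟩, by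
      have := hx.2; have := hy.2; rcases hσ with rfl | rfl <;> linarith [hz.1, hz.2]⟩⟩
  rw [hU]
  refine IsAC.union (t0 := e + σ * r) ?_ ?_ ⟨ht0, hl0.le⟩ ⟨ht0, hl0.ge⟩
  · have h1 : IsAC (fun t => c (rescale e σ r t)) (fun t => (σ / r) • c' (rescale e σ r t)) J1 :=
      hc.ac.comp_affine _ _ fun t ht => by
        have := rescale_eq e σ r t
        rw [rescale] at this
        rw [this]
        exact ⟨div_nonneg (h.pos ht.1).le hr.le, (div_le_one hr).2 ht.2⟩
    refine (h1.congr_on fun t ht => if_pos ht.2).congr_deriv_of_ne (t0 := e) hO1 fun t ht _ => ?_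
    exact if_pos ht.2
  · have h2 : IsAC w w' J2 := hw.mono fun t ht => ht.1
    have hne : ∀ t ∈ J2, t ≠ e + σ * r → ¬ σ * (t - e) ≤ r := fun t ht hn hle => hn (by
      have h3 := le_antisymm hle ht.2
      rcases hσ with rfl | rfl <;> linarith)
    -- At the edge of the collar the glued derivative is taken from the path rather than from `w`; a
    -- single point does not matter.
    refine (h2.congr_on fun t ht => ?_).congr_deriv_of_ne (t0 := e + σ * r) hO2 fun t ht hn => ?_
    · rcases eq_or_ne t (e + σ * r) with rfl | hn
      · rw [glue, if_pos hl0.le, rescale_eq, hl0, div_self hr.ne', hc.end_eq]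
      · exact if_neg (hne t ht hn)
    · exact if_neg (hne t ht hn)

theorem glue_mem (h : S.IsPole e σ) (hr : 0 < r) (hw : ∀ t ∈ Ioo S.a S.b, w t ∈ T.carrier)
    (hc : T.IsRadialPath θ q c c') {t : ℝ} (ht : t ∈ Ioo S.a S.b) :
    glue e σ r c w t ∈ T.carrier := by
  rw [glue]
  split_ifs with h1
  · refine hc.mem _ ?_
    rw [rescale_eq]
    exact ⟨div_nonneg (h.pos ht).le hr.le, (div_le_one hr).2 h1⟩
  · exact hw t ht

theorem glue_bounds (hσ : σ = 1 ∨ σ = -1) (hc : T.IsRadialPath θ q c c') {t : ℝ}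
    (ht : t ∈ collar e σ r) :
    ‖perp (glue e σ r c w t)‖ ^ 2 ≤ θ ^ 2 * ‖perp q‖ ^ 2 / r ^ 2 * (σ * (t - e)) ^ 2 ∧
    ‖glueDeriv e σ r c' w' t‖ ^ 2 ≤ θ ^ 2 * ‖perp q‖ ^ 2 / r ^ 2 := by
  have hr : 0 < r := ht.1.trans_le ht.2
  have hl : rescale e σ r t ∈ Icc (0 : ℝ) 1 := by
    rw [rescale_eq]
    exact ⟨div_nonneg ht.1.le hr.le, (div_le_one hr).2 ht.2⟩
  have h1 := hc.perp_le _ hl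
  have h2 := hc.speed _ hl
  rw [glue, glueDeriv, if_pos ht.2, if_pos ht.2]
  have hs : ‖σ / r‖ ^ 2 = 1 / r ^ 2 := by
    rw [Real.norm_eq_abs, sq_abs, div_pow, sign_sq hσ]
  constructor
  · calc _ ≤ (θ * rescale e σ r t * ‖perp q‖) ^ 2 := pow_le_pow_left₀ (norm_nonneg _) h1 2
      _ = _ := by rw [rescale_eq]; ring
  · rw [norm_smul, mul_pow, hs]
    calc _ ≤ 1 / r ^ 2 * (θ * ‖perp q‖) ^ 2 := by gcongr
      _ = _ := by ring

end Competitor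

end SurfaceOfRevolution

namespace SurfaceOfRevolution

variable {S T : SurfaceOfRevolution} {e σ : ℝ} {g : ℝ → ℝ} {a : E3 → E3} {w w' : ℝ → E3}
  {c c' : ℝ → E3} {k r θ : ℝ} {q : E3}

/-- In the collar the horizontal part of the path is at most a multiple of the distance to the pole,
which compensates the weight `1 / x`; elsewhere nothing has changed. A curve with a pole is not a
loop, so there is no closing condition. -/
theorem Profile.glue (hw : Profile S T w w') (hac : IsAC w w' (Ioo S.a S.b)) (h : S.IsPole e σ)
    (hr : 0 < r) (hrb : r < S.b - S.a) (hk : 0 < k)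
    (hkx : ∀ t ∈ collar e σ r, k * (σ * (t - e)) ≤ S.x t)
    (hc : T.IsRadialPath θ (w (e + σ * r)) c c') :
    Profile S T (glue e σ r c w) (glueDeriv e σ r c' w') := by
  have hA := isAC_glue h hr hrb hac hc
  have hT : ∀ t ∈ Ioo S.a S.b, SurfaceOfRevolution.glue e σ r c w t ∈ T.carrier :=
    fun t ht => glue_mem h hr hw.mem hc ht
  have hm' := hA.aestronglyMeasurable_deriv
  have hm := hA.continuousOn_Ioo.aestronglyMeasurable measurableSet_Ioo (μ := volume)
  obtain ⟨M, -, hM⟩ := T.exists_norm_bound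
  obtain ⟨X, hX, hXb⟩ := S.exists_x_bound
  set Kc := θ ^ 2 * ‖perp (w (e + σ * r))‖ ^ 2 / r ^ 2 with hKc
  have hKc0 : 0 ≤ Kc := by positivity
  have hcol : ∀ t ∈ Ioo S.a S.b, σ * (t - e) ≤ r → t ∈ collar e σ r :=
    fun t ht h' => ⟨h.pos ht, h'⟩
  refine ⟨weakD1_of_isAC hA ⟨M, fun t ht => hM _ (hT t ht)⟩ hm' ?_ fun hL => (h.not_isLoop hL).elim,
    hT, ?_⟩
  · refine Integrable.mono' ((integrable_const (Kc * X)).add hw.weak.sq_int)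
      ((hm'.norm.pow 2).mul aestronglyMeasurable_x) ?_
    filter_upwards [ae_restrict_mem measurableSet_Ioo] with t ht
    have hx := (S.x_pos t ht).le
    rw [Real.norm_of_nonneg (mul_nonneg (sq_nonneg _) hx)]
    simp only [Pi.add_apply]
    by_cases h' : σ * (t - e) ≤ r
    · have h1 := (glue_bounds (w := w) (w' := w') h.sign hc (hcol t ht h')).2
      have h2 := mul_le_mul h1 (hXb t (Ioo_subset_Icc_self ht)) hx hKc0
      have h3 : 0 ≤ ‖w' t‖ ^ 2 * S.x t := mul_nonneg (sq_nonneg _) hx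
      linarith
    · rw [glueDeriv, if_neg h']
      have : 0 ≤ Kc * X := mul_nonneg hKc0 hX.le
      linarith
  · refine Integrable.mono' ((integrable_const (Kc * (r / k))).add hw.perp_int)
      (((continuous_perp.comp_aestronglyMeasurable hm).norm.pow 2).mul aesm_inv_x) ?_
    filter_upwards [ae_restrict_mem measurableSet_Ioo] with t ht
    have hx := S.x_pos t ht
    have hxi := inv_nonneg.2 hx.le
    rw [Real.norm_of_nonneg (mul_nonneg (sq_nonneg _) hxi)]
    simp only [Pi.add_apply]
    by_cases h' : σ * (t - e) ≤ r
    · have hs := h.pos ht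
      have h1 := (glue_bounds (w := w) (w' := w') h.sign hc (hcol t ht h')).1
      have h4 := hkx t (hcol t ht h')
      have h2 := mul_le_mul_of_nonneg_right h1 hxi
      have h5 : Kc * (σ * (t - e)) ^ 2 * (S.x t)⁻¹ ≤ Kc * (r / k) := by
        rw [mul_assoc]
        refine mul_le_mul_of_nonneg_left ?_ hKc0
        rw [← div_eq_mul_inv, div_le_div_iff₀ hx hk]
        nlinarith [mul_le_mul_of_nonneg_left h4 hs.le, mul_le_mul_of_nonneg_right h' hx.le]
      have h3 : 0 ≤ ‖perp (w t)‖ ^ 2 * (S.x t)⁻¹ := mul_nonneg (sq_nonneg _) hxi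
      linarith
    · rw [SurfaceOfRevolution.glue, if_neg h']
      have : 0 ≤ Kc * (r / k) := by positivity
      linarith

/-- The energy of a minimal profile in a collar is at most that of a competitor. -/
theorem MinProfile.collar_le (hw : MinProfile S T g a w w') (hg : Continuous g)
    (ha : ContinuousOn a S.carrier) (h : S.IsPole e σ)
    (hr : 0 < r) (hrb : r < S.b - S.a) (hk : 0 < k)
    (hkx : ∀ t ∈ collar e σ r, k * (σ * (t - e)) ≤ S.x t)
    (hc : T.IsRadialPath θ (w (e + σ * r)) c c') :
    ∫ t in collar e σ r, S.density g a w w' t ≤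
      ∫ t in collar e σ r, S.density g a (glue e σ r c w) (glueDeriv e σ r c' w') t := by
  have hu := hw.toProfile.glue hw.ac h hr hrb hk hkx hc
  have hle := hw.le _ _ hu
  have i1 := hw.toProfile.integrable_density hg ha
  have i2 := hu.integrable_density hg ha
  have hsub := h.collar_subset hrb
  have hmc := measurableSet_collar (e := e) (σ := σ) r
  have hsplit : ∀ f : ℝ → ℝ, IntegrableOn f (Ioo S.a S.b) → ∫ t in Ioo S.a S.b, f t =
      (∫ t in collar e σ r, f t) + ∫ t in Ioo S.a S.b \ collar e σ r, f t := fun f hf => by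
    rw [← integral_inter_add_sdiff hmc hf, inter_eq_right.2 hsub]
  rw [hsplit _ i1, hsplit _ i2] at hle
  have heq : ∫ t in Ioo S.a S.b \ collar e σ r, S.density g a w w' t =
      ∫ t in Ioo S.a S.b \ collar e σ r,
        S.density g a (glue e σ r c w) (glueDeriv e σ r c' w') t := by
    refine setIntegral_congr_fun (measurableSet_Ioo.diff hmc) fun t ht => ?_
    have hn : ¬ σ * (t - e) ≤ r := fun h' => ht.2 ⟨h.pos ht.1, h'⟩
    simp only [density, SurfaceOfRevolution.glue, glueDeriv, if_neg hn]
  linarith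

/-- Meridian sections in the coordinate `s = σ (t - e)`. -/
theorem poleDensity_comp (hσ : σ = 1 ∨ σ = -1) (s : ℝ) :
    poleDensity (fun s => w (e + σ * s)) (fun s => σ • w' (e + σ * s)) s =
      ‖perp (w (e + σ * s))‖ ^ 2 * (σ * (e + σ * s - e))⁻¹ +
        ‖w' (e + σ * s)‖ ^ 2 * (σ * (e + σ * s - e)) := by
  rw [poleDensity, sign_mul_sign hσ, norm_smul, mul_pow, Real.norm_eq_abs, sq_abs, sign_sq hσ,
    one_mul]

/-- The radial path has almost the Dirichlet energy of the linear cone over the boundary value,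
namely the squared horizontal length of that value. Minimality transfers this bound to `w`, and the
potential costs only `O(r²)`, the area of the collar. The resulting growth condition is the
hypothesis of `integrableOn_deriv_sq_of_le`. -/
theorem MinProfile.integrable_deriv_sq_pole (hw : MinProfile S T g a w w') (hg : Continuous g)
    (hg0 : ∀ s, 0 ≤ g s) (ha : ContinuousOn a S.carrier) (h : S.IsPole e σ) :
    ∃ r, 0 < r ∧ IntegrableOn (fun t => ‖w' t‖ ^ 2) (collar e σ r) := by
  have hσ := h.sign
  -- The ratio `51 / 50` is lost once for the weight under `w`, once for the weight under the
  -- competitor and twice for the path, and `(51 / 50)^4 ≤ 9 / 8`.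
  obtain ⟨k, R0, hk, hR0, hR0b, hwt⟩ := h.weights (θ := 51 / 50) (by norm_num)
  obtain ⟨ρ, hρ, hrad⟩ := T.exists_radial_path (θ := 51 / 50) (by norm_num)
  obtain ⟨P, hP0, hP⟩ := exists_potential_bound hg ha T
  set R := R0 / 2 with hR
  have hRR : R < R0 := by linarith
  have hRpos : 0 < R := by linarith
  have hRb : R < S.b - S.a := hRR.trans_le hR0b
  set f : ℝ → E3 := fun s => w (e + σ * s) with hf
  set f' : ℝ → E3 := fun s => σ • w' (e + σ * s) with hf'
  set D : ℝ → ℝ := fun t => ‖perp (w t)‖ ^ 2 * (σ * (t - e))⁻¹ + ‖w' t‖ ^ 2 * (σ * (t - e)) with hD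
  have hDf : ∀ s, poleDensity f f' s = D (e + σ * s) := fun s => poleDensity_comp hσ s
  have hmemI : ∀ s ∈ Ioo 0 R, e + σ * s ∈ Ioo S.a S.b := fun s hs =>
    h.collar_subset hRb (by
      simp only [collar, mem_ofPred_eq, sign_mul_sign hσ]; exact ⟨hs.1, hs.2.le⟩)
  have hfac : IsAC f f' (Ioo 0 R) := hw.ac.comp_affine e σ hmemI
  -- the energy density at the pole is controlled by the energy density
  have hDle : ∀ t ∈ collar e σ R, 0 ≤ D t ∧ D t ≤ 51 / 50 *
      (‖perp (w t)‖ ^ 2 * (S.h2 t / S.x t) + ‖w' t‖ ^ 2 * (S.x t / S.h2 t)) := by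
    intro t ht
    obtain ⟨-, ⟨-, h1⟩, ⟨-, h2⟩, -⟩ := hwt t R hRR ht
    have hs := ht.1
    refine ⟨by rw [hD]; positivity, ?_⟩
    have k1 := mul_le_mul_of_nonneg_left h1 (sq_nonneg ‖perp (w t)‖)
    have k2 := mul_le_mul_of_nonneg_left h2 (sq_nonneg ‖w' t‖)
    rw [hD]; linarith
  have hpd : IntegrableOn (fun t => ‖perp (w t)‖ ^ 2 * (S.h2 t / S.x t) +
      ‖w' t‖ ^ 2 * (S.x t / S.h2 t)) (Ioo S.a S.b) :=
    hw.toProfile.integrable_perp.add hw.toProfile.integrable_deriv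
  have hDi : IntegrableOn D (collar e σ R) := by
    have hsub := h.collar_subset hRb
    refine Integrable.mono' ((hpd.mono_set hsub).const_mul (51 / 50)) ?_ ?_
    · have m1 := (hw.weak.meas.mono_measure (Measure.restrict_mono hsub le_rfl))
      have m2 := (hw.weak.meas'.mono_measure (Measure.restrict_mono hsub le_rfl))
      have m3 : Measurable fun t : ℝ => σ * (t - e) := by fun_prop
      exact (((continuous_perp.comp_aestronglyMeasurable m1).norm.pow 2).mul
        m3.inv.aestronglyMeasurable).add ((m2.norm.pow 2).mul m3.aestronglyMeasurable)
    · filter_upwards [ae_restrict_mem (measurableSet_collar R)] with t ht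
      rw [Real.norm_of_nonneg (hDle t ht).1]
      exact (hDle t ht).2
  have hki : IntegrableOn (poleDensity f f') (Ioo 0 R) := by
    have := (integrableOn_collar hσ R D).1 hDi
    simp only [← hDf] at this
    exact this.mono_set Ioo_subset_Ioc_self
  -- the energy in small collars
  set C : ℝ := 51 / 50 * (P * (51 / 50 * k) ^ 2) with hC
  have hC0 : 0 ≤ C := by positivity
  have key : ∀ r ∈ Ioo 0 R, ‖perp (f r)‖ < ρ →
      ∫ s in Ioo 0 r, poleDensity f f' s ≤ 9 / 8 * ‖perp (f r)‖ ^ 2 + C * r ^ 2 := by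
    intro r hr hlt
    have hrb := hr.2.trans hRb
    have hcs : collar e σ r ⊆ collar e σ R := fun t ht => ⟨ht.1, ht.2.trans hr.2.le⟩
    obtain ⟨c, c', hc⟩ := hrad (f r) (hw.mem _ (hmemI r hr)) hlt
    have hkx : ∀ t ∈ collar e σ r, k * (σ * (t - e)) ≤ S.x t := fun t ht =>
      (hwt t r (hr.2.trans hRR) ht).1
    have hcomp := hw.collar_le hg ha h hr.1 hrb hk hkx hc
    have hu := hw.toProfile.glue hw.ac h hr.1 hrb hk hkx hc
    have iw := (hw.toProfile.integrable_density hg ha).mono_set (h.collar_subset hrb)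
    have iu := (hu.integrable_density hg ha).mono_set (h.collar_subset hrb)
    set W := ‖perp (f r)‖ ^ 2 with hW
    -- On the collar the competitor's density is at most `L s` at distance `s` from the pole: two
    -- equal Dirichlet terms and the potential.
    set L : ℝ := 2 * (51 / 50) ^ 3 * W / r ^ 2 + P * (51 / 50 * k) ^ 2 with hL
    have e1 : ∫ s in Ioo 0 r, poleDensity f f' s = ∫ t in collar e σ r, D t := by
      rw [setIntegral_collar hσ, integral_Ioc_eq_integral_Ioo]
      simp only [hDf]
    have e2 : ∫ t in collar e σ r, D t ≤ 51 / 50 * ∫ t in collar e σ r, S.density g a w w' t := by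
      rw [← integral_const_mul]
      refine setIntegral_mono_on (hDi.mono_set hcs) (iw.const_mul _) (measurableSet_collar r)
        fun t ht => ?_
      have := density_ge (S := S) (a := a) (w := w) (w' := w') hg0 t
      have := (hDle t (hcs ht)).2
      linarith
    have e3 : ∫ t in collar e σ r, S.density g a (SurfaceOfRevolution.glue e σ r c w)
        (glueDeriv e σ r c' w') t ≤ ∫ t in collar e σ r, L * (σ * (t - e)) := by
      refine setIntegral_mono_on iu ?_ (measurableSet_collar r) fun t ht => ?_
      · rw [integrableOn_collar hσ]
        exact (Continuous.integrableOn_Icc (by fun_prop)).mono_set Ioc_subset_Icc_self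
      · obtain ⟨-, ⟨h1, -⟩, ⟨h2, -⟩, h3⟩ := hwt t r (hr.2.trans hRR) ht
        obtain ⟨b1, b2⟩ := glue_bounds (w := w) (w' := w') hσ hc ht
        have htI := h.collar_subset hrb ht
        have hs := ht.1
        have hq : (51 / 50 : ℝ) ^ 2 * ‖perp (f r)‖ ^ 2 / r ^ 2 = (51 / 50) ^ 2 * W / r ^ 2 := rfl
        rw [hq] at b1 b2
        set s := σ * (t - e) with hsdef
        set V := (51 / 50) ^ 2 * W / r ^ 2 with hV
        have hV0 : 0 ≤ V := by positivity
        have w1 : 0 ≤ S.h2 t / S.x t :=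
          div_nonneg (S.h2_pos (Ioo_subset_Icc_self htI)).le (S.x_pos t htI).le
        have w2 : 0 ≤ S.x t / S.h2 t :=
          div_nonneg (S.x_pos t htI).le (S.h2_pos (Ioo_subset_Icc_self htI)).le
        have p1 := mul_le_mul b1 h1 w1 (by positivity)
        have p2 := mul_le_mul b2 h2 w2 hV0
        have p3 : g (inner ℝ (SurfaceOfRevolution.glue e σ r c w t) (a (S.param 0 t))) *
            S.areaElt t ≤ P * ((51 / 50 * k) ^ 2 * s) :=
          mul_le_mul ((le_abs_self _).trans (hP _ (hu.mem t htI) 0 t (Ioo_subset_Icc_self htI))) h3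
            (S.areaElt_nonneg t) hP0
        have q1 : V * s ^ 2 * (51 / 50 * s⁻¹) = 51 / 50 * V * s := by field_simp
        have q2 : L * s = 51 / 50 * V * s + V * (51 / 50 * s) + P * ((51 / 50 * k) ^ 2 * s) := by
          rw [hL, hV]; ring
        rw [density, q2]
        rw [q1] at p1
        linarith
    have e4 : ∫ t in collar e σ r, L * (σ * (t - e)) = L * (r ^ 2 / 2) := by
      rw [setIntegral_collar hσ]
      simp only [sign_mul_sign hσ]
      rw [integral_const_mul, ← intervalIntegral.integral_of_le hr.1.le, integral_id]
      ring
    have e5 : 51 / 50 * (L * (r ^ 2 / 2)) = (51 / 50) ^ 4 * W + C * r ^ 2 / 2 := by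
      rw [hL, hC]
      have := hr.1.ne'
      field_simp
    have hW0 : 0 ≤ W := sq_nonneg _
    have hCr : 0 ≤ C * r ^ 2 := by positivity
    rw [e1]
    linarith
  -- small collars have small energy
  obtain ⟨R1, hR1, hsmall⟩ : ∃ R1 ∈ Ioo 0 R, ∀ r ∈ Ioo 0 R1, ‖perp (f r)‖ < ρ := by
    have hkI : IntegrableOn (poleDensity f f') (uIcc 0 R) := by
      rw [uIcc_of_le hRpos.le, integrableOn_Icc_iff_integrableOn_Ioo]; exact hki
    have hcont := intervalIntegral.continuousOn_primitive_interval hkI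
    have h0 := Metric.continuousWithinAt_iff.1 (hcont 0 left_mem_uIcc) (ρ ^ 2) (by positivity)
    obtain ⟨δ, hδ, hb⟩ := h0
    refine ⟨min δ (R / 2), ⟨lt_min hδ (by linarith), (min_le_right _ _).trans_lt (by linarith)⟩,
      fun r hr => ?_⟩
    have hrR : r ∈ Ioo 0 R := ⟨hr.1, hr.2.trans ((min_le_right _ _).trans_lt (by linarith))⟩
    have h1 := hb (x := r) (by rw [uIcc_of_le hRpos.le]; exact ⟨hrR.1.le, hrR.2.le⟩) (by
      rw [Real.dist_eq, sub_zero, abs_of_pos hr.1]; exact hr.2.trans_le (min_le_left _ _))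
    rw [intervalIntegral.integral_same, Real.dist_eq, sub_zero,
      intervalIntegral.integral_of_le hr.1.le, integral_Ioc_eq_integral_Ioo] at h1
    have h2 := norm_sq_perp_le_integral hfac hki hrR
    have h3 := (h2.trans (le_abs_self _)).trans_lt h1
    exact lt_of_pow_lt_pow_left₀ 2 hρ.le h3
  have hfin := integrableOn_deriv_sq_of_le (hfac.mono (Ioo_subset_Ioo_right hR1.2.le))
    (hki.mono_set (Ioo_subset_Ioo_right hR1.2.le)) hC0
    (fun r hr => key r ⟨hr.1, hr.2.trans hR1.2⟩ (hsmall r hr)) (R' := R1 / 2)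
    ⟨by linarith [hR1.1], by linarith [hR1.1]⟩
  refine ⟨R1 / 2, by linarith [hR1.1], ?_⟩
  rw [integrableOn_collar hσ]
  refine hfin.congr_fun (fun s _ => ?_) measurableSet_Ioc
  simp only [hf', norm_smul, mul_pow, Real.norm_eq_abs, sq_abs, sign_sq hσ, one_mul]

end SurfaceOfRevolution

theorem memLp_two_of_integrable_sq {F : Type*} [NormedAddCommGroup F] {f : ℝ → F} {s : Set ℝ}
    (hm : AEStronglyMeasurable f (volume.restrict s)) (h : IntegrableOn (fun t => ‖f t‖ ^ 2) s) :
    MemLp f 2 (volume.restrict s) := (memLp_two_iff_integrable_sq_norm hm).2 h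

/-! ### Minimal profiles up to the ends of the curve -/

namespace SurfaceOfRevolution

variable {S T : SurfaceOfRevolution} {e σ : ℝ} {g : ℝ → ℝ} {a : E3 → E3} {w w' : ℝ → E3}

/-- The interval is covered by the collars of the poles, where the previous estimate applies, and
the set where `x ≥ k`, where the weight can be divided out. -/
theorem MinProfile.integrable_deriv_sq (hw : MinProfile S T g a w w') (hg : Continuous g)
    (hg0 : ∀ s, 0 ≤ g s) (ha : ContinuousOn a S.carrier) :
    IntegrableOn (fun t => ‖w' t‖ ^ 2) (Ioo S.a S.b) := by
  have hex : ∀ e σ : ℝ, ∃ r, 0 < r ∧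
      (S.IsPole e σ → IntegrableOn (fun t => ‖w' t‖ ^ 2) (collar e σ r)) := fun e σ => by
    by_cases h : S.IsPole e σ
    · obtain ⟨r, hr, hi⟩ := hw.integrable_deriv_sq_pole hg hg0 ha h
      exact ⟨r, hr, fun _ => hi⟩
    · exact ⟨1, one_pos, fun h' => (h h').elim⟩
  obtain ⟨r1, hr1, hi1⟩ := hex S.a 1
  obtain ⟨r2, hr2, hi2⟩ := hex S.b (-1)
  obtain ⟨k, hk, hkx⟩ := S.exists_x_lower_away hr1 hr2
  have hmeas := hw.weak.meas'
  have hcov : Ioo S.a S.b ⊆ ({t | S.IsPole S.a 1 ∧ t ∈ collar S.a 1 r1} ∪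
      {t | S.IsPole S.b (-1) ∧ t ∈ collar S.b (-1) r2}) ∪
      {t | t ∈ Ioo S.a S.b ∧ k ≤ S.x t} := by
    intro t ht
    rcases hkx t (Ioo_subset_Icc_self ht) with h | ⟨h, hr⟩ | ⟨h, hr⟩
    · exact Or.inr ⟨ht, h⟩
    · rw [h.abs_eq (Ioo_subset_Icc_self ht)] at hr
      exact Or.inl (Or.inl ⟨h, h.pos ht, hr.le⟩)
    · rw [h.abs_eq (Ioo_subset_Icc_self ht)] at hr
      exact Or.inl (Or.inr ⟨h, h.pos ht, hr.le⟩)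
  have hpole : ∀ e σ r, (S.IsPole e σ → IntegrableOn (fun t => ‖w' t‖ ^ 2) (collar e σ r)) →
      IntegrableOn (fun t => ‖w' t‖ ^ 2) {t | S.IsPole e σ ∧ t ∈ collar e σ r} := by
    intro e σ r h
    by_cases hp : S.IsPole e σ
    · exact (h hp).mono_set fun t ht => ht.2
    · have : {t | S.IsPole e σ ∧ t ∈ collar e σ r} = ∅ := by ext t; simp [hp]
      rw [this]; exact integrableOn_empty
  have hms : MeasurableSet {t | t ∈ Ioo S.a S.b ∧ k ≤ S.x t} := by
    have h1 : IsClosed (Icc S.a S.b ∩ S.x ⁻¹' Ici k) :=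
      S.continuousOn_x.preimage_isClosed_of_isClosed isClosed_Icc isClosed_Ici
    have h2 : {t | t ∈ Ioo S.a S.b ∧ k ≤ S.x t} =
        Ioo S.a S.b ∩ (Icc S.a S.b ∩ S.x ⁻¹' Ici k) := by
      ext t
      exact ⟨fun h => ⟨h.1, Ioo_subset_Icc_self h.1, h.2⟩, fun h => ⟨h.1, h.2.2⟩⟩
    rw [h2]
    exact measurableSet_Ioo.inter h1.measurableSet
  refine (((hpole _ _ _ hi1).union (hpole _ _ _ hi2)).union ?_).mono_set hcov
  have hsub : {t | t ∈ Ioo S.a S.b ∧ k ≤ S.x t} ⊆ Ioo S.a S.b := fun t ht => ht.1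
  refine Integrable.mono' ((hw.weak.sq_int.mono_set hsub).const_mul k⁻¹)
    ((hmeas.mono_measure (Measure.restrict_mono hsub le_rfl)).norm.pow 2) ?_
  filter_upwards [ae_restrict_mem hms] with t ht
  rw [Real.norm_of_nonneg (sq_nonneg _), ← div_eq_inv_mul, le_div_iff₀ hk]
  exact mul_le_mul_of_nonneg_left ht.2 (sq_nonneg _)

/-- A continuous function of finite energy is vertical at the poles. -/
theorem IsPole.perp_eq_zero (h : S.IsPole e σ) (hc : ContinuousOn w (Icc S.a S.b))
    (hi : IntegrableOn (fun t => ‖perp (w t)‖ ^ 2 * (S.x t)⁻¹) (Ioo S.a S.b)) :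
    perp (w e) = 0 := by
  by_contra hne
  set η := ‖perp (w e)‖ ^ 2 with hη
  have hη0 : 0 < η := pow_pos (norm_pos_iff.2 hne) 2
  have hcp : ContinuousOn (fun t => ‖perp (w t)‖ ^ 2) (Icc S.a S.b) :=
    (continuous_perp.comp_continuousOn hc).norm.pow 2
  obtain ⟨δ, hδ, hb⟩ := Metric.continuousWithinAt_iff.1 (hcp e h.mem) (η / 2) (half_pos hη0)
  obtain ⟨k, R, hk, hR, has⟩ := h.asymptotics (θ := 2) (by norm_num)
  obtain ⟨r, hr0, hr⟩ := exists_between (lt_min (lt_min hδ hR) (sub_pos.2 S.a_lt_b))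
  have hrb := hr.trans_le (min_le_right _ _)
  have hrd := hr.trans_le ((min_le_left _ _).trans (min_le_left _ _))
  have hrR := hr.trans_le ((min_le_left _ _).trans (min_le_right _ _))
  have hsub := h.collar_subset hrb
  -- Near the pole `‖perp w‖²` is at least `η / 2` and `x` is at most `2 k` times the distance to
  -- the pole, so the finite integral would make `1 / s` integrable.
  have hmeas : Measurable fun t : ℝ => (σ * (t - e))⁻¹ := by fun_prop
  have h1 : IntegrableOn (fun t => (σ * (t - e))⁻¹) (collar e σ r) := by
    refine Integrable.mono' ((hi.mono_set hsub).const_mul (4 * k / η)) hmeas.aestronglyMeasurable ?_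
    filter_upwards [ae_restrict_mem (measurableSet_collar r)] with t ht
    have htI := Ioo_subset_Icc_self (hsub ht)
    have habs := h.abs_eq htI
    have hs : 0 < σ * (t - e) := ht.1
    have hx := S.x_pos t (hsub ht)
    have h2 := hb htI (by rw [Real.dist_eq, habs]; exact ht.2.trans_lt hrd)
    rw [Real.dist_eq, abs_lt] at h2
    have h3 := (has t htI (by rw [habs]; exact ht.2.trans_lt hrR)).1.2
    rw [habs] at h3
    rw [Real.norm_of_nonneg (inv_nonneg.2 hs.le)]
    have h4 : η / 2 ≤ ‖perp (w t)‖ ^ 2 := by linarith [h2.1]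
    have h5 : (2 * k * (σ * (t - e)))⁻¹ ≤ (S.x t)⁻¹ := inv_anti₀ hx h3
    calc (σ * (t - e))⁻¹ = 4 * k / η * (η / 2 * (2 * k * (σ * (t - e)))⁻¹) := by
          field_simp; norm_num
      _ ≤ _ := by gcongr
  rw [integrableOn_collar h.sign] at h1
  simp only [sign_mul_sign h.sign] at h1
  exact not_integrableOn_inv hr0 (h1.mono_set Ioo_subset_Ioc_self)

/-- Continuous profiles on the closed interval with square integrable derivatives. -/
structure RegularProfile (S T : SurfaceOfRevolution) (w w' : ℝ → E3) : Prop where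
  ac : IsAC w w' (Icc S.a S.b)
  memLp : MemLp w' 2 (volume.restrict (Ioo S.a S.b))
  mem : ∀ t ∈ Icc S.a S.b, w t ∈ T.carrier
  perp_int : IntegrableOn (fun t => ‖perp (w t)‖ ^ 2 * (S.x t)⁻¹) (Ioo S.a S.b)
  loop : S.IsLoop → w S.a = w S.b

theorem RegularProfile.continuousOn (hw : RegularProfile S T w w') :
    ContinuousOn w (Icc S.a S.b) := hw.ac.continuousOn_Icc S.a_lt_b.le

theorem closure_Ioo_eq (S : SurfaceOfRevolution) : closure (Ioo S.a S.b) = Icc S.a S.b :=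
  closure_Ioo S.a_lt_b.ne

/-- A square integrable derivative is integrable, so the profile extends continuously to the closed
interval. The values stay in `T` because `T` is closed, and the ends of a loop match because the
derivative has integral zero. -/
theorem MinProfile.exists_regular (hw : MinProfile S T g a w w') (hg : Continuous g)
    (hg0 : ∀ s, 0 ≤ g s) (ha : ContinuousOn a S.carrier) :
    ∃ W, (∀ t ∈ Ioo S.a S.b, W t = w t) ∧ RegularProfile S T W w' := by
  have hL := memLp_two_of_integrable_sq hw.weak.meas' (hw.integrable_deriv_sq hg hg0 ha)
  obtain ⟨W, hW, hWw⟩ := IsAC.exists_extension S.a_lt_b hw.ac (hL.integrable (by norm_num))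
  have hc := hW.continuousOn_Icc S.a_lt_b.le
  refine ⟨W, hWw, hW, hL, fun t ht => ?_, ?_, fun hloop => ?_⟩
  · have hcl : t ∈ closure (Ioo S.a S.b) := by rw [S.closure_Ioo_eq]; exact ht
    exact T.isCompact_carrier.isClosed.closure_subset
      ((hc t ht).mono Ioo_subset_Icc_self |>.mem_closure hcl fun s hs => by
        rw [hWw s hs]; exact hw.mem s hs)
  · refine hw.perp_int.congr_fun (fun t ht => ?_) measurableSet_Ioo
    simp only [hWw t ht]
  · have h1 := hW.eq_add (left_mem_Icc.2 S.a_lt_b.le) (right_mem_Icc.2 S.a_lt_b.le)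
    rw [intervalIntegral.integral_of_le S.a_lt_b.le, integral_Ioc_eq_integral_Ioo, hw.loop hloop,
      add_zero] at h1
    exact h1.symm

end SurfaceOfRevolution

/-! ### Equivariant minimizers and first harmonic representatives -/

/-- Square integrable absolutely continuous functions are in `H¹`. -/
theorem intervalH1_of_isAC {a b : ℝ} (hab : a < b) {u u' : ℝ → E3} (hu : IsAC u u' (Icc a b))
    (hL : MemLp u' 2 (volume.restrict (Ioo a b))) : IntervalH1 a b u := by
  have hc := hu.continuousOn_Icc hab.le
  obtain ⟨K, hK⟩ := isCompact_Icc.exists_bound_of_continuousOn hc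
  have hum : AEStronglyMeasurable u (volume.restrict (Ioo a b)) :=
    (hc.mono Ioo_subset_Icc_self).aestronglyMeasurable measurableSet_Ioo
  refine ⟨MemLp.of_bound hum K ?_, u', hL, fun ψ hψ hψc hψs => ?_⟩
  · filter_upwards [ae_restrict_mem measurableSet_Ioo] with t ht using hK t (Ioo_subset_Icc_self ht)
  obtain ⟨c, d, hc', hd', hcd⟩ : ∃ c d, a < c ∧ d < b ∧ tsupport ψ ⊆ Icc c d := by
    rcases (tsupport ψ).eq_empty_or_nonempty with he | hne
    · exact ⟨a + 1, b - 1, by simp, by simp, by simp [he]⟩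
    · exact ⟨sInf (tsupport ψ), sSup (tsupport ψ), (hψs (hψc.isCompact.sInf_mem hne)).1,
        (hψs (hψc.isCompact.sSup_mem hne)).2, fun t ht =>
          ⟨csInf_le hψc.isCompact.bddBelow ht, le_csSup hψc.isCompact.bddAbove ht⟩⟩
  have h0 := SurfaceOfRevolution.integral_test_of_support hab
    (hu.mono Ioo_subset_Icc_self) hψ hc' hd'
    fun t ht => hcd (subset_tsupport ψ ht)
  have hui : IntegrableOn u (Ioo a b) := hc.integrableOn_Icc.mono_set Ioo_subset_Icc_self
  have hui' : IntegrableOn u' (Ioo a b) := hL.integrable (by norm_num)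
  have hsm : ∀ (ρ : ℝ → ℝ) (f : ℝ → E3), Continuous ρ → IntegrableOn f (Ioo a b) →
      IntegrableOn (fun t => ρ t • f t) (Ioo a b) := by
    intro ρ f hρ hf
    obtain ⟨M, hM⟩ := isCompact_Icc.exists_bound_of_continuousOn (hρ.continuousOn (s := Icc a b))
    refine Integrable.mono' (hf.norm.const_mul M)
      (hρ.aestronglyMeasurable.smul hf.aestronglyMeasurable) ?_
    filter_upwards [ae_restrict_mem measurableSet_Ioo] with t ht
    rw [norm_smul]
    exact mul_le_mul_of_nonneg_right (hM t (Ioo_subset_Icc_self ht)) (norm_nonneg _)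
  rw [integral_add (hsm _ _ (hψ.continuous_deriv (by simp)) hui) (hsm _ _ hψ.continuous hui')] at h0
  exact eq_neg_of_add_eq_zero_left h0

theorem IntervalH1.clm {F F' : Type*} [NormedAddCommGroup F] [NormedSpace ℝ F] [CompleteSpace F]
    [NormedAddCommGroup F'] [NormedSpace ℝ F'] [CompleteSpace F'] {a b : ℝ} {f : ℝ → F}
    (hf : IntervalH1 a b f) (L : F →L[ℝ] F') : IntervalH1 a b fun t => L (f t) := by
  obtain ⟨h1, f', h2, h3⟩ := hf
  have hsm : ∀ (ρ : ℝ → ℝ) (h : ℝ → F), Continuous ρ → IntegrableOn h (Ioo a b) →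
      IntegrableOn (fun t => ρ t • h t) (Ioo a b) := by
    intro ρ f hρ hf
    obtain ⟨M, hM⟩ := isCompact_Icc.exists_bound_of_continuousOn (hρ.continuousOn (s := Icc a b))
    refine Integrable.mono' (hf.norm.const_mul M)
      (hρ.aestronglyMeasurable.smul hf.aestronglyMeasurable) ?_
    filter_upwards [ae_restrict_mem measurableSet_Ioo] with t ht
    rw [norm_smul]
    exact mul_le_mul_of_nonneg_right (hM t (Ioo_subset_Icc_self ht)) (norm_nonneg _)
  refine ⟨L.comp_memLp' h1, fun t => L (f' t), L.comp_memLp' h2, fun ψ hψ hc hs => ?_⟩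
  have e := congrArg L (h3 ψ hψ hc hs)
  rw [map_neg, ← L.integral_comp_comm (hsm _ _ (hψ.continuous_deriv (by simp))
    (h1.integrable (by norm_num))), ← L.integral_comp_comm (hsm _ _ hψ.continuous
    (h2.integrable (by norm_num)))] at e
  simpa only [map_smul] using e

namespace SurfaceOfRevolution

variable {S T : SurfaceOfRevolution} {e σ ε : ℝ} {g : ℝ → ℝ} {a m : E3 → E3} {w w' : ℝ → E3}
  {X X' Y Y' Z Z' : ℝ → E3}

theorem exists_isPole {t : ℝ} (ht : t ∈ Icc S.a S.b) (hx : S.x t = 0) : ∃ σ, S.IsPole t σ := by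
  rcases eq_or_lt_of_le ht.1 with h | h
  · exact ⟨1, hx, Or.inl ⟨h.symm, rfl⟩⟩
  rcases eq_or_lt_of_le ht.2 with h' | h'
  · exact ⟨-1, hx, Or.inr ⟨h', rfl⟩⟩
  · exact ((S.x_pos t ⟨h, h'⟩).ne' hx).elim

/-- Consistency at a pole, where the angle is undetermined, requires the oscillating coefficients to
vanish; at the seam of a loop the coefficients at both ends must agree. -/
theorem exists_field_trig {A B C : ℝ → E3}
    (h0 : ∀ t ∈ Icc S.a S.b, S.x t = 0 → A t = 0 ∧ B t = 0)
    (hl : S.IsLoop → A S.a = A S.b ∧ B S.a = B S.b ∧ C S.a = C S.b) :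
    ∃ u : E3 → E3, ∀ φ, ∀ t ∈ Icc S.a S.b, u (S.param φ t) =
      Real.cos φ • A t + Real.sin φ • B t + C t := by
  refine S.exists_field _ fun φ φ' t ht t' ht' h => ?_
  obtain ⟨⟨hx, -⟩, h1, h2⟩ := param_eq_param S ht ht' h
  have hABC : A t = A t' ∧ B t = B t' ∧ C t = C t' := by
    rcases h1 with rfl | ⟨hL, ⟨rfl, rfl⟩ | ⟨rfl, rfl⟩⟩
    · exact ⟨rfl, rfl, rfl⟩
    · exact hl hL
    · obtain ⟨k1, k2, k3⟩ := hl hL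
      exact ⟨k1.symm, k2.symm, k3.symm⟩
  rw [← hABC.1, ← hABC.2.1, ← hABC.2.2]
  rcases h2 with h2 | ⟨h2, h3⟩
  · rw [(h0 t ht h2).1, (h0 t ht h2).2]; simp
  · rw [h2, h3]

theorem quarter_eq_zero {v : E3} (h : perp v = 0) : quarter v = 0 := by
  rw [← norm_eq_zero, norm_quarter, h, norm_zero]

/-- A regular profile generates an equivariant field on the whole surface. -/
theorem RegularProfile.exists_field (hw : RegularProfile S T w w') (hε : ε = 1 ∨ ε = -1) :
    ∃ u : E3 → E3, (∀ φ, ∀ t ∈ Icc S.a S.b, u (S.param φ t) = rot (ε * φ) (w t)) ∧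
      MapsTo u S.carrier T.carrier ∧ S.Equivariant ε u := by
  have hp : ∀ t ∈ Icc S.a S.b, S.x t = 0 → perp (w t) = 0 := fun t ht hx => by
    obtain ⟨σ, h⟩ := exists_isPole ht hx
    exact h.perp_eq_zero hw.continuousOn hw.perp_int
  obtain ⟨u, hu⟩ := S.exists_field_trig (A := fun t => perp (w t)) (B := fun t => ε • quarter (w t))
    (C := fun t => w t 2 • e3)
    (fun t ht hx => ⟨hp t ht hx, by rw [quarter_eq_zero (hp t ht hx), smul_zero]⟩)
    fun hL => by rw [hw.loop hL]; exact ⟨rfl, rfl, rfl⟩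
  have hu' : ∀ φ, ∀ t ∈ Icc S.a S.b, u (S.param φ t) = rot (ε * φ) (w t) := fun φ t ht => by
    rw [hu φ t ht, rot_sign_eq hε]
  refine ⟨u, hu', ?_, ?_⟩
  · rintro p ⟨φ, t, ht, rfl⟩
    rw [hu' φ t ht]
    exact T.rot_mem _ (hw.mem t ht)
  · rintro φ p ⟨θ, t, ht, rfl⟩
    rw [rot_param, hu' _ t ht, hu' _ t ht, rot_rot, mul_add]

/-- Equivariant fields are null-average. -/
theorem Equivariant.nullAverage (hm : S.Equivariant ε m) (hε : ε = 1 ∨ ε = -1) :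
    S.NullAverage m := by
  filter_upwards [ae_restrict_mem measurableSet_Ioo] with t ht
  have htc := Ioo_subset_Icc_self ht
  obtain ⟨v, hv⟩ : ∃ v, ∀ φ, m (S.param φ t) = rot (ε * φ) v :=
    ⟨_, fun φ => hm.apply_param φ htc⟩
  rw [latitudeAverage, ← integral_Ioo_two_pi]
  have hc : IntegrableOn (fun φ => rot (ε * φ) (v)) (Ioo 0 (2 * Real.pi)) := by
    have : Continuous fun φ : ℝ => rot (ε * φ) v := by
      simp only [rot_sign_eq hε]; fun_prop
    exact this.integrableOn_Icc.mono_set Ioo_subset_Icc_self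
  have h0 : ∀ c0 c1 : ℝ, ∫ φ in Ioo 0 (2 * Real.pi), (c0 * Real.cos φ + c1 * Real.sin φ) = 0 := by
    intro c0 c1
    have := integral_trig_quadratic 0 c0 c1 0 0 0
    simpa using this
  simp only [hv]
  apply ext_coords
  · rw [perp_apply_zero, PiLp.smul_apply, integral_coord hc]
    simp only [rot_apply_zero, (cos_sign_mul hε _).1, (cos_sign_mul hε _).2]
    have := h0 (v 0) (-(ε * v 1))
    simp only [PiLp.zero_apply, smul_eq_mul, mul_eq_zero]
    refine Or.inr (Eq.trans ?_ this)
    congr 1; funext φ; ring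
  · rw [perp_apply_one, PiLp.smul_apply, integral_coord hc]
    simp only [rot_apply_one, (cos_sign_mul hε _).1, (cos_sign_mul hε _).2]
    have := h0 (v 1) (ε * v 0)
    simp only [PiLp.zero_apply, smul_eq_mul, mul_eq_zero]
    refine Or.inr (Eq.trans ?_ this)
    congr 1; funext φ; ring
  · simp

theorem exists_mem_of_ae {P : ℝ → Prop}
    (h : ∀ᵐ φ ∂(volume.restrict (Ioo 0 (2 * Real.pi))), P φ) {c d : ℝ} (hc : 0 ≤ c) (hcd : c < d)
    (hd : d ≤ 2 * Real.pi) : ∃ φ ∈ Ioo c d, P φ := by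
  have h1 := ae_restrict_of_ae_restrict_of_subset (Ioo_subset_Ioo hc hd) h
  have : (ae ((volume : Measure ℝ).restrict (Ioo c d))).NeBot := by
    rw [ae_neBot, Ne, Measure.restrict_eq_zero, Real.volume_Ioo]
    simp [hcd]
  obtain ⟨φ, h2, h3⟩ := (h1.and (ae_restrict_mem measurableSet_Ioo)).exists
  exact ⟨φ, h3, h2⟩

/-- Almost every section of a null-average minimizer generates a field of the same energy. One of
them is chosen, and its continuous extension makes the field equivariant at every point, the poles
and the boundary included. -/
theorem exists_equivariant_minimizer (hmin : S.IsMinimizer T g a m) (h0 : S.NullAverage m)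
    (hε : ε = 1 ∨ ε = -1) (hg : Continuous g) (hg0 : ∀ s, 0 ≤ g s) (ha : ContinuousOn a S.carrier)
    (hae : S.Equivariant ε a) :
    ∃ u, S.IsMinimizer T g a u ∧ MapsTo u S.carrier T.carrier ∧ S.Equivariant ε u := by
  obtain ⟨φ, -, w, w', hw, -, hE⟩ := exists_mem_of_ae
    (hmin.null_average h0 hε hg ha hae).2 le_rfl Real.two_pi_pos le_rfl
  obtain ⟨W, hWw, hW⟩ := hw.exists_regular hg hg0 ha
  obtain ⟨u, hu, hmaps, heq⟩ := hW.exists_field hε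
  obtain ⟨h1, h2⟩ := hw.toProfile.memH1Into_energy hε hg ha hae (m := u) fun φ t ht => by
    rw [hu φ t (Ioo_subset_Icc_self ht), hWw t ht]
  exact ⟨u, ⟨h1, fun m' hm' => by rw [h2, ← hE]; exact hmin.2 m' hm'⟩, hmaps, heq⟩

/-- Fields `cos φ X⊥ + sin φ Y⊥ + Z₃ e₃` with continuous `H¹` coefficients and values in `T`. -/
structure HarmonicField (S T : SurfaceOfRevolution) (X X' Y Y' Z Z' : ℝ → E3) : Prop where
  acX : IsAC X X' (Icc S.a S.b)
  acY : IsAC Y Y' (Icc S.a S.b)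
  acZ : IsAC Z Z' (Icc S.a S.b)
  memX : MemLp X' 2 (volume.restrict (Ioo S.a S.b))
  memY : MemLp Y' 2 (volume.restrict (Ioo S.a S.b))
  memZ : MemLp Z' 2 (volume.restrict (Ioo S.a S.b))
  mem : ∀ φ, ∀ t ∈ Icc S.a S.b,
    Real.cos φ • perp (X t) + Real.sin φ • perp (Y t) + Z t 2 • e3 ∈ T.carrier
  intX : IntegrableOn (fun t => ‖perp (X t)‖ ^ 2 * (S.x t)⁻¹) (Ioo S.a S.b)
  intY : IntegrableOn (fun t => ‖perp (Y t)‖ ^ 2 * (S.x t)⁻¹) (Ioo S.a S.b)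
  loop : S.IsLoop → X S.a = X S.b ∧ Y S.a = Y S.b ∧ Z S.a = Z S.b

theorem integrable_perp_comb {v1 v2 : ℝ → E3} (c1 c2 : ℝ) (h1 : ContinuousOn v1 (Icc S.a S.b))
    (h2 : ContinuousOn v2 (Icc S.a S.b))
    (i1 : IntegrableOn (fun t => ‖perp (v1 t)‖ ^ 2 * (S.x t)⁻¹) (Ioo S.a S.b))
    (i2 : IntegrableOn (fun t => ‖perp (v2 t)‖ ^ 2 * (S.x t)⁻¹) (Ioo S.a S.b)) :
    IntegrableOn (fun t => ‖perp (c1 • v1 t + c2 • v2 t)‖ ^ 2 * (S.x t)⁻¹) (Ioo S.a S.b) := by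
  refine Integrable.mono' ((i1.const_mul (2 * c1 ^ 2)).add (i2.const_mul (2 * c2 ^ 2)))
    (((continuous_perp.comp_aestronglyMeasurable (S.aestronglyMeasurable_of_continuousOn
      ((h1.const_smul c1).add (h2.const_smul c2)))).norm.pow 2).mul aesm_inv_x) ?_
  filter_upwards [ae_restrict_mem measurableSet_Ioo] with t ht
  have hx := inv_nonneg.2 (S.x_pos t ht).le
  rw [Real.norm_of_nonneg (mul_nonneg (sq_nonneg _) hx)]
  simp only [Pi.add_apply]
  have h := norm_sq_add_le (perp (c1 • v1 t)) (perp (c2 • v2 t))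
  rw [← perpL_apply, ← perpL_apply, map_smul, map_smul, norm_smul, norm_smul, mul_pow, mul_pow,
    Real.norm_eq_abs, Real.norm_eq_abs, sq_abs, sq_abs] at h
  rw [← perpL_apply, map_add, map_smul, map_smul]
  have := mul_le_mul_of_nonneg_right h hx
  simp only [perpL_apply] at this ⊢
  linarith

theorem continuousOn_harmonic (hX : ContinuousOn X (Icc S.a S.b))
    (hY : ContinuousOn Y (Icc S.a S.b))
    (hZ : ContinuousOn Z (Icc S.a S.b)) :
    ContinuousOn (fun p : ℝ × ℝ => Real.cos p.1 • perp (X p.2) + Real.sin p.1 • perp (Y p.2) +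
      Z p.2 2 • e3) (univ ×ˢ Icc S.a S.b) := by
  have hs : MapsTo (Prod.snd : ℝ × ℝ → ℝ) (univ ×ˢ Icc S.a S.b) (Icc S.a S.b) := fun p hp => hp.2
  have k1 := (perpL.continuous.comp_continuousOn hX).comp continuousOn_snd hs
  have k2 := (perpL.continuous.comp_continuousOn hY).comp continuousOn_snd hs
  have k3 := (vertL.continuous.comp_continuousOn hZ).comp continuousOn_snd hs
  exact (((Real.continuous_cos.comp continuous_fst).continuousOn.smul k1).add
    ((Real.continuous_sin.comp continuous_fst).continuousOn.smul k2)).add k3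

/-- `T` is closed, the expression is continuous and periodic in the angle, and the coordinate domain
is dense in the closed rectangle. -/
theorem harmonic_mem (hX : ContinuousOn X (Icc S.a S.b)) (hY : ContinuousOn Y (Icc S.a S.b))
    (hZ : ContinuousOn Z (Icc S.a S.b)) (h : ∀ᵐ p ∂(volume.restrict S.cell),
      Real.cos p.1 • perp (X p.2) + Real.sin p.1 • perp (Y p.2) + Z p.2 2 • e3 ∈ T.carrier) :
    ∀ φ, ∀ t ∈ Icc S.a S.b,
      Real.cos φ • perp (X t) + Real.sin φ • perp (Y t) + Z t 2 • e3 ∈ T.carrier := by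
  intro φ t ht
  have hc := continuousOn_harmonic hX hY hZ
  have hsub : S.cell ⊆ univ ×ˢ Icc S.a S.b := prod_mono (subset_univ _) Ioo_subset_Icc_self
  have h1 := mem_of_ae_mem (μ := volume) S.isOpen_cell (hc.mono hsub)
    T.isCompact_carrier.isClosed h
  obtain ⟨θ, hθ, he⟩ := (show Function.Periodic
    (fun φ => Real.cos φ • perp (X t) + Real.sin φ • perp (Y t) + Z t 2 • e3) (2 * Real.pi) from
      fun φ => by simp only [Real.cos_add_two_pi, Real.sin_add_two_pi]).exists_mem_Ico₀
        Real.two_pi_pos φ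
  beta_reduce at he
  rw [he]
  have hcl : (θ, t) ∈ closure S.cell := by
    rw [cell, closure_prod_eq, closure_Ioo Real.two_pi_pos.ne, closure_Ioo S.a_lt_b.ne]
    exact ⟨⟨hθ.1, hθ.2.le⟩, ht⟩
  exact T.isCompact_carrier.isClosed.closure_subset
    (((hc (θ, t) ⟨mem_univ _, ht⟩).mono hsub).mem_closure hcl fun p hp => h1 p hp)

/-- The averaging argument yields the coefficients only as functions of `t` without regularity.
Meridian sections at almost every angle are regular, and two of them at independent angles determine
both coefficients by a linear system with constant matrix. -/
theorem exists_harmonic (hmin : S.IsMinimizer T g a m) (h0 : S.NullAverage m)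
    (hε : ε = 1 ∨ ε = -1) (hg : Continuous g) (hg0 : ∀ s, 0 ≤ g s) (ha : ContinuousOn a S.carrier)
    (hae : S.Equivariant ε a) :
    ∃ X X' Y Y' Z Z', HarmonicField S T X X' Y Y' Z Z' ∧
      ∀ᵐ p ∂(volume.restrict S.cell), S.pull m p =
        Real.cos p.1 • perp (X p.2) + Real.sin p.1 • perp (Y p.2) + Z p.2 2 • e3 := by
  obtain ⟨⟨A, B, C, hABC⟩, hsec⟩ := hmin.null_average h0 hε hg ha hae
  have hgood : ∀ᵐ φ ∂(volume.restrict (Ioo 0 (2 * Real.pi))), ∃ v v' : ℝ → E3,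
      IsAC v v' (Icc S.a S.b) ∧ MemLp v' 2 (volume.restrict (Ioo S.a S.b)) ∧
      IntegrableOn (fun t => ‖perp (v t)‖ ^ 2 * (S.x t)⁻¹) (Ioo S.a S.b) ∧
      (S.IsLoop → v S.a = v S.b) ∧ ∀ᵐ t ∂(volume.restrict (Ioo S.a S.b)),
        v t = Real.cos φ • perp (A t) + Real.sin φ • perp (B t) + C t 2 • e3 := by
    filter_upwards [hsec, ae_ae_cell hABC] with φ ⟨w, w', hw, hmw, _⟩ hφ
    obtain ⟨W, hWw, hW⟩ := hw.exists_regular hg hg0 ha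
    refine ⟨fun t => rotL (ε * φ) (W t), fun t => rotL (ε * φ) (w' t), hW.ac.clm _,
      (rotL (ε * φ)).comp_memLp' hW.memLp, ?_, fun hL => congrArg _ (hW.loop hL), ?_⟩
    · simp only [rotL_apply, perp_rot, norm_rot]
      exact hW.perp_int
    · filter_upwards [hmw, hφ, ae_restrict_mem measurableSet_Ioo] with t h1 h2 ht
      rw [rotL_apply, hWw t ht, ← h1, h2]
  have hpi := Real.pi_gt_three
  -- The angles are taken in `(0, 1)` and `(1, 2)`, so their difference lies strictly between `0`
  -- and `π` and the determinant `sin (φ2 - φ1)` is nonzero.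
  obtain ⟨φ1, hφ1, v1, v1', ac1, L1, i1, l1, e1⟩ := exists_mem_of_ae hgood (c := 0) (d := 1) le_rfl
    one_pos (by linarith)
  obtain ⟨φ2, hφ2, v2, v2', ac2, L2, i2, l2, e2⟩ := exists_mem_of_ae hgood (c := 1) (d := 2)
    zero_le_one one_lt_two (by linarith)
  have hs : Real.sin (φ2 - φ1) ≠ 0 := (Real.sin_pos_of_pos_of_lt_pi (by linarith [hφ1.2, hφ2.1])
    (by linarith [hφ1.1, hφ2.2])).ne'
  have hs' := Real.sin_sub φ2 φ1
  set s := Real.sin (φ2 - φ1) with hsdef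
  -- The four numbers are the entries of the inverse of the matrix with rows `(cos φ1, sin φ1)` and
  -- `(cos φ2, sin φ2)`.
  set x1 := s⁻¹ * Real.sin φ2 with hx1
  set x2 := -(s⁻¹ * Real.sin φ1) with hx2
  set y1 := -(s⁻¹ * Real.cos φ2) with hy1
  set y2 := s⁻¹ * Real.cos φ1 with hy2
  have k1 : x1 * Real.cos φ1 + x2 * Real.cos φ2 = 1 := by
    rw [hx1, hx2]; field_simp; linarith
  have k2 : x1 * Real.sin φ1 + x2 * Real.sin φ2 = 0 := by rw [hx1, hx2]; ring
  have k3 : y1 * Real.cos φ1 + y2 * Real.cos φ2 = 0 := by rw [hy1, hy2]; ring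
  have k4 : y1 * Real.sin φ1 + y2 * Real.sin φ2 = 1 := by
    rw [hy1, hy2]; field_simp; linarith
  have c1 := ac1.continuousOn_Icc S.a_lt_b.le
  have c2 := ac2.continuousOn_Icc S.a_lt_b.le
  have acX := (ac1.const_smul x1).add (ac2.const_smul x2)
  have acY := (ac1.const_smul y1).add (ac2.const_smul y2)
  have hae' : ∀ᵐ p ∂(volume.restrict S.cell), S.pull m p =
      Real.cos p.1 • perp (x1 • v1 p.2 + x2 • v2 p.2) +
      Real.sin p.1 • perp (y1 • v1 p.2 + y2 • v2 p.2) + v1 p.2 2 • e3 := by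
    have e12 : ∀ᵐ p ∂(volume.restrict S.cell), (v1 p.2 = Real.cos φ1 • perp (A p.2) +
        Real.sin φ1 • perp (B p.2) + C p.2 2 • e3) ∧ (v2 p.2 = Real.cos φ2 • perp (A p.2) +
        Real.sin φ2 • perp (B p.2) + C p.2 2 • e3) := by
      rw [restrict_cell]
      exact Measure.quasiMeasurePreserving_snd.ae (e1.and e2)
    filter_upwards [hABC, e12] with p h1 ⟨h2, h3⟩
    rw [h1, h2, h3]
    apply ext_coords
    · simp
      linear_combination (-(Real.cos p.1 * A p.2 0)) * k1 - (Real.cos p.1 * B p.2 0) * k2 -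
        (Real.sin p.1 * A p.2 0) * k3 - (Real.sin p.1 * B p.2 0) * k4
    · simp
      linear_combination (-(Real.cos p.1 * A p.2 1)) * k1 - (Real.cos p.1 * B p.2 1) * k2 -
        (Real.sin p.1 * A p.2 1) * k3 - (Real.sin p.1 * B p.2 1) * k4
    · simp
  refine ⟨fun t => x1 • v1 t + x2 • v2 t, fun t => x1 • v1' t + x2 • v2' t,
    fun t => y1 • v1 t + y2 • v2 t, fun t => y1 • v1' t + y2 • v2' t, v1, v1',
    ⟨acX, acY, ac1, (L1.const_smul x1).add (L2.const_smul x2),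
      (L1.const_smul y1).add (L2.const_smul y2), L1, ?_, integrable_perp_comb _ _ c1 c2 i1 i2,
      integrable_perp_comb _ _ c1 c2 i1 i2, fun hL => ?_⟩, hae'⟩
  · refine harmonic_mem (acX.continuousOn_Icc S.a_lt_b.le) (acY.continuousOn_Icc S.a_lt_b.le) c1 ?_
    filter_upwards [hae', hmin.1.2] with p h1 h2
    rw [← h1]; exact h2
  · simp only [l1 hL, l2 hL, and_self]

theorem HarmonicField.exists_form (hF : HarmonicField S T X X' Y Y' Z Z')
    (hae : ∀ᵐ p ∂(volume.restrict S.cell), S.pull m p =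
      Real.cos p.1 • perp (X p.2) + Real.sin p.1 • perp (Y p.2) + Z p.2 2 • e3) :
    ∃ u, S.IsFirstHarmonicForm T m u (fun t => toPlaneL (X t)) (fun t => toPlaneL (Y t))
      fun t => Z t 2 := by
  have cX := hF.acX.continuousOn_Icc S.a_lt_b.le
  have cY := hF.acY.continuousOn_Icc S.a_lt_b.le
  have cZ := hF.acZ.continuousOn_Icc S.a_lt_b.le
  obtain ⟨u, hu⟩ := S.exists_field_trig (A := fun t => perp (X t)) (B := fun t => perp (Y t))
    (C := fun t => Z t 2 • e3) (fun t ht hx => by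
      obtain ⟨σ, h⟩ := exists_isPole ht hx
      exact ⟨h.perp_eq_zero cX hF.intX, h.perp_eq_zero cY hF.intY⟩)
    fun hL => by obtain ⟨h1, h2, h3⟩ := hF.loop hL; rw [h1, h2, h3]; exact ⟨rfl, rfl, rfl⟩
  refine ⟨u, ?_, ?_, ?_, ?_, ?_, ?_, ?_, ?_, fun φ t ht => ?_⟩
  · rintro p ⟨φ, t, ht, rfl⟩
    rw [hu φ t ht]
    exact hF.mem φ t ht
  · filter_upwards [hae, ae_restrict_mem S.measurableSet_cell] with p hp hpc
    rw [hp, pull, hu _ _ (Ioo_subset_Icc_self hpc.2)]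
  · exact (intervalH1_of_isAC S.a_lt_b hF.acX hF.memX).clm toPlaneL
  · exact (intervalH1_of_isAC S.a_lt_b hF.acY hF.memY).clm toPlaneL
  · exact (intervalH1_of_isAC S.a_lt_b hF.acZ hF.memZ).clm (EuclideanSpace.proj 2)
  · exact toPlaneL.continuous.comp_continuousOn cX
  · exact toPlaneL.continuous.comp_continuousOn cY
  · exact (EuclideanSpace.proj (2 : Fin 3) : E3 →L[ℝ] ℝ).continuous.comp_continuousOn cZ
  · rw [hu φ t ht, planar_toPlaneL, planar_toPlaneL]

end SurfaceOfRevolution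

/-! ### Never flat targets: conformality and the frozen competitor -/

theorem eq_of_continuous_of_finite {f : ℝ → ℝ} (hf : Continuous f) {R : Finset ℝ}
    (h : ∀ x, f x ∈ R) (x y : ℝ) : f x = f y := by
  by_contra hne
  have h1 : uIcc (f x) (f y) ⊆ (R : Set ℝ) := by
    intro c hc
    obtain ⟨z, -, rfl⟩ := intermediate_value_uIcc (hf.continuousOn (s := uIcc x y)) hc
    exact h z
  have h2 : (uIcc (f x) (f y)).Infinite := by
    rw [uIcc]
    exact Icc_infinite (min_lt_max.2 hne)
  exact h2 (R.finite_toSet.subset h1)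

/-- Two orthogonal vectors of the same length in the plane differ by a quarter turn. -/
theorem eq_quarter_or {u v : E3} (hn : ‖perp u‖ = ‖perp v‖)
    (ho : inner ℝ (perp u) (perp v) = 0) : perp v = quarter u ∨ perp v = -quarter u := by
  have h1 : ‖perp u‖ ^ 2 = ‖perp v‖ ^ 2 := by rw [hn]
  rw [norm_perp_sq, norm_perp_sq] at h1
  have h2 : u 0 * v 0 + u 1 * v 1 = 0 := by
    rw [inner_eq_coords] at ho; simpa using ho
  -- Lagrange's identity gives `d² = n²`, and the sign of the determinant `d` decides the sense of
  -- the quarter turn.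
  set d := u 0 * v 1 - u 1 * v 0 with hd
  set n := u 0 ^ 2 + u 1 ^ 2 with hnn
  have h3 : (d - n) * (d + n) = 0 := by
    have : d ^ 2 + (u 0 * v 0 + u 1 * v 1) ^ 2 = n * (v 0 ^ 2 + v 1 ^ 2) := by rw [hd, hnn]; ring
    rw [h2, ← h1] at this
    linear_combination this
  rcases mul_eq_zero.1 h3 with h4 | h4
  · have h5 : (v 0 + u 1) ^ 2 + (v 1 - u 0) ^ 2 = 0 := by
      have e : (v 0 + u 1) ^ 2 + (v 1 - u 0) ^ 2 =
        (v 0 ^ 2 + v 1 ^ 2) + (u 0 ^ 2 + u 1 ^ 2) - 2 * (u 0 * v 1 - u 1 * v 0) := by ring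
      rw [e, ← h1, ← hd]; linarith
    have k0 : v 0 + u 1 = 0 := by nlinarith [sq_nonneg (v 0 + u 1), sq_nonneg (v 1 - u 0)]
    have k1 : v 1 - u 0 = 0 := by nlinarith [sq_nonneg (v 0 + u 1), sq_nonneg (v 1 - u 0)]
    left; apply ext_coords <;> simp <;> linarith
  · have h5 : (v 0 - u 1) ^ 2 + (v 1 + u 0) ^ 2 = 0 := by
      have e : (v 0 - u 1) ^ 2 + (v 1 + u 0) ^ 2 =
        (v 0 ^ 2 + v 1 ^ 2) + (u 0 ^ 2 + u 1 ^ 2) + 2 * (u 0 * v 1 - u 1 * v 0) := by ring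
      rw [e, ← h1, ← hd]; linarith
    have k0 : v 0 - u 1 = 0 := by nlinarith [sq_nonneg (v 0 - u 1), sq_nonneg (v 1 + u 0)]
    have k1 : v 1 + u 0 = 0 := by nlinarith [sq_nonneg (v 0 - u 1), sq_nonneg (v 1 + u 0)]
    right; apply ext_coords <;> simp <;> linarith

theorem integral_comp_double {h : ℝ → ℝ} (hc : Continuous h)
    (hp : Function.Periodic h (2 * Real.pi)) :
    ∫ φ in Ioo 0 (2 * Real.pi), h (2 * φ) = ∫ φ in Ioo 0 (2 * Real.pi), h φ := by
  rw [integral_Ioo_two_pi, integral_Ioo_two_pi,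
    intervalIntegral.integral_comp_mul_left (fun φ => h φ) two_ne_zero, mul_zero,
    ← intervalIntegral.integral_add_adjacent_intervals (hc.intervalIntegrable 0 (2 * Real.pi))
      (hc.intervalIntegrable (2 * Real.pi) (2 * (2 * Real.pi)))]
  have := hp.intervalIntegral_add_eq (2 * Real.pi) 0
  rw [zero_add, ← two_mul] at this
  rw [this, smul_eq_mul]; ring

theorem rot_perp_add (ε φ : ℝ) (hε : ε = 1 ∨ ε = -1) (v w : E3) :
    rot (ε * φ) (perp v + w 2 • e3) =
      Real.cos φ • perp v + Real.sin φ • (ε • quarter v) + w 2 • e3 := by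
  rw [SurfaceOfRevolution.rot_sign_eq hε]
  apply ext_coords <;> simp

/-- The parallelogram law for the co-rotating and the counter-rotating part of a first harmonic:
their energies add up without a mixed term. -/
theorem norm_perp_sq_add {ε : ℝ} (hε : ε = 1 ∨ ε = -1) (x y : E3) :
    ‖perp x‖ ^ 2 + ‖perp y‖ ^ 2 =
      2 * ‖perp ((1 / 2 : ℝ) • x + (-(ε / 2)) • quarter y)‖ ^ 2 +
      2 * ‖perp ((1 / 2 : ℝ) • x + (ε / 2) • quarter y)‖ ^ 2 := by
  have hε2 := SurfaceOfRevolution.sign_sq hε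
  simp only [norm_perp_sq, PiLp.add_apply, PiLp.smul_apply, quarter_apply_zero,
    quarter_apply_one, smul_eq_mul]
  linear_combination (-(y 0 ^ 2 + y 1 ^ 2)) * hε2

/-- Freezing the counter-rotating part does not change a co-rotating first harmonic. -/
theorem freeze_of_co {ε : ℝ} (hε : ε = 1 ∨ ε = -1) {X Y Z : E3}
    (h : perp Y = ε • quarter X) (φ : ℝ) :
    Real.cos φ • perpL ((1 / 2 : ℝ) • X + (-(ε / 2)) • quarter Y) +
        Real.sin φ • (ε • quarterL) ((1 / 2 : ℝ) • X + (-(ε / 2)) • quarter Y) +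
        (perpL ((1 / 2 : ℝ) • X + (ε / 2) • quarter Y) + vertL Z) =
      Real.cos φ • perp X + Real.sin φ • perp Y + Z 2 • e3 := by
  have k0 : Y 0 = -(ε * X 1) := by simpa using congrArg (fun w : E3 => w 0) h
  have k1 : Y 1 = ε * X 0 := by simpa using congrArg (fun w : E3 => w 1) h
  rcases hε with rfl | rfl <;> apply ext_coords <;> simp [k0, k1] <;> ring

/-- Freezing the counter-rotating part makes a counter-rotating first harmonic constant. -/
theorem freeze_of_counter {ε : ℝ} (hε : ε = 1 ∨ ε = -1) {X Y Z : E3}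
    (h : perp Y = -(ε • quarter X)) (φ : ℝ) :
    Real.cos φ • perpL ((1 / 2 : ℝ) • X + (-(ε / 2)) • quarter Y) +
        Real.sin φ • (ε • quarterL) ((1 / 2 : ℝ) • X + (-(ε / 2)) • quarter Y) +
        (perpL ((1 / 2 : ℝ) • X + (ε / 2) • quarter Y) + vertL Z) =
      perp X + Z 2 • e3 := by
  have k0 : Y 0 = ε * X 1 := by simpa using congrArg (fun w : E3 => w 0) h
  have k1 : Y 1 = -(ε * X 0) := by simpa using congrArg (fun w : E3 => w 1) h
  rcases hε with rfl | rfl <;> apply ext_coords <;> simp [k0, k1] <;> ring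

/-- If the counter-rotating part vanishes, a first harmonic is co-rotating. -/
theorem harmonic_eq_rot {ε : ℝ} (hε : ε = 1 ∨ ε = -1) {X Y Z : E3}
    (h : perp ((1 / 2 : ℝ) • X + (ε / 2) • quarter Y) = 0) (φ : ℝ) :
    Real.cos φ • perp X + Real.sin φ • perp Y + Z 2 • e3 =
      rot (ε * φ) (perp X + Z 2 • e3) := by
  have k0 : 1 / 2 * X 0 - ε / 2 * Y 1 = 0 := by
    have := congrArg (fun w : E3 => w 0) h
    simp at this; linarith
  have k1 : 1 / 2 * X 1 + ε / 2 * Y 0 = 0 := by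
    have := congrArg (fun w : E3 => w 1) h
    simp at this; linarith
  rw [rot_perp_add ε φ hε]
  congr 3
  rcases hε with rfl | rfl <;> apply ext_coords <;> simp <;> linarith

namespace SurfaceOfRevolution

variable {S T : SurfaceOfRevolution} {ε : ℝ} {g : ℝ → ℝ} {a m : E3 → E3}
  {X X' Y Y' Z Z' : ℝ → E3}

/-- On a horizontal section of a never flat surface a first harmonic is a uniform rotation. -/
theorem NeverFlat.harmonic (hT : T.NeverFlat) {A B C : E3}
    (h : ∀ φ, Real.cos φ • perp A + Real.sin φ • perp B + C 2 • e3 ∈ T.carrier) :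
    ‖perp A‖ = ‖perp B‖ ∧ inner ℝ (perp A) (perp B) = 0 := by
  obtain ⟨R, -, hR⟩ := hT (C 2)
  -- The height does not depend on `φ`, so all points lie in one horizontal section, and their
  -- distance from the axis is a continuous function with finitely many values.
  set f : ℝ → ℝ := fun φ => ‖Real.cos φ • perp A + Real.sin φ • perp B‖ with hf
  have hmem : ∀ φ, f φ ∈ R := by
    intro φ
    have h1 : perp (Real.cos φ • perp A + Real.sin φ • perp B + C 2 • e3) ∈
        ⋃ r ∈ R, horizontalCircle r := by
      rw [← hR]
      exact ⟨_, ⟨h φ, by simp⟩, rfl⟩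
    simp only [mem_iUnion, exists_prop] at h1
    obtain ⟨r, hr, -, hn⟩ := h1
    have e : perp (Real.cos φ • perp A + Real.sin φ • perp B + C 2 • e3) =
        Real.cos φ • perp A + Real.sin φ • perp B := by apply ext_coords <;> simp
    rw [e] at hn
    rw [hf]; beta_reduce; rw [hn]; exact hr
  have hconst := eq_of_continuous_of_finite (f := f) (by fun_prop) hmem
  have h1 := hconst 0 (Real.pi / 2)
  simp only [hf, Real.cos_zero, Real.sin_zero, Real.cos_pi_div_two, Real.sin_pi_div_two, one_smul,
    zero_smul, add_zero, zero_add] at h1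
  refine ⟨h1, ?_⟩
  -- At `π / 4` the squared length is the mean of the two squared lengths plus the inner product;
  -- with equal lengths the inner product must vanish.
  have h2 := hconst (Real.pi / 4) 0
  simp only [hf, Real.cos_zero, Real.sin_zero, Real.cos_pi_div_four, Real.sin_pi_div_four, one_smul,
    zero_smul, add_zero] at h2
  have h3 : ‖(√2 / 2) • perp A + (√2 / 2) • perp B‖ ^ 2 = ‖perp A‖ ^ 2 := by rw [h2]
  rw [← smul_add, norm_smul, mul_pow, norm_add_sq_real, ← h1, Real.norm_eq_abs, sq_abs, div_pow,
    Real.sq_sqrt zero_le_two] at h3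
  linarith

theorem HarmonicField.quarter_or (hF : HarmonicField S T X X' Y Y' Z Z') (hT : T.NeverFlat)
    (hε : ε = 1 ∨ ε = -1) {t : ℝ} (ht : t ∈ Icc S.a S.b) :
    perp (Y t) = ε • quarter (X t) ∨ perp (Y t) = -(ε • quarter (X t)) := by
  obtain ⟨h1, h2⟩ := hT.harmonic fun φ => hF.mem φ t ht
  rcases hε with rfl | rfl
  · simpa using eq_quarter_or h1 h2
  · simpa using (eq_quarter_or h1 h2).symm

theorem HarmonicField.lineSymmetric (hF : HarmonicField S T X X' Y Y' Z Z') (hT : T.NeverFlat)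
    {u : E3 → E3} (hu : ∀ φ, ∀ t ∈ Icc S.a S.b, u (S.param φ t) =
      Real.cos φ • perp (X t) + Real.sin φ • perp (Y t) + Z t 2 • e3) : S.LineSymmetric u := by
  rintro p ⟨θ, t, ht, rfl⟩
  rcases hF.quarter_or hT (Or.inl rfl) ht with h | h
  · left
    have h1 : ∀ φ, u (S.param φ t) = rot (1 * φ) (perp (X t) + Z t 2 • e3) := fun φ => by
      rw [hu φ t ht, h, rot_perp_add 1 φ (Or.inl rfl)]
    intro φ
    rw [rot_param, h1, h1, rot_rot, one_mul, one_mul]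
  · right
    have h1 : ∀ φ, u (S.param φ t) = rot (-1 * φ) (perp (X t) + Z t 2 • e3) := fun φ => by
      rw [hu φ t ht, h, rot_perp_add (-1) φ (Or.inr rfl), neg_one_smul, one_smul]
    intro φ
    rw [rot_param, h1, h1, rot_rot, neg_one_mul, neg_one_mul, neg_add]

theorem weakD1_of_isAC_Icc {v v' : ℝ → E3} (hv : IsAC v v' (Icc S.a S.b))
    (hL : MemLp v' 2 (volume.restrict (Ioo S.a S.b))) (hloop : S.IsLoop → v S.a = v S.b) :
    S.WeakD1 v v' := by
  obtain ⟨K, hK⟩ := isCompact_Icc.exists_bound_of_continuousOn (hv.continuousOn_Icc S.a_lt_b.le)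
  obtain ⟨M, hM, hx⟩ := S.exists_x_bound
  refine weakD1_of_isAC (hv.mono Ioo_subset_Icc_self)
    ⟨K, fun t ht => hK t (Ioo_subset_Icc_self ht)⟩ hL.1 ?_ fun h => ?_
  · refine Integrable.mono' (((memLp_two_iff_integrable_sq_norm hL.1).1 hL).mul_const M)
      ((hL.1.norm.pow 2).mul aestronglyMeasurable_x) ?_
    filter_upwards [ae_restrict_mem measurableSet_Ioo] with t ht
    rw [Real.norm_of_nonneg (mul_nonneg (sq_nonneg _) (S.x_pos t ht).le)]
    exact mul_le_mul_of_nonneg_left (hx t (Ioo_subset_Icc_self ht)) (sq_nonneg _)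
  · have h1 := hv.eq_add (left_mem_Icc.2 S.a_lt_b.le) (right_mem_Icc.2 S.a_lt_b.le)
    rw [intervalIntegral.integral_of_le S.a_lt_b.le, integral_Ioc_eq_integral_Ioo, hloop h] at h1
    exact left_eq_add.1 h1

/-- The potential energy does not change when the counter-rotating part of a field is frozen. -/
theorem integral_potential_frozen (hε : ε = 1 ∨ ε = -1) (hg : Continuous g) (V b : E3) (c : ℝ) :
    ∫ φ in Ioo 0 (2 * Real.pi), g (inner ℝ (rot (-(ε * φ)) V) (rot (ε * φ) b)) * c =
      ∫ φ in Ioo 0 (2 * Real.pi), g (inner ℝ V (rot (ε * φ) b)) * c := by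
  have hr : Continuous fun φ : ℝ => rot (ε * φ) b := by simp only [rot_sign_eq hε]; fun_prop
  -- Moving the rotation from `V` to `b` doubles the angle, and the integral over a full period does
  -- not see the doubling.
  have h := integral_comp_double (h := fun φ => g (inner ℝ V (rot (ε * φ) b)) * c)
    ((hg.comp (continuous_const.inner hr)).mul continuous_const) fun φ => by
      simp only [rot_sign_eq hε, Real.cos_add_two_pi, Real.sin_add_two_pi]
  rw [← h]
  congr 1
  funext φ
  rw [inner_rot_left, neg_neg, rot_rot]
  congr 4; ring

set_option maxHeartbeats 400000 in
/-- Null-average minimizers with values in a never flat surface have the symmetry of `a`. -/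
theorem HarmonicField.equivariant (hF : HarmonicField S T X X' Y Y' Z Z') (hT : T.NeverFlat)
    (hε : ε = 1 ∨ ε = -1) (hg : Continuous g) (ha : ContinuousOn a S.carrier)
    (hae : S.Equivariant ε a) {u : E3 → E3} (hmin : S.IsMinimizer T g a u)
    (hu : ∀ φ, ∀ t ∈ Icc S.a S.b, u (S.param φ t) =
      Real.cos φ • perp (X t) + Real.sin φ • perp (Y t) + Z t 2 • e3) : S.Equivariant ε u := by
  have cX := hF.acX.continuousOn_Icc S.a_lt_b.le
  have cY := hF.acY.continuousOn_Icc S.a_lt_b.le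
  have cJY : ContinuousOn (fun t => quarter (Y t)) (Icc S.a S.b) :=
    quarterL.continuous.comp_continuousOn cY
  have wX := weakD1_of_isAC_Icc hF.acX hF.memX fun h => (hF.loop h).1
  have wY := weakD1_of_isAC_Icc hF.acY hF.memY fun h => (hF.loop h).2.1
  have wZ := weakD1_of_isAC_Icc hF.acZ hF.memZ fun h => (hF.loop h).2.2
  have iJY : IntegrableOn (fun t => ‖perp (quarter (Y t))‖ ^ 2 * (S.x t)⁻¹) (Ioo S.a S.b) := by
    have e : ∀ t, ‖perp (quarter (Y t))‖ = ‖perp (Y t)‖ := fun t => by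
      rw [← norm_quarter (Y t)]; congr 1
    simp only [e]; exact hF.intY
  -- the co-rotating and the counter-rotating part
  obtain ⟨P, hP⟩ : ∃ f : ℝ → E3, f =
      fun t => (1 / 2 : ℝ) • X t + (-(ε / 2)) • quarter (Y t) := ⟨_, rfl⟩
  obtain ⟨P', hP'⟩ : ∃ f : ℝ → E3, f =
      fun t => (1 / 2 : ℝ) • X' t + (-(ε / 2)) • quarter (Y' t) := ⟨_, rfl⟩
  obtain ⟨Q, hQ⟩ : ∃ f : ℝ → E3, f =
      fun t => (1 / 2 : ℝ) • X t + (ε / 2) • quarter (Y t) := ⟨_, rfl⟩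
  obtain ⟨Q', hQ'⟩ : ∃ f : ℝ → E3, f =
      fun t => (1 / 2 : ℝ) • X' t + (ε / 2) • quarter (Y' t) := ⟨_, rfl⟩
  have wP : S.WeakD1 P P' := by
    rw [hP, hP']; exact (wX.const_smul _).add ((wY.clm quarterL).const_smul _)
  have wQ : S.WeakD1 Q Q' := by
    rw [hQ, hQ']; exact (wX.const_smul _).add ((wY.clm quarterL).const_smul _)
  have iP : IntegrableOn (fun t => ‖perp (P t)‖ ^ 2 * (S.x t)⁻¹) (Ioo S.a S.b) := by
    rw [hP]; exact integrable_perp_comb _ _ cX cJY hF.intX iJY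
  have iQ : IntegrableOn (fun t => ‖perp (Q t)‖ ^ 2 * (S.x t)⁻¹) (Ioo S.a S.b) := by
    rw [hQ]; exact integrable_perp_comb _ _ cX cJY hF.intX iJY
  have cQ : ContinuousOn Q (Icc S.a S.b) := by
    rw [hQ]; exact (cX.const_smul (1 / 2 : ℝ)).add (cJY.const_smul (ε / 2))
  have hsum := fun x y => norm_perp_sq_add hε x y
  -- the competitor
  have hA := wP.clm perpL
  have hB := wP.clm (ε • quarterL)
  have hC := (wQ.clm perpL).add (wZ.clm vertL)
  -- The co-rotating part `P` keeps turning and the counter-rotating part `Q` is frozen. Both are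
  -- linear in `X` and `Y`, so the competitor is an `H¹` field even where the sense of rotation
  -- changes from one circle to another.
  obtain ⟨v, hv⟩ := S.exists_field_Ioo (fun t => perpL (P t)) (fun t => (ε • quarterL) (P t))
    fun t => perpL (Q t) + vertL (Z t)
  have hJ : ∀ p : E3, ‖(ε • quarterL) p‖ ^ 2 = ‖perp p‖ ^ 2 := fun p => norm_sign_quarter hε p
  have hAB : IntegrableOn (fun t => (‖perpL (P t)‖ ^ 2 + ‖(ε • quarterL) (P t)‖ ^ 2) * (S.x t)⁻¹)
      (Ioo S.a S.b) := by
    refine (iP.const_mul 2).congr ?_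
    filter_upwards with t
    rw [hJ, perpL_apply]; ring
  -- On each circle one of the two parts vanishes: either nothing changes, or the whole circle is
  -- sent to the value of `u` at angle `0`. In both cases the values stay in `T`.
  have hcases : ∀ t ∈ Ioo S.a S.b, (∀ φ, v (S.param φ t) = u (S.param φ t)) ∨
      (∀ φ, v (S.param φ t) = perp (X t) + Z t 2 • e3) ∧
      ∀ φ, u (S.param φ t) = rot (-(ε * φ)) (perp (X t) + Z t 2 • e3) := by
    intro t ht
    have htc := Ioo_subset_Icc_self ht
    rcases hF.quarter_or hT hε htc with h | h
    · exact Or.inl fun φ => by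
        rw [hv φ t ht, hu φ t htc]
        simp only [hP, hQ]
        exact freeze_of_co hε h φ
    · refine Or.inr ⟨fun φ => ?_, fun φ => ?_⟩
      · rw [hv φ t ht]
        simp only [hP, hQ]
        exact freeze_of_counter hε h φ
      · rw [hu φ t htc, h, ← neg_mul, rot_perp_add (-ε) φ (by
          rcases hε with rfl | rfl <;> norm_num), neg_smul]
  have hvH := memH1_trig hA hB hC hAB hv
  have hvT : ∀ᵐ p ∂(volume.restrict S.cell), S.pull v p ∈ T.carrier :=
    S.ae_cell_of_forall fun φ t ht => by
      have htc := Ioo_subset_Icc_self ht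
      rw [pull]
      rcases hcases t ht with h | ⟨h, -⟩
      · rw [h φ, hu φ t htc]; exact hF.mem φ t htc
      · rw [h φ]; simpa using hF.mem 0 t htc
  have hle := hmin.2 v ⟨hvH, hvT⟩
  -- the energies
  have hAu := wX.clm perpL
  have hBu := wY.clm perpL
  have hCu := wZ.clm vertL
  have hABu : IntegrableOn (fun t => (‖perpL (X t)‖ ^ 2 + ‖perpL (Y t)‖ ^ 2) * (S.x t)⁻¹)
      (Ioo S.a S.b) := by
    simp only [add_mul]; exact hF.intX.add hF.intY
  have hu' : ∀ φ, ∀ t ∈ Ioo S.a S.b, u (S.param φ t) =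
      Real.cos φ • perpL (X t) + Real.sin φ • perpL (Y t) + vertL (Z t) :=
    fun φ t ht => hu φ t (Ioo_subset_Icc_self ht)
  have hpot : ∫ p in S.cell, g (inner ℝ (S.pull v p) (S.pull a p)) * S.areaElt p.2 =
      ∫ p in S.cell, g (inner ℝ (S.pull u p) (S.pull a p)) * S.areaElt p.2 := by
    rw [integral_cell_symm (integrableOn_potential hg ha hvH.1 hvT),
      integral_cell_symm (integrableOn_potential hg ha hmin.1.1.1 hmin.1.2)]
    refine setIntegral_congr_fun measurableSet_Ioo fun t ht => ?_
    simp only [pull]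
    rcases hcases t ht with h | ⟨h1, h2⟩
    · simp only [h]
    · obtain ⟨b, hb⟩ : ∃ b, ∀ φ, a (S.param φ t) = rot (ε * φ) b :=
        ⟨_, fun φ => hae.apply_param φ (Ioo_subset_Icc_self ht)⟩
      simp only [h1, h2, hb]
      exact (integral_potential_frozen hε hg _ b _).symm
  rw [energy_eq (isWeakGradient_trig hAu hBu hCu hABu hu'), energy_eq
    (isWeakGradient_trig hA hB hC hAB hv), hpot, integral_gradSq_trig hAu hBu hCu hABu,
    integral_gradSq_trig hA hB hC hAB] at hle
  obtain ⟨K, hK, hcmp⟩ := S.exists_weight_comparison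
  have j1 : IntegrableOn (fun t => ‖perp (Q t)‖ ^ 2 * (S.h2 t / S.x t)) (Ioo S.a S.b) := by
    refine integrableOn_mul_weight (C := K) iQ
      ((continuous_perp.comp_aestronglyMeasurable wQ.meas).norm.pow 2) aesm_h2_div_x
      (fun _ => sq_nonneg _) ?_
    filter_upwards [ae_restrict_mem measurableSet_Ioo] with t ht using (hcmp t ht).1
  have j2 : IntegrableOn (fun t => ‖perpL (P t)‖ ^ 2 * (S.h2 t / S.x t)) (Ioo S.a S.b) := by
    refine integrableOn_mul_weight (C := K) iP
      ((continuous_perp.comp_aestronglyMeasurable wP.meas).norm.pow 2) aesm_h2_div_x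
      (fun _ => sq_nonneg _) ?_
    filter_upwards [ae_restrict_mem measurableSet_Ioo] with t ht using (hcmp t ht).1
  have jd : ∀ {y y' : ℝ → E3}, S.WeakD1 y y' →
      IntegrableOn (fun t => ‖y' t‖ ^ 2 * (S.x t / S.h2 t)) (Ioo S.a S.b) := fun hy => by
    refine integrableOn_mul_weight (C := K) hy.sq_int (hy.meas'.norm.pow 2) aesm_x_div_h2
      (fun _ => sq_nonneg _) ?_
    filter_upwards [ae_restrict_mem measurableSet_Ioo] with t ht using (hcmp t ht).2.2.1
  have jv : IntegrableOn (fun t => Real.pi * (‖perpL (P t)‖ ^ 2 + ‖(ε • quarterL) (P t)‖ ^ 2) *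
      (S.h2 t / S.x t) + (Real.pi * (‖perpL (P' t)‖ ^ 2 + ‖(ε • quarterL) (P' t)‖ ^ 2) +
        2 * Real.pi * ‖perpL (Q' t) + vertL (Z' t)‖ ^ 2) * (S.x t / S.h2 t)) (Ioo S.a S.b) := by
    refine ((j2.const_mul (2 * Real.pi)).add (((jd hA).const_mul (2 * Real.pi)).add
      ((jd hC).const_mul (2 * Real.pi)))).congr ?_
    filter_upwards with t
    simp only [Pi.add_apply]
    rw [hJ, hJ, perpL_apply, perpL_apply]; ring
  -- The `t`-derivatives of both fields contribute equally, since the parts are orthogonal in the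
  -- mean; freezing removes exactly the angular energy of `Q`.
  have hdens : ∀ t, Real.pi * (‖perpL (X t)‖ ^ 2 + ‖perpL (Y t)‖ ^ 2) * (S.h2 t / S.x t) +
      (Real.pi * (‖perpL (X' t)‖ ^ 2 + ‖perpL (Y' t)‖ ^ 2) + 2 * Real.pi * ‖vertL (Z' t)‖ ^ 2) *
        (S.x t / S.h2 t) =
      (Real.pi * (‖perpL (P t)‖ ^ 2 + ‖(ε • quarterL) (P t)‖ ^ 2) *
      (S.h2 t / S.x t) + (Real.pi * (‖perpL (P' t)‖ ^ 2 + ‖(ε • quarterL) (P' t)‖ ^ 2) +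
        2 * Real.pi * ‖perpL (Q' t) + vertL (Z' t)‖ ^ 2) * (S.x t / S.h2 t)) +
      2 * Real.pi * (‖perp (Q t)‖ ^ 2 * (S.h2 t / S.x t)) := fun t => by
    have e1 : ‖perpL (Q' t) + vertL (Z' t)‖ ^ 2 = ‖perp (Q' t)‖ ^ 2 + ‖vertL (Z' t)‖ ^ 2 := by
      simp only [norm_sq_eq_coords]; simp
    have e2 := hsum (X t) (Y t)
    have e3 := hsum (X' t) (Y' t)
    rw [e1, hJ, hJ]
    simp only [perpL_apply, hP, hP', hQ, hQ']
    rw [e2, e3]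
    ring
  simp only [hdens] at hle
  rw [integral_add jv (j1.const_mul _), integral_const_mul] at hle
  have hQ0 : ∫ t in Ioo S.a S.b, ‖perp (Q t)‖ ^ 2 * (S.h2 t / S.x t) ≤ 0 := by
    have := Real.two_pi_pos
    by_contra hcon
    push Not at hcon
    have := mul_pos this hcon
    linarith
  have hnn : 0 ≤ᵐ[volume.restrict (Ioo S.a S.b)] fun t =>
      ‖perp (Q t)‖ ^ 2 * (S.h2 t / S.x t) := by
    filter_upwards [ae_restrict_mem measurableSet_Ioo] with t ht
    exact mul_nonneg (sq_nonneg _) (hcmp t ht).1.1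
  have hzero := (integral_eq_zero_iff_of_nonneg_ae hnn j1).1
    (le_antisymm hQ0 (integral_nonneg_of_ae hnn))
  have hpQ : ContinuousOn (fun t => perp (Q t)) (Icc S.a S.b) :=
    continuous_perp.comp_continuousOn cQ
  -- The angular energy of `Q` vanishes and its weight is positive, so by continuity its horizontal
  -- part is zero everywhere.
  have hQz : ∀ t ∈ Ioo S.a S.b, perp (Q t) ∈ ({0} : Set E3) := by
    refine mem_of_ae_mem (μ := volume) isOpen_Ioo (hpQ.mono Ioo_subset_Icc_self)
      isClosed_singleton ?_
    filter_upwards [hzero, ae_restrict_mem measurableSet_Ioo] with t h1 ht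
    have hpos : 0 < S.h2 t / S.x t :=
      div_pos (S.h2_pos (Ioo_subset_Icc_self ht)) (S.x_pos t ht)
    have h2 := (mul_eq_zero.1 h1).resolve_right hpos.ne'
    exact norm_eq_zero.1 (pow_eq_zero_iff two_ne_zero |>.1 h2)
  have hQzc : ∀ t ∈ Icc S.a S.b, perp (Q t) = 0 := fun t ht => by
    have hcl : t ∈ closure (Ioo S.a S.b) := by rw [S.closure_Ioo_eq]; exact ht
    exact isClosed_singleton.closure_subset
      (((hpQ t ht).mono Ioo_subset_Icc_self).mem_closure hcl hQz)
  have hfin : ∀ φ, ∀ t ∈ Icc S.a S.b, u (S.param φ t) = rot (ε * φ) (perp (X t) + Z t 2 • e3) := by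
    intro φ t ht
    rw [hu φ t ht, harmonic_eq_rot hε (by simpa only [hQ] using hQzc t ht)]
  rintro φ p ⟨θ, t, ht, rfl⟩
  rw [rot_param, hfin _ t ht, hfin _ t ht, rot_rot, mul_add]

end SurfaceOfRevolution

theorem inner_eq_coords_two (v w : E2) : inner ℝ v w = v 0 * w 0 + v 1 * w 1 := by
  simp [PiLp.inner_apply, Fin.sum_univ_two]; ring

/-! ### Assembly of the theorem -/

namespace SurfaceOfRevolution

variable {S T : SurfaceOfRevolution} {ε : ℝ} {g : ℝ → ℝ} {a m u : E3 → E3}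

theorem equivariant_one : S.Equivariant 1 u ↔ S.AxiallySymmetric u := by
  simp [Equivariant, AxiallySymmetric]

theorem equivariant_neg_one : S.Equivariant (-1) u ↔ S.AxiallyAntisymmetric u := by
  simp [Equivariant, AxiallyAntisymmetric]

theorem exists_equivariant (h : S.AxiallySymmetric a ∨ S.AxiallyAntisymmetric a) :
    ∃ ε : ℝ, (ε = 1 ∨ ε = -1) ∧ S.Equivariant ε a :=
  h.elim (fun h => ⟨1, Or.inl rfl, equivariant_one.2 h⟩)
    fun h => ⟨-1, Or.inr rfl, equivariant_neg_one.2 h⟩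

/-- A null-average minimizer has a representative in first harmonic form; if the target is never
flat, then it is line symmetric, its coefficients are conformal, and it has the symmetry of `a`. -/
theorem exists_isFirstHarmonicForm (hmin : S.IsMinimizer T g a m) (h0 : S.NullAverage m)
    (hε : ε = 1 ∨ ε = -1) (hg : Continuous g) (hg0 : ∀ s, 0 ≤ g s) (ha : ContinuousOn a S.carrier)
    (hae : S.Equivariant ε a) :
    ∃ u α β η, S.IsFirstHarmonicForm T m u α β η ∧ (T.NeverFlat → S.Equivariant ε u ∧
      S.LineSymmetric u ∧ (∀ t ∈ Icc S.a S.b, inner ℝ (β t) (α t) = 0) ∧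
      ∀ t ∈ Icc S.a S.b, ‖β t‖ = ‖α t‖) := by
  obtain ⟨X, X', Y, Y', Z, Z', hF, hm⟩ := exists_harmonic hmin h0 hε hg hg0 ha hae
  obtain ⟨u, hu⟩ := hF.exists_form hm
  have hform := hu.form
  simp only [planar_toPlaneL] at hform
  refine ⟨u, _, _, _, hu, fun hT => ⟨hF.equivariant hT hε hg ha hae (hmin.congr hu.aeEq) hform,
    hF.lineSymmetric hT hform, fun t ht => ?_, fun t ht => ?_⟩⟩
  · have h := (hT.harmonic fun φ => hF.mem φ t ht).2
    rw [inner_eq_coords] at h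
    rw [inner_eq_coords_two]
    simp at h ⊢
    linarith
  · have h := (hT.harmonic fun φ => hF.mem φ t ht).1
    rw [← sq_eq_sq₀ (norm_nonneg _) (norm_nonneg _), norm_perp_sq, norm_perp_sq] at h
    rw [← sq_eq_sq₀ (norm_nonneg _) (norm_nonneg _), norm_sq_eq_coords_two, norm_sq_eq_coords_two]
    simpa using h.symm

theorem exists_equivariant_minimizer_iff (hε : ε = 1 ∨ ε = -1) (hg : Continuous g)
    (hg0 : ∀ s, 0 ≤ g s) (ha : ContinuousOn a S.carrier) (hae : S.Equivariant ε a) :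
    (∃ u, S.IsMinimizer T g a u ∧ MapsTo u S.carrier T.carrier ∧ S.Equivariant ε u) ↔
      ∃ m, S.IsMinimizer T g a m ∧ S.NullAverage m :=
  ⟨fun ⟨u, hu, _, hs⟩ => ⟨u, hu, hs.nullAverage hε⟩,
    fun ⟨_, hm, h0⟩ => exists_equivariant_minimizer hm h0 hε hg hg0 ha hae⟩

end SurfaceOfRevolution

end

end AxialSym

theorem theorem3 (S T : AxialSym.SurfaceOfRevolution)
    (g : ℝ → ℝ) (hg_nonneg : ∀ s, 0 ≤ g s) (hg_lip : ∃ K, LipschitzWith K g)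
    (a : E3 → E3) (ha_lip : ∃ K, LipschitzOnWith K a S.carrier) :
    -- (i) axially null-average minimizers contain only first harmonics in the angle
    ((S.AxiallySymmetric a ∨ S.AxiallyAntisymmetric a) →
      ∀ m, S.IsMinimizer T g a m → S.NullAverage m →
        ∃ u α β η, S.IsFirstHarmonicForm T m u α β η) ∧
    -- (ii) never flat targets
    (T.NeverFlat →
      (S.AxiallySymmetric a → (∃ m, S.IsMinimizer T g a m ∧ S.NullAverage m) →
        (∀ m, S.IsMinimizer T g a m → S.NullAverage m →
          ∃ u, Set.MapsTo u S.carrier T.carrier ∧ S.AEEq m u ∧ S.AxiallySymmetric u) ∨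
        (∃ v, S.IsMinimizer T g a v ∧ Set.MapsTo v S.carrier T.carrier ∧
          S.AxiallyAntisymmetric v)) ∧
      (S.AxiallyAntisymmetric a → (∃ m, S.IsMinimizer T g a m ∧ S.NullAverage m) →
        (∀ m, S.IsMinimizer T g a m → S.NullAverage m →
          ∃ u, Set.MapsTo u S.carrier T.carrier ∧ S.AEEq m u ∧ S.AxiallyAntisymmetric u) ∨
        (∃ v, S.IsMinimizer T g a v ∧ Set.MapsTo v S.carrier T.carrier ∧
          S.AxiallySymmetric v)) ∧
      ((S.AxiallySymmetric a ∨ S.AxiallyAntisymmetric a) →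
        ∀ m, S.IsMinimizer T g a m → S.NullAverage m →
          ∃ u α β η, S.IsFirstHarmonicForm T m u α β η ∧ S.LineSymmetric u ∧
            (∀ t ∈ Set.Icc S.a S.b, inner ℝ (β t) (α t) = 0) ∧
            (∀ t ∈ Set.Icc S.a S.b, ‖β t‖ = ‖α t‖))) ∧
    -- the characterization of the existence of (anti)symmetric minimizers
    (S.AxiallySymmetric a →
      ((∃ u, S.IsMinimizer T g a u ∧ Set.MapsTo u S.carrier T.carrier ∧ S.AxiallySymmetric u) ↔
        ∃ m, S.IsMinimizer T g a m ∧ S.NullAverage m)) ∧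
    (S.AxiallyAntisymmetric a →
      ((∃ u, S.IsMinimizer T g a u ∧ Set.MapsTo u S.carrier T.carrier ∧
          S.AxiallyAntisymmetric u) ↔
        ∃ m, S.IsMinimizer T g a m ∧ S.NullAverage m)) := by
  obtain ⟨_, hK⟩ := hg_lip
  obtain ⟨_, hL⟩ := ha_lip
  have hg := hK.continuous
  have ha := hL.continuousOn
  -- For a never flat target the first alternative holds in both cases, since every null-average
  -- minimizer turns in the same sense as `a`.
  refine ⟨fun h m hm h0 => ?_, fun hT => ⟨fun h _ => Or.inl fun m hm h0 => ?_,
    fun h _ => Or.inl fun m hm h0 => ?_, fun h m hm h0 => ?_⟩, fun h => ?_, fun h => ?_⟩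
  · obtain ⟨ε, hε, hae⟩ := AxialSym.SurfaceOfRevolution.exists_equivariant h
    obtain ⟨u, α, β, η, hu, -⟩ := AxialSym.SurfaceOfRevolution.exists_isFirstHarmonicForm hm h0 hε
      hg hg_nonneg ha hae
    exact ⟨u, α, β, η, hu⟩
  · obtain ⟨u, α, β, η, hu, hs⟩ := AxialSym.SurfaceOfRevolution.exists_isFirstHarmonicForm hm h0
      (Or.inl rfl) hg hg_nonneg ha (AxialSym.SurfaceOfRevolution.equivariant_one.2 h)
    exact ⟨u, hu.mapsTo, hu.aeEq, AxialSym.SurfaceOfRevolution.equivariant_one.1 (hs hT).1⟩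
  · obtain ⟨u, α, β, η, hu, hs⟩ := AxialSym.SurfaceOfRevolution.exists_isFirstHarmonicForm hm h0
      (Or.inr rfl) hg hg_nonneg ha (AxialSym.SurfaceOfRevolution.equivariant_neg_one.2 h)
    exact ⟨u, hu.mapsTo, hu.aeEq, AxialSym.SurfaceOfRevolution.equivariant_neg_one.1 (hs hT).1⟩
  · obtain ⟨ε, hε, hae⟩ := AxialSym.SurfaceOfRevolution.exists_equivariant h
    obtain ⟨u, α, β, η, hu, hs⟩ := AxialSym.SurfaceOfRevolution.exists_isFirstHarmonicForm hm h0 hε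
      hg hg_nonneg ha hae
    exact ⟨u, α, β, η, hu, (hs hT).2⟩
  · have := AxialSym.SurfaceOfRevolution.exists_equivariant_minimizer_iff (T := T) (Or.inl rfl) hg
      hg_nonneg ha (AxialSym.SurfaceOfRevolution.equivariant_one.2 h)
    simpa only [AxialSym.SurfaceOfRevolution.equivariant_one] using this
  · have := AxialSym.SurfaceOfRevolution.exists_equivariant_minimizer_iff (T := T) (Or.inr rfl) hg
      hg_nonneg ha (AxialSym.SurfaceOfRevolution.equivariant_neg_one.2 h)
    simpa only [AxialSym.SurfaceOfRevolution.equivariant_neg_one] using this
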